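/- Fix $C>0$ and $\gamma,s$ with $-3<\gamma<0<s<1$ and $\gamma+2s\le 0$. For $v,v_*\in\mathbb R^3$, $\sigma\in\mathbb S^2$ let $\theta$ be the angle between $v-v_*$ and $\sigma$, put $$v'=\tfrac{v+v_*}{2}+\tfrac{|v-v_*|}{2}\sigma,\qquad v'_*=\tfrac{v+v_*}{2}-\tfrac{|v-v_*|}{2}\sigma,$$ $$B(v-v_*,\sigma)=C|v-v_*|^{\gamma}\Big(\sin^{-1-s}\tfrac{\theta}{2}+\cos^{-1-s}\tfrac{\theta}{2}\Big)^2\mathbf 1_{0\le\theta\le\pi/2},\qquad \mu(v)=(2\pi)^{-3/2}e^{-|v|^2/2},$$ and write $h=h(v)$, $h_*=h(v_*)$, $h'=h(v')$, $h'_*=h(v'_*)$. For functions $g,h$ of $v$ define $$\tilde Q(g,h)(v)=\int_{\mathbb S^2\times\mathbb R^3}B(v-v_*,\sigma)\big[g'_*h'(1+g_*+g)-g_*h(1+g'_*+g')\big]\,d\sigma\,dv_*,$$ where, $B$ being not integrable at $\theta=0$, the integral means the limit in the sense of distributions on $\mathbb R^3_v$, as $\varepsilon\to0^+$, of the integrals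 over $\{\theta\ge\varepsilon\}$. For $x\in\mathbb T^3=\mathbb R^3/\mathbb Z^3$ put $$\|f\|_{H^m_xH^n}^2=\sum_{|\alpha|\le m,\,|\beta|\le n}\|\partial_x^\alpha\partial_v^\beta f\|_{L^2(\mathbb T^3\times\mathbb R^3)}^2 .$$ **Proposition (positivity).** Let $T>0$ and let $F_0\in L^2(\mathbb T^3\times\mathbb R^3)$ satisfy $F_0\ge0$. Let $G=G(t,x,v)\ge0$ satisfy $$\sup_{0\le t\le T}\|\mu^{-1/4}G(t,\cdot,\cdot)\|_{H^2_xH^4}<\infty .$$ Let $F\in L^\infty([0,T];L^2(\mathbb T^3\times\mathbb R^3))$ be a solution of $$\partial_tF+v\cdot\nabla_xF=\tilde Q(G,F),\qquad F|_{t=0}=F_0,$$ as an equation in $L^2$, that is: for a.e. $(t,x)$ the term $\tilde Q(G(t,x,\cdot),F(t,x,\cdot))$ is a function of $v$, these functions make up an element $\tilde Q(G,F)$ of $L^1([0,T];L^2(\mathbb T^3\times\mathbb R^3))$, and for every $\varphi\in C_c^\infty((-\infty,T)\times\mathbb T^3\times\mathbb R^3)$ $$\int_0^T\!\!\int_{\mathbb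 T^3\times\mathbb R^3}\big[F(\partial_t+v\cdot\nabla_x)\varphi+\tilde Q(G,F)\varphi\big]\,dx\,dv\,dt+\int_{\mathbb T^3\times\mathbb R^3}F_0\,\varphi(0,\cdot,\cdot)\,dx\,dv=0 .$$ Then $F\ge0$ almost everywhere on $[0,T]\times\mathbb T^3\times\mathbb R^3$. -/

import Mathlib

open MeasureTheory Filter Topology Set
open scoped ENNReal ContDiff

namespace QuantumBoltzmann

noncomputable section

/-- The velocity space `ℝ³` with its Euclidean norm. -/
abbrev Vel := EuclideanSpace ℝ (Fin 3)

/-- The periodic box `𝕋³` of unit volume. -/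
abbrev Torus3 := UnitAddTorus (Fin 3)

/-- The class in `𝕋³` of a point of `ℝ³`. -/
def toTorus (y : Vel) : Torus3 := fun i => (y i : UnitAddCircle)

/-- The Maxwellian `μ(v) = (2π)^{-3/2} exp(-|v|²/2)`. -/
def maxwellian (v : Vel) : ℝ :=
  (2 * Real.pi) ^ (-(3 / 2) : ℝ) * Real.exp (-(‖v‖ ^ 2 / 2))

/-! ### The collision operator -/

/-- The velocity `v' = (v + v_*)/2 + (|v - v_*|/2) σ`. -/
def postVel (v vs σ : Vel) : Vel := (1 / 2 : ℝ) • (v + vs) + (‖v - vs‖ / 2) • σ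

/-- The velocity `v'_* = (v + v_*)/2 - (|v - v_*|/2) σ`. -/
def postVelStar (v vs σ : Vel) : Vel := (1 / 2 : ℝ) • (v + vs) - (‖v - vs‖ / 2) • σ

/-- The Boltzmann kernel
`B(v - v_*, σ) = C |v - v_*|^γ (sin^{-1-s}(θ/2) + cos^{-1-s}(θ/2))² 1_{0 ≤ θ ≤ π/2}`,
where `θ` is the angle between `v - v_*` and `σ`; the argument `z` stands for `v - v_*`. -/
def kernel (C γ s : ℝ) (z σ : Vel) : ℝ :=
  let θ := InnerProductGeometry.angle z σ
  if θ ≤ Real.pi / 2 then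
    C * ‖z‖ ^ γ * (Real.sin (θ / 2) ^ (-1 - s) + Real.cos (θ / 2) ^ (-1 - s)) ^ 2
  else 0

/-- The kernel with the grazing collisions `θ < ε` removed. -/
def truncKernel (C γ s ε : ℝ) (z σ : Vel) : ℝ :=
  if ε ≤ InnerProductGeometry.angle z σ then kernel C γ s z σ else 0

/-- The quantity `D(g'_* h' (1 + g_* + g)) = g'_* h' (1 + g_* + g) - g_* h (1 + g'_* + g')`. -/
def collisionDiff (g h : Vel → ℝ) (v vs σ : Vel) : ℝ :=
  g (postVelStar v vs σ) * h (postVel v vs σ) * (1 + g vs + g v)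
    - g vs * h v * (1 + g (postVelStar v vs σ) + g (postVel v vs σ))

/-- The collision integral `∫ B(v - v_*, σ) D(g'_* h' (1 + g_* + g)) dσ dv_*` restricted to
`θ ≥ ε`; here `dσ` is the surface measure of the unit sphere. -/
def truncCollision (C γ s ε : ℝ) (g h : Vel → ℝ) (v : Vel) : ℝ :=
  ∫ p : Metric.sphere (0 : Vel) 1 × Vel,
    truncKernel C γ s ε (v - p.2) p.1 * collisionDiff g h v p.2 p.1
    ∂((volume : Measure Vel).toSphere.prod volume)

/-- `q = Q̃(g, h)`: the kernel is not integrable at `θ = 0`, so the collision integral is the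
limit, in the sense of distributions on `ℝ³`, of the integrals over `θ ≥ ε` as `ε → 0⁺`. -/
def IsCollisionTerm (C γ s : ℝ) (g h q : Vel → ℝ) : Prop :=
  ∀ φ : Vel → ℝ, ContDiff ℝ ∞ φ → HasCompactSupport φ →
    Tendsto (fun ε : ℝ => ∫ v, truncCollision C γ s ε g h v * φ v) (𝓝[>] 0)
      (𝓝 (∫ v, q v * φ v))

/-! ### Weak derivatives and Sobolev norms on `𝕋³ × ℝ³` -/

/-- Partial derivative in `x_i`. -/
def partialX (i : Fin 3) (φ : Torus3 → Vel → ℝ) : Torus3 → Vel → ℝ := fun x v =>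
  deriv (fun r : ℝ => φ (x + toTorus (EuclideanSpace.single i r)) v) 0

/-- Partial derivative in `v_i`. -/
def partialV (i : Fin 3) (φ : Torus3 → Vel → ℝ) : Torus3 → Vel → ℝ := fun x v =>
  deriv (fun r : ℝ => φ x (v + EuclideanSpace.single i r)) 0

/-- The derivative `∂^α_x ∂^β_v`. -/
def partialXV (α β : Fin 3 → ℕ) (φ : Torus3 → Vel → ℝ) : Torus3 → Vel → ℝ :=
  (partialX 0)^[α 0] ((partialX 1)^[α 1] ((partialX 2)^[α 2]
    ((partialV 0)^[β 0] ((partialV 1)^[β 1] ((partialV 2)^[β 2] φ)))))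

/-- Test functions on `𝕋³ × ℝ³`: smooth with compact support. -/
def IsTestXV (φ : Torus3 → Vel → ℝ) : Prop :=
  ContDiff ℝ ∞ (fun p : Vel × Vel => φ (toTorus p.1) p.2) ∧
    HasCompactSupport (fun z : Torus3 × Vel => φ z.1 z.2)

/-- `w` is the weak derivative `∂^α_x ∂^β_v u`. -/
def IsWeakDeriv (α β : Fin 3 → ℕ) (u w : Torus3 → Vel → ℝ) : Prop :=
  LocallyIntegrable (fun z : Torus3 × Vel => u z.1 z.2) volume ∧
  LocallyIntegrable (fun z : Torus3 × Vel => w z.1 z.2) volume ∧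
  ∀ φ : Torus3 → Vel → ℝ, IsTestXV φ →
    ∫ z : Torus3 × Vel, u z.1 z.2 * partialXV α β φ z.1 z.2 =
      (-1) ^ (∑ i, α i + ∑ i, β i) * ∫ z : Torus3 × Vel, w z.1 z.2 * φ z.1 z.2

/-- The norm of a function in `L²(𝕋³ × ℝ³)`, in `[0, ∞]`. -/
def normL2 (u : Torus3 → Vel → ℝ) : ℝ≥0∞ :=
  eLpNorm (fun z : Torus3 × Vel => u z.1 z.2) 2 volume

/-- The `L²` norm of the weak derivative `∂^α_x ∂^β_v u` (which is unique up to null sets), and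
`∞` if there is no such derivative. -/
def weakDerivNorm (α β : Fin 3 → ℕ) (u : Torus3 → Vel → ℝ) : ℝ≥0∞ :=
  ⨅ (w : Torus3 → Vel → ℝ) (_ : IsWeakDeriv α β u w), normL2 w

/-- Multi-indices of length at most `m`. -/
def multiIndices (m : ℕ) : Finset (Fin 3 → ℕ) :=
  (Fintype.piFinset fun _ => Finset.range (m + 1)).filter fun α => ∑ i, α i ≤ m

/-- The norm of `H^m_x H^n`:
`‖u‖² = ∑_{|α| ≤ m, |β| ≤ n} ‖∂^α_x ∂^β_v u‖²_{L²(𝕋³ × ℝ³)}`, in `[0, ∞]`. -/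
def sobolevNorm (m n : ℕ) (u : Torus3 → Vel → ℝ) : ℝ≥0∞ :=
  (∑ α ∈ multiIndices m, ∑ β ∈ multiIndices n, weakDerivNorm α β u ^ 2) ^ (1 / 2 : ℝ)

/-! ### The linear Cauchy problem -/

/-- The derivative `(∂_t + v · ∇_x) φ`. -/
def transportDeriv (φ : ℝ → Torus3 → Vel → ℝ) : ℝ → Torus3 → Vel → ℝ := fun t x v =>
  deriv (fun r : ℝ => φ (t + r) (x + toTorus (r • v)) v) 0

/-- Test functions for the Cauchy problem: smooth, with compact support in
`(-∞, T) × 𝕋³ × ℝ³`; they need not vanish at `t = 0`. -/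
def IsTestTXV (T : ℝ) (φ : ℝ → Torus3 → Vel → ℝ) : Prop :=
  ContDiff ℝ ∞ (fun p : ℝ × Vel × Vel => φ p.1 (toTorus p.2.1) p.2.2) ∧
    HasCompactSupport (fun p : ℝ × Torus3 × Vel => φ p.1 p.2.1 p.2.2) ∧
    tsupport (fun p : ℝ × Torus3 × Vel => φ p.1 p.2.1 p.2.2) ⊆ {p | p.1 < T}

/-- `F ∈ L^∞([0,T]; L²(𝕋³ × ℝ³))`, for a Borel representative. -/
def MemLinftyL2 (T : ℝ) (F : ℝ → Torus3 → Vel → ℝ) : Prop :=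
  Measurable (fun p : ℝ × Torus3 × Vel => F p.1 p.2.1 p.2.2) ∧
    essSup (fun t => normL2 (F t)) (volume.restrict (Icc 0 T)) < ⊤

/-- `F` solves `∂_t F + v · ∇_x F = Q̃(G, F)` on `[0,T]` with `F|_{t=0} = F₀`, as an equation in
`L²`: the collision term `q = Q̃(G, F)` is a function in `L¹([0,T]; L²(𝕋³ × ℝ³))`, and the
equation with its initial condition holds in the sense of distributions. -/
def IsSolution (C γ s T : ℝ) (G : ℝ → Torus3 → Vel → ℝ) (F₀ : Torus3 → Vel → ℝ)
    (F : ℝ → Torus3 → Vel → ℝ) : Prop :=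
  ∃ q : ℝ → Torus3 → Vel → ℝ,
    Measurable (fun p : ℝ × Torus3 × Vel => q p.1 p.2.1 p.2.2) ∧
    (∫⁻ t in Icc 0 T, normL2 (q t)) < ⊤ ∧
    (∀ᵐ t ∂(volume.restrict (Icc 0 T)), ∀ᵐ x : Torus3,
      IsCollisionTerm C γ s (G t x) (F t x) (q t x)) ∧
    ∀ φ : ℝ → Torus3 → Vel → ℝ, IsTestTXV T φ →
      (∫ t in Icc 0 T, ∫ z : Torus3 × Vel,
          (F t z.1 z.2 * transportDeriv φ t z.1 z.2 + q t z.1 z.2 * φ t z.1 z.2))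
        + ∫ z : Torus3 × Vel, F₀ z.1 z.2 * φ 0 z.1 z.2 = 0

end

end QuantumBoltzmann

open scoped Pointwise

namespace QuantumBoltzmann

noncomputable section

open scoped Convolution

/-! ### Averages against compactly supported kernels -/

/-! Write F_- = max(-F, 0) and q = Q̃(G, F). Along free transport the equation is an ordinary
differential equation in time, and F_0 ≥ 0, so the L² norm over 𝕋³ × ℝ³ satisfies ‖F_-(t)‖² = -2
∫_0^t ∫ q F_-. It therefore suffices to prove a Kato inequality on velocity slices, -∫ q F_- dv ≤ K
∫ F_-² dv, with K independent of (t, x) (`IsKernelParam.exists_kato`). Gronwall's inequality then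
gives F_- = 0 (`ae_nonneg_of_kato`).

Fix (t, x) and write g, h for the slices of G, F. Put a = v' - v and m = g_*(1 + g'_* + g').
Exchanging pre- and postcollisional velocities gives the weak form ∫ Q̃(g,h) φ = ∫ B m h (φ' - φ).
For φ = h_- one has h (φ' - φ) ≥ (φ² - φ'²)/2 pointwise. After a second exchange, ∫ B m (φ² - φ'²)
becomes the integral of φ² against loss rate minus gain rate. The cancellation lemma
`exists_cancellation_bound` bounds that difference uniformly in the angular cutoff: averaging over
the reflection of σ in the axis v - v_* turns it into second differences of g of size |a|²(1 + 1/|v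
- v_*|), which compensate the singularity |a|^(-2-2s).

This is only formal. h is merely in L², and q is known only through smooth compactly supported
tests, so h_- is not admissible. Put u = ρ_δ * h, f = (u + η)_- and test with ρ_δ * f; the shift η >
0 makes f compactly supported. Moving the mollifier onto m h produces m u, to which the formal
argument applies, plus the commutator V of mollification with multiplication by m. Two facts make V
harmless. The factor f' - f is odd under the exchange of velocities, so for |a| ≤ δ one may replace
V by half its difference under the exchange, which is O(|a|) and not just O(δ). And a nonnegative
function with bounded second derivatives has gradient at most a multiple of its square root, so V is
controlled by √(w m), up to a term of relative size δ, w being a decaying weight. Hence V (f' - f)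
is absorbed by m (f' - f)²/2, the surplus in the convexity inequality (`form_pointwise`), up to
min(|a|, δ)² w. The integral of the latter against B is O(δ^(2-2s)), uniformly in the cutoff, and
vanishes with δ since s < 1. The limits ε → 0, η → 0, δ → 0 are taken in this order.

The regularity of g comes from the norm H²_x H⁴. In x, H²(𝕋³) embeds in L^∞ by Fourier series. In v,
the mollifiers of scale 2⁻ⁿ differ from the one of scale 1 by pure second derivatives of functions
bounded in L² (`exists_mollifier_decomposition`), so two extra velocity derivatives bound all
derivatives of order at most two. The factor μ^(1/4) supplies the decay
(`exists_isRegular_gauss_mul`). -/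

/-- The average `v ↦ ∫ κ(w - v) h(w) dw`. -/
def avg (κ h : Vel → ℝ) (v : Vel) : ℝ := ∫ w, κ (w - v) * h w

/-- Bounded nonnegative Borel kernels supported in the closed ball of radius `r`. -/
structure IsKernel (κ : Vel → ℝ) (r : ℝ) : Prop where
  meas : Measurable κ
  nonneg : ∀ v, 0 ≤ κ v
  bdd : ∃ B, ∀ v, κ v ≤ B
  supp : ∀ v, r < ‖v‖ → κ v = 0

lemma avg_eq_convolution (κ h : Vel → ℝ) :
    avg κ h = (fun v => κ (-v)) ⋆[ContinuousLinearMap.lsmul ℝ ℝ, volume] h := by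
  funext v
  rw [convolution_eq_swap]
  simp [avg]

namespace IsKernel

variable {κ : Vel → ℝ} {r : ℝ}

lemma integrable_mul (hκ : IsKernel κ r) {h : Vel → ℝ} (hh : LocallyIntegrable h) (v : Vel) :
    Integrable (fun w => κ (w - v) * h w) := by
  obtain ⟨B, hB⟩ := hκ.bdd
  have h1 : IntegrableOn h (Metric.closedBall v r) :=
    hh.integrableOn_isCompact (isCompact_closedBall v r)
  have h2 : Integrable ((Metric.closedBall v r).indicator h) :=
    (integrable_indicator_iff Metric.isClosed_closedBall.measurableSet).2 h1
  refine (h2.norm.const_mul B).mono'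
    ((hκ.meas.comp (measurable_id.sub_const v)).aestronglyMeasurable.mul hh.aestronglyMeasurable) ?_
  refine Eventually.of_forall fun w => ?_
  by_cases hw : w ∈ Metric.closedBall v r
  · simp only [hw, indicator_of_mem, norm_mul, Real.norm_eq_abs]
    rw [abs_of_nonneg (hκ.nonneg _)]
    exact mul_le_mul_of_nonneg_right (hB _) (abs_nonneg _)
  · have : κ (w - v) = 0 := hκ.supp _ (by simpa [dist_eq_norm] using hw)
    simp [this, hw]

lemma integrable (hκ : IsKernel κ r) : Integrable κ := by
  have h1 := hκ.integrable_mul (h := fun _ => 1) (locallyIntegrable_const 1) 0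
  simpa using h1

lemma integrable_neg (hκ : IsKernel κ r) : Integrable (fun v => κ (-v)) := hκ.integrable.comp_neg

lemma integrable_avg (hκ : IsKernel κ r) {P : Vel → ℝ} (hP : Integrable P) :
    Integrable (avg κ P) := by
  rw [avg_eq_convolution]
  exact hκ.integrable_neg.integrable_convolution _ hP

lemma integral_avg (hκ : IsKernel κ r) {P : Vel → ℝ} (hP : Integrable P) :
    ∫ v, avg κ P v = (∫ v, κ v) * ∫ v, P v := by
  rw [avg_eq_convolution, integral_convolution _ hκ.integrable_neg hP, integral_neg_eq_self]
  simp

lemma avg_nonneg (hκ : IsKernel κ r) {h : Vel → ℝ} (hh : ∀ v, 0 ≤ h v) (v : Vel) :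
    0 ≤ avg κ h v :=
  integral_nonneg fun _ => mul_nonneg (hκ.nonneg _) (hh _)

/-- Cauchy–Schwarz for the measure κ(w - v) dw, read off from the discriminant of the nonnegative
quadratic t ↦ ∫ κ(w - v)(t - h(w))² dw. -/
lemma sq_avg_le (hκ : IsKernel κ r) {h : Vel → ℝ} (hh : MemLp h 2) (v : Vel) :
    avg κ h v ^ 2 ≤ (∫ w, κ w) * avg κ (fun w => h w ^ 2) v := by
  have hl : LocallyIntegrable h := hh.locallyIntegrable (by norm_num)
  have hl2 : LocallyIntegrable (fun w => h w ^ 2) := hh.integrable_sq.locallyIntegrable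
  have hc : ∫ w, κ (w - v) = ∫ w, κ w := integral_sub_right_eq_self κ v
  have key : ∀ t : ℝ, 0 ≤ t ^ 2 * (∫ w, κ w) - 2 * t * avg κ h v + avg κ (fun w => h w ^ 2) v := by
    intro t
    have e : t ^ 2 * (∫ w, κ w) - 2 * t * avg κ h v + avg κ (fun w => h w ^ 2) v
        = ∫ w, κ (w - v) * (t - h w) ^ 2 := by
      rw [← hc, avg, avg, ← integral_const_mul, ← integral_const_mul, ← integral_sub,
        ← integral_add]
      · congr 1; funext w; ring
      · exact ((hκ.integrable.comp_sub_right v).const_mul _).sub ((hκ.integrable_mul hl v).const_mul _)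
      · exact hκ.integrable_mul hl2 v
      · exact (hκ.integrable.comp_sub_right v).const_mul _
      · exact (hκ.integrable_mul hl v).const_mul _
    rw [e]
    exact integral_nonneg fun w => mul_nonneg (hκ.nonneg _) (sq_nonneg _)
  have hd := discrim_le_zero (K := ℝ) (a := ∫ w, κ w) (b := -2 * avg κ h v)
    (c := avg κ (fun w => h w ^ 2) v) (fun t => by have := key t; nlinarith)
  rw [discrim] at hd
  nlinarith

lemma measurable_avg (hκ : IsKernel κ r) {h : Vel → ℝ} (hh : LocallyIntegrable h) :
    AEStronglyMeasurable (avg κ h) volume := by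
  have : AEStronglyMeasurable (fun p : Vel × Vel => κ (p.2 - p.1) * h p.2)
      (volume.prod volume) :=
    ((hκ.meas.comp (measurable_snd.sub measurable_fst)).aestronglyMeasurable).mul
      hh.aestronglyMeasurable.comp_snd
  exact this.integral_prod_right'

lemma memLp_avg (hκ : IsKernel κ r) {h : Vel → ℝ} (hh : MemLp h 2) : MemLp (avg κ h) 2 := by
  have hm := hκ.measurable_avg (hh.locallyIntegrable (by norm_num))
  rw [memLp_two_iff_integrable_sq hm]
  refine ((hκ.integrable_avg hh.integrable_sq).const_mul (∫ w, κ w)).mono' (hm.pow 2) ?_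
  refine Eventually.of_forall fun v => ?_
  rw [Real.norm_of_nonneg (sq_nonneg _)]
  exact hκ.sq_avg_le hh v

/-- Young's inequality. Only the mass of κ enters, so the bound is uniform in the scale of a
rescaled kernel. -/
lemma integral_avg_sq_le (hκ : IsKernel κ r) {h : Vel → ℝ} (hh : MemLp h 2) :
    ∫ v, avg κ h v ^ 2 ≤ (∫ w, κ w) ^ 2 * ∫ v, h v ^ 2 := by
  have h1 : ∫ v, avg κ h v ^ 2 ≤ ∫ v, (∫ w, κ w) * avg κ (fun w => h w ^ 2) v :=
    integral_mono (hκ.memLp_avg hh).integrable_sq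
      ((hκ.integrable_avg hh.integrable_sq).const_mul _) fun v => hκ.sq_avg_le hh v
  rw [integral_const_mul, hκ.integral_avg hh.integrable_sq] at h1
  linarith [h1]

end IsKernel

/-! ### Mollifiers -/

/-- Smooth, nonnegative, even functions of integral one that vanish outside the unit ball. -/
structure IsMollifier (ρ : Vel → ℝ) : Prop where
  smooth : ContDiff ℝ ∞ ρ
  nonneg : ∀ v, 0 ≤ ρ v
  even : ∀ v, ρ (-v) = ρ v
  supp : ∀ v, 1 < ‖v‖ → ρ v = 0
  int : ∫ v, ρ v = 1

/-- The rescaled kernel `δ⁻³ ρ(v / δ)`. -/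
def scaled (ρ : Vel → ℝ) (δ : ℝ) (v : Vel) : ℝ := (δ⁻¹) ^ 3 * ρ (δ⁻¹ • v)

namespace IsMollifier

variable {ρ : Vel → ℝ} {δ : ℝ}

lemma hasCompactSupport (hρ : IsMollifier ρ) : HasCompactSupport ρ :=
  HasCompactSupport.of_support_subset_isCompact (isCompact_closedBall 0 1) fun v hv => by
    by_contra hv'
    exact hv (hρ.supp v (by simpa using hv'))

lemma scaled_mollifier_zero (hρ : IsMollifier ρ) (hδ : 0 < δ) {v : Vel} (hv : δ < ‖v‖) :
    scaled ρ δ v = 0 := by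
  rw [scaled, hρ.supp, mul_zero]
  rw [norm_smul, norm_inv, Real.norm_of_nonneg hδ.le, inv_mul_eq_div, lt_div_iff₀ hδ, one_mul]
  exact hv

lemma scaled_smooth (hρ : IsMollifier ρ) : ContDiff ℝ ∞ (scaled ρ δ) :=
  contDiff_const.mul (hρ.smooth.comp (contDiff_const_smul _))

lemma scaled_nonneg (hρ : IsMollifier ρ) (hδ : 0 < δ) (v : Vel) : 0 ≤ scaled ρ δ v :=
  mul_nonneg (by positivity) (hρ.nonneg _)

lemma scaled_even (hρ : IsMollifier ρ) (v : Vel) : scaled ρ δ (-v) = scaled ρ δ v := by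
  simp [scaled, hρ.even]

lemma scaled_hasCompactSupport (hρ : IsMollifier ρ) (hδ : 0 < δ) :
    HasCompactSupport (scaled ρ δ) :=
  HasCompactSupport.of_support_subset_isCompact (isCompact_closedBall 0 δ) fun v hv => by
    by_contra hv'
    exact hv (hρ.scaled_mollifier_zero hδ (by simpa using hv'))

lemma integral_scaled (hρ : IsMollifier ρ) (hδ : 0 < δ) : ∫ v, scaled ρ δ v = 1 := by
  simp only [scaled]
  rw [integral_const_mul, Measure.integral_comp_inv_smul, hρ.int]
  simp only [finrank_euclideanSpace, Fintype.card_fin, smul_eq_mul, mul_one]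
  rw [abs_of_pos (by positivity)]
  field_simp

lemma exists_bound (hρ : IsMollifier ρ) : ∃ B : ℝ, 0 < B ∧ (∀ v, ρ v ≤ B) ∧
    ∀ v w, |ρ v - ρ w| ≤ B * ‖v - w‖ := by
  obtain ⟨B1, hB1⟩ := hρ.hasCompactSupport.exists_bound_of_continuous hρ.smooth.continuous
  have hd : Differentiable ℝ ρ := hρ.smooth.differentiable (by norm_num)
  obtain ⟨B2, hB2⟩ := (hρ.hasCompactSupport.fderiv (𝕜 := ℝ)).exists_bound_of_continuous
    (hρ.smooth.continuous_fderiv (by norm_num))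
  refine ⟨max B1 B2 + 1, ?_, fun v => ?_, fun v w => ?_⟩
  · have := (norm_nonneg _).trans (hB1 0)
    have := le_max_left B1 B2
    linarith
  · have h1 := hB1 v
    have := le_max_left B1 B2
    rw [Real.norm_eq_abs] at h1
    linarith [le_abs_self (ρ v)]
  · have h1 := Convex.norm_image_sub_le_of_norm_fderiv_le (𝕜 := ℝ) (f := ρ) (s := univ) (C := B2)
      (fun x _ => hd x) (fun x _ => hB2 x) convex_univ (mem_univ w) (mem_univ v)
    rw [Real.norm_eq_abs] at h1
    have := le_max_right B1 B2
    exact h1.trans (mul_le_mul_of_nonneg_right (by linarith) (norm_nonneg _))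

lemma scaled_le {B : ℝ} (hB : ∀ v, ρ v ≤ B) (hδ : 0 < δ) (v : Vel) :
    scaled ρ δ v ≤ B * (δ⁻¹) ^ 3 := by
  rw [scaled, mul_comm B]
  exact mul_le_mul_of_nonneg_left (hB _) (by positivity)

lemma scaled_lipschitz {B : ℝ} (hB : ∀ v w, |ρ v - ρ w| ≤ B * ‖v - w‖) (hδ : 0 < δ) (v w : Vel) :
    |scaled ρ δ v - scaled ρ δ w| ≤ B * (δ⁻¹) ^ 4 * ‖v - w‖ := by
  rw [scaled, scaled, ← mul_sub, abs_mul, abs_of_pos (by positivity : 0 < (δ⁻¹) ^ 3)]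
  have := hB (δ⁻¹ • v) (δ⁻¹ • w)
  rw [← smul_sub, norm_smul, norm_inv, Real.norm_of_nonneg hδ.le] at this
  calc (δ⁻¹) ^ 3 * |ρ (δ⁻¹ • v) - ρ (δ⁻¹ • w)| ≤ (δ⁻¹) ^ 3 * (B * (δ⁻¹ * ‖v - w‖)) :=
        mul_le_mul_of_nonneg_left this (by positivity)
    _ = _ := by ring

lemma isKernel_scaled (hρ : IsMollifier ρ) (hδ : 0 < δ) : IsKernel (scaled ρ δ) δ where
  meas := hρ.scaled_smooth.continuous.measurable
  nonneg := hρ.scaled_nonneg hδ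
  bdd := by
    obtain ⟨B, _, hB, _⟩ := hρ.exists_bound
    exact ⟨_, scaled_le hB hδ⟩
  supp := fun v hv => hρ.scaled_mollifier_zero hδ hv

lemma avg_eq (hρ : IsMollifier ρ) (h : Vel → ℝ) :
    avg (scaled ρ δ) h = (scaled ρ δ) ⋆[ContinuousLinearMap.lsmul ℝ ℝ, volume] h := by
  rw [avg_eq_convolution]
  congr 1
  funext v
  exact hρ.scaled_even v

lemma contDiff_avg (hρ : IsMollifier ρ) (hδ : 0 < δ) {h : Vel → ℝ} (hh : LocallyIntegrable h) :
    ContDiff ℝ ∞ (avg (scaled ρ δ) h) := by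
  rw [hρ.avg_eq]
  exact (hρ.scaled_hasCompactSupport hδ).contDiff_convolution_left _ hρ.scaled_smooth hh

lemma hasCompactSupport_avg (hρ : IsMollifier ρ) (hδ : 0 < δ) {h : Vel → ℝ}
    (hh : HasCompactSupport h) : HasCompactSupport (avg (scaled ρ δ) h) := by
  rw [hρ.avg_eq]
  exact (hρ.scaled_hasCompactSupport hδ).convolution _ hh

/-- Lebesgue differentiation: the rescaled kernel is at most a fixed multiple of the normalized
indicator of the ball of radius δ. -/
lemma ae_tendsto_avg (hρ : IsMollifier ρ) {d : ℕ → ℝ} (hd : ∀ n, 0 < d n)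
    (hd0 : Tendsto d atTop (𝓝 0)) {h : Vel → ℝ} (hh : LocallyIntegrable h) :
    ∀ᵐ v, Tendsto (fun n => avg (scaled ρ (d n)) h v) atTop (𝓝 (h v)) := by
  obtain ⟨B, hB0, hB, _⟩ := hρ.exists_bound
  filter_upwards [(Besicovitch.vitaliFamily (volume : Measure Vel)).ae_tendsto_average_norm_sub hh]
    with v hv
  have hd' : Tendsto d atTop (𝓝[>] 0) :=
    tendsto_nhdsWithin_iff.2 ⟨hd0, Eventually.of_forall hd⟩
  have h1 := (hv.comp (Besicovitch.tendsto_filterAt volume v)).comp hd'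
  have := tendsto_integral_smul_of_tendsto_average_norm_sub (μ := (volume : Measure Vel))
    (g := fun n w => scaled ρ (d n) (w - v))
    (B * volume.real (Metric.closedBall (0 : Vel) 1)) h1 ?_ ?_ ?_ ?_
  · simpa [avg] using this
  · exact Eventually.of_forall fun n => hh.integrableOn_isCompact (isCompact_closedBall _ _)
  · refine tendsto_const_nhds.congr fun n => ?_
    rw [integral_sub_right_eq_self (fun w => scaled ρ (d n) w) v, hρ.integral_scaled (hd n)]
  · refine Eventually.of_forall fun n w hw => ?_
    by_contra hw'
    exact hw (hρ.scaled_mollifier_zero (hd n) (by simpa [dist_eq_norm] using hw'))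
  · refine Eventually.of_forall fun n w => ?_
    change _ ≤ _ / volume.real (Metric.closedBall v (d n))
    rw [abs_of_nonneg (hρ.scaled_nonneg (hd n) _), measureReal_def, measureReal_def, Measure.addHaar_closedBall' _ _ (hd n).le,
      ENNReal.toReal_mul, ENNReal.toReal_ofReal (by have := hd n; positivity)]
    refine (scaled_le hB (hd n) _).trans_eq ?_
    have h3 : (volume (Metric.closedBall (0 : Vel) 1)).toReal ≠ 0 := by
      refine (ENNReal.toReal_pos ?_ (measure_closedBall_lt_top).ne).ne'
      exact (Metric.measure_closedBall_pos volume _ one_pos).ne'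
    have := (hd n).ne'
    simp only [finrank_euclideanSpace, Fintype.card_fin]
    field_simp

/-- Mollification does not increase the L² norm and converges almost everywhere; Fatou's lemma
upgrades the two facts to strong convergence. -/
lemma tendsto_avg_L2 (hρ : IsMollifier ρ) {d : ℕ → ℝ} (hd : ∀ n, 0 < d n)
    (hd0 : Tendsto d atTop (𝓝 0)) {h : Vel → ℝ} (hh : MemLp h 2) :
    Tendsto (fun n => ∫ v, (avg (scaled ρ (d n)) h v - h v) ^ 2) atTop (𝓝 0) := by
  have hl : LocallyIntegrable h := hh.locallyIntegrable (by norm_num)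
  have hae := hρ.ae_tendsto_avg hd hd0 hl
  have hmem : ∀ n, MemLp (avg (scaled ρ (d n)) h) 2 :=
    fun n => (hρ.isKernel_scaled (hd n)).memLp_avg hh
  set A : ℝ := ∫ v, h v ^ 2
  have hle : ∀ n, ∫ v, avg (scaled ρ (d n)) h v ^ 2 ≤ A := fun n => by
    have := (hρ.isKernel_scaled (hd n)).integral_avg_sq_le hh
    simpa [hρ.integral_scaled (hd n)] using this
  -- This is the square of the sum of the average and h. It is nonnegative and tends to 4h², so
  -- Fatou's lemma forces the subtracted square to vanish in the limit.
  let f : ℕ → Vel → ℝ := fun n v =>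
    2 * avg (scaled ρ (d n)) h v ^ 2 + 2 * h v ^ 2 - (avg (scaled ρ (d n)) h v - h v) ^ 2
  have hf0 : ∀ n v, 0 ≤ f n v := fun n v => by
    have : f n v = (avg (scaled ρ (d n)) h v + h v) ^ 2 := by simp only [f]; ring
    rw [this]; positivity
  have hdi : ∀ n, Integrable (fun v => (avg (scaled ρ (d n)) h v - h v) ^ 2) :=
    fun n => ((hmem n).sub hh).integrable_sq
  have hfi : ∀ n, Integrable (f n) := fun n =>
    (((hmem n).integrable_sq.const_mul 2).add (hh.integrable_sq.const_mul 2)).sub (hdi n)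
  have hfint : ∀ n, ∫ v, f n v ≤ 4 * A - ∫ v, (avg (scaled ρ (d n)) h v - h v) ^ 2 := fun n => by
    have h1 : ∫ v, f n v = 2 * (∫ v, avg (scaled ρ (d n)) h v ^ 2) + 2 * A
        - ∫ v, (avg (scaled ρ (d n)) h v - h v) ^ 2 := by
      have h2 := integral_sub
        (((hmem n).integrable_sq.const_mul 2).add (hh.integrable_sq.const_mul 2)) (hdi n)
      have h3 := integral_add ((hmem n).integrable_sq.const_mul 2) (hh.integrable_sq.const_mul 2)
      rw [integral_const_mul, integral_const_mul] at h3
      rw [← h3]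
      exact h2
    rw [h1]; linarith [hle n]
  have hfatou : ENNReal.ofReal (4 * A) ≤ liminf (fun n => ENNReal.ofReal (∫ v, f n v)) atTop := by
    have h1 : ∫⁻ v, ENNReal.ofReal (4 * h v ^ 2) ≤
        liminf (fun n => ∫⁻ v, ENNReal.ofReal (f n v)) atTop := by
      refine le_trans ?_ (lintegral_liminf_le' fun n => (hfi n).1.aemeasurable.ennreal_ofReal)
      refine lintegral_mono_ae ?_
      filter_upwards [hae] with v hv
      have : Tendsto (fun n => ENNReal.ofReal (f n v)) atTop (𝓝 (ENNReal.ofReal (4 * h v ^ 2))) := by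
        refine ENNReal.tendsto_ofReal ?_
        have := (((hv.pow 2).const_mul 2).add_const (2 * h v ^ 2)).sub ((hv.sub_const (h v)).pow 2)
        convert this using 2
        ring
      exact this.liminf_eq.ge
    rw [← ofReal_integral_eq_lintegral_ofReal (hh.integrable_sq.const_mul 4)
      (Eventually.of_forall fun v => by positivity), integral_const_mul] at h1
    refine h1.trans_eq ?_
    congr 1
    funext n
    rw [ofReal_integral_eq_lintegral_ofReal (hfi n) (Eventually.of_forall (hf0 n))]
  have hA : 0 ≤ A := integral_nonneg fun v => sq_nonneg _
  rw [Metric.tendsto_atTop]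
  by_contra hcon
  push Not at hcon
  obtain ⟨η, hη, hcon⟩ := hcon
  have hfreq : ∃ᶠ n in atTop, ENNReal.ofReal (∫ v, f n v) ≤ ENNReal.ofReal (4 * A - η) := by
    rw [frequently_atTop]
    intro N
    obtain ⟨n, hn, hn'⟩ := hcon N
    refine ⟨n, hn, ENNReal.ofReal_le_ofReal ((hfint n).trans ?_)⟩
    rw [Real.dist_eq, sub_zero, abs_of_nonneg (integral_nonneg fun v => sq_nonneg _)] at hn'
    linarith
  have h2 := hfatou.trans (liminf_le_of_frequently_le' hfreq)
  have h3 : 0 ≤ 4 * A - η := by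
    obtain ⟨n, -, hn'⟩ := hcon 0
    rw [Real.dist_eq, sub_zero, abs_of_nonneg (integral_nonneg fun v => sq_nonneg _)] at hn'
    have := hfint n
    have : 0 ≤ ∫ v, f n v := integral_nonneg fun v => hf0 n v
    linarith
  rw [ENNReal.ofReal_le_ofReal_iff h3] at h2
  linarith

/-- Mollifications of L² functions decay at infinity, since only the tail of h² is seen there. This
is what makes (u + η)_- compactly supported for η > 0. -/
lemma exists_radius_avg_lt (hρ : IsMollifier ρ) (hδ : 0 < δ) {h : Vel → ℝ} (hh : MemLp h 2)
    {η : ℝ} (hη : 0 < η) : ∃ R, ∀ v, R < ‖v‖ → |avg (scaled ρ δ) h v| < η := by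
  obtain ⟨B, hB0, hB, _⟩ := hρ.exists_bound
  set b : ℝ := B * (δ⁻¹) ^ 3
  have hb : 0 < b := by positivity
  have hlim : Tendsto (fun n : ℕ => ∫ w in (Metric.closedBall (0 : Vel) n)ᶜ, h w ^ 2) atTop (𝓝 0) := by
    have hmono : Antitone fun n : ℕ => (Metric.closedBall (0 : Vel) n)ᶜ := fun n m hnm =>
      compl_subset_compl.2 (Metric.closedBall_subset_closedBall (by exact_mod_cast hnm))
    have := tendsto_setIntegral_of_antitone (f := fun w => h w ^ 2)
      (fun n : ℕ => (Metric.isClosed_closedBall (x := (0 : Vel)) (ε := n)).measurableSet.compl) hmono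
      ⟨0, hh.integrable_sq.integrableOn⟩
    have he : ⋂ n : ℕ, (Metric.closedBall (0 : Vel) n)ᶜ = ∅ := by
      rw [← compl_iUnion, Metric.iUnion_closedBall_nat, compl_univ]
    simpa [he] using this
  have hη2 : 0 < η ^ 2 / b := by positivity
  obtain ⟨N, hN⟩ := (hlim.eventually (gt_mem_nhds hη2)).exists
  refine ⟨N + δ, fun v hv => ?_⟩
  have hk := hρ.isKernel_scaled hδ
  have h1 := hk.sq_avg_le hh v
  rw [hρ.integral_scaled hδ, one_mul] at h1
  have h2 : avg (scaled ρ δ) (fun w => h w ^ 2) v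
      ≤ b * ∫ w in (Metric.closedBall (0 : Vel) N)ᶜ, h w ^ 2 := by
    rw [← integral_const_mul, ← integral_indicator
      (Metric.isClosed_closedBall (x := (0 : Vel)) (ε := N)).measurableSet.compl]
    refine integral_mono (hk.integrable_mul hh.integrable_sq.locallyIntegrable v)
      (((hh.integrable_sq.const_mul b)).indicator
        (Metric.isClosed_closedBall (x := (0 : Vel)) (ε := N)).measurableSet.compl) fun w => ?_
    by_cases hw : w ∈ (Metric.closedBall (0 : Vel) N)ᶜ
    · simp only [hw, indicator_of_mem]
      exact mul_le_mul_of_nonneg_right (scaled_le hB hδ _) (sq_nonneg _)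
    · simp only [hw, not_false_eq_true, indicator_of_notMem]
      have hw' : ‖w‖ ≤ N := by simpa using hw
      rw [hρ.scaled_mollifier_zero hδ, zero_mul]
      have := norm_sub_norm_le v w
      rw [norm_sub_rev] at this
      linarith
  have h3 : avg (scaled ρ δ) h v ^ 2 < η ^ 2 := by
    calc _ ≤ _ := h1
      _ ≤ _ := h2
      _ < b * (η ^ 2 / b) := by gcongr
      _ = η ^ 2 := by field_simp
  exact abs_lt_of_sq_lt_sq h3 hη.le

end IsMollifier

end

end QuantumBoltzmann

/-! ### Collision geometry and estimates for the singular kernel. -/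

namespace QuantumBoltzmann

noncomputable section

/-! ### Relative velocities and directions -/

/-- The unit sphere of `ℝ³`. -/
abbrev Sph := Metric.sphere (0 : Vel) 1

/-- The surface measure of the unit sphere. -/
abbrev sphMeasure : Measure Sph := (volume : Measure Vel).toSphere

/-- The deviation `a = (|z| σ - z) / 2`, so that `v' = v + a` and `v'_* = v - z - a`. -/
def dev (x : Vel × Sph) : Vel := (1 / 2 : ℝ) • (‖x.1‖ • (x.2 : Vel) - x.1)

/-- The direction of `z`, or `σ` if `z = 0`. -/
def dir (x : Vel × Sph) : Sph :=
  ⟨if x.1 = 0 then (x.2 : Vel) else ‖x.1‖⁻¹ • x.1, by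
    split_ifs with h
    · exact x.2.2
    · simp [norm_smul, h]⟩

/-- The exchange of pre- and postcollisional relative velocities. -/
def flip (x : Vel × Sph) : Vel × Sph := (‖x.1‖ • (x.2 : Vel), dir x)

/-- The reflection of `σ` in the line spanned by `z`. -/
def reflDir (x : Vel × Sph) : Sph :=
  ⟨(Submodule.span ℝ {x.1}).reflection (x.2 : Vel), by simp⟩

/-- The reflection of `σ` in the line spanned by `z`, as a map of pairs. -/
def reflPair (x : Vel × Sph) : Vel × Sph := (x.1, reflDir x)

lemma norm_sph (σ : Sph) : ‖(σ : Vel)‖ = 1 := by simp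

lemma coe_reflDir (x : Vel × Sph) :
    (reflDir x : Vel) = (2 * (inner ℝ x.1 (x.2 : Vel) / ‖x.1‖ ^ 2)) • x.1 - x.2 := by
  simp only [reflDir, Submodule.reflection_apply, Submodule.starProjection_singleton]
  rw [two_smul, ← add_smul, two_mul]
  simp

lemma measurable_dev : Measurable dev := by
  unfold dev
  fun_prop

lemma measurable_dir : Measurable dir := by
  refine Measurable.subtype_mk ?_
  refine Measurable.ite (measurable_fst (measurableSet_singleton 0)) (by fun_prop) (by fun_prop)

lemma measurable_flip : Measurable flip :=
  Measurable.prodMk (by fun_prop) measurable_dir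

lemma measurable_reflDir : Measurable reflDir := by
  have : reflDir = fun x => ⟨(2 * (inner ℝ x.1 (x.2 : Vel) / ‖x.1‖ ^ 2)) • x.1 - x.2, by
      rw [← coe_reflDir]; exact (reflDir x).2⟩ := by
    funext x; exact Subtype.ext (coe_reflDir x)
  rw [this]
  refine Measurable.subtype_mk ?_
  fun_prop

lemma measurable_reflPair : Measurable reflPair := measurable_fst.prodMk measurable_reflDir

lemma norm_flip_fst (x : Vel × Sph) : ‖(flip x).1‖ = ‖x.1‖ := by
  simp [flip, norm_smul]

lemma norm_smul_dir {x : Vel × Sph} (hx : x.1 ≠ 0) : ‖x.1‖ • (dir x : Vel) = x.1 := by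
  simp [dir, hx, smul_smul]

lemma dev_flip {x : Vel × Sph} (hx : x.1 ≠ 0) : dev (flip x) = -dev x := by
  simp only [dev, norm_flip_fst]
  change (1 / 2 : ℝ) • (‖x.1‖ • (dir x : Vel) - ‖x.1‖ • (x.2 : Vel)) = _
  rw [norm_smul_dir hx, ← smul_neg, neg_sub]

lemma flip_fst (x : Vel × Sph) : (flip x).1 = x.1 + (2 : ℝ) • dev x := by
  simp only [flip, dev, smul_smul]
  norm_num

lemma norm_dev_sq (x : Vel × Sph) :
    ‖dev x‖ ^ 2 = (‖x.1‖ ^ 2 - ‖x.1‖ * inner ℝ x.1 (x.2 : Vel)) / 2 := by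
  rw [dev, norm_smul, mul_pow, @norm_sub_sq_real, norm_smul, norm_norm, norm_sph,
    real_inner_smul_left, real_inner_comm]
  norm_num
  ring

lemma norm_dev_eq {x : Vel × Sph} (hx : x.1 ≠ 0) : ‖dev x‖ = ‖x.1‖ / 2 * ‖(x.2 : Vel) - dir x‖ := by
  rw [dev]
  nth_rewrite 2 [← norm_smul_dir hx]
  rw [← smul_sub, norm_smul, norm_smul, norm_norm]
  norm_num
  ring

lemma norm_dev_le (x : Vel × Sph) : ‖dev x‖ ≤ ‖x.1‖ := by
  rw [dev, norm_smul]
  have := norm_sub_le (‖x.1‖ • (x.2 : Vel)) x.1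
  rw [norm_smul, norm_norm, norm_sph] at this
  norm_num
  linarith

lemma inner_reflDir (x : Vel × Sph) : inner ℝ x.1 (reflDir x : Vel) = inner ℝ x.1 (x.2 : Vel) := by
  by_cases hx : x.1 = 0
  · simp [hx]
  rw [coe_reflDir, inner_sub_right, real_inner_smul_right, real_inner_self_eq_norm_sq]
  have : ‖x.1‖ ≠ 0 := norm_ne_zero_iff.2 hx
  field_simp
  ring

lemma norm_dev_reflPair (x : Vel × Sph) : ‖dev (reflPair x)‖ = ‖dev x‖ := by
  rw [← sq_eq_sq₀ (norm_nonneg _) (norm_nonneg _), norm_dev_sq, norm_dev_sq]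
  simp only [reflPair, inner_reflDir]

/-- The components of the two deviations orthogonal to z cancel. What remains points along z and is
quadratic in |a|; this gain of one order is the source of the cancellation lemma. -/
lemma dev_add_dev_reflPair {x : Vel × Sph} (hx : x.1 ≠ 0) :
    dev x + dev (reflPair x) = -(2 * ‖dev x‖ ^ 2 / ‖x.1‖ ^ 2) • x.1 := by
  have hx' : ‖x.1‖ ≠ 0 := norm_ne_zero_iff.2 hx
  rw [norm_dev_sq]
  simp only [dev, reflPair, coe_reflDir]
  have : ∀ (n i : ℝ), n ≠ 0 → ∀ z σ : Vel, (1 / 2 : ℝ) • (n • σ - z) +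
      (1 / 2 : ℝ) • (n • ((2 * (i / n ^ 2)) • z - σ) - z) =
      -(2 * ((n ^ 2 - n * i) / 2) / n ^ 2) • z := by
    intro n i hn z σ
    have h1 : -(2 * ((n ^ 2 - n * i) / 2) / n ^ 2) = i / n - 1 := by field_simp; ring
    have h2 : n * (2 * (i / n ^ 2)) = 2 * (i / n) := by field_simp
    rw [smul_sub n, smul_smul n, h1, h2]
    module
  exact this _ _ hx' _ _

lemma norm_dev_add_dev_reflPair {x : Vel × Sph} (hx : x.1 ≠ 0) :
    ‖dev x + dev (reflPair x)‖ = 2 * ‖dev x‖ ^ 2 / ‖x.1‖ := by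
  have hx' : ‖x.1‖ ≠ 0 := norm_ne_zero_iff.2 hx
  rw [dev_add_dev_reflPair hx, norm_smul, Real.norm_eq_abs, abs_neg, abs_of_nonneg (by positivity)]
  field_simp

/-! ### Invariance of the measure `dz dσ` -/

lemma lintegral_polar {f : Vel → ℝ≥0∞} (hf : Measurable f) :
    ∫⁻ z, f z = ∫⁻ p : Sph × Ioi (0 : ℝ), f ((p.2 : ℝ) • (p.1 : Vel))
      ∂(sphMeasure.prod (Measure.volumeIoiPow 2)) := by
  have h1 : ∫⁻ z, f z = ∫⁻ z : ({(0 : Vel)}ᶜ : Set Vel), f z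
      ∂(Measure.comap ((↑) : ({(0 : Vel)}ᶜ : Set Vel) → Vel) volume) := by
    rw [lintegral_subtype_comap (measurableSet_singleton _).compl f, restrict_compl_singleton]
  have h2 := (volume : Measure Vel).measurePreserving_homeomorphUnitSphereProd.lintegral_comp
    (f := fun p : Sph × Ioi (0 : ℝ) => f ((p.2 : ℝ) • (p.1 : Vel))) (by fun_prop)
  simp only [finrank_euclideanSpace, Fintype.card_fin, Nat.add_one_sub_one] at h2
  rw [h1, ← h2]
  refine lintegral_congr fun z => ?_
  congr 1
  have hz : ‖(z : Vel)‖ ≠ 0 := norm_ne_zero_iff.2 z.2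
  simp [smul_smul, hz]

/-- In polar coordinates z = r e the map exchanges e and σ at fixed r, so Tonelli's theorem
suffices. -/
lemma lintegral_comp_flip {F : Vel × Sph → ℝ≥0∞} (hF : Measurable F) :
    ∫⁻ x, F (flip x) ∂(volume.prod sphMeasure) = ∫⁻ x, F x ∂(volume.prod sphMeasure) := by
  have key : ∀ G : Vel × Sph → ℝ≥0∞, Measurable G → ∫⁻ x, G x ∂(volume.prod sphMeasure) =
      ∫⁻ r : Ioi (0 : ℝ), ∫⁻ e, ∫⁻ σ, G ((r : ℝ) • (e : Vel), σ) ∂sphMeasure ∂sphMeasure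
        ∂(Measure.volumeIoiPow 2) := by
    intro G hG
    rw [lintegral_prod _ hG.aemeasurable, lintegral_polar hG.lintegral_prod_right',
      lintegral_prod_symm]
    exact (by
      refine (Measurable.lintegral_prod_right' (f := fun q : (Sph × Ioi (0 : ℝ)) × Sph =>
        G ((q.1.2 : ℝ) • (q.1.1 : Vel), q.2)) ?_).aemeasurable
      exact hG.comp (by fun_prop))
  rw [key (fun x => F (flip x)) (hF.comp measurable_flip), key F hF]
  refine lintegral_congr fun r => ?_
  have hr : (0 : ℝ) < r := r.2
  have e1 : ∀ e σ : Sph, F (flip ((r : ℝ) • (e : Vel), σ)) = F ((r : ℝ) • (σ : Vel), e) := by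
    intro e σ
    congr 1
    have hn : ‖(r : ℝ) • (e : Vel)‖ = r := by
      rw [norm_smul, norm_sph, mul_one, Real.norm_of_nonneg hr.le]
    have h0 : (r : ℝ) • (e : Vel) ≠ 0 := by
      rw [← norm_ne_zero_iff, hn]; exact hr.ne'
    refine Prod.ext ?_ (Subtype.ext ?_)
    · simp only [flip, hn]
    · simp only [flip, dir, h0, if_false, hn, smul_smul, inv_mul_cancel₀ hr.ne', one_smul]
  simp only [e1]
  rw [lintegral_lintegral_swap]
  exact (hF.comp (by fun_prop)).aemeasurable

/-- The surface measure of a set is a multiple of the volume of the cone over it, and a linear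
isometry maps cones to cones. -/
lemma measurePreserving_sphere (L : Vel ≃ₗᵢ[ℝ] Vel) :
    MeasurePreserving (fun σ : Sph => (⟨L σ, by simp⟩ : Sph)) sphMeasure sphMeasure := by
  have hm : Measurable (fun σ : Sph => (⟨L σ, by simp⟩ : Sph)) :=
    Measurable.subtype_mk (L.continuous.measurable.comp measurable_subtype_coe)
  refine ⟨hm, Measure.ext fun s hs => ?_⟩
  rw [Measure.map_apply hm hs, Measure.toSphere_apply' _ hs, Measure.toSphere_apply' _ (hm hs)]
  congr 1
  have : Ioo (0 : ℝ) 1 • ((↑) '' ((fun σ : Sph => (⟨L σ, by simp⟩ : Sph)) ⁻¹' s) : Set Vel) =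
      L ⁻¹' (Ioo (0 : ℝ) 1 • ((↑) '' s : Set Vel)) := by
    ext x
    simp only [Set.mem_smul, mem_image, mem_preimage]
    constructor
    · rintro ⟨t, ht, _, ⟨σ, hσ, rfl⟩, rfl⟩
      exact ⟨t, ht, _, ⟨_, hσ, rfl⟩, by simp⟩
    · rintro ⟨t, ht, _, ⟨σ, hσ, rfl⟩, h⟩
      refine ⟨t, ht, L.symm σ, ⟨⟨L.symm σ, by simp⟩, ?_, rfl⟩, ?_⟩
      · simpa using hσ
      · apply L.injective
        simpa using h
  rw [this]
  exact L.measurePreserving.measure_preimage_emb L.toHomeomorph.measurableEmbedding _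

lemma lintegral_comp_reflPair {F : Vel × Sph → ℝ≥0∞} (hF : Measurable F) :
    ∫⁻ x, F (reflPair x) ∂(volume.prod sphMeasure) = ∫⁻ x, F x ∂(volume.prod sphMeasure) := by
  rw [lintegral_prod (fun x => F (reflPair x)) (hF.comp measurable_reflPair).aemeasurable,
    lintegral_prod _ hF.aemeasurable]
  refine lintegral_congr fun z => ?_
  exact (measurePreserving_sphere (Submodule.span ℝ {z}).reflection).lintegral_comp
    (hF.comp (measurable_const.prodMk measurable_id))

lemma ae_fst_ne_zero : ∀ᵐ x : Vel × Sph ∂(volume.prod sphMeasure), x.1 ≠ 0 := by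
  have : ∀ᵐ z : Vel, z ≠ 0 := by simp [ae_iff]
  exact Measure.quasiMeasurePreserving_fst.ae this

/-! ### Caps of the sphere -/

/-- For r ≤ 1 the cone over a cap of radius r is covered by about 1/r balls of radius 2r centred on
its axis, of total volume of order r². For r > 1 the mass of the whole sphere is enough. -/
lemma exists_cap_bound : ∃ c : ℝ, 0 < c ∧ ∀ (e : Sph) (r : ℝ), 0 < r →
    sphMeasure {σ : Sph | ‖(σ : Vel) - e‖ < r} ≤ ENNReal.ofReal (c * r ^ 2) := by
  set V : ℝ := (volume (Metric.closedBall (0 : Vel) 1)).toReal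
  have hVt : volume (Metric.closedBall (0 : Vel) 1) ≠ ⊤ := measure_closedBall_lt_top.ne
  have hV : 0 < V := ENNReal.toReal_pos (Metric.measure_closedBall_pos volume _ one_pos).ne' hVt
  refine ⟨48 * V, by positivity, fun e r hr => ?_⟩
  have hms : MeasurableSet {σ : Sph | ‖(σ : Vel) - e‖ < r} :=
    measurableSet_lt (by fun_prop) measurable_const
  rcases le_or_gt r 1 with hr1 | hr1
  · rw [Measure.toSphere_apply' _ hms]
    set n : ℕ := ⌈1 / r⌉₊
    have hn : 1 / r ≤ n := Nat.le_ceil _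
    have hn' : (n : ℝ) < 1 / r + 1 := Nat.ceil_lt_add_one (by positivity)
    have hn0 : (0 : ℝ) < n := lt_of_lt_of_le (by positivity) hn
    have hnr : 1 / (n : ℝ) ≤ r := by
      rw [div_le_iff₀ hn0]; rw [div_le_iff₀ hr] at hn; linarith
    have hsub : Ioo (0 : ℝ) 1 • ((↑) '' {σ : Sph | ‖(σ : Vel) - e‖ < r} : Set Vel) ⊆
        ⋃ j ∈ Finset.range n, Metric.closedBall (((j : ℝ) / n) • (e : Vel)) (2 * r) := by
      rintro _ ⟨t, ht, _, ⟨σ, hσ, rfl⟩, rfl⟩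
      have htn : 0 ≤ t * n := mul_nonneg ht.1.le hn0.le
      have hj1 := Nat.floor_le htn
      have hj2 := Nat.lt_floor_add_one (t * n)
      simp only [mem_iUnion, Finset.mem_range]
      refine ⟨⌊t * n⌋₊, ?_, ?_⟩
      · rw [Nat.floor_lt htn]
        nlinarith [ht.2]
      · rw [mem_closedBall_iff_norm]
        have e1 : t • (σ : Vel) - ((⌊t * n⌋₊ : ℝ) / n) • (e : Vel) =
            t • ((σ : Vel) - e) + (t - (⌊t * n⌋₊ : ℝ) / n) • (e : Vel) := by module
        have h2 : |t - (⌊t * n⌋₊ : ℝ) / n| ≤ r := by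
          refine le_trans ?_ hnr
          rw [abs_of_nonneg (by rw [sub_nonneg, div_le_iff₀ hn0]; exact hj1)]
          rw [sub_le_iff_le_add, ← add_div, le_div_iff₀ hn0]
          linarith
        change ‖t • (σ : Vel) - _‖ ≤ _
        rw [e1]
        refine (norm_add_le _ _).trans ?_
        rw [norm_smul, norm_smul, norm_sph, Real.norm_eq_abs, Real.norm_eq_abs, abs_of_pos ht.1]
        have h3 : t * ‖(σ : Vel) - e‖ ≤ 1 * r :=
          mul_le_mul ht.2.le (le_of_lt hσ) (norm_nonneg _) zero_le_one
        linarith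
    have hvol : ∀ c : Vel, volume (Metric.closedBall c (2 * r)) = ENNReal.ofReal (8 * r ^ 3 * V) := by
      intro c
      rw [Measure.addHaar_closedBall' _ _ (by positivity), ← ENNReal.ofReal_toReal hVt,
        ← ENNReal.ofReal_mul (by positivity)]
      congr 1
      simp only [finrank_euclideanSpace, Fintype.card_fin, V]
      ring
    have h4 := (measure_mono hsub).trans (measure_biUnion_finset_le (μ := (volume : Measure Vel)) _ _)
    simp only [hvol, Finset.sum_const, Finset.card_range, nsmul_eq_mul] at h4
    calc _ ≤ (3 : ℝ≥0∞) * (n * ENNReal.ofReal (8 * r ^ 3 * V)) := by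
          refine mul_le_mul' ?_ h4
          simp
      _ = ENNReal.ofReal (3 * (n * (8 * r ^ 3 * V))) := by
          rw [ENNReal.ofReal_mul (p := 3) (by norm_num),
            ENNReal.ofReal_mul (p := (n : ℝ)) (by positivity)]
          rw [ENNReal.ofReal_natCast, ENNReal.ofReal_ofNat]
      _ ≤ _ := by
          refine ENNReal.ofReal_le_ofReal ?_
          have h5 : (n : ℝ) * r ≤ 2 := by
            have : (n : ℝ) * r < (1 / r + 1) * r := mul_lt_mul_of_pos_right hn' hr
            have h6 : (1 / r + 1) * r = 1 + r := by field_simp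
            linarith
          have h7 : 0 ≤ r ^ 2 * V := by positivity
          nlinarith
  · refine (measure_mono (subset_univ _)).trans ?_
    rw [Measure.toSphere_apply_univ]
    have h1 : volume (Metric.ball (0 : Vel) 1) ≤ ENNReal.ofReal V := by
      rw [ENNReal.ofReal_toReal hVt]
      exact measure_mono Metric.ball_subset_closedBall
    calc _ ≤ (3 : ℝ≥0∞) * ENNReal.ofReal V := by
          refine mul_le_mul' ?_ h1
          simp
      _ = ENNReal.ofReal (3 * V) := by
          rw [ENNReal.ofReal_mul (by norm_num)]; simp
      _ ≤ _ := by
          refine ENNReal.ofReal_le_ofReal ?_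
          nlinarith [mul_pos hV (by nlinarith : (0 : ℝ) < r ^ 2 - 1)]

end

end QuantumBoltzmann

namespace QuantumBoltzmann

noncomputable section

/-! ### Singular integrals over the sphere -/

lemma lintegral_Ioi_rpow {p a : ℝ} (hp : p < -1) (ha : 0 < a) :
    ∫⁻ τ in Ioi a, ENNReal.ofReal (τ ^ p) = ENNReal.ofReal (-a ^ (p + 1) / (p + 1)) := by
  rw [← integral_Ioi_rpow_of_lt hp ha,
    ofReal_integral_eq_lintegral_ofReal (integrableOn_Ioi_rpow_of_lt hp ha)]
  filter_upwards [ae_restrict_mem measurableSet_Ioi] with τ hτ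
  exact Real.rpow_nonneg (ha.trans hτ).le _

lemma lintegral_Ioc_rpow {p r : ℝ} (hp : -1 < p) (hr : 0 < r) :
    ∫⁻ τ in Ioc 0 r, ENNReal.ofReal (τ ^ p) = ENNReal.ofReal (r ^ (p + 1) / (p + 1)) := by
  have h1 : IntegrableOn (fun τ : ℝ => τ ^ p) (Ioc 0 r) :=
    (intervalIntegral.intervalIntegrable_rpow' hp (a := 0) (b := r)).1
  rw [← ofReal_integral_eq_lintegral_ofReal h1, ← intervalIntegral.integral_of_le hr.le,
    integral_rpow (Or.inl hp), Real.zero_rpow (by linarith), sub_zero]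
  filter_upwards [ae_restrict_mem measurableSet_Ioc] with τ hτ
  exact Real.rpow_nonneg hτ.1.le _

/-- Layer-cake argument: cap measures of order τ² turn the integral into ∫ τ^(-1-2s) min(τ, r)² dτ,
which converges at 0 because s < 1 and at infinity because s > 0. -/
lemma exists_sphere_bound {s : ℝ} (hs : 0 < s) (hs1 : s < 1) : ∃ K : ℝ, 0 < K ∧
    ∀ (e : Sph) (r : ℝ), 0 < r →
      ∫⁻ σ : Sph, ENNReal.ofReal (min ‖(σ : Vel) - e‖ r ^ 2 * ‖(σ : Vel) - e‖ ^ (-2 - 2 * s))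
        ∂sphMeasure ≤ ENNReal.ofReal (K * r ^ (2 - 2 * s)) := by
  obtain ⟨c, hc, hcap⟩ := exists_cap_bound
  have h2s : 0 < 2 - 2 * s := by linarith
  refine ⟨(2 + 2 * s) * c * (1 / (2 - 2 * s) + 1 / (2 * s)), by positivity, fun e r hr => ?_⟩
  -- Integrating (2 + 2s) τ^(-3-2s) over τ > d returns d^(-2-2s). On that range min(d, r) may be
  -- raised to min(τ, r), which removes the dependence on σ.
  set G : ℝ → ℝ := fun τ => (2 + 2 * s) * τ ^ (-3 - 2 * s) * min τ r ^ 2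
  have hGm : Measurable G := by fun_prop
  have hpt : ∀ σ : Sph, ENNReal.ofReal
      (min ‖(σ : Vel) - e‖ r ^ 2 * ‖(σ : Vel) - e‖ ^ (-2 - 2 * s)) ≤
      ∫⁻ τ in Ioi (0 : ℝ), {τ | ‖(σ : Vel) - e‖ < τ}.indicator (fun τ => ENNReal.ofReal (G τ)) τ := by
    intro σ
    set d := ‖(σ : Vel) - e‖
    rcases (norm_nonneg ((σ : Vel) - e)).eq_or_lt with h0 | h0
    · have : d = 0 := h0.symm
      rw [this, min_eq_left hr.le]
      simp
    · have hd : 0 < d := h0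
      have e1 : ∫⁻ τ in Ioi (0 : ℝ), {τ | d < τ}.indicator (fun τ => ENNReal.ofReal (G τ)) τ =
          ∫⁻ τ in Ioi d, ENNReal.ofReal (G τ) := by
        have hset : {τ : ℝ | d < τ} = Ioi d := rfl
        rw [hset, lintegral_indicator measurableSet_Ioi, Measure.restrict_restrict measurableSet_Ioi,
          Ioi_inter_Ioi, max_eq_left hd.le]
      rw [e1]
      calc _ = ENNReal.ofReal ((2 + 2 * s) * min d r ^ 2) *
            ∫⁻ τ in Ioi d, ENNReal.ofReal (τ ^ (-3 - 2 * s)) := by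
              rw [lintegral_Ioi_rpow (by linarith) hd, ← ENNReal.ofReal_mul (by positivity)]
              congr 1
              have : -3 - 2 * s + 1 = -2 - 2 * s := by ring
              have h3 : -d ^ (-2 - 2 * s) / (-2 - 2 * s) = d ^ (-2 - 2 * s) / (2 + 2 * s) := by
                rw [neg_div, ← div_neg]; congr 1; ring
              rw [this, h3]
              field_simp
        _ = ∫⁻ τ in Ioi d, ENNReal.ofReal ((2 + 2 * s) * min d r ^ 2) *
            ENNReal.ofReal (τ ^ (-3 - 2 * s)) := by
              rw [lintegral_const_mul _ (by fun_prop)]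
        _ ≤ _ := by
              refine setLIntegral_mono hGm.ennreal_ofReal fun τ hτ => ?_
              have hτ0 : 0 < τ := hd.trans hτ
              rw [← ENNReal.ofReal_mul (by positivity)]
              refine ENNReal.ofReal_le_ofReal ?_
              simp only [G]
              have h4 : min d r ≤ min τ r := min_le_min_right r (le_of_lt hτ)
              have h5 : min d r ^ 2 ≤ min τ r ^ 2 := pow_le_pow_left₀ (le_min hd.le hr.le) h4 2
              have h6 : 0 ≤ τ ^ (-3 - 2 * s) := Real.rpow_nonneg hτ0.le _
              nlinarith [mul_le_mul_of_nonneg_left h5 (by positivity : 0 ≤ (2 + 2 * s) * τ ^ (-3 - 2 * s))]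
  calc _ ≤ ∫⁻ σ : Sph, (∫⁻ τ in Ioi (0 : ℝ),
        {τ | ‖(σ : Vel) - e‖ < τ}.indicator (fun τ => ENNReal.ofReal (G τ)) τ) ∂sphMeasure :=
        lintegral_mono hpt
    _ = ∫⁻ τ in Ioi (0 : ℝ), ∫⁻ σ : Sph,
        {τ | ‖(σ : Vel) - e‖ < τ}.indicator (fun τ => ENNReal.ofReal (G τ)) τ ∂sphMeasure := by
        refine lintegral_lintegral_swap ?_
        refine Measurable.aemeasurable ?_
        change Measurable (fun p : Sph × ℝ =>
          {τ | ‖(p.1 : Vel) - e‖ < τ}.indicator (fun τ => ENNReal.ofReal (G τ)) p.2)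
        have : (fun p : Sph × ℝ =>
          {τ | ‖(p.1 : Vel) - e‖ < τ}.indicator (fun τ => ENNReal.ofReal (G τ)) p.2) =
          {p : Sph × ℝ | ‖(p.1 : Vel) - e‖ < p.2}.indicator fun p => ENNReal.ofReal (G p.2) := by
          funext p; simp [indicator]
        rw [this]
        exact (hGm.comp measurable_snd).ennreal_ofReal.indicator
          (measurableSet_lt (by fun_prop) measurable_snd)
    _ ≤ ∫⁻ τ in Ioi (0 : ℝ), ENNReal.ofReal (c * (2 + 2 * s) * (τ ^ (-1 - 2 * s) * min τ r ^ 2)) := by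
        refine setLIntegral_mono (by fun_prop) fun τ hτ => ?_
        have hτ0 : 0 < τ := hτ
        have : ∀ σ : Sph, {τ | ‖(σ : Vel) - e‖ < τ}.indicator (fun τ => ENNReal.ofReal (G τ)) τ =
          {σ : Sph | ‖(σ : Vel) - e‖ < τ}.indicator (fun _ => ENNReal.ofReal (G τ)) σ := by
          intro σ; simp [indicator]
        simp only [this]
        rw [lintegral_indicator_const (measurableSet_lt (by fun_prop) measurable_const)]
        refine (mul_le_mul_right (hcap e τ hτ0) _).trans_eq ?_
        have hG0 : 0 ≤ G τ := by simp only [G]; positivity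
        rw [← ENNReal.ofReal_mul hG0]
        congr 1
        have h7 : τ ^ (-1 - 2 * s) = τ ^ (-3 - 2 * s) * τ ^ 2 := by
          rw [← Real.rpow_natCast, ← Real.rpow_add hτ0]; congr 1; push_cast; ring
        simp only [G, h7]
        ring
    _ = ENNReal.ofReal (c * (2 + 2 * s)) *
        ∫⁻ τ in Ioi (0 : ℝ), ENNReal.ofReal (τ ^ (-1 - 2 * s) * min τ r ^ 2) := by
        rw [← lintegral_const_mul _ (by fun_prop)]
        refine lintegral_congr fun τ => ?_
        rw [ENNReal.ofReal_mul (by positivity)]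
    _ ≤ ENNReal.ofReal (c * (2 + 2 * s)) *
        (ENNReal.ofReal (r ^ (2 - 2 * s) / (2 - 2 * s)) +
          ENNReal.ofReal (r ^ (2 - 2 * s) / (2 * s))) := by
        refine mul_le_mul_right ?_ _
        rw [← Ioc_union_Ioi_eq_Ioi hr.le]
        refine (lintegral_union_le _ _ _).trans (add_le_add ?_ ?_)
        · have h8 := lintegral_Ioc_rpow (p := 1 - 2 * s) (r := r) (by linarith) hr
          have h9 : 1 - 2 * s + 1 = 2 - 2 * s := by ring
          rw [h9] at h8
          rw [← h8]
          refine setLIntegral_mono (by fun_prop) fun τ hτ => ENNReal.ofReal_le_ofReal ?_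
          rw [min_eq_left hτ.2, ← Real.rpow_natCast, ← Real.rpow_add hτ.1]
          refine le_of_eq ?_
          congr 1; push_cast; ring
        · have h8 := lintegral_Ioi_rpow (p := -1 - 2 * s) (a := r) (by linarith) hr
          have h9 : ENNReal.ofReal (r ^ (2 - 2 * s) / (2 * s)) = ENNReal.ofReal (r ^ 2) *
              ∫⁻ τ in Ioi r, ENNReal.ofReal (τ ^ (-1 - 2 * s)) := by
            rw [h8, ← ENNReal.ofReal_mul (by positivity)]
            congr 1
            have h10 : r ^ (2 - 2 * s) = r ^ 2 * r ^ (-1 - 2 * s + 1) := by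
              rw [← Real.rpow_natCast, ← Real.rpow_add hr]; congr 1; push_cast; ring
            have h11 : -1 - 2 * s + 1 = -(2 * s) := by ring
            rw [h10, h11]
            field_simp
          rw [h9, ← lintegral_const_mul _ (by fun_prop)]
          refine setLIntegral_mono (by fun_prop) fun τ hτ => ?_
          have hτr : r < τ := hτ
          rw [min_eq_right hτr.le, mul_comm, ENNReal.ofReal_mul (by positivity)]
    _ = _ := by
        rw [← ENNReal.ofReal_add (by positivity) (by positivity), ← ENNReal.ofReal_mul (by positivity)]
        congr 1
        field_simp

/-! ### Integration of the postcollisional velocity -/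

lemma add_dev (z : Vel) (σ : Sph) : z + dev (z, σ) = (1 / 2 : ℝ) • (z + ‖z‖ • (σ : Vel)) := by
  simp only [dev]
  module

lemma hasFDerivAt_add_dev {z : Vel} (hz : z ≠ 0) (σ : Sph) :
    HasFDerivAt (fun z : Vel => (1 / 2 : ℝ) • (z + ‖z‖ • (σ : Vel)))
      ((1 / 2 : ℝ) • (ContinuousLinearMap.id ℝ Vel +
        (‖z‖⁻¹ • innerSL ℝ z).smulRight (σ : Vel))) z := by
  have h1 : HasFDerivAt (fun z : Vel => ‖z‖) (‖z‖⁻¹ • innerSL ℝ z) z := by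
    have h2 := (hasStrictFDerivAt_norm_sq z).hasFDerivAt.sqrt (by simpa using hz)
    simp only [Real.sqrt_sq (norm_nonneg _)] at h2
    have hz' : ‖z‖ ≠ 0 := norm_ne_zero_iff.2 hz
    refine h2.congr_fderiv (ContinuousLinearMap.ext fun y => ?_)
    simp
    field_simp
  exact ((hasFDerivAt_id z).add (h1.smul_const (σ : Vel))).const_smul (1 / 2 : ℝ)

/-- For fixed σ the map z ↦ z + a is injective on the half space ⟨z, σ⟩ ≥ 0 with Jacobian (1 + cos
θ)/8 ≥ 1/8. It moves a weight evaluated at v'_* = v - z - a to one evaluated at v - w. -/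
lemma lintegral_add_dev_le (σ : Sph) (H : Vel → ℝ≥0∞) :
    ∫⁻ z in {z : Vel | z ≠ 0 ∧ 0 ≤ inner ℝ z (σ : Vel)}, H (z + dev (z, σ)) ≤ 8 * ∫⁻ w, H w := by
  set A : Set Vel := {z : Vel | z ≠ 0 ∧ 0 ≤ inner ℝ z (σ : Vel)}
  have hin : Measurable fun z : Vel => inner ℝ z (σ : Vel) := by fun_prop
  have hA : MeasurableSet A :=
    (measurableSet_singleton (0 : Vel)).compl.inter (measurableSet_le measurable_const hin)
  set f : Vel → Vel := fun z => (1 / 2 : ℝ) • (z + ‖z‖ • (σ : Vel))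
  set f' : Vel → Vel →L[ℝ] Vel := fun z => (1 / 2 : ℝ) • (ContinuousLinearMap.id ℝ Vel +
        (‖z‖⁻¹ • innerSL ℝ z).smulRight (σ : Vel))
  have hσσ : inner ℝ (σ : Vel) (σ : Vel) = (1 : ℝ) := by
    rw [real_inner_self_eq_norm_sq, norm_sph]; norm_num
  have hinj : InjOn f A := by
    -- The image w determines |z| = |w|²/⟨w, σ⟩, and then z = 2w - |z|σ.
    have key : ∀ z ∈ A, ‖z‖ * inner ℝ (f z) (σ : Vel) = ‖f z‖ ^ 2 ∧ 0 < inner ℝ (f z) (σ : Vel) := by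
      intro z hz
      have hz0 : 0 < ‖z‖ := norm_pos_iff.2 hz.1
      have e1 : inner ℝ (f z) (σ : Vel) = (inner ℝ z (σ : Vel) + ‖z‖) / 2 := by
        simp only [f, real_inner_smul_left, inner_add_left, hσσ]; ring
      refine ⟨?_, ?_⟩
      · rw [e1]
        simp only [f]
        rw [norm_smul, mul_pow, @norm_add_sq_real, norm_smul, norm_norm, norm_sph,
          real_inner_smul_right]
        norm_num
        ring
      · rw [e1]; have := hz.2; linarith
    intro z1 h1 z2 h2 h12
    have k1 := key z1 h1
    have k2 := key z2 h2
    have hn : ‖z1‖ = ‖z2‖ := by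
      have := k1.1
      rw [h12, ← k2.1] at this
      exact mul_right_cancel₀ k2.2.ne' this
    have h3 : (1 / 2 : ℝ) • (z1 + ‖z1‖ • (σ : Vel)) = (1 / 2 : ℝ) • (z2 + ‖z2‖ • (σ : Vel)) := h12
    rw [hn] at h3
    have h4 := smul_right_injective Vel (by norm_num : (1 / 2 : ℝ) ≠ 0) h3
    exact add_right_cancel h4
  have hcv := lintegral_image_eq_lintegral_abs_det_fderiv_mul volume hA
    (fun z hz => (hasFDerivAt_add_dev hz.1 σ).hasFDerivWithinAt) hinj H
  have hdet : ∀ z ∈ A, 1 / 8 ≤ |(f' z).det| := by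
    intro z hz
    have hz0 : 0 < ‖z‖ := norm_pos_iff.2 hz.1
    -- The derivative is half of a rank-one perturbation of the identity; the 1/8 is (1/2)³.
    have e1 : (f' z).det = (1 / 8) * (1 + ‖z‖⁻¹ * inner ℝ z (σ : Vel)) := by
      have e2 : ((f' z : Vel →L[ℝ] Vel) : Vel →ₗ[ℝ] Vel) = (1 / 2 : ℝ) •
          LinearMap.transvection ((‖z‖⁻¹ • innerSL ℝ z : Vel →L[ℝ] ℝ) : Vel →ₗ[ℝ] ℝ) (σ : Vel) := by
        ext y
        simp [f', LinearMap.transvection]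
      rw [ContinuousLinearMap.det, e2, LinearMap.det_smul, LinearMap.transvection.det]
      simp
      norm_num
    rw [e1]
    have h5 : 0 ≤ ‖z‖⁻¹ * inner ℝ z (σ : Vel) := mul_nonneg (by positivity) hz.2
    rw [abs_of_nonneg (by positivity)]
    linarith
  calc _ ≤ ∫⁻ z in A, 8 * (ENNReal.ofReal |(f' z).det| * H (f z)) := by
        refine setLIntegral_mono' hA fun z hz => ?_
        rw [add_dev, ← mul_assoc]
        have h6 : (1 : ℝ≥0∞) ≤ 8 * ENNReal.ofReal |(f' z).det| := by
          have h7 := ENNReal.ofReal_le_ofReal (hdet z hz)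
          calc (1 : ℝ≥0∞) = 8 * ENNReal.ofReal (1 / 8) := by
                rw [← ENNReal.ofReal_ofNat, ← ENNReal.ofReal_mul (by norm_num)]; norm_num
            _ ≤ _ := mul_le_mul_right h7 _
        calc H (f z) = 1 * H (f z) := (one_mul _).symm
          _ ≤ _ := mul_le_mul_left h6 _
    _ = 8 * ∫⁻ z in A, ENNReal.ofReal |(f' z).det| * H (f z) := by
        rw [lintegral_const_mul' _ _ (by norm_num)]
    _ ≤ _ := by
        rw [← hcv]
        exact mul_le_mul_right (setLIntegral_le_lintegral _ _) _

/-! ### The weight -/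

/-- The weight `ω(v) = (1 + |v|)⁻⁴`. -/
def wt (v : Vel) : ℝ := ((1 + ‖v‖) ^ 4)⁻¹

lemma wt_pos (v : Vel) : 0 < wt v := by unfold wt; positivity

lemma wt_le_one (v : Vel) : wt v ≤ 1 := by
  unfold wt
  refine inv_le_one_of_one_le₀ (one_le_pow₀ ?_)
  linarith [norm_nonneg v]

lemma continuous_wt : Continuous wt := by
  unfold wt
  refine Continuous.inv₀ (by fun_prop) fun v => by positivity

lemma integrable_wt : Integrable wt := by
  have h := integrable_one_add_norm (E := Vel) (μ := volume) (r := 4)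
    (by simp only [finrank_euclideanSpace, Fintype.card_fin]; norm_num)
  refine h.congr (Eventually.of_forall fun v => ?_)
  simp only [wt]
  rw [Real.rpow_neg (by positivity)]
  norm_cast

lemma wt_add_le (v y : Vel) (hy : ‖y‖ ≤ 1) : wt (v + y) ≤ 16 * wt v := by
  unfold wt
  have h1 : ‖v‖ ≤ ‖v + y‖ + 1 := by
    have := norm_sub_le (v + y) y
    rw [add_sub_cancel_right] at this
    linarith
  have h2 : (1 + ‖v‖) ^ 4 ≤ 16 * (1 + ‖v + y‖) ^ 4 := by
    calc (1 + ‖v‖) ^ 4 ≤ (2 * (1 + ‖v + y‖)) ^ 4 :=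
          pow_le_pow_left₀ (by positivity) (by linarith [norm_nonneg (v + y)]) 4
      _ = _ := by ring
  rw [← div_eq_mul_inv, le_div_iff₀ (by positivity), inv_mul_le_iff₀ (by positivity)]
  linarith

/-- Near z = 0 the power |z|^γ is integrable because γ > -3. Elsewhere it is at most 1 and the
translated weight has an integral independent of v. -/
lemma exists_weight_bound {γ : ℝ} (hγ : -3 < γ) (hγ0 : γ < 0) : ∃ W : ℝ, 0 < W ∧
    ∀ v : Vel, ∫⁻ z, ENNReal.ofReal ((1 + ‖z‖ ^ γ) * wt (v - z)) ≤ ENNReal.ofReal W := by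
  have h1 : IntegrableOn (fun z : Vel => ‖z‖ ^ γ) (Metric.ball 0 1) := by
    rw [integrableOn_fun_norm_addHaar volume (f := fun y => y ^ γ)]
    simp only [finrank_euclideanSpace, Fintype.card_fin, smul_eq_mul]
    have h2 : IntegrableOn (fun y : ℝ => y ^ (2 + γ)) (Ioo 0 1) :=
      (intervalIntegral.integrableOn_Ioo_rpow_iff one_pos).2 (by linarith)
    refine h2.congr_fun (fun y hy => ?_) measurableSet_Ioo
    simp only
    rw [Real.rpow_add hy.1]
    norm_num
  have h1' := (integrable_indicator_iff (measurableSet_ball)).2 h1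
  set I := ∫ z, (Metric.ball (0 : Vel) 1).indicator (fun z : Vel => ‖z‖ ^ γ) z
  have hI : 0 ≤ I := integral_nonneg fun z => indicator_nonneg (fun _ _ => by positivity) _
  have hJ : 0 ≤ ∫ z, wt z := integral_nonneg fun z => (wt_pos z).le
  refine ⟨2 * (∫ z, wt z) + I + 1, by positivity, fun v => ?_⟩
  have h3 : Integrable fun z => wt (v - z) := integrable_wt.comp_sub_left v
  calc _ ≤ ∫⁻ z, ENNReal.ofReal (2 * wt (v - z) +
        (Metric.ball (0 : Vel) 1).indicator (fun z : Vel => ‖z‖ ^ γ) z) := by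
        refine lintegral_mono fun z => ENNReal.ofReal_le_ofReal ?_
        have hw := wt_pos (v - z)
        have hw1 := wt_le_one (v - z)
        by_cases hz : z ∈ Metric.ball (0 : Vel) 1
        · rw [indicator_of_mem hz]
          have : 0 ≤ ‖z‖ ^ γ := by positivity
          nlinarith
        · rw [indicator_of_notMem hz]
          have : ‖z‖ ^ γ ≤ 1 := Real.rpow_le_one_of_one_le_of_nonpos (by simpa using hz) hγ0.le
          nlinarith
    _ = ENNReal.ofReal (2 * (∫ z, wt z) + I) := by
        have h5 := ofReal_integral_eq_lintegral_ofReal ((h3.const_mul 2).add h1')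
          (Eventually.of_forall fun z => add_nonneg (by have := wt_pos (v - z); positivity)
            (indicator_nonneg (fun _ _ => by positivity) _))
        have h6 := integral_add (h3.const_mul 2) h1'
        rw [integral_const_mul, integral_sub_left_eq_self (fun z => wt z) volume v] at h6
        rw [← h6]
        exact h5.symm
    _ ≤ _ := ENNReal.ofReal_le_ofReal (by linarith)

end

end QuantumBoltzmann

namespace QuantumBoltzmann

noncomputable section

/-! ### Bounds for the collision kernel -/

lemma norm_dev_eq_sin {z : Vel} (hz : z ≠ 0) (σ : Sph) :
    ‖dev (z, σ)‖ = ‖z‖ * Real.sin (InnerProductGeometry.angle z (σ : Vel) / 2) := by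
  set θ := InnerProductGeometry.angle z (σ : Vel)
  have h0 : 0 ≤ θ := InnerProductGeometry.angle_nonneg _ _
  have h1 : θ ≤ Real.pi := InnerProductGeometry.angle_le_pi _ _
  have hs : 0 ≤ Real.sin (θ / 2) := Real.sin_nonneg_of_nonneg_of_le_pi (by linarith) (by linarith)
  have hc : inner ℝ z (σ : Vel) = ‖z‖ * Real.cos θ := by
    have := InnerProductGeometry.cos_angle_mul_norm_mul_norm z (σ : Vel)
    rw [norm_sph] at this
    linarith
  rw [← sq_eq_sq₀ (norm_nonneg _) (by positivity), norm_dev_sq]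
  simp only [hc]
  have h2 : Real.cos θ = 1 - 2 * Real.sin (θ / 2) ^ 2 := by
    have h3 := Real.cos_two_mul (θ / 2)
    have h4 := Real.sin_sq_add_cos_sq (θ / 2)
    rw [mul_div_cancel₀ θ (by norm_num : (2 : ℝ) ≠ 0)] at h3
    linarith
  rw [h2]
  ring

variable {C γ s ε : ℝ}

lemma truncKernel_nonneg (hC : 0 < C) (z σ : Vel) : 0 ≤ truncKernel C γ s ε z σ := by
  unfold truncKernel kernel
  split_ifs <;> positivity

/-- For θ ≤ π/2 the cosine of θ/2 dominates its sine, so both powers in the kernel are bounded by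
that of sin(θ/2) = |a|/|z|. The third bound is uniform in the cutoff; the fourth is not, but has no
angular singularity. -/
lemma truncKernel_bounds (hC : 0 < C) (hs : 0 < s) (hε : 0 < ε) {z : Vel} (hz : z ≠ 0) (σ : Sph)
    (hne : truncKernel C γ s ε z σ ≠ 0) :
    0 ≤ inner ℝ z (σ : Vel) ∧ 0 < ‖dev (z, σ)‖ ∧
    truncKernel C γ s ε z σ ≤ 4 * C * (‖z‖ ^ γ * (‖dev (z, σ)‖ / ‖z‖) ^ (-2 - 2 * s)) ∧
    truncKernel C γ s ε z σ ≤ 4 * C * Real.sin (ε / 2) ^ (-2 - 2 * s) * ‖z‖ ^ γ := by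
  have hz0 : 0 < ‖z‖ := norm_pos_iff.2 hz
  have hdev := norm_dev_eq_sin hz σ
  unfold truncKernel kernel at hne ⊢
  set θ := InnerProductGeometry.angle z (σ : Vel)
  by_cases h1 : ε ≤ θ
  swap
  · simp [h1] at hne
  by_cases h2 : θ ≤ Real.pi / 2
  swap
  · simp [h2] at hne
  simp only [h1, h2, if_true]
  have hpi := Real.pi_pos
  have hsε : 0 < Real.sin (ε / 2) := Real.sin_pos_of_pos_of_lt_pi (by linarith) (by linarith)
  have hsθ : Real.sin (ε / 2) ≤ Real.sin (θ / 2) :=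
    Real.sin_le_sin_of_le_of_le_pi_div_two (by linarith) (by linarith) (by linarith)
  have hsθ0 : 0 < Real.sin (θ / 2) := hsε.trans_le hsθ
  have hcs : Real.sin (θ / 2) ≤ Real.cos (θ / 2) := by
    rw [← Real.sin_pi_div_two_sub]
    exact Real.sin_le_sin_of_le_of_le_pi_div_two (by linarith) (by linarith) (by linarith)
  have hq : ‖dev (z, σ)‖ / ‖z‖ = Real.sin (θ / 2) := by
    rw [hdev]; field_simp
  have hcos : Real.cos (θ / 2) ^ (-1 - s) ≤ Real.sin (θ / 2) ^ (-1 - s) :=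
    Real.rpow_le_rpow_of_nonpos hsθ0 hcs (by linarith)
  have hcos0 : 0 ≤ Real.cos (θ / 2) ^ (-1 - s) := Real.rpow_nonneg (hsθ0.le.trans hcs) _
  have hsq : (Real.sin (θ / 2) ^ (-1 - s)) ^ 2 = Real.sin (θ / 2) ^ (-2 - 2 * s) := by
    rw [← Real.rpow_natCast, ← Real.rpow_mul hsθ0.le]; congr 1; push_cast; ring
  have hmain : (Real.sin (θ / 2) ^ (-1 - s) + Real.cos (θ / 2) ^ (-1 - s)) ^ 2 ≤
      4 * Real.sin (θ / 2) ^ (-2 - 2 * s) := by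
    rw [← hsq]
    nlinarith [Real.rpow_nonneg hsθ0.le (-1 - s)]
  have hzγ : 0 ≤ ‖z‖ ^ γ := by positivity
  refine ⟨?_, ?_, ?_, ?_⟩
  · have := InnerProductGeometry.cos_angle_mul_norm_mul_norm z (σ : Vel)
    rw [← this]
    exact mul_nonneg (Real.cos_nonneg_of_neg_pi_div_two_le_of_le (by linarith) h2) (by positivity)
  · rw [hdev]; positivity
  · rw [hq]
    calc _ ≤ C * ‖z‖ ^ γ * (4 * Real.sin (θ / 2) ^ (-2 - 2 * s)) :=
          mul_le_mul_of_nonneg_left hmain (by positivity)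
      _ = _ := by ring
  · have h3 : Real.sin (θ / 2) ^ (-2 - 2 * s) ≤ Real.sin (ε / 2) ^ (-2 - 2 * s) :=
      Real.rpow_le_rpow_of_nonpos hsε hsθ (by linarith)
    calc _ ≤ C * ‖z‖ ^ γ * (4 * Real.sin (θ / 2) ^ (-2 - 2 * s)) :=
          mul_le_mul_of_nonneg_left hmain (by positivity)
      _ ≤ C * ‖z‖ ^ γ * (4 * Real.sin (ε / 2) ^ (-2 - 2 * s)) := by gcongr
      _ = _ := by ring

lemma truncKernel_flip {x : Vel × Sph} (hx : x.1 ≠ 0) :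
    truncKernel C γ s ε (flip x).1 (flip x).2 = truncKernel C γ s ε x.1 x.2 := by
  have hx0 : 0 < ‖x.1‖ := norm_pos_iff.2 hx
  have h1 : InnerProductGeometry.angle (flip x).1 ((flip x).2 : Vel) =
      InnerProductGeometry.angle x.1 (x.2 : Vel) := by
    simp only [flip, dir, hx, if_false]
    rw [InnerProductGeometry.angle_smul_left_of_pos _ _ hx0,
      InnerProductGeometry.angle_smul_right_of_pos _ _ (inv_pos.2 hx0),
      InnerProductGeometry.angle_comm]
  unfold truncKernel kernel
  rw [h1, norm_flip_fst]

lemma truncKernel_reflPair (x : Vel × Sph) :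
    truncKernel C γ s ε (reflPair x).1 (reflPair x).2 = truncKernel C γ s ε x.1 x.2 := by
  have h1 : InnerProductGeometry.angle (reflPair x).1 ((reflPair x).2 : Vel) =
      InnerProductGeometry.angle x.1 (x.2 : Vel) := by
    simp only [InnerProductGeometry.angle, reflPair, inner_reflDir, norm_sph]
  unfold truncKernel kernel
  rw [h1]
  rfl

lemma measurable_truncKernel :
    Measurable fun x : Vel × Sph => truncKernel C γ s ε x.1 x.2 := by
  have h1 : Measurable fun x : Vel × Sph => InnerProductGeometry.angle x.1 (x.2 : Vel) := by
    unfold InnerProductGeometry.angle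
    exact Real.measurable_arccos.comp (by fun_prop)
  unfold truncKernel kernel
  refine Measurable.ite (measurableSet_le measurable_const h1) ?_ measurable_const
  refine Measurable.ite (measurableSet_le h1 measurable_const) ?_ measurable_const
  fun_prop

/-! ### The collision measure -/

variable (C γ s ε) in
/-- The measure `B(z, σ) 1_{θ ≥ ε} dz dσ`. -/
def collMeasure : Measure (Vel × Sph) :=
  (volume.prod sphMeasure).withDensity fun x => ENNReal.ofReal (truncKernel C γ s ε x.1 x.2)

instance : SigmaFinite (collMeasure C γ s ε) := by
  have : SigmaFinite ((volume : Measure Vel).prod sphMeasure) := Measure.prod.instSigmaFinite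
  exact SigmaFinite.withDensity_ofReal (μ := (volume : Measure Vel).prod sphMeasure) _

lemma lintegral_collMeasure (F : Vel × Sph → ℝ≥0∞) :
    ∫⁻ x, F x ∂(collMeasure C γ s ε) =
      ∫⁻ x, ENNReal.ofReal (truncKernel C γ s ε x.1 x.2) * F x ∂(volume.prod sphMeasure) := by
  rw [collMeasure, lintegral_withDensity_eq_lintegral_mul_non_measurable _
    measurable_truncKernel.ennreal_ofReal (Eventually.of_forall fun x => ENNReal.ofReal_lt_top)]
  rfl

lemma ae_collMeasure {p : Vel × Sph → Prop} (h : ∀ᵐ x ∂(volume.prod sphMeasure), p x) :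
    ∀ᵐ x ∂(collMeasure C γ s ε), p x :=
  (withDensity_absolutelyContinuous _ _).ae_le h

lemma measurePreserving_of_lintegral {α : Type*} [MeasurableSpace α] {μ : Measure α} {T : α → α}
    (hT : Measurable T) (h : ∀ F : α → ℝ≥0∞, Measurable F → ∫⁻ x, F (T x) ∂μ = ∫⁻ x, F x ∂μ) :
    MeasurePreserving T μ μ := by
  refine ⟨hT, Measure.ext fun A hA => ?_⟩
  rw [Measure.map_apply hT hA, ← lintegral_indicator_one hA, ← lintegral_indicator_one (hT hA)]
  exact h (A.indicator 1) (measurable_one.indicator hA)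

lemma measurePreserving_flip : MeasurePreserving flip (collMeasure C γ s ε) (collMeasure C γ s ε) := by
  refine measurePreserving_of_lintegral measurable_flip fun F hF => ?_
  have h := lintegral_comp_flip
    (F := fun x => ENNReal.ofReal (truncKernel C γ s ε x.1 x.2) * F x)
    (measurable_truncKernel.ennreal_ofReal.mul hF)
  rw [lintegral_collMeasure, lintegral_collMeasure, ← h]
  refine lintegral_congr_ae ?_
  filter_upwards [ae_fst_ne_zero] with x hx
  simp only [truncKernel_flip hx]

lemma measurePreserving_reflPair :
    MeasurePreserving reflPair (collMeasure C γ s ε) (collMeasure C γ s ε) := by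
  refine measurePreserving_of_lintegral measurable_reflPair fun F hF => ?_
  have h := lintegral_comp_reflPair
    (F := fun x => ENNReal.ofReal (truncKernel C γ s ε x.1 x.2) * F x)
    (measurable_truncKernel.ennreal_ofReal.mul hF)
  rw [lintegral_collMeasure, lintegral_collMeasure, ← h]
  refine lintegral_congr fun x => ?_
  simp only [truncKernel_reflPair]

/-! ### Uniform bounds for the collision measure -/

/-- The majorant of `B min(|a|, δ)²`. -/
def sing (γ s δ : ℝ) (x : Vel × Sph) : ℝ :=
  ‖x.1‖ ^ γ * (‖dev x‖ / ‖x.1‖) ^ (-2 - 2 * s) * min ‖dev x‖ δ ^ 2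

lemma sing_nonneg (δ : ℝ) (x : Vel × Sph) : 0 ≤ sing γ s δ x := by
  unfold sing; positivity

lemma measurable_sing (δ : ℝ) : Measurable (sing γ s δ) := by
  have := measurable_dev
  unfold sing
  fun_prop

/-- Since |a| = (|z|/2)|σ - z/|z||, this is the sphere bound at radius 2δ/|z|; collecting powers of
|z| leaves the exponent γ + 2s. -/
lemma exists_sing_bound (hs : 0 < s) (hs1 : s < 1) (γ : ℝ) : ∃ K : ℝ, 0 < K ∧
    ∀ (z : Vel) (δ : ℝ), z ≠ 0 → 0 < δ →
      ∫⁻ σ : Sph, ENNReal.ofReal (sing γ s δ (z, σ)) ∂sphMeasure ≤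
        ENNReal.ofReal (K * (‖z‖ ^ (γ + 2 * s) * δ ^ (2 - 2 * s))) := by
  obtain ⟨K, hK, hb⟩ := exists_sphere_bound hs hs1
  refine ⟨4 * K, by positivity, fun z δ hz hδ => ?_⟩
  have hz0 : 0 < ‖z‖ := norm_pos_iff.2 hz
  set e : Sph := ⟨‖z‖⁻¹ • z, by simp [norm_smul, hz]⟩
  have hr : 0 < 2 * δ / ‖z‖ := by positivity
  have hpt : ∀ σ : Sph, sing γ s δ (z, σ) = (2 ^ (2 * s) * ‖z‖ ^ (γ + 2)) *
      (min ‖(σ : Vel) - e‖ (2 * δ / ‖z‖) ^ 2 * ‖(σ : Vel) - e‖ ^ (-2 - 2 * s)) := by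
    intro σ
    have hd : ‖dev (z, σ)‖ = ‖z‖ / 2 * ‖(σ : Vel) - e‖ := by
      rw [norm_dev_eq (x := (z, σ)) hz]
      simp [dir, hz, e]
    set ρ := ‖(σ : Vel) - e‖
    have hρ : 0 ≤ ρ := norm_nonneg _
    have h1 : ‖z‖ / 2 * ρ / ‖z‖ = 2⁻¹ * ρ := by field_simp
    have h2 : min (‖z‖ / 2 * ρ) δ = ‖z‖ / 2 * min ρ (2 * δ / ‖z‖) := by
      rw [mul_min_of_nonneg _ _ (by positivity)]
      congr 1
      field_simp
    have h3 : (2 : ℝ)⁻¹ ^ (-2 - 2 * s) = 4 * 2 ^ (2 * s) := by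
      rw [Real.inv_rpow (by norm_num), ← Real.rpow_neg (by norm_num)]
      have : -(-2 - 2 * s) = 2 + 2 * s := by ring
      rw [this, Real.rpow_add (by norm_num)]
      norm_num
    have h4 : ‖z‖ ^ (γ + 2) = ‖z‖ ^ γ * ‖z‖ ^ 2 := by
      rw [Real.rpow_add hz0]; norm_num
    simp only [sing, hd]
    rw [h1, h2, Real.mul_rpow (by norm_num) hρ, h3, h4]
    ring
  simp only [hpt]
  have hfm : ∀ c : ℝ, 0 ≤ c → ∀ f : Sph → ℝ, ∫⁻ σ, ENNReal.ofReal (c * f σ) ∂sphMeasure =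
      ENNReal.ofReal c * ∫⁻ σ, ENNReal.ofReal (f σ) ∂sphMeasure := fun c hc f => by
    rw [← lintegral_const_mul' _ _ ENNReal.ofReal_ne_top]
    simp only [ENNReal.ofReal_mul hc]
  rw [hfm _ (by positivity)]
  refine (mul_le_mul_right (hb e _ hr) _).trans_eq ?_
  rw [← ENNReal.ofReal_mul (by positivity)]
  congr 1
  have h5 : (2 * δ / ‖z‖) ^ (2 - 2 * s) =
      2 ^ (2 - 2 * s) * δ ^ (2 - 2 * s) * ‖z‖ ^ (-(2 - 2 * s)) := by
    rw [Real.div_rpow (by positivity) hz0.le, Real.mul_rpow (by norm_num) hδ.le,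
      Real.rpow_neg hz0.le]
    rfl
  have h6 : ‖z‖ ^ (γ + 2) * ‖z‖ ^ (-(2 - 2 * s)) = ‖z‖ ^ (γ + 2 * s) := by
    rw [← Real.rpow_add hz0]; congr 1; ring
  have h7 : (2 : ℝ) ^ (2 * s) * 2 ^ (2 - 2 * s) = 4 := by
    rw [← Real.rpow_add (by norm_num)]
    have : 2 * s + (2 - 2 * s) = 2 := by ring
    rw [this]; norm_num
  rw [h5, ← h6]
  calc _ = ((2 : ℝ) ^ (2 * s) * 2 ^ (2 - 2 * s)) * K *
      (‖z‖ ^ (γ + 2) * ‖z‖ ^ (-(2 - 2 * s)) * δ ^ (2 - 2 * s)) := by ring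
    _ = _ := by rw [h7]

lemma rpow_le_one_add_rpow {r p q : ℝ} (hr : 0 < r) (hpq : p ≤ q) (hq : q ≤ 0) :
    r ^ q ≤ 1 + r ^ p := by
  rcases le_or_gt 1 r with h | h
  · have := Real.rpow_le_one_of_one_le_of_nonpos h hq
    have := Real.rpow_nonneg hr.le p
    linarith
  · have := Real.rpow_le_rpow_of_exponent_ge hr h.le hpq
    linarith

/-- The assumption γ + 2s ≤ 0 enters here: it places γ + 2s between γ and 0, so that |z|^(γ+2s) ≤ 1
+ |z|^γ and the weight bound applies. -/
lemma exists_sing_weight_bound (hγ : -3 < γ) (hγ0 : γ < 0) (hs : 0 < s) (hs1 : s < 1)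
    (hγs : γ + 2 * s ≤ 0) : ∃ Λ : ℝ, 0 < Λ ∧ ∀ (v : Vel) (δ : ℝ), 0 < δ →
      ∫⁻ x : Vel × Sph, ENNReal.ofReal (sing γ s δ x * wt (v - x.1)) ∂(volume.prod sphMeasure) ≤
        ENNReal.ofReal (Λ * δ ^ (2 - 2 * s)) := by
  obtain ⟨K, hK, hb⟩ := exists_sing_bound hs hs1 γ
  obtain ⟨W, hW, hw⟩ := exists_weight_bound hγ hγ0
  refine ⟨K * W, by positivity, fun v δ hδ => ?_⟩
  have hm : Measurable fun x : Vel × Sph => ENNReal.ofReal (sing γ s δ x * wt (v - x.1)) := by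
    have := continuous_wt.measurable
    exact ((measurable_sing δ).mul (by fun_prop)).ennreal_ofReal
  rw [lintegral_prod _ hm.aemeasurable]
  calc _ ≤ ∫⁻ z : Vel, ENNReal.ofReal (K * δ ^ (2 - 2 * s)) *
        ENNReal.ofReal ((1 + ‖z‖ ^ γ) * wt (v - z)) := by
        refine lintegral_mono_ae ?_
        have : ∀ᵐ z : Vel, z ≠ 0 := by simp [ae_iff]
        filter_upwards [this] with z hz
        have hz0 : 0 < ‖z‖ := norm_pos_iff.2 hz
        have hwz := wt_pos (v - z)
        calc _ = ∫⁻ σ : Sph, ENNReal.ofReal (sing γ s δ (z, σ)) * ENNReal.ofReal (wt (v - z))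
                ∂sphMeasure := by
              refine lintegral_congr fun σ => ?_
              rw [ENNReal.ofReal_mul (sing_nonneg _ _)]
          _ = (∫⁻ σ : Sph, ENNReal.ofReal (sing γ s δ (z, σ)) ∂sphMeasure) *
                ENNReal.ofReal (wt (v - z)) := lintegral_mul_const' _ _ ENNReal.ofReal_ne_top
          _ ≤ _ := mul_le_mul_left (hb z δ hz hδ) _
          _ ≤ _ := by
              rw [← ENNReal.ofReal_mul (by positivity), ← ENNReal.ofReal_mul (by positivity)]
              refine ENNReal.ofReal_le_ofReal ?_
              have h1 := rpow_le_one_add_rpow hz0 (by linarith : γ ≤ γ + 2 * s) hγs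
              calc _ = K * δ ^ (2 - 2 * s) * (‖z‖ ^ (γ + 2 * s) * wt (v - z)) := by ring
                _ ≤ _ := by gcongr
    _ = ENNReal.ofReal (K * δ ^ (2 - 2 * s)) *
        ∫⁻ z : Vel, ENNReal.ofReal ((1 + ‖z‖ ^ γ) * wt (v - z)) :=
        lintegral_const_mul' _ _ ENNReal.ofReal_ne_top
    _ ≤ _ := by
        refine (mul_le_mul_right (hw v) _).trans_eq ?_
        rw [← ENNReal.ofReal_mul (by positivity)]
        congr 1
        ring

/-- Comparison of the deviations at `z` and at `w = z + a`. -/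
lemma add_dev_bounds {z : Vel} (hz : z ≠ 0) (σ : Sph) (hi : 0 ≤ inner ℝ z (σ : Vel)) :
    ‖z + dev (z, σ)‖ ≤ ‖z‖ ∧ ‖z‖ ≤ 2 * ‖z + dev (z, σ)‖ ∧
    ‖dev (z + dev (z, σ), σ)‖ ≤ ‖dev (z, σ)‖ ∧
    ‖dev (z, σ)‖ ≤ 4 * ‖dev (z + dev (z, σ), σ)‖ := by
  have hz0 : 0 < ‖z‖ := norm_pos_iff.2 hz
  set a := dev (z, σ) with ha
  set w := z + a with hw
  have ha2 : ‖a‖ ^ 2 = (‖z‖ ^ 2 - ‖z‖ * inner ℝ z (σ : Vel)) / 2 := norm_dev_sq (z, σ)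
  have hw2 : ‖w‖ ^ 2 = (‖z‖ ^ 2 + ‖z‖ * inner ℝ z (σ : Vel)) / 2 := by
    rw [hw, ha, add_dev, norm_smul, mul_pow, @norm_add_sq_real, norm_smul, norm_norm, norm_sph,
      real_inner_smul_right]
    norm_num
    ring
  have hzi : 0 ≤ ‖z‖ * inner ℝ z (σ : Vel) := by positivity
  have hsum : ‖w‖ ^ 2 + ‖a‖ ^ 2 = ‖z‖ ^ 2 := by rw [ha2, hw2]; ring
  have haw : ‖a‖ ≤ ‖w‖ := by
    refine abs_le_of_sq_le_sq' ?_ (norm_nonneg _) |>.2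
    linarith
  have hwz : ‖w‖ ≤ ‖z‖ := by
    refine abs_le_of_sq_le_sq' ?_ (norm_nonneg _) |>.2
    nlinarith [sq_nonneg ‖a‖]
  have hzw : ‖z‖ ≤ 2 * ‖w‖ := by
    refine abs_le_of_sq_le_sq' ?_ (by positivity) |>.2
    nlinarith [norm_nonneg a, norm_nonneg w]
  have hdw : dev (w, σ) = (1 / 2 : ℝ) • ((‖w‖ - ‖z‖) • (σ : Vel) + a) := by
    simp only [hw, ha, dev]
    module
  have hnw : ‖(‖w‖ - ‖z‖) • (σ : Vel)‖ = ‖z‖ - ‖w‖ := by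
    rw [norm_smul, norm_sph, Real.norm_eq_abs, abs_of_nonpos (by linarith)]; ring
  have hdiff : ‖z‖ - ‖w‖ ≤ ‖a‖ / 2 := by
    have h1 : (‖z‖ - ‖w‖) * (‖z‖ + ‖w‖) = ‖a‖ ^ 2 := by nlinarith
    rcases (norm_nonneg a).eq_or_lt with h0 | h0
    · rw [← h0] at h1 ⊢
      have : 0 < ‖z‖ + ‖w‖ := by linarith [norm_nonneg w]
      nlinarith
    · nlinarith
  refine ⟨hwz, hzw, ?_, ?_⟩
  · rw [hdw, norm_smul]
    have := norm_add_le ((‖w‖ - ‖z‖) • (σ : Vel)) a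
    rw [hnw] at this
    norm_num
    linarith [norm_nonneg a]
  · rw [hdw, norm_smul]
    have := norm_sub_le ((‖w‖ - ‖z‖) • (σ : Vel) + a) ((‖w‖ - ‖z‖) • (σ : Vel))
    rw [hnw, add_sub_cancel_left] at this
    norm_num
    linarith

/-- Passing from z to z + a at fixed σ changes the relative speed and the size of the deviation by
bounded factors only, so the change of variables of `lintegral_add_dev_le` can be applied to the
singular majorant. -/
lemma sing_le_sing_add_dev {δ : ℝ} (hγ0 : γ < 0) (hs : 0 < s) (hδ : 0 < δ) {z : Vel} (hz : z ≠ 0)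
    (σ : Sph) (hi : 0 ≤ inner ℝ z (σ : Vel)) (hd : 0 < ‖dev (z, σ)‖) :
    sing γ s δ (z, σ) ≤ (2 ^ (2 + 2 * s) * 16) * sing γ s δ (z + dev (z, σ), σ) := by
  obtain ⟨h1, h2, h3, h4⟩ := add_dev_bounds hz σ hi
  have hz0 : 0 < ‖z‖ := norm_pos_iff.2 hz
  simp only [sing]
  set a := ‖dev (z, σ)‖
  set b := ‖dev (z + dev (z, σ), σ)‖
  set w := ‖z + dev (z, σ)‖
  have hb : 0 < b := by linarith
  have hw : 0 < w := by linarith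
  have e1 : ‖z‖ ^ γ ≤ w ^ γ := Real.rpow_le_rpow_of_nonpos hw h1 hγ0.le
  have e2 : (a / ‖z‖) ^ (-2 - 2 * s) ≤ 2 ^ (2 + 2 * s) * (b / w) ^ (-2 - 2 * s) := by
    have e3 : 2⁻¹ * (b / w) ≤ a / ‖z‖ := by
      rw [← div_eq_inv_mul, div_div, div_le_div_iff₀ (by positivity) hz0]
      nlinarith
    refine (Real.rpow_le_rpow_of_nonpos (by positivity) e3 (by linarith)).trans_eq ?_
    rw [Real.mul_rpow (by norm_num) (by positivity), Real.inv_rpow (by norm_num),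
      ← Real.rpow_neg (by norm_num)]
    congr 2
    ring
  have e4 : min a δ ≤ 4 * min b δ := by
    rw [mul_min_of_nonneg _ _ (by norm_num)]
    exact min_le_min h4 (by linarith)
  have e5 : min a δ ^ 2 ≤ 16 * min b δ ^ 2 := by
    have := pow_le_pow_left₀ (le_min hd.le hδ.le) e4 2
    nlinarith
  calc _ ≤ w ^ γ * (2 ^ (2 + 2 * s) * (b / w) ^ (-2 - 2 * s)) * (16 * min b δ ^ 2) := by gcongr
    _ = _ := by ring

lemma lintegral_prod_add_dev_le {H : Vel × Sph → ℝ≥0∞} (hH : Measurable H) :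
    ∫⁻ x in {x : Vel × Sph | x.1 ≠ 0 ∧ 0 ≤ inner ℝ x.1 (x.2 : Vel)}, H (x.1 + dev x, x.2)
      ∂(volume.prod sphMeasure) ≤ 8 * ∫⁻ x, H x ∂(volume.prod sphMeasure) := by
  have hin : Measurable fun x : Vel × Sph => inner ℝ x.1 (x.2 : Vel) := by fun_prop
  have hA : MeasurableSet {x : Vel × Sph | x.1 ≠ 0 ∧ 0 ≤ inner ℝ x.1 (x.2 : Vel)} :=
    (measurable_fst (measurableSet_singleton (0 : Vel)).compl).inter
      (measurableSet_le measurable_const hin)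
  have hm : Measurable fun x : Vel × Sph => H (x.1 + dev x, x.2) :=
    hH.comp ((measurable_fst.add measurable_dev).prodMk measurable_snd)
  rw [← lintegral_indicator hA, lintegral_prod_symm _ (hm.indicator hA).aemeasurable,
    lintegral_prod_symm _ hH.aemeasurable, ← lintegral_const_mul _ hH.lintegral_prod_left']
  refine lintegral_mono fun σ => ?_
  have h1 := lintegral_add_dev_le σ (fun w => H (w, σ))
  refine le_trans (le_of_eq ?_) h1
  have hin' : Measurable fun z : Vel => inner ℝ z (σ : Vel) := by fun_prop
  have hA' : MeasurableSet {z : Vel | z ≠ 0 ∧ 0 ≤ inner ℝ z (σ : Vel)} :=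
    (measurableSet_singleton (0 : Vel)).compl.inter (measurableSet_le measurable_const hin')
  rw [← lintegral_indicator hA']
  rfl

lemma measurable_wt_sub (v : Vel) : Measurable fun x : Vel × Sph => wt (v - x.1) := by
  have := continuous_wt.measurable
  fun_prop

lemma measurable_wt_sub_dev (v : Vel) : Measurable fun x : Vel × Sph => wt (v - x.1 - dev x) := by
  have := continuous_wt.measurable
  have := measurable_dev
  fun_prop

/-- The basic estimate, uniform in ε and v. The positive power of δ is what makes the commutator
errors vanish in the end. The weight at v'_* is reduced to the one at v_* by replacing z with z + a.
-/
lemma exists_coll_bound (hC : 0 < C) (hγ : -3 < γ) (hγ0 : γ < 0) (hs : 0 < s) (hs1 : s < 1)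
    (hγs : γ + 2 * s ≤ 0) : ∃ Λ : ℝ, 0 < Λ ∧ ∀ (ε δ : ℝ) (v : Vel), 0 < ε → 0 < δ →
      ∫⁻ x, ENNReal.ofReal (min ‖dev x‖ δ ^ 2 * wt (v - x.1)) ∂(collMeasure C γ s ε) ≤
        ENNReal.ofReal (Λ * δ ^ (2 - 2 * s)) ∧
      ∫⁻ x, ENNReal.ofReal (min ‖dev x‖ δ ^ 2 * wt (v - x.1 - dev x)) ∂(collMeasure C γ s ε) ≤
        ENNReal.ofReal (Λ * δ ^ (2 - 2 * s)) := by
  obtain ⟨Λ, hΛ, hb⟩ := exists_sing_weight_bound hγ hγ0 hs hs1 hγs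
  set c : ℝ := 4 * C * (2 ^ (2 + 2 * s) * 16)
  refine ⟨4 * C * Λ + c * 8 * Λ, by positivity, fun ε δ v hε hδ => ⟨?_, ?_⟩⟩
  · rw [lintegral_collMeasure]
    calc _ ≤ ∫⁻ x : Vel × Sph, ENNReal.ofReal (4 * C) * ENNReal.ofReal (sing γ s δ x * wt (v - x.1))
          ∂(volume.prod sphMeasure) := by
          refine lintegral_mono_ae ?_
          filter_upwards [ae_fst_ne_zero] with x hx
          rw [← ENNReal.ofReal_mul (truncKernel_nonneg hC _ _), ← ENNReal.ofReal_mul (by positivity)]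
          refine ENNReal.ofReal_le_ofReal ?_
          by_cases h0 : truncKernel C γ s ε x.1 x.2 = 0
          · rw [h0, zero_mul]
            exact mul_nonneg (by positivity) (mul_nonneg (sing_nonneg _ _) (wt_pos _).le)
          · obtain ⟨-, -, h3, -⟩ := truncKernel_bounds hC hs hε hx x.2 h0
            have hw := wt_pos (v - x.1)
            calc _ ≤ 4 * C * (‖x.1‖ ^ γ * (‖dev x‖ / ‖x.1‖) ^ (-2 - 2 * s)) *
                  (min ‖dev x‖ δ ^ 2 * wt (v - x.1)) := by gcongr
              _ = _ := by simp only [sing]; ring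
      _ ≤ ENNReal.ofReal (4 * C) * ENNReal.ofReal (Λ * δ ^ (2 - 2 * s)) := by
          rw [lintegral_const_mul' _ _ ENNReal.ofReal_ne_top]
          exact mul_le_mul_right (hb v δ hδ) _
      _ ≤ _ := by
          rw [← ENNReal.ofReal_mul (by positivity)]
          refine ENNReal.ofReal_le_ofReal ?_
          have : 0 ≤ c * 8 * Λ * δ ^ (2 - 2 * s) := by positivity
          linarith
  · rw [lintegral_collMeasure]
    set H : Vel × Sph → ℝ≥0∞ := fun x => ENNReal.ofReal (sing γ s δ x * wt (v - x.1))
    have hHm : Measurable H := ((measurable_sing δ).mul (measurable_wt_sub v)).ennreal_ofReal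
    have hin : Measurable fun x : Vel × Sph => inner ℝ x.1 (x.2 : Vel) := by fun_prop
    have hA : MeasurableSet {x : Vel × Sph | x.1 ≠ 0 ∧ 0 ≤ inner ℝ x.1 (x.2 : Vel)} :=
      (measurable_fst (measurableSet_singleton (0 : Vel)).compl).inter
        (measurableSet_le measurable_const hin)
    calc _ ≤ ∫⁻ x : Vel × Sph, ENNReal.ofReal c *
          {x : Vel × Sph | x.1 ≠ 0 ∧ 0 ≤ inner ℝ x.1 (x.2 : Vel)}.indicator
            (fun x => H (x.1 + dev x, x.2)) x ∂(volume.prod sphMeasure) := by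
          refine lintegral_mono_ae ?_
          filter_upwards [ae_fst_ne_zero] with x hx
          by_cases h0 : truncKernel C γ s ε x.1 x.2 = 0
          · rw [h0, ENNReal.ofReal_zero, zero_mul]
            exact zero_le
          · obtain ⟨h1, h2, h3, -⟩ := truncKernel_bounds hC hs hε hx x.2 h0
            rw [indicator_of_mem (by exact ⟨hx, h1⟩), ← ENNReal.ofReal_mul (truncKernel_nonneg hC _ _),
              ← ENNReal.ofReal_mul (by positivity)]
            refine ENNReal.ofReal_le_ofReal ?_
            simp only
            rw [← sub_sub]
            have hw := wt_pos (v - x.1 - dev x)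
            have h4 := sing_le_sing_add_dev hγ0 hs hδ hx x.2 h1 h2
            calc _ ≤ 4 * C * (‖x.1‖ ^ γ * (‖dev x‖ / ‖x.1‖) ^ (-2 - 2 * s)) *
                  (min ‖dev x‖ δ ^ 2 * wt (v - x.1 - dev x)) := by gcongr
              _ = 4 * C * sing γ s δ x * wt (v - x.1 - dev x) := by simp only [sing]; ring
              _ ≤ 4 * C * ((2 ^ (2 + 2 * s) * 16) * sing γ s δ (x.1 + dev x, x.2)) *
                  wt (v - x.1 - dev x) := by gcongr
              _ = _ := by simp only [c]; ring
      _ ≤ ENNReal.ofReal c * (8 * ENNReal.ofReal (Λ * δ ^ (2 - 2 * s))) := by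
          rw [lintegral_const_mul' _ _ ENNReal.ofReal_ne_top, lintegral_indicator hA]
          refine mul_le_mul_right ((lintegral_prod_add_dev_le hHm).trans ?_) _
          exact mul_le_mul_right (hb v δ hδ) _
      _ ≤ _ := by
          rw [← ENNReal.ofReal_ofNat, ← ENNReal.ofReal_mul (by norm_num),
            ← ENNReal.ofReal_mul (by positivity)]
          refine ENNReal.ofReal_le_ofReal ?_
          have : 0 ≤ 4 * C * Λ * δ ^ (2 - 2 * s) := by positivity
          linarith

/-- The bound degenerates as ε → 0. It serves only to give absolute convergence at fixed cutoff, so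
that integrals may be split and exchanged. -/
lemma exists_coll_bound_trunc (hC : 0 < C) (hγ : -3 < γ) (hγ0 : γ < 0) (hs : 0 < s) (hε : 0 < ε) :
    ∃ L : ℝ, 0 < L ∧ ∀ v : Vel,
      ∫⁻ x, ENNReal.ofReal (wt (v - x.1)) ∂(collMeasure C γ s ε) ≤ ENNReal.ofReal L ∧
      ∫⁻ x, ENNReal.ofReal (wt (v - x.1 - dev x)) ∂(collMeasure C γ s ε) ≤ ENNReal.ofReal L := by
  obtain ⟨W, hW, hw⟩ := exists_weight_bound hγ hγ0
  set k : ℝ := max (4 * C * Real.sin (ε / 2) ^ (-2 - 2 * s)) 1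
  have hk : 0 < k := lt_max_of_lt_right one_pos
  set A := sphMeasure.real univ
  set H : Vel → Vel × Sph → ℝ≥0∞ := fun v x => ENNReal.ofReal ((1 + ‖x.1‖ ^ γ) * wt (v - x.1))
  have hHm : ∀ v, Measurable (H v) := fun v =>
    (Measurable.mul (by fun_prop) (measurable_wt_sub v)).ennreal_ofReal
  have hH : ∀ v, ∫⁻ x, H v x ∂(volume.prod sphMeasure) ≤ ENNReal.ofReal (W * A) := fun v => by
    rw [lintegral_prod _ (hHm v).aemeasurable]
    simp only [H, lintegral_const]
    rw [lintegral_mul_const' _ _ (measure_ne_top _ _), ENNReal.ofReal_mul hW.le]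
    refine mul_le_mul' (hw v) ?_
    exact (ENNReal.ofReal_toReal (measure_ne_top _ _)).ge
  have hk' : ∀ x : Vel × Sph, x.1 ≠ 0 → truncKernel C γ s ε x.1 x.2 ≠ 0 →
      truncKernel C γ s ε x.1 x.2 ≤ k * ‖x.1‖ ^ γ := fun x hx h0 => by
    obtain ⟨-, -, -, h4⟩ := truncKernel_bounds hC hs hε hx x.2 h0
    refine h4.trans ?_
    gcongr
    exact le_max_left _ _
  have hin : Measurable fun x : Vel × Sph => inner ℝ x.1 (x.2 : Vel) := by fun_prop
  have hS : MeasurableSet {x : Vel × Sph | x.1 ≠ 0 ∧ 0 ≤ inner ℝ x.1 (x.2 : Vel)} :=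
    (measurable_fst (measurableSet_singleton (0 : Vel)).compl).inter
      (measurableSet_le measurable_const hin)
  refine ⟨k * (8 * (W * A)) + 1, by positivity, fun v => ⟨?_, ?_⟩⟩
  · rw [lintegral_collMeasure]
    calc _ ≤ ∫⁻ x, ENNReal.ofReal k * H v x ∂(volume.prod sphMeasure) := by
          refine lintegral_mono_ae ?_
          filter_upwards [ae_fst_ne_zero] with x hx
          rw [← ENNReal.ofReal_mul (truncKernel_nonneg hC _ _), ← ENNReal.ofReal_mul hk.le]
          refine ENNReal.ofReal_le_ofReal ?_
          have hw := wt_pos (v - x.1)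
          by_cases h0 : truncKernel C γ s ε x.1 x.2 = 0
          · rw [h0, zero_mul]; positivity
          · calc _ ≤ k * ‖x.1‖ ^ γ * wt (v - x.1) := by gcongr; exact hk' x hx h0
              _ ≤ _ := by
                rw [mul_assoc]
                gcongr
                linarith
      _ ≤ ENNReal.ofReal k * ENNReal.ofReal (W * A) := by
          rw [lintegral_const_mul' _ _ ENNReal.ofReal_ne_top]
          exact mul_le_mul_right (hH v) _
      _ ≤ _ := by
          rw [← ENNReal.ofReal_mul hk.le]
          refine ENNReal.ofReal_le_ofReal ?_
          have : 0 ≤ k * (W * A) := by positivity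
          linarith
  · rw [lintegral_collMeasure]
    calc _ ≤ ∫⁻ x, ENNReal.ofReal k *
          {x : Vel × Sph | x.1 ≠ 0 ∧ 0 ≤ inner ℝ x.1 (x.2 : Vel)}.indicator
            (fun x => H v (x.1 + dev x, x.2)) x ∂(volume.prod sphMeasure) := by
          refine lintegral_mono_ae ?_
          filter_upwards [ae_fst_ne_zero] with x hx
          by_cases h0 : truncKernel C γ s ε x.1 x.2 = 0
          · rw [h0, ENNReal.ofReal_zero, zero_mul]
            exact zero_le
          · obtain ⟨h1, h2, -, -⟩ := truncKernel_bounds hC hs hε hx x.2 h0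
            rw [indicator_of_mem (by exact ⟨hx, h1⟩), ← ENNReal.ofReal_mul (truncKernel_nonneg hC _ _),
              ← ENNReal.ofReal_mul hk.le]
            refine ENNReal.ofReal_le_ofReal ?_
            simp only
            rw [← sub_sub]
            have hw := wt_pos (v - x.1 - dev x)
            obtain ⟨h5, h6, -, -⟩ := add_dev_bounds hx x.2 h1
            have h7 : 0 < ‖x.1 + dev x‖ := by
              have h8 : 0 < ‖x.1‖ := norm_pos_iff.2 hx
              have h9 : ‖x.1‖ ≤ 2 * ‖x.1 + dev x‖ := h6
              linarith
            have h10 : ‖x.1‖ ^ γ ≤ ‖x.1 + dev x‖ ^ γ := Real.rpow_le_rpow_of_nonpos h7 h5 hγ0.le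
            calc _ ≤ k * ‖x.1‖ ^ γ * wt (v - x.1 - dev x) := by gcongr; exact hk' x hx h0
              _ ≤ _ := by
                rw [mul_assoc]
                gcongr
                linarith
      _ ≤ ENNReal.ofReal k * (8 * ENNReal.ofReal (W * A)) := by
          rw [lintegral_const_mul' _ _ ENNReal.ofReal_ne_top, lintegral_indicator hS]
          refine mul_le_mul_right ((lintegral_prod_add_dev_le (hHm v)).trans ?_) _
          exact mul_le_mul_right (hH v) _
      _ ≤ _ := by
          rw [← ENNReal.ofReal_ofNat, ← ENNReal.ofReal_mul (by norm_num),
            ← ENNReal.ofReal_mul (by positivity)]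
          refine ENNReal.ofReal_le_ofReal ?_
          linarith

end

end QuantumBoltzmann

/-! ### Regular coefficients, gain and loss rates, and cancellation. -/

namespace QuantumBoltzmann

noncomputable section

/-! ### Regular coefficients and the cancellation lemma -/

/-- Nonnegative functions with the decay and regularity of a function in `μ^{1/4} C²`. -/
structure IsRegular (M : ℝ) (g : Vel → ℝ) : Prop where
  cont : Continuous g
  nonneg : ∀ v, 0 ≤ g v
  le : ∀ v, g v ≤ M * wt v
  -- The factor √(wt v * g v) expresses that the gradient of a nonnegative function with bounded
  -- second derivatives is small where the function is. A plain Lipschitz bound would not let the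
  -- commutator be absorbed by a term proportional to g_*.
  lip : ∀ v y, ‖y‖ ≤ 1 → |g (v + y) - g v| ≤ M * (‖y‖ * √(wt v * g v) + ‖y‖ ^ 2 * wt v)
  diff2 : ∀ v a b, ‖a‖ ≤ 1 → ‖b‖ ≤ 1 →
    |g (v + a) + g (v + b) - 2 * g v| ≤ M * wt v * (‖a‖ ^ 2 + ‖b‖ ^ 2 + ‖a + b‖)

lemma IsRegular.const_nonneg {M : ℝ} {g : Vel → ℝ} (hg : IsRegular M g) : 0 ≤ M :=
  nonneg_of_mul_nonneg_left ((hg.nonneg 0).trans (hg.le 0)) (wt_pos 0)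

lemma IsRegular.le_const {M : ℝ} {g : Vel → ℝ} (hg : IsRegular M g) (v : Vel) : g v ≤ M :=
  (hg.le v).trans (mul_le_of_le_one_right hg.const_nonneg (wt_le_one v))

/-- The factor `g_* (1 + g'_* + g')` of the loss term. -/
def lossRate (g : Vel → ℝ) (v : Vel) (x : Vel × Sph) : ℝ :=
  g (v - x.1) * (1 + g (v - x.1 - dev x) + g (v + dev x))

/-- The factor `g'_* (1 + g_* + g)` of the gain term. -/
def gainRate (g : Vel → ℝ) (v : Vel) (x : Vel × Sph) : ℝ :=
  g (v - x.1 - dev x) * (1 + g (v - x.1) + g v)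

variable {C γ s ε M : ℝ} {g : Vel → ℝ}

lemma measurable_lossRate (hg : Measurable g) :
    Measurable fun p : Vel × Vel × Sph => lossRate g p.1 p.2 := by
  have := measurable_dev
  unfold lossRate
  fun_prop

lemma measurable_gainRate (hg : Measurable g) :
    Measurable fun p : Vel × Vel × Sph => gainRate g p.1 p.2 := by
  have := measurable_dev
  unfold gainRate
  fun_prop

lemma lossRate_nonneg (hg : ∀ v, 0 ≤ g v) (v : Vel) (x : Vel × Sph) : 0 ≤ lossRate g v x :=
  mul_nonneg (hg _) (by linarith [hg (v - x.1 - dev x), hg (v + dev x)])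

lemma gainRate_nonneg (hg : ∀ v, 0 ≤ g v) (v : Vel) (x : Vel × Sph) : 0 ≤ gainRate g v x :=
  mul_nonneg (hg _) (by linarith [hg (v - x.1), hg v])

lemma IsRegular.lossRate_le (hg : IsRegular M g) (v : Vel) (x : Vel × Sph) :
    lossRate g v x ≤ M * (1 + 2 * M) * wt (v - x.1) := by
  have h1 := hg.le (v - x.1)
  have h2 := hg.le_const (v - x.1 - dev x)
  have h3 := hg.le_const (v + dev x)
  have h4 := hg.nonneg (v - x.1 - dev x)
  have h5 := hg.nonneg (v + dev x)
  have h6 := hg.nonneg (v - x.1)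
  calc _ ≤ (M * wt (v - x.1)) * (1 + 2 * M) := by
        unfold lossRate
        exact mul_le_mul h1 (by linarith) (by linarith) (h6.trans h1)
    _ = _ := by ring

lemma IsRegular.gainRate_le (hg : IsRegular M g) (v : Vel) (x : Vel × Sph) :
    gainRate g v x ≤ M * (1 + 2 * M) * wt (v - x.1 - dev x) := by
  have h1 := hg.le (v - x.1 - dev x)
  have h2 := hg.le_const (v - x.1)
  have h3 := hg.le_const v
  have h4 := hg.nonneg (v - x.1)
  have h5 := hg.nonneg v
  have h6 := hg.nonneg (v - x.1 - dev x)
  calc _ ≤ (M * wt (v - x.1 - dev x)) * (1 + 2 * M) := by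
        unfold gainRate
        exact mul_le_mul h1 (by linarith) (by linarith) (h6.trans h1)
    _ = _ := by ring

/-- For |a| ≤ 1 the sum over σ and its reflection is a combination of second differences of g, and
the two deviations add up to only 2|a|²/|z|. For |a| > 1 each rate is bounded separately. -/
lemma IsRegular.abs_rate_sub_add_le (hg : IsRegular M g) (v : Vel) {x : Vel × Sph} (hx : x.1 ≠ 0) :
    |(lossRate g v x - gainRate g v x) +
        (lossRate g v (reflPair x) - gainRate g v (reflPair x))| ≤
      4 * (M * (1 + 2 * M)) * (min ‖dev x‖ 1 ^ 2 * (1 + ‖x.1‖⁻¹) * wt (v - x.1) +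
        min ‖dev x‖ 1 ^ 2 * wt (v - x.1 - dev x) +
        min ‖dev (reflPair x)‖ 1 ^ 2 * wt (v - (reflPair x).1 - dev (reflPair x))) := by
  have hM := hg.const_nonneg
  have hM' : 0 ≤ M * (1 + 2 * M) := by positivity
  have hx0 : 0 < ‖x.1‖ := norm_pos_iff.2 hx
  have hRn := norm_dev_reflPair x
  have hRs := norm_dev_add_dev_reflPair hx
  have w1 := wt_pos (v - x.1)
  have w2 := wt_pos (v - x.1 - dev x)
  have w3 := wt_pos (v - x.1 - dev (reflPair x))
  have hz : (reflPair x).1 = x.1 := rfl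
  rw [hRn, hz]
  rcases le_or_gt ‖dev x‖ 1 with h | h
  · have hb : ‖dev (reflPair x)‖ ≤ 1 := hRn.trans_le h
    have d1 := hg.diff2 (v - x.1) (-dev x) (-dev (reflPair x)) (by simpa) (by simpa)
    have d2 := hg.diff2 v (dev x) (dev (reflPair x)) h hb
    rw [norm_neg, norm_neg, ← neg_add, norm_neg, hRn, hRs, ← sub_eq_add_neg, ← sub_eq_add_neg] at d1
    rw [hRn, hRs] at d2
    rw [min_eq_left h]
    set a := dev x
    set b := dev (reflPair x)
    have e1 : ‖a‖ ^ 2 + ‖a‖ ^ 2 + 2 * ‖a‖ ^ 2 / ‖x.1‖ = 2 * (‖a‖ ^ 2 * (1 + ‖x.1‖⁻¹)) := by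
      field_simp; ring
    rw [e1] at d1 d2
    set N := ‖a‖ ^ 2 * (1 + ‖x.1‖⁻¹)
    have hN : 0 ≤ N := by positivity
    -- The products g_* g'_* cancel between loss and gain, leaving one second difference at v_* and
    -- one at v.
    have e2 : (lossRate g v x - gainRate g v x) +
        (lossRate g v (reflPair x) - gainRate g v (reflPair x)) =
        -(1 + g v) * (g (v - x.1 - a) + g (v - x.1 - b) - 2 * g (v - x.1)) +
          g (v - x.1) * (g (v + a) + g (v + b) - 2 * g v) := by
      simp only [lossRate, gainRate, hz]
      ring
    have hgv := hg.nonneg v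
    have hgv' := hg.le_const v
    have hgu := hg.nonneg (v - x.1)
    have hgu' := hg.le (v - x.1)
    have hwv := wt_le_one v
    have hwv' := wt_pos v
    rw [e2]
    refine (abs_add_le _ _).trans ?_
    rw [abs_mul, abs_mul, abs_neg, abs_of_nonneg (by linarith : 0 ≤ 1 + g v), abs_of_nonneg hgu]
    have t1 : (1 + g v) * |g (v - x.1 - a) + g (v - x.1 - b) - 2 * g (v - x.1)| ≤
        (1 + M) * (M * wt (v - x.1) * (2 * N)) :=
      mul_le_mul (by linarith) d1 (abs_nonneg _) (by positivity)
    have t2 : g (v - x.1) * |g (v + a) + g (v + b) - 2 * g v| ≤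
        (M * wt (v - x.1)) * (M * 1 * (2 * N)) := by
      refine mul_le_mul hgu' (d2.trans ?_) (abs_nonneg _) (by positivity)
      gcongr
    have t3 : 0 ≤ 4 * (M * (1 + 2 * M)) * (‖a‖ ^ 2 * wt (v - x.1 - a) + ‖a‖ ^ 2 * wt (v - x.1 - b)) := by
      positivity
    have t4 : 0 ≤ M * wt (v - x.1) * N := by positivity
    have t5 : 0 ≤ M * (M * wt (v - x.1) * N) := by positivity
    nlinarith
  · rw [min_eq_right h.le]
    have l1 := hg.lossRate_le v x
    have l2 := hg.lossRate_le v (reflPair x)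
    have l3 := hg.gainRate_le v x
    have l4 := hg.gainRate_le v (reflPair x)
    have n1 := lossRate_nonneg hg.nonneg v x
    have n2 := lossRate_nonneg hg.nonneg v (reflPair x)
    have n3 := gainRate_nonneg hg.nonneg v x
    have n4 := gainRate_nonneg hg.nonneg v (reflPair x)
    rw [hz] at l2 l4
    set c := M * (1 + 2 * M)
    have p1 : 0 ≤ c * wt (v - x.1) := by positivity
    have p2 : 0 ≤ c * wt (v - x.1 - dev x) := by positivity
    have p3 : 0 ≤ c * wt (v - x.1 - dev (reflPair x)) := by positivity
    have p4 : 0 ≤ c * wt (v - x.1) * ‖x.1‖⁻¹ := by positivity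
    rw [abs_le]
    constructor <;> nlinarith

/-- Since |a| ≤ |z|, the truncation at 1 equals the truncation at min(1, |z|). The resulting power
|z|^(2-2s) for small z outweighs the factor |z|⁻¹. -/
lemma exists_sing_weight_bound_inv (hγ : -3 < γ) (hγ0 : γ < 0) (hs : 0 < s) (hs1 : s < 1)
    (hγs : γ + 2 * s ≤ 0) : ∃ Λ : ℝ, 0 < Λ ∧ ∀ v : Vel,
      ∫⁻ x : Vel × Sph, ENNReal.ofReal (sing γ s 1 x * ((1 + ‖x.1‖⁻¹) * wt (v - x.1)))
        ∂(volume.prod sphMeasure) ≤ ENNReal.ofReal Λ := by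
  obtain ⟨K, hK, hb⟩ := exists_sing_bound hs hs1 γ
  obtain ⟨W, hW, hw⟩ := exists_weight_bound hγ hγ0
  refine ⟨2 * K * W, by positivity, fun v => ?_⟩
  have hm : Measurable fun x : Vel × Sph =>
      ENNReal.ofReal (sing γ s 1 x * ((1 + ‖x.1‖⁻¹) * wt (v - x.1))) :=
    ((measurable_sing 1).mul (Measurable.mul (by fun_prop) (measurable_wt_sub v))).ennreal_ofReal
  rw [lintegral_prod _ hm.aemeasurable]
  calc _ ≤ ∫⁻ z : Vel, ENNReal.ofReal (2 * K) * ENNReal.ofReal ((1 + ‖z‖ ^ γ) * wt (v - z)) := by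
        refine lintegral_mono_ae ?_
        have : ∀ᵐ z : Vel, z ≠ 0 := by simp [ae_iff]
        filter_upwards [this] with z hz
        have hz0 : 0 < ‖z‖ := norm_pos_iff.2 hz
        have hwz := wt_pos (v - z)
        have hmin : ∀ σ : Sph, sing γ s 1 (z, σ) = sing γ s (min 1 ‖z‖) (z, σ) := fun σ => by
          have h1 : min ‖dev (z, σ)‖ ‖z‖ = ‖dev (z, σ)‖ := min_eq_left (norm_dev_le (z, σ))
          simp only [sing]
          rw [min_comm 1, ← min_assoc, h1]
        calc _ = ∫⁻ σ : Sph, ENNReal.ofReal (sing γ s (min 1 ‖z‖) (z, σ)) *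
                ENNReal.ofReal ((1 + ‖z‖⁻¹) * wt (v - z)) ∂sphMeasure := by
              refine lintegral_congr fun σ => ?_
              rw [ENNReal.ofReal_mul (sing_nonneg _ _), hmin]
          _ = (∫⁻ σ : Sph, ENNReal.ofReal (sing γ s (min 1 ‖z‖) (z, σ)) ∂sphMeasure) *
                ENNReal.ofReal ((1 + ‖z‖⁻¹) * wt (v - z)) :=
              lintegral_mul_const' _ _ ENNReal.ofReal_ne_top
          _ ≤ _ := mul_le_mul_left (hb z _ hz (lt_min one_pos hz0)) _
          _ ≤ _ := by
              rw [← ENNReal.ofReal_mul (by positivity), ← ENNReal.ofReal_mul (by positivity)]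
              refine ENNReal.ofReal_le_ofReal ?_
              have key : ‖z‖ ^ (γ + 2 * s) * min 1 ‖z‖ ^ (2 - 2 * s) * (1 + ‖z‖⁻¹) ≤
                  2 * (1 + ‖z‖ ^ γ) := by
                have hzγ : 0 ≤ ‖z‖ ^ γ := by positivity
                rcases le_or_gt 1 ‖z‖ with h | h
                · rw [min_eq_left h, Real.one_rpow, mul_one]
                  have h1 := Real.rpow_le_one_of_one_le_of_nonpos h hγs
                  have h2 : ‖z‖⁻¹ ≤ 1 := inv_le_one_of_one_le₀ h
                  calc _ ≤ 1 * (1 + 1 : ℝ) := by gcongr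
                    _ ≤ _ := by linarith
                · rw [min_eq_right h.le, ← Real.rpow_add hz0,
                    show γ + 2 * s + (2 - 2 * s) = γ + 2 by ring, Real.rpow_add hz0, Real.rpow_two]
                  have h1 : ‖z‖ ^ 2 * (1 + ‖z‖⁻¹) ≤ 2 := by
                    have h2 : ‖z‖ ^ 2 * (1 + ‖z‖⁻¹) = ‖z‖ ^ 2 + ‖z‖ := by field_simp
                    nlinarith
                  calc _ = ‖z‖ ^ γ * (‖z‖ ^ 2 * (1 + ‖z‖⁻¹)) := by ring
                    _ ≤ ‖z‖ ^ γ * 2 := by gcongr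
                    _ ≤ _ := by linarith
              calc _ = K * (‖z‖ ^ (γ + 2 * s) * min 1 ‖z‖ ^ (2 - 2 * s) * (1 + ‖z‖⁻¹)) *
                    wt (v - z) := by ring
                _ ≤ K * (2 * (1 + ‖z‖ ^ γ)) * wt (v - z) := by gcongr
                _ = _ := by ring
    _ = ENNReal.ofReal (2 * K) * ∫⁻ z : Vel, ENNReal.ofReal ((1 + ‖z‖ ^ γ) * wt (v - z)) :=
        lintegral_const_mul' _ _ ENNReal.ofReal_ne_top
    _ ≤ _ := by
        refine (mul_le_mul_right (hw v) _).trans_eq ?_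
        rw [← ENNReal.ofReal_mul (by positivity)]

lemma exists_coll_bound_inv (hC : 0 < C) (hγ : -3 < γ) (hγ0 : γ < 0) (hs : 0 < s) (hs1 : s < 1)
    (hγs : γ + 2 * s ≤ 0) : ∃ Λ : ℝ, 0 < Λ ∧ ∀ (ε : ℝ) (v : Vel), 0 < ε →
      ∫⁻ x, ENNReal.ofReal (min ‖dev x‖ 1 ^ 2 * (1 + ‖x.1‖⁻¹) * wt (v - x.1))
        ∂(collMeasure C γ s ε) ≤ ENNReal.ofReal Λ := by
  obtain ⟨Λ, hΛ, hb⟩ := exists_sing_weight_bound_inv hγ hγ0 hs hs1 hγs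
  refine ⟨4 * C * Λ, by positivity, fun ε v hε => ?_⟩
  rw [lintegral_collMeasure]
  calc _ ≤ ∫⁻ x : Vel × Sph, ENNReal.ofReal (4 * C) *
        ENNReal.ofReal (sing γ s 1 x * ((1 + ‖x.1‖⁻¹) * wt (v - x.1)))
        ∂(volume.prod sphMeasure) := by
        refine lintegral_mono_ae ?_
        filter_upwards [ae_fst_ne_zero] with x hx
        rw [← ENNReal.ofReal_mul (truncKernel_nonneg hC _ _), ← ENNReal.ofReal_mul (by positivity)]
        refine ENNReal.ofReal_le_ofReal ?_
        have hw := wt_pos (v - x.1)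
        by_cases h0 : truncKernel C γ s ε x.1 x.2 = 0
        · rw [h0, zero_mul]
          have := sing_nonneg (γ := γ) (s := s) 1 x
          positivity
        · obtain ⟨-, -, h3, -⟩ := truncKernel_bounds hC hs hε hx x.2 h0
          calc _ ≤ 4 * C * (‖x.1‖ ^ γ * (‖dev x‖ / ‖x.1‖) ^ (-2 - 2 * s)) *
                (min ‖dev x‖ 1 ^ 2 * (1 + ‖x.1‖⁻¹) * wt (v - x.1)) := by gcongr
            _ = _ := by simp only [sing]; ring
    _ ≤ ENNReal.ofReal (4 * C) * ENNReal.ofReal Λ := by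
        rw [lintegral_const_mul' _ _ ENNReal.ofReal_ne_top]
        exact mul_le_mul_right (hb v) _
    _ = _ := by rw [← ENNReal.ofReal_mul (by positivity)]

lemma lintegral_wt_lt_top (hC : 0 < C) (hγ : -3 < γ) (hγ0 : γ < 0) (hs : 0 < s) (hε : 0 < ε)
    (v : Vel) : Integrable (fun x => wt (v - x.1)) (collMeasure C γ s ε) ∧
      Integrable (fun x => wt (v - x.1 - dev x)) (collMeasure C γ s ε) := by
  obtain ⟨L, hL, hb⟩ := exists_coll_bound_trunc hC hγ hγ0 hs hε
  obtain ⟨h1, h2⟩ := hb v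
  refine ⟨⟨(measurable_wt_sub v).aestronglyMeasurable, ?_⟩,
    ⟨(measurable_wt_sub_dev v).aestronglyMeasurable, ?_⟩⟩
  · rw [hasFiniteIntegral_iff_ofReal (Eventually.of_forall fun x => (wt_pos _).le)]
    exact h1.trans_lt ENNReal.ofReal_lt_top
  · rw [hasFiniteIntegral_iff_ofReal (Eventually.of_forall fun x => (wt_pos _).le)]
    exact h2.trans_lt ENNReal.ofReal_lt_top

lemma IsRegular.integrable_rate (hg : IsRegular M g) (hC : 0 < C) (hγ : -3 < γ) (hγ0 : γ < 0)
    (hs : 0 < s) (hε : 0 < ε) (v : Vel) :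
    Integrable (lossRate g v) (collMeasure C γ s ε) ∧
      Integrable (gainRate g v) (collMeasure C γ s ε) := by
  obtain ⟨h1, h2⟩ := lintegral_wt_lt_top hC hγ hγ0 hs hε v
  have hgm := hg.cont.measurable
  have m1 : Measurable (lossRate g v) := (measurable_lossRate hgm).comp measurable_prodMk_left
  have m2 : Measurable (gainRate g v) := (measurable_gainRate hgm).comp measurable_prodMk_left
  refine ⟨(h1.const_mul (M * (1 + 2 * M))).mono' m1.aestronglyMeasurable
      (Eventually.of_forall fun x => ?_),
    (h2.const_mul (M * (1 + 2 * M))).mono' m2.aestronglyMeasurable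
      (Eventually.of_forall fun x => ?_)⟩
  · rw [Real.norm_of_nonneg (lossRate_nonneg hg.nonneg v x)]
    exact hg.lossRate_le v x
  · rw [Real.norm_of_nonneg (gainRate_nonneg hg.nonneg v x)]
    exact hg.gainRate_le v x

lemma integral_comp_measurePreserving {α β : Type*} [MeasurableSpace α] [MeasurableSpace β]
    {μ : Measure α} {ν : Measure β} {T : α → β} (hT : MeasurePreserving T μ ν) {f : β → ℝ} (hf : AEStronglyMeasurable f ν) :
    ∫ x, f (T x) ∂μ = ∫ x, f x ∂ν := by
  have h := hf
  rw [← hT.map_eq] at h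
  rw [← integral_map hT.measurable.aemeasurable h, hT.map_eq]

lemma integrable_integral_le_of_lintegral {α : Type*} [MeasurableSpace α] {μ : Measure α}
    {f : α → ℝ} (hf : Measurable f) (h0 : ∀ x, 0 ≤ f x) {c : ℝ} (hc : 0 ≤ c)
    (h : ∫⁻ x, ENNReal.ofReal (f x) ∂μ ≤ ENNReal.ofReal c) : Integrable f μ ∧ ∫ x, f x ∂μ ≤ c := by
  refine ⟨⟨hf.aestronglyMeasurable, ?_⟩, ?_⟩
  · rw [hasFiniteIntegral_iff_ofReal (Eventually.of_forall h0)]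
    exact h.trans_lt ENNReal.ofReal_lt_top
  · rw [integral_eq_lintegral_of_nonneg_ae (Eventually.of_forall h0) hf.aestronglyMeasurable]
    exact ENNReal.toReal_le_of_le_ofReal hc h

/-- D and D ∘ R have the same integral, so a bound for their sum suffices, even when |D| itself has
no uniform bound. -/
lemma abs_integral_le_of_symmetrized {α : Type*} [MeasurableSpace α] {μ : Measure α}
    {R : α → α} (hR : MeasurePreserving R μ μ) {D f₁ f₂ : α → ℝ} {c : ℝ}
    (hD : Integrable D μ) (h₁ : Integrable f₁ μ) (h₂ : Integrable f₂ μ)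
    (h : ∀ᵐ x ∂μ, |D x + D (R x)| ≤ c * (f₁ x + f₂ x + f₂ (R x))) :
    2 * |∫ x, D x ∂μ| ≤ c * (∫ x, f₁ x ∂μ + 2 * ∫ x, f₂ x ∂μ) := by
  have hDR : Integrable (fun x => D (R x)) μ := hR.integrable_comp_of_integrable hD
  have h₃ : Integrable (fun x => f₂ (R x)) μ := hR.integrable_comp_of_integrable h₂
  have e1 : ∫ x, (D x + D (R x)) ∂μ = 2 * ∫ x, D x ∂μ := by
    rw [integral_add hD hDR, integral_comp_measurePreserving hR hD.aestronglyMeasurable]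
    ring
  have h₁₂ : Integrable (fun x => f₁ x + f₂ x) μ := h₁.add h₂
  have e2 : ∫ x, (f₁ x + f₂ x + f₂ (R x)) ∂μ = ∫ x, f₁ x ∂μ + 2 * ∫ x, f₂ x ∂μ := by
    rw [integral_add h₁₂ h₃, integral_add h₁ h₂,
      integral_comp_measurePreserving hR h₂.aestronglyMeasurable]
    ring
  have e3 : |∫ x, (D x + D (R x)) ∂μ| ≤ ∫ x, c * (f₁ x + f₂ x + f₂ (R x)) ∂μ :=
    abs_integral_le_integral_abs.trans
      (integral_mono_ae (hD.add hDR).abs ((h₁₂.add h₃).const_mul _) h)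
  rwa [e1, abs_mul, abs_two, integral_const_mul, e2] at e3

/-- The cancellation lemma: the difference of the two rates is integrable uniformly in the
angular cutoff. -/
lemma exists_cancellation_bound (hC : 0 < C) (hγ : -3 < γ) (hγ0 : γ < 0) (hs : 0 < s) (hs1 : s < 1)
    (hγs : γ + 2 * s ≤ 0) (M : ℝ) : ∃ K : ℝ, 0 < K ∧ ∀ (ε : ℝ) (g : Vel → ℝ) (v : Vel), 0 < ε →
      IsRegular M g → |∫ x, (lossRate g v x - gainRate g v x) ∂(collMeasure C γ s ε)| ≤ K := by
  obtain ⟨Λ1, hΛ1, hb1⟩ := exists_coll_bound_inv hC hγ hγ0 hs hs1 hγs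
  obtain ⟨Λ2, hΛ2, hb2⟩ := exists_coll_bound hC hγ hγ0 hs hs1 hγs
  -- The absolute value and the added 1 keep the constant positive for every real M; a regular g
  -- forces M ≥ 0.
  refine ⟨4 * |M * (1 + 2 * M)| * (Λ1 + 2 * Λ2) + 1, by positivity, fun ε g v hε hg => ?_⟩
  have hM := hg.const_nonneg
  have hM' : 0 ≤ M * (1 + 2 * M) := by positivity
  rw [abs_of_nonneg hM']
  have hD : Integrable (fun x => lossRate g v x - gainRate g v x) (collMeasure C γ s ε) := by
    obtain ⟨h1, h2⟩ := hg.integrable_rate hC hγ hγ0 hs hε v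
    exact h1.sub h2
  have mdev := measurable_dev
  have mwt := continuous_wt.measurable
  have b1 := hb1 ε v hε
  have b2 := (hb2 ε 1 v hε one_pos).2
  rw [Real.one_rpow, mul_one] at b2
  obtain ⟨i1, j1⟩ := integrable_integral_le_of_lintegral (by fun_prop)
    (fun x => by have := wt_pos (v - x.1); positivity) hΛ1.le b1
  obtain ⟨i2, j2⟩ := integrable_integral_le_of_lintegral (by fun_prop)
    (fun x => by have := wt_pos (v - x.1 - dev x); positivity) hΛ2.le b2
  have h := abs_integral_le_of_symmetrized (c := 4 * (M * (1 + 2 * M)))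
    (measurePreserving_reflPair (C := C) (γ := γ) (s := s) (ε := ε)) hD i1 i2 (by
      filter_upwards [ae_collMeasure ae_fst_ne_zero] with x hx
      exact hg.abs_rate_sub_add_le v hx)
  have h' : 4 * (M * (1 + 2 * M)) * ((∫ x, min ‖dev x‖ 1 ^ 2 * (1 + ‖x.1‖⁻¹) * wt (v - x.1)
      ∂(collMeasure C γ s ε)) + 2 * ∫ x, min ‖dev x‖ 1 ^ 2 * wt (v - x.1 - dev x)
      ∂(collMeasure C γ s ε)) ≤ 4 * (M * (1 + 2 * M)) * (Λ1 + 2 * Λ2) := by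
    gcongr
  have := abs_nonneg (∫ x, (lossRate g v x - gainRate g v x) ∂(collMeasure C γ s ε))
  linarith [h.trans h']

end

end QuantumBoltzmann

/-! ### Weak formulation at fixed angular cutoff. -/

namespace QuantumBoltzmann

noncomputable section

/-! ### The weak form of the collision operator -/

/-- The standing assumptions on the parameters of the kernel. -/
structure IsKernelParam (C γ s : ℝ) : Prop where
  C_pos : 0 < C
  neg_three_lt : -3 < γ
  gamma_neg : γ < 0
  s_pos : 0 < s
  s_lt_one : s < 1
  soft : γ + 2 * s ≤ 0

variable {C γ s ε M : ℝ} {g : Vel → ℝ}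

variable (C γ s ε) in
/-- The measure `B(z, σ) 1_{θ ≥ ε} dz dσ dv`. -/
abbrev pairMeasure : Measure ((Vel × Sph) × Vel) := (collMeasure C γ s ε).prod volume

/-- The exchange of pre- and postcollisional velocities. -/
def swapMap (p : (Vel × Sph) × Vel) : (Vel × Sph) × Vel := (flip p.1, p.2 + dev p.1)

lemma measurePreserving_swapMap :
    MeasurePreserving swapMap (pairMeasure C γ s ε) (pairMeasure C γ s ε) := by
  have hm : Measurable (Function.uncurry fun (x : Vel × Sph) (v : Vel) => v + dev x) :=
    measurable_snd.add (measurable_dev.comp measurable_fst)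
  exact measurePreserving_flip.skew_product hm
    (Eventually.of_forall fun x => map_add_right_eq_self volume (dev x))

lemma ae_pairMeasure : ∀ᵐ p ∂(pairMeasure C γ s ε), p.1.1 ≠ 0 :=
  Measure.quasiMeasurePreserving_fst.ae (ae_collMeasure ae_fst_ne_zero)

lemma ae_pairMeasure_add {c : Vel × Sph → Vel} (hc : Measurable c) {P : Vel → Prop}
    (hP : ∀ᵐ v, P v) : ∀ᵐ p ∂(pairMeasure C γ s ε), P (p.2 + c p.1) := by
  have hm : Measurable (Function.uncurry fun (x : Vel × Sph) (v : Vel) => v + c x) :=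
    measurable_snd.add (hc.comp measurable_fst)
  have h : MeasurePreserving (fun p : (Vel × Sph) × Vel => (p.1, p.2 + c p.1))
      (pairMeasure C γ s ε) (pairMeasure C γ s ε) :=
    (MeasurePreserving.id _).skew_product hm
      (Eventually.of_forall fun x => map_add_right_eq_self volume (c x))
  exact (Measure.quasiMeasurePreserving_snd.comp h.quasiMeasurePreserving).ae hP

/-- Exchanging v with v' and v_* with v'_* turns the loss rate into the gain rate. Together with the
invariance of the measure this gives both the weak form and the reduction to loss minus gain. -/
lemma lossRate_swap {x : Vel × Sph} (hx : x.1 ≠ 0) (v : Vel) :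
    lossRate g (v + dev x) (flip x) = gainRate g v x := by
  simp only [lossRate, gainRate, flip_fst, dev_flip hx]
  have e1 : v + dev x - (x.1 + (2 : ℝ) • dev x) = v - x.1 - dev x := by module
  have e2 : v - x.1 - dev x - -dev x = v - x.1 := by module
  have e3 : v + dev x + -dev x = v := by module
  rw [e1, e2, e3]

lemma integrable_mul_of_lintegral_le {α : Type*} [MeasurableSpace α] {μ : Measure α} [SFinite μ]
    {k : α × Vel → ℝ} (hk : Measurable k) (h0 : ∀ p, 0 ≤ k p) {L : ℝ} (hL : 0 ≤ L)
    (h : ∀ v, ∫⁻ x, ENNReal.ofReal (k (x, v)) ∂μ ≤ ENNReal.ofReal L)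
    {P : Vel → ℝ} (hP : Integrable P) :
    Integrable (fun p => k p * P p.2) (μ.prod volume) ∧
      ∫ p, k p * P p.2 ∂(μ.prod volume) ≤ L * ∫ v, |P v| := by
  have hm : AEStronglyMeasurable (fun p : α × Vel => k p * P p.2) (μ.prod volume) :=
    hk.aestronglyMeasurable.mul hP.aestronglyMeasurable.comp_snd
  have hle : ∀ v, Integrable (fun x => k (x, v)) μ ∧ ∫ x, k (x, v) ∂μ ≤ L := fun v =>
    integrable_integral_le_of_lintegral (hk.comp measurable_prodMk_right) (fun x => h0 _) hL (h v)
  have hi : Integrable (fun p => k p * P p.2) (μ.prod volume) := by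
    rw [integrable_prod_iff' hm]
    refine ⟨Eventually.of_forall fun v => (hle v).1.mul_const (P v), ?_⟩
    refine (hP.abs.const_mul L).mono' hm.norm.prod_swap.integral_prod_right' ?_
    refine Eventually.of_forall fun v => ?_
    rw [Real.norm_of_nonneg (integral_nonneg fun _ => norm_nonneg _)]
    simp only [norm_mul, Real.norm_eq_abs, abs_of_nonneg (h0 _)]
    rw [integral_mul_const]
    exact mul_le_mul_of_nonneg_right (hle v).2 (abs_nonneg _)
  refine ⟨hi, ?_⟩
  rw [integral_prod_symm _ hi, ← integral_const_mul]
  refine integral_mono hi.integral_prod_right (hP.abs.const_mul L) fun v => ?_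
  simp only
  rw [integral_mul_const]
  calc _ ≤ (∫ x, k (x, v) ∂μ) * |P v| :=
        mul_le_mul_of_nonneg_left (le_abs_self _) (integral_nonneg fun _ => h0 _)
    _ ≤ _ := mul_le_mul_of_nonneg_right (hle v).2 (abs_nonneg _)

lemma measurable_wt_pair : Measurable fun p : (Vel × Sph) × Vel => wt (p.2 - p.1.1) := by
  have := continuous_wt.measurable
  fun_prop

lemma measurable_wt_pair_dev :
    Measurable fun p : (Vel × Sph) × Vel => wt (p.2 - p.1.1 - dev p.1) := by
  have := continuous_wt.measurable
  have := measurable_dev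
  fun_prop

/-- The second function is the image under the exchange of velocities of P(v) with the weight at
v'_*, which is why both weights were estimated. -/
lemma IsKernelParam.integrable_wt_mul (hp : IsKernelParam C γ s) (hε : 0 < ε) {P : Vel → ℝ}
    (hP : Integrable P) :
    Integrable (fun p => wt (p.2 - p.1.1) * P p.2) (pairMeasure C γ s ε) ∧
      Integrable (fun p => wt (p.2 - p.1.1) * P (p.2 + dev p.1)) (pairMeasure C γ s ε) := by
  obtain ⟨L, hL, hb⟩ := exists_coll_bound_trunc hp.C_pos hp.neg_three_lt hp.gamma_neg hp.s_pos hε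
  refine ⟨(integrable_mul_of_lintegral_le measurable_wt_pair (fun _ => (wt_pos _).le) hL.le
    (fun v => (hb v).1) hP).1, ?_⟩
  have h2 := (integrable_mul_of_lintegral_le measurable_wt_pair_dev (fun _ => (wt_pos _).le) hL.le
    (fun v => (hb v).2) hP).1
  have h3 : Integrable _ (pairMeasure C γ s ε) :=
    measurePreserving_swapMap.integrable_comp_of_integrable h2
  refine h3.congr ?_
  filter_upwards [ae_pairMeasure] with p hp0
  simp only [Function.comp, swapMap, flip_fst, dev_flip hp0]
  have e1 : p.2 + dev p.1 - (p.1.1 + (2 : ℝ) • dev p.1) - -dev p.1 = p.2 - p.1.1 := by module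
  rw [e1]

/-- |a| is unchanged by the exchange of velocities, so the integral with P at v' becomes one with P
at v and the weight at v'_*. -/
lemma IsKernelParam.exists_min_sq_bound (hp : IsKernelParam C γ s) : ∃ Λ : ℝ, 0 < Λ ∧
    ∀ (ε δ : ℝ), 0 < ε → 0 < δ → ∀ P : Vel → ℝ, Integrable P → (∀ v, 0 ≤ P v) →
      ∫ p, min ‖dev p.1‖ δ ^ 2 * wt (p.2 - p.1.1) * P p.2 ∂(pairMeasure C γ s ε) ≤
        Λ * δ ^ (2 - 2 * s) * ∫ v, P v ∧
      ∫ p, min ‖dev p.1‖ δ ^ 2 * wt (p.2 - p.1.1) * P (p.2 + dev p.1) ∂(pairMeasure C γ s ε) ≤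
        Λ * δ ^ (2 - 2 * s) * ∫ v, P v := by
  obtain ⟨Λ, hΛ, hb⟩ := exists_coll_bound hp.C_pos hp.neg_three_lt hp.gamma_neg hp.s_pos
    hp.s_lt_one hp.soft
  refine ⟨Λ, hΛ, fun ε δ hε hδ P hP hP0 => ?_⟩
  have mdev := measurable_dev
  have mwt := continuous_wt.measurable
  have hL : 0 ≤ Λ * δ ^ (2 - 2 * s) := by positivity
  have hPa : ∫ v, |P v| = ∫ v, P v := by simp only [abs_of_nonneg (hP0 _)]
  have h1 := (integrable_mul_of_lintegral_le (μ := collMeasure C γ s ε)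
    (k := fun p => min ‖dev p.1‖ δ ^ 2 * wt (p.2 - p.1.1)) (by fun_prop)
    (fun p => mul_nonneg (by positivity) (wt_pos _).le) hL (fun v => (hb ε δ v hε hδ).1) hP).2
  obtain ⟨h2i, h2⟩ := integrable_mul_of_lintegral_le (μ := collMeasure C γ s ε)
    (k := fun p => min ‖dev p.1‖ δ ^ 2 * wt (p.2 - p.1.1 - dev p.1)) (by fun_prop)
    (fun p => mul_nonneg (by positivity) (wt_pos _).le) hL (fun v => (hb ε δ v hε hδ).2) hP
  rw [hPa] at h1 h2
  refine ⟨h1, le_trans (le_of_eq ?_) h2⟩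
  rw [← integral_comp_measurePreserving measurePreserving_swapMap h2i.aestronglyMeasurable]
  refine integral_congr_ae ?_
  filter_upwards [ae_pairMeasure] with p hp0
  simp only [swapMap, flip_fst, dev_flip hp0, norm_neg]
  have e1 : p.2 + dev p.1 - (p.1.1 + (2 : ℝ) • dev p.1) - -dev p.1 = p.2 - p.1.1 := by module
  rw [e1]

lemma IsKernelParam.integrable_pair (hp : IsKernelParam C γ s) (hε : 0 < ε) {P Q : Vel → ℝ}
    (hP : Integrable P) (hQ : Integrable Q) {E : (Vel × Sph) × Vel → ℝ}
    (hE : AEStronglyMeasurable E (pairMeasure C γ s ε))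
    (hle : ∀ p, |E p| ≤ wt (p.2 - p.1.1) * (P p.2 + Q (p.2 + dev p.1))) :
    Integrable E (pairMeasure C γ s ε) := by
  refine ((hp.integrable_wt_mul hε hP).1.add (hp.integrable_wt_mul hε hQ).2).mono' hE ?_
  refine Eventually.of_forall fun p => ?_
  rw [Real.norm_eq_abs, Pi.add_apply, ← mul_add]
  exact hle p

lemma postVel_eq (v : Vel) (x : Vel × Sph) : postVel v (v - x.1) x.2 = v + dev x := by
  simp only [postVel, dev, sub_sub_cancel]
  module

lemma postVelStar_eq (v : Vel) (x : Vel × Sph) : postVelStar v (v - x.1) x.2 = v - x.1 - dev x := by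
  simp only [postVelStar, dev, sub_sub_cancel]
  module

lemma IsKernelParam.truncCollision_eq (hp : IsKernelParam C γ s) {h : Vel → ℝ} (hg : Measurable g) (hh : Measurable h) (v : Vel) :
    truncCollision C γ s ε g h v =
      ∫ x, (gainRate g v x * h (v + dev x) - lossRate g v x * h v) ∂(collMeasure C γ s ε) := by
  have hT : MeasurePreserving (fun x : Vel × Sph => (x.2, v - x.1)) (volume.prod sphMeasure)
      (sphMeasure.prod volume) := by
    have h1 : MeasurePreserving (fun z : Vel => v - z) volume volume :=
      Measure.measurePreserving_sub_left volume v
    have h2 : MeasurePreserving (Prod.map (fun z : Vel => v - z) (id : Sph → Sph))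
        (volume.prod sphMeasure) (volume.prod sphMeasure) :=
      h1.prod (MeasurePreserving.id sphMeasure)
    have h3 : MeasurePreserving (Prod.swap : Vel × Sph → Sph × Vel)
        (volume.prod sphMeasure) (sphMeasure.prod volume) := Measure.measurePreserving_swap
    exact h3.comp h2
  have mk : Measurable fun p : Sph × Vel => truncKernel C γ s ε (v - p.2) p.1 := by
    have h4 : Measurable fun p : Sph × Vel => (v - p.2, p.1) := by fun_prop
    have h5 := (measurable_truncKernel (C := C) (γ := γ) (s := s) (ε := ε)).comp h4
    exact h5
  have mp : Measurable fun p : Sph × Vel => postVel v p.2 p.1 := by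
    unfold postVel; fun_prop
  have mps : Measurable fun p : Sph × Vel => postVelStar v p.2 p.1 := by
    unfold postVelStar; fun_prop
  have mc : Measurable fun p : Sph × Vel => collisionDiff g h v p.2 p.1 := by
    unfold collisionDiff; fun_prop
  have e := integral_comp_measurePreserving
    (f := fun p : Sph × Vel => truncKernel C γ s ε (v - p.2) p.1 * collisionDiff g h v p.2 p.1) hT
    (mk.mul mc).aestronglyMeasurable
  refine e.symm.trans ?_
  rw [collMeasure, integral_withDensity_eq_integral_toReal_smul
      measurable_truncKernel.ennreal_ofReal (Eventually.of_forall fun x => ENNReal.ofReal_lt_top)]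
  refine integral_congr_ae (Eventually.of_forall fun x => ?_)
  simp only [ENNReal.toReal_ofReal (truncKernel_nonneg hp.C_pos _ _), smul_eq_mul, sub_sub_cancel,
    collisionDiff, postVel_eq, postVelStar_eq, gainRate, lossRate]
  ring

end

end QuantumBoltzmann

namespace QuantumBoltzmann

noncomputable section

variable {C γ s ε M : ℝ} {g h : Vel → ℝ}

lemma measurable_lossRate_pair (hg : Measurable g) :
    Measurable fun p : (Vel × Sph) × Vel => lossRate g p.2 p.1 :=
  (measurable_lossRate hg).comp measurable_swap

lemma measurable_add_dev : Measurable fun p : (Vel × Sph) × Vel => p.2 + dev p.1 :=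
  measurable_snd.add (measurable_dev.comp measurable_fst)

lemma aestronglyMeasurable_comp_add_dev {P : Vel → ℝ} (hP : AEStronglyMeasurable P) :
    AEStronglyMeasurable (fun p => P (p.2 + dev p.1)) (pairMeasure C γ s ε) := by
  refine hP.comp_quasiMeasurePreserving (f := fun p : (Vel × Sph) × Vel => p.2 + dev p.1) ?_
  exact Measure.quasiMeasurePreserving_snd.comp
    measurePreserving_swapMap.quasiMeasurePreserving

/-- The weak form of the collision operator, after the change of variables exchanging pre- and
postcollisional velocities. -/
lemma IsKernelParam.integral_truncCollision_mul (hp : IsKernelParam C γ s) (hε : 0 < ε)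
    (hg : IsRegular M g) (hh : Measurable h) (hh2 : MemLp h 2) {φ : Vel → ℝ} (hφ : Measurable φ)
    (hφ2 : MemLp φ 2) :
    ∫ v, truncCollision C γ s ε g h v * φ v =
      ∫ p, lossRate g p.2 p.1 * h p.2 * (φ (p.2 + dev p.1) - φ p.2) ∂(pairMeasure C γ s ε) := by
  have hgm := hg.cont.measurable
  have hM := hg.const_nonneg
  set c := M * (1 + 2 * M)
  have hc : 0 ≤ c := by positivity
  have ml := measurable_lossRate_pair hgm
  have mad := measurable_add_dev
  have ih := hh2.integrable_sq
  have iφ := hφ2.integrable_sq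
  have hl : ∀ p : (Vel × Sph) × Vel, 0 ≤ lossRate g p.2 p.1 ∧
      lossRate g p.2 p.1 ≤ c * wt (p.2 - p.1.1) := fun p =>
    ⟨lossRate_nonneg hg.nonneg _ _, hg.lossRate_le _ _⟩
  have hprod : ∀ (l w x y : ℝ), 0 ≤ l → l ≤ c * w → 0 ≤ w → |l * x * y| ≤ w * (c * x ^ 2 + c * y ^ 2) := by
    intro l w x y h0 h1 h2
    rw [mul_assoc, abs_mul, abs_of_nonneg h0]
    have h3 : |x * y| ≤ x ^ 2 + y ^ 2 := by
      rw [abs_le]; constructor <;> nlinarith [sq_nonneg (x + y), sq_nonneg (x - y)]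
    calc _ ≤ c * w * (x ^ 2 + y ^ 2) := mul_le_mul h1 h3 (abs_nonneg _) (h0.trans h1)
      _ = _ := by ring
  have i1 : Integrable (fun p => lossRate g p.2 p.1 * h p.2 * φ p.2) (pairMeasure C γ s ε) := by
    refine hp.integrable_pair hε (Q := fun _ => 0) ((ih.const_mul c).add (iφ.const_mul c))
      (integrable_zero _ _ _) (by fun_prop) fun p => ?_
    rw [add_zero]
    exact hprod _ _ _ _ (hl p).1 (hl p).2 (wt_pos _).le
  have i2 : Integrable (fun p => lossRate g p.2 p.1 * h p.2 * φ (p.2 + dev p.1))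
      (pairMeasure C γ s ε) := by
    refine hp.integrable_pair hε (ih.const_mul c) (iφ.const_mul c) (by fun_prop) fun p => ?_
    exact hprod _ _ _ _ (hl p).1 (hl p).2 (wt_pos _).le
  -- The gain term tested against φ is the image under the exchange of the loss term tested against
  -- φ'.
  have e2 : (fun p => gainRate g p.2 p.1 * h (p.2 + dev p.1) * φ p.2) =ᵐ[pairMeasure C γ s ε]
      fun p => lossRate g (swapMap p).2 (swapMap p).1 * h (swapMap p).2 *
        φ ((swapMap p).2 + dev (swapMap p).1) := by
    filter_upwards [ae_pairMeasure] with p hp0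
    simp only [swapMap]
    rw [lossRate_swap hp0, dev_flip hp0, add_neg_cancel_right]
  have i3 : Integrable (fun p => gainRate g p.2 p.1 * h (p.2 + dev p.1) * φ p.2)
      (pairMeasure C γ s ε) :=
    (measurePreserving_swapMap.integrable_comp_of_integrable i2).congr e2.symm
  have e3 : ∫ p, gainRate g p.2 p.1 * h (p.2 + dev p.1) * φ p.2 ∂(pairMeasure C γ s ε) =
      ∫ p, lossRate g p.2 p.1 * h p.2 * φ (p.2 + dev p.1) ∂(pairMeasure C γ s ε) := by
    rw [integral_congr_ae e2]
    exact integral_comp_measurePreserving measurePreserving_swapMap i2.aestronglyMeasurable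
  have e4 : ∫ p, lossRate g p.2 p.1 * h p.2 * (φ (p.2 + dev p.1) - φ p.2) ∂(pairMeasure C γ s ε) =
      ∫ p, (gainRate g p.2 p.1 * h (p.2 + dev p.1) * φ p.2 - lossRate g p.2 p.1 * h p.2 * φ p.2)
        ∂(pairMeasure C γ s ε) := by
    rw [integral_sub i3 i1, e3, ← integral_sub i2 i1]
    refine integral_congr_ae (Eventually.of_forall fun p => ?_)
    simp only
    ring
  have i31 : Integrable (fun p => gainRate g p.2 p.1 * h (p.2 + dev p.1) * φ p.2 -
      lossRate g p.2 p.1 * h p.2 * φ p.2) (pairMeasure C γ s ε) := i3.sub i1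
  rw [e4, integral_prod_symm _ i31]
  refine integral_congr_ae (Eventually.of_forall fun v => ?_)
  simp only
  rw [hp.truncCollision_eq hgm hh, ← integral_mul_const]
  refine integral_congr_ae (Eventually.of_forall fun x => ?_)
  simp only
  ring

/-- A slice of G agrees with its regular version only off a null set. Each of the four velocities at
which g is evaluated pulls null sets back to null sets of the pair measure. -/
lemma IsKernelParam.truncCollision_congr_ae (hp : IsKernelParam C γ s) {g' : Vel → ℝ}
    (hg : Measurable g) (hg' : Measurable g') (hh : Measurable h) (hgg : g' =ᵐ[volume] g) :
    ∀ᵐ v, truncCollision C γ s ε g' h v = truncCollision C γ s ε g h v := by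
  have h1 : ∀ᵐ p ∂(pairMeasure C γ s ε), g' (p.2 + -p.1.1) = g (p.2 + -p.1.1) :=
    ae_pairMeasure_add (c := fun x => -x.1) (by fun_prop) hgg
  have h2 : ∀ᵐ p ∂(pairMeasure C γ s ε), g' (p.2 + (-p.1.1 - dev p.1)) = g (p.2 + (-p.1.1 - dev p.1)) :=
    ae_pairMeasure_add (c := fun x => -x.1 - dev x) (measurable_fst.neg.sub measurable_dev) hgg
  have h3 : ∀ᵐ p ∂(pairMeasure C γ s ε), g' (p.2 + dev p.1) = g (p.2 + dev p.1) :=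
    ae_pairMeasure_add measurable_dev hgg
  have h4 : ∀ᵐ p ∂(pairMeasure C γ s ε), g' p.2 = g p.2 :=
    Measure.quasiMeasurePreserving_snd.ae hgg
  have h5 : ∀ᵐ p ∂(pairMeasure C γ s ε), lossRate g' p.2 p.1 = lossRate g p.2 p.1 ∧
      gainRate g' p.2 p.1 = gainRate g p.2 p.1 := by
    filter_upwards [h1, h2, h3, h4] with p p1 p2 p3 p4
    rw [← sub_eq_add_neg] at p1
    rw [← add_sub_assoc, ← sub_eq_add_neg] at p2
    simp only [lossRate, gainRate, p1, p2, p3, p4, true_and]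
  have h6 : ∀ᵐ q ∂((volume : Measure Vel).prod (collMeasure C γ s ε)),
      lossRate g' q.1 q.2 = lossRate g q.1 q.2 ∧ gainRate g' q.1 q.2 = gainRate g q.1 q.2 :=
    Measure.measurePreserving_swap.quasiMeasurePreserving.ae h5
  filter_upwards [Measure.ae_ae_of_ae_prod h6] with v hv
  rw [hp.truncCollision_eq hg' hh, hp.truncCollision_eq hg hh]
  refine integral_congr_ae ?_
  filter_upwards [hv] with x hx
  rw [hx.1, hx.2]

/-! ### Mollification of the weak form -/

/-- Averaging against an even kernel is self-adjoint; Fubini's theorem is justified by |PQ| ≤ P² +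
Q². -/
lemma IsKernel.integral_mul_avg {κ : Vel → ℝ} {r : ℝ} (hκ : IsKernel κ r)
    (heven : ∀ v, κ (-v) = κ v) {P Q : Vel → ℝ} (hP : MemLp P 2) (hQ : MemLp Q 2) :
    ∫ v, P v * avg κ Q v = ∫ v, avg κ P v * Q v := by
  have hm1 : Measurable fun p : Vel × Vel => κ (p.1 - p.2) :=
    hκ.meas.comp (measurable_fst.sub measurable_snd)
  have hc : ∀ v, ∫⁻ x, ENNReal.ofReal (κ (x - v)) ≤ ENNReal.ofReal (∫ w, κ w) := fun v => by
    rw [lintegral_sub_right_eq_self (fun x => ENNReal.ofReal (κ x)) v,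
      ofReal_integral_eq_lintegral_ofReal hκ.integrable (Eventually.of_forall hκ.nonneg)]
  have h0 : 0 ≤ ∫ w, κ w := integral_nonneg hκ.nonneg
  have j1 := (integrable_mul_of_lintegral_le (μ := (volume : Measure Vel)) hm1
    (fun p => hκ.nonneg _) h0 hc hP.integrable_sq).1
  have j2 := (integrable_mul_of_lintegral_le (μ := (volume : Measure Vel)) hm1
    (fun p => hκ.nonneg _) h0 hc hQ.integrable_sq).1
  have hsym : ∀ v w : Vel, κ (v - w) = κ (w - v) := fun v w => by rw [← heven, neg_sub]
  have hi : Integrable (fun p : Vel × Vel => κ (p.2 - p.1) * (P p.1 * Q p.2)) (volume.prod volume) := by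
    have hm : AEStronglyMeasurable (fun p : Vel × Vel => κ (p.2 - p.1) * (P p.1 * Q p.2))
        (volume.prod volume) := by
      have m2 : Measurable fun p : Vel × Vel => κ (p.2 - p.1) :=
        hκ.meas.comp (measurable_snd.sub measurable_fst)
      exact m2.aestronglyMeasurable.mul
        (hP.aestronglyMeasurable.comp_fst.mul hQ.aestronglyMeasurable.comp_snd)
    refine (j1.swap.add j2).mono' hm (Eventually.of_forall fun p => ?_)
    simp only [Pi.add_apply, Function.comp, Prod.fst_swap, Prod.snd_swap, hsym p.1 p.2]
    rw [Real.norm_eq_abs, abs_mul, abs_of_nonneg (hκ.nonneg _), ← mul_add]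
    refine mul_le_mul_of_nonneg_left ?_ (hκ.nonneg _)
    rw [abs_le]
    constructor <;> nlinarith [sq_nonneg (P p.1 + Q p.2), sq_nonneg (P p.1 - Q p.2)]
  have e1 : ∫ v, P v * avg κ Q v = ∫ v, ∫ w, κ (w - v) * (P v * Q w) := by
    refine integral_congr_ae (Eventually.of_forall fun v => ?_)
    simp only [avg]
    rw [← integral_const_mul]
    refine integral_congr_ae (Eventually.of_forall fun w => ?_)
    simp only
    ring
  have e2 : ∫ v, avg κ P v * Q v = ∫ w, ∫ v, κ (w - v) * (P v * Q w) := by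
    refine integral_congr_ae (Eventually.of_forall fun w => ?_)
    simp only [avg]
    rw [← integral_mul_const]
    refine integral_congr_ae (Eventually.of_forall fun v => ?_)
    simp only [hsym v w]
    ring
  rw [e1, e2]
  exact integral_integral_swap hi

lemma IsRegular.lossRate_le_of_near (hg : IsRegular M g) {v w : Vel} (hvw : ‖w - v‖ ≤ 1)
    (x : Vel × Sph) : lossRate g w x ≤ 16 * (M * (1 + 2 * M)) * wt (v - x.1) := by
  have hM := hg.const_nonneg
  have h1 := wt_add_le (v - x.1) (w - v) hvw
  have e1 : v - x.1 + (w - v) = w - x.1 := by module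
  rw [e1] at h1
  calc _ ≤ M * (1 + 2 * M) * wt (w - x.1) := hg.lossRate_le w x
    _ ≤ M * (1 + 2 * M) * (16 * wt (v - x.1)) := by gcongr
    _ = _ := by ring

/-- The mollified product of the loss rate and `h`. -/
def rateAvg (κ g h : Vel → ℝ) (p : (Vel × Sph) × Vel) : ℝ :=
  avg κ (fun w => lossRate g w p.1 * h w) p.2

lemma measurable_rateAvg {κ : Vel → ℝ} (hκ : Measurable κ) (hg : Measurable g) (hh : Measurable h) :
    Measurable (rateAvg κ g h) := by
  have ml := measurable_lossRate hg
  have m1 : Measurable fun q : ((Vel × Sph) × Vel) × Vel => lossRate g q.2 q.1.1 :=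
    ml.comp (g := fun p : Vel × Vel × Sph => lossRate g p.1 p.2)
      (f := fun q : ((Vel × Sph) × Vel) × Vel => (q.2, q.1.1)) (by fun_prop)
  have m2 : Measurable fun q : ((Vel × Sph) × Vel) × Vel =>
      κ (q.2 - q.1.2) * (lossRate g q.2 q.1.1 * h q.2) := by fun_prop
  exact (m2.stronglyMeasurable.integral_prod_right (f := fun (p : (Vel × Sph) × Vel) (w : Vel) =>
      κ (w - p.2) * (lossRate g w p.1 * h w))).measurable

lemma IsRegular.integrable_kernel_loss {κ : Vel → ℝ} {r : ℝ} (hκ : IsKernel κ r)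
    (hg : IsRegular M g) (hh : LocallyIntegrable h) (v : Vel) (x : Vel × Sph) :
    Integrable fun w => κ (w - v) * (lossRate g w x * h w) := by
  have hgm := hg.cont.measurable
  have hM := hg.const_nonneg
  have ml : Measurable fun w => lossRate g w x := (measurable_lossRate hgm).comp measurable_prodMk_right
  have h1 := (hκ.integrable_mul hh v).bdd_mul (c := M * (1 + 2 * M)) ml.aestronglyMeasurable
    (Eventually.of_forall fun w => by
      rw [Real.norm_of_nonneg (lossRate_nonneg hg.nonneg w x)]
      exact (hg.lossRate_le w x).trans (mul_le_of_le_one_right (by positivity) (wt_le_one _)))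
  refine h1.congr (Eventually.of_forall fun w => ?_)
  simp only
  ring

lemma IsRegular.abs_rateAvg_le {κ : Vel → ℝ} {r : ℝ} (hκ : IsKernel κ r) (hr : r ≤ 1)
    (hg : IsRegular M g) (hh : LocallyIntegrable h) (p : (Vel × Sph) × Vel) :
    |rateAvg κ g h p| ≤ 16 * (M * (1 + 2 * M)) * wt (p.2 - p.1.1) * avg κ (fun w => |h w|) p.2 := by
  have hM := hg.const_nonneg
  have hha : LocallyIntegrable (fun w => |h w|) :=
    hh.mono hh.aestronglyMeasurable.norm (Eventually.of_forall fun w => by simp)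
  simp only [rateAvg, avg]
  rw [← integral_const_mul, ← Real.norm_eq_abs]
  refine norm_integral_le_of_norm_le ((hκ.integrable_mul hha p.2).const_mul _)
    (Eventually.of_forall fun w => ?_)
  rw [norm_mul, norm_mul, Real.norm_of_nonneg (hκ.nonneg _),
    Real.norm_of_nonneg (lossRate_nonneg hg.nonneg _ _), Real.norm_eq_abs]
  rcases le_or_gt ‖w - p.2‖ r with h1 | h1
  · have h2 := hg.lossRate_le_of_near (h1.trans hr) p.1
    have h3 := hκ.nonneg (w - p.2)
    calc _ ≤ κ (w - p.2) * (16 * (M * (1 + 2 * M)) * wt (p.2 - p.1.1) * |h w|) := by gcongr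
      _ = _ := by ring
  · rw [hκ.supp _ h1]
    simp

lemma IsKernelParam.integrable_mul_diff (hp : IsKernelParam C γ s) (hε : 0 < ε) {c : ℝ}
    {X Y : Vel → ℝ} (hX : MemLp X 2) (hY : MemLp Y 2) {E : (Vel × Sph) × Vel → ℝ}
    (hE : AEStronglyMeasurable E (pairMeasure C γ s ε))
    (hle : ∀ p, |E p| ≤ c * wt (p.2 - p.1.1) * |X p.2|) :
    Integrable (fun p => E p * (Y (p.2 + dev p.1) - Y p.2)) (pairMeasure C γ s ε) := by
  refine hp.integrable_pair hε (((hX.integrable_sq.add hY.integrable_sq).const_mul |c|))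
    (hY.integrable_sq.const_mul |c|)
    (hE.mul ((aestronglyMeasurable_comp_add_dev hY.aestronglyMeasurable).sub
      hY.aestronglyMeasurable.comp_snd)) fun p => ?_
  simp only [Pi.add_apply]
  set w := wt (p.2 - p.1.1)
  have hw : 0 < w := wt_pos _
  set y' := Y (p.2 + dev p.1)
  set y := Y p.2
  have h1 : |E p| ≤ |c| * w * |X p.2| :=
    (hle p).trans (mul_le_mul_of_nonneg_right
      (mul_le_mul_of_nonneg_right (le_abs_self c) hw.le) (abs_nonneg _))
  have h2 : |X p.2| * |y' - y| ≤ X p.2 ^ 2 + y ^ 2 + y' ^ 2 := by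
    have h3 : |y' - y| ^ 2 ≤ 2 * (y' ^ 2 + y ^ 2) := by
      rw [sq_abs]; nlinarith [sq_nonneg (y' + y)]
    nlinarith [sq_nonneg (|X p.2| - |y' - y|), sq_abs (X p.2)]
  rw [abs_mul]
  calc _ ≤ |c| * w * |X p.2| * |y' - y| := mul_le_mul_of_nonneg_right h1 (abs_nonneg _)
    _ = |c| * w * (|X p.2| * |y' - y|) := by ring
    _ ≤ |c| * w * (X p.2 ^ 2 + y ^ 2 + y' ^ 2) := by gcongr
    _ = _ := by ring

lemma avg_add (κ f : Vel → ℝ) (v a : Vel) : avg κ f (v + a) = avg κ (fun w => f (w + a)) v := by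
  simp only [avg]
  rw [← integral_add_right_eq_self (fun w => κ (w - (v + a)) * f w) a]
  simp only [add_sub_add_right_eq_sub]

/-- At fixed (z, σ) the shift by a commutes with averaging in v, and averaging is self-adjoint. The
mollifier thus moves from the test function onto the product of the loss rate and h. -/
lemma IsKernelParam.integral_loss_avg (hp : IsKernelParam C γ s) (hε : 0 < ε)
    (hg : IsRegular M g) (hh : Measurable h) (hh2 : MemLp h 2) {κ : Vel → ℝ} {r : ℝ}
    (hκ : IsKernel κ r) (heven : ∀ v, κ (-v) = κ v) (hr : r ≤ 1) {f : Vel → ℝ} (hf : MemLp f 2) :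
    ∫ p, lossRate g p.2 p.1 * h p.2 * (avg κ f (p.2 + dev p.1) - avg κ f p.2)
        ∂(pairMeasure C γ s ε) =
      ∫ p, rateAvg κ g h p * (f (p.2 + dev p.1) - f p.2) ∂(pairMeasure C γ s ε) := by
  have hgm := hg.cont.measurable
  have hM := hg.const_nonneg
  have hl : LocallyIntegrable h := hh2.locallyIntegrable (by norm_num)
  have hfl : LocallyIntegrable f := hf.locallyIntegrable (by norm_num)
  have hκf := hκ.memLp_avg hf
  have ml := measurable_lossRate_pair hgm
  have i1 := hp.integrable_mul_diff hε (E := fun p => lossRate g p.2 p.1 * h p.2)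
    (c := M * (1 + 2 * M)) hh2 hκf (by fun_prop) fun p => by
      rw [abs_mul, abs_of_nonneg (lossRate_nonneg hg.nonneg _ _)]
      exact mul_le_mul_of_nonneg_right (hg.lossRate_le _ _) (abs_nonneg _)
  have i2 := hp.integrable_mul_diff hε (E := rateAvg κ g h) (c := 16 * (M * (1 + 2 * M)))
    (hκ.memLp_avg (h := fun w => |h w|) hh2.norm) hf
    (measurable_rateAvg hκ.meas hgm hh).aestronglyMeasurable fun p =>
      (hg.abs_rateAvg_le hκ hr hl p).trans (mul_le_mul_of_nonneg_left (le_abs_self _)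
        (mul_nonneg (by positivity) (wt_pos _).le))
  rw [integral_prod _ i1, integral_prod _ i2]
  refine integral_congr_ae (Eventually.of_forall fun x => ?_)
  have hfa : MemLp (fun w => f (w + dev x)) 2 :=
    hf.comp_measurePreserving (measurePreserving_add_right volume (dev x))
  have hD : MemLp (fun w => f (w + dev x) - f w) 2 := hfa.sub hf
  have hP : MemLp (fun w => lossRate g w x * h w) 2 := by
    have mlx : Measurable fun w => lossRate g w x :=
      (measurable_lossRate hgm).comp measurable_prodMk_right
    refine (hh2.const_mul (M * (1 + 2 * M))).mono (mlx.mul hh).aestronglyMeasurable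
      (Eventually.of_forall fun w => ?_)
    rw [norm_mul, norm_mul, Real.norm_of_nonneg (lossRate_nonneg hg.nonneg w x)]
    refine mul_le_mul_of_nonneg_right (((hg.lossRate_le w x).trans
      (mul_le_of_le_one_right (by positivity) (wt_le_one _))).trans (le_abs_self _)) (norm_nonneg _)
  have key := hκ.integral_mul_avg heven hP hD
  simp only [rateAvg]
  rw [← key]
  refine integral_congr_ae (Eventually.of_forall fun v => ?_)
  simp only
  congr 1
  rw [avg_add]
  have hfal : LocallyIntegrable (fun w => f (w + dev x)) := hfa.locallyIntegrable (by norm_num)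
  simp only [avg]
  rw [← integral_sub (hκ.integrable_mul hfal v) (hκ.integrable_mul hfl v)]
  simp only [mul_sub]

end

end QuantumBoltzmann

/-! ### The commutator of mollification with the loss rate. -/

namespace QuantumBoltzmann

noncomputable section

/-! ### Commutator estimates -/

variable {C γ s ε M δ : ℝ} {g h ρ : Vel → ℝ}

/-- The local modulus of continuity of `lossRate` at scale `δ`, in terms of `u = v_*`. -/
def modulus (g : Vel → ℝ) (δ : ℝ) (u : Vel) : ℝ := √(wt u * g u) + δ * wt u

lemma modulus_nonneg (hδ : 0 < δ) (u : Vel) : 0 ≤ modulus g δ u :=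
  add_nonneg (Real.sqrt_nonneg _) (mul_nonneg hδ.le (wt_pos u).le)

/-- √(w g) at a nearby point costs at most one extra term δ w. This lets all intermediate points of
the commutator estimates be compared with the single base point v_*. -/
lemma IsRegular.sqrt_le_modulus (hg : IsRegular M g) (hδ : 0 < δ) (hδ1 : δ ≤ 1 / 8) {u u' : Vel}
    (hu : ‖u' - u‖ ≤ 4 * δ) : √(wt u' * g u') ≤ 4 * (1 + 16 * M) * modulus g δ u := by
  have hM := hg.const_nonneg
  have hw := wt_pos u
  have hw' := wt_pos u'
  have h1 := hg.lip u (u' - u) (by linarith)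
  have h2 := wt_add_le u (u' - u) (by linarith)
  rw [add_sub_cancel] at h1 h2
  set S := √(wt u * g u)
  have hS0 : 0 ≤ S := Real.sqrt_nonneg _
  have hS : S ^ 2 = wt u * g u := Real.sq_sqrt (mul_nonneg hw.le (hg.nonneg u))
  have hΓ : 0 ≤ S + δ * wt u := modulus_nonneg hδ u
  refine Real.sqrt_le_iff.2 ⟨by unfold modulus; positivity, ?_⟩
  have h3 : g u' ≤ g u + M * (4 * δ * S + (4 * δ) ^ 2 * wt u) := by
    have h4 : M * (‖u' - u‖ * S + ‖u' - u‖ ^ 2 * wt u) ≤ M * (4 * δ * S + (4 * δ) ^ 2 * wt u) := by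
      gcongr
    have := le_abs_self (g u' - g u)
    linarith
  have hgu' := hg.nonneg u'
  calc wt u' * g u' ≤ (16 * wt u) * (g u + M * (4 * δ * S + (4 * δ) ^ 2 * wt u)) :=
        mul_le_mul h2 h3 hgu' (by positivity)
    _ = 16 * (S ^ 2 + M * (4 * (δ * wt u) * S + 16 * (δ * wt u) ^ 2)) := by rw [hS]; ring
    _ ≤ 16 * ((1 + 16 * M) * (S + δ * wt u) ^ 2) := by
        have hd : 0 ≤ δ * wt u := by positivity
        have e1 : 0 ≤ M * (S * (δ * wt u)) := by positivity
        have e2 : 0 ≤ S * (δ * wt u) := by positivity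
        have e3 : 0 ≤ M * S ^ 2 := by positivity
        nlinarith [sq_nonneg (δ * wt u)]
    _ ≤ 16 * ((1 + 16 * M) ^ 2 * (S + δ * wt u) ^ 2) := by
        gcongr
        nlinarith
    _ = (4 * (1 + 16 * M) * modulus g δ u) ^ 2 := by
        change _ = (4 * (1 + 16 * M) * (S + δ * wt u)) ^ 2
        ring

/-- A Lipschitz constant for the products `g u (1 + g p + g q)`. -/
def lipConst (M : ℝ) : ℝ :=
  M * (4 * (1 + 16 * M) + 32) * (1 + 2 * M) + (M + 1) * (4 * (1 + 16 * M)) * (2 * M * (2 + M))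

lemma lipConst_nonneg (hM : 0 ≤ M) : 0 ≤ lipConst M := by
  unfold lipConst; positivity

/-- One difference carries the modulus directly. In the others the undifferentiated factor g u₂
supplies it, so a plain Lipschitz bound for g at the remaining points is enough. -/
lemma IsRegular.abs_product_sub_le (hg : IsRegular M g) (hδ : 0 < δ) (hδ1 : δ ≤ 1 / 8)
    {τ : ℝ} (hτ0 : 0 ≤ τ) (hτ : τ ≤ 2 * δ) {u u₁ u₂ p₁ p₂ q₁ q₂ : Vel} (h2 : ‖u₂ - u‖ ≤ 4 * δ)
    (hu : ‖u₁ - u₂‖ ≤ τ) (hp : ‖p₁ - p₂‖ ≤ τ) (hq : ‖q₁ - q₂‖ ≤ τ) :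
    |g u₁ * (1 + g p₁ + g q₁) - g u₂ * (1 + g p₂ + g q₂)| ≤ lipConst M * τ * modulus g δ u := by
  have hM := hg.const_nonneg
  set Γ := modulus g δ u
  have hΓ : 0 ≤ Γ := modulus_nonneg hδ u
  have hE := hg.sqrt_le_modulus hδ hδ1 h2
  set E := √(wt u₂ * g u₂)
  have hE0 : 0 ≤ E := Real.sqrt_nonneg _
  have hEsq : E ^ 2 = wt u₂ * g u₂ := Real.sq_sqrt (mul_nonneg (wt_pos _).le (hg.nonneg _))
  have hw := wt_pos u
  have hδw : δ * wt u ≤ Γ := le_add_of_nonneg_left (Real.sqrt_nonneg _)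
  have hw2 : wt u₂ ≤ 16 * wt u := by
    have := wt_add_le u (u₂ - u) (by linarith)
    rwa [add_sub_cancel] at this
  have c1 : |g u₁ - g u₂| ≤ M * (4 * (1 + 16 * M) + 32) * τ * Γ := by
    have h := hg.lip u₂ (u₁ - u₂) (by linarith)
    rw [add_sub_cancel] at h
    refine h.trans ?_
    have hw2p := wt_pos u₂
    calc M * (‖u₁ - u₂‖ * E + ‖u₁ - u₂‖ ^ 2 * wt u₂) ≤
          M * (τ * (4 * (1 + 16 * M) * Γ) + (τ * (2 * δ)) * (16 * wt u)) := by
          have : ‖u₁ - u₂‖ ^ 2 ≤ τ * (2 * δ) := by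
            rw [pow_two]
            exact mul_le_mul hu (hu.trans hτ) (norm_nonneg _) hτ0
          gcongr
      _ = M * τ * (4 * (1 + 16 * M) * Γ + 32 * (δ * wt u)) := by ring
      _ ≤ M * τ * (4 * (1 + 16 * M) * Γ + 32 * Γ) := by gcongr
      _ = _ := by ring
  -- From g ≤ M w one gets g² ≤ M w g, so g itself is at most a multiple of √(w g).
  have c2 : g u₂ ≤ (M + 1) * (4 * (1 + 16 * M)) * Γ := by
    have h3 : g u₂ ≤ (M + 1) * E := by
      refine abs_le_of_sq_le_sq' ?_ (by positivity) |>.2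
      have h4 : g u₂ ^ 2 ≤ M * E ^ 2 := by
        rw [hEsq]
        nlinarith [hg.le u₂, hg.nonneg u₂]
      nlinarith [mul_nonneg hM (sq_nonneg E), mul_nonneg (mul_nonneg hM hM) (sq_nonneg E), sq_nonneg E]
    calc _ ≤ (M + 1) * E := h3
      _ ≤ (M + 1) * (4 * (1 + 16 * M) * Γ) := by gcongr
      _ = _ := by ring
  have c3 : ∀ a b : Vel, ‖a - b‖ ≤ τ → |g a - g b| ≤ M * (2 + M) * τ := by
    intro a b hab
    have h := hg.lip b (a - b) (by linarith)
    rw [add_sub_cancel] at h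
    have h3 : √(wt b * g b) ≤ 1 + M := by
      refine Real.sqrt_le_iff.2 ⟨by positivity, ?_⟩
      have h4 : wt b * g b ≤ 1 * M :=
        mul_le_mul (wt_le_one b) (hg.le_const b) (hg.nonneg b) zero_le_one
      nlinarith
    have hτ1 : τ ≤ 1 := by linarith
    have hwb := wt_le_one b
    have hwb' := wt_pos b
    refine h.trans ?_
    have h5 : ‖a - b‖ ^ 2 ≤ τ * 1 := by
      rw [pow_two]
      exact mul_le_mul hab (hab.trans hτ1) (norm_nonneg _) hτ0
    calc _ ≤ M * (τ * (1 + M) + τ * 1 * 1) := by gcongr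
      _ = _ := by ring
  have n1 := hg.nonneg p₁
  have n2 := hg.nonneg q₁
  have m1 := hg.le_const p₁
  have m2 := hg.le_const q₁
  have e1 : g u₁ * (1 + g p₁ + g q₁) - g u₂ * (1 + g p₂ + g q₂) =
      (g u₁ - g u₂) * (1 + g p₁ + g q₁) + g u₂ * ((g p₁ - g p₂) + (g q₁ - g q₂)) := by ring
  rw [e1]
  refine (abs_add_le _ _).trans ?_
  rw [abs_mul, abs_mul, abs_of_nonneg (hg.nonneg u₂), abs_of_nonneg (by linarith : 0 ≤ 1 + g p₁ + g q₁)]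
  have d1 : |g u₁ - g u₂| * (1 + g p₁ + g q₁) ≤
      M * (4 * (1 + 16 * M) + 32) * τ * Γ * (1 + 2 * M) :=
    mul_le_mul c1 (by linarith) (by linarith) (by positivity)
  have d2 : g u₂ * |(g p₁ - g p₂) + (g q₁ - g q₂)| ≤
      (M + 1) * (4 * (1 + 16 * M)) * Γ * (2 * (M * (2 + M) * τ)) := by
    refine mul_le_mul c2 ((abs_add_le _ _).trans ?_) (abs_nonneg _) (by positivity)
    linarith [c3 _ _ hp, c3 _ _ hq]
  calc _ ≤ _ := add_le_add d1 d2
    _ = _ := by unfold lipConst; ring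

/-- The normalized indicator of the ball of radius `2δ`. -/
def bump (δ : ℝ) (v : Vel) : ℝ := if ‖v‖ ≤ 2 * δ then (δ⁻¹) ^ 3 else 0

lemma isKernel_bump (hδ : 0 < δ) : IsKernel (bump δ) (2 * δ) where
  meas := Measurable.ite (measurableSet_le measurable_norm measurable_const) measurable_const
    measurable_const
  nonneg v := by unfold bump; split_ifs <;> positivity
  bdd := ⟨(δ⁻¹) ^ 3, fun v => by unfold bump; split_ifs <;> [exact le_rfl; positivity]⟩
  supp v hv := by simp [bump, hv]

lemma integral_bump (hδ : 0 < δ) :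
    ∫ v, bump δ v = 8 * (volume (Metric.closedBall (0 : Vel) 1)).toReal := by
  have h1 : bump δ = (Metric.closedBall (0 : Vel) (2 * δ)).indicator fun _ => (δ⁻¹) ^ 3 := by
    funext v
    by_cases hv : ‖v‖ ≤ 2 * δ <;> simp [bump, hv]
  rw [h1, integral_indicator Metric.isClosed_closedBall.measurableSet, setIntegral_const,
    measureReal_def, Measure.addHaar_closedBall' volume (0 : Vel) (by positivity : 0 ≤ 2 * δ),
    ENNReal.toReal_mul, ENNReal.toReal_ofReal (by positivity)]
  simp only [finrank_euclideanSpace, Fintype.card_fin, smul_eq_mul]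
  field_simp
  norm_num

/-- The local average of `|h|` at scale `δ`. -/
def localAvg (h : Vel → ℝ) (δ : ℝ) : Vel → ℝ := avg (bump δ) fun w => |h w|

lemma localAvg_nonneg (hδ : 0 < δ) (v : Vel) : 0 ≤ localAvg h δ v :=
  (isKernel_bump hδ).avg_nonneg (fun _ => abs_nonneg _) v

lemma abs_integral_le_localAvg (hδ : 0 < δ) (hh : LocallyIntegrable h) {c : ℝ} (v : Vel)
    {F : Vel → ℝ} (hF : ∀ w, ‖w - v‖ ≤ 2 * δ → |F w| ≤ c * (δ⁻¹) ^ 3 * |h w|)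
    (hF0 : ∀ w, 2 * δ < ‖w - v‖ → F w = 0) : |∫ w, F w| ≤ c * localAvg h δ v := by
  have hha : LocallyIntegrable (fun w => |h w|) :=
    hh.mono hh.aestronglyMeasurable.norm (Eventually.of_forall fun w => by simp)
  rw [localAvg, avg, ← integral_const_mul, ← Real.norm_eq_abs]
  refine norm_integral_le_of_norm_le (((isKernel_bump hδ).integrable_mul hha v).const_mul _)
    (Eventually.of_forall fun w => ?_)
  rcases le_or_gt ‖w - v‖ (2 * δ) with h1 | h1
  · refine (hF w h1).trans_eq ?_
    simp only [bump, h1, if_true]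
    ring
  · rw [hF0 w h1, bump, if_neg (not_le.2 h1)]
    simp

/-- The commutator of mollification and multiplication by the loss rate. -/
def commutator (κ g h : Vel → ℝ) (p : (Vel × Sph) × Vel) : ℝ :=
  rateAvg κ g h p - lossRate g p.2 p.1 * avg κ h p.2

lemma IsRegular.commutator_eq {κ : Vel → ℝ} {r : ℝ} (hκ : IsKernel κ r)
    (hg : IsRegular M g) (hh : LocallyIntegrable h) (p : (Vel × Sph) × Vel) :
    Integrable (fun w => κ (w - p.2) * ((lossRate g w p.1 - lossRate g p.2 p.1) * h w)) ∧
    commutator κ g h p = ∫ w, κ (w - p.2) * ((lossRate g w p.1 - lossRate g p.2 p.1) * h w) := by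
  have i1 := hg.integrable_kernel_loss hκ hh p.2 p.1
  have i2 := (hκ.integrable_mul hh p.2).const_mul (lossRate g p.2 p.1)
  have e : ∀ w, κ (w - p.2) * ((lossRate g w p.1 - lossRate g p.2 p.1) * h w) =
      κ (w - p.2) * (lossRate g w p.1 * h w) - lossRate g p.2 p.1 * (κ (w - p.2) * h w) :=
    fun w => by ring
  refine ⟨(i1.sub i2).congr (Eventually.of_forall fun w => (e w).symm), ?_⟩
  simp only [e]
  rw [integral_sub i1 i2, integral_const_mul]
  rfl

lemma IsRegular.abs_lossRate_sub_le (hg : IsRegular M g) (hδ : 0 < δ) (hδ1 : δ ≤ 1 / 8)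
    {v w : Vel} (hvw : ‖w - v‖ ≤ 2 * δ) (x : Vel × Sph) :
    |lossRate g w x - lossRate g v x| ≤ lipConst M * (2 * δ) * modulus g δ (v - x.1) := by
  unfold lossRate
  refine hg.abs_product_sub_le hδ hδ1 (by positivity) le_rfl ?_ ?_ ?_ ?_
  · simp; positivity
  · rwa [show w - x.1 - (v - x.1) = w - v by module]
  · rwa [show w - x.1 - dev x - (v - x.1 - dev x) = w - v by module]
  · rwa [show w + dev x - (v + dev x) = w - v by module]

lemma IsMollifier.abs_commutator_le (hρ : IsMollifier ρ) {B : ℝ} (hB : ∀ v, ρ v ≤ B)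
    (hg : IsRegular M g) (hh : LocallyIntegrable h) (hδ : 0 < δ) (hδ1 : δ ≤ 1 / 8)
    (p : (Vel × Sph) × Vel) :
    |commutator (scaled ρ δ) g h p| ≤
      6 * (B * lipConst M) * δ * modulus g δ (p.2 - p.1.1) * localAvg h δ p.2 := by
  have hκ := hρ.isKernel_scaled hδ
  have hB0 : 0 ≤ B := (hρ.nonneg 0).trans (hB 0)
  have hL := lipConst_nonneg hg.const_nonneg
  have hΓ := modulus_nonneg (g := g) hδ (p.2 - p.1.1)
  rw [(hg.commutator_eq hκ hh p).2]
  refine abs_integral_le_localAvg hδ hh p.2 (fun w hw => ?_) fun w hw => ?_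
  · rw [abs_mul, abs_mul, abs_of_nonneg (hκ.nonneg _), ← mul_assoc]
    refine mul_le_mul_of_nonneg_right ?_ (abs_nonneg _)
    calc _ ≤ (B * (δ⁻¹) ^ 3) * (lipConst M * (2 * δ) * modulus g δ (p.2 - p.1.1)) :=
          mul_le_mul (scaled_le hB hδ _) (hg.abs_lossRate_sub_le hδ hδ1 hw p.1) (abs_nonneg _)
            (by positivity)
      _ = 2 * (B * lipConst M * δ * modulus g δ (p.2 - p.1.1) * (δ⁻¹) ^ 3) := by ring
      _ ≤ 6 * (B * lipConst M * δ * modulus g δ (p.2 - p.1.1) * (δ⁻¹) ^ 3) := by gcongr; norm_num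
      _ = _ := by ring
  · rw [hκ.supp _ (by linarith), zero_mul]

/-- For |a| ≤ δ the exchange of velocities moves the centre of the mollifier by a and every argument
of the rates by at most 2|a|, so the commutator changes by O(|a|) instead of O(δ). The averaging
radius 2δ covers both mollifier supports. The 6 is 2 from moving the kernel plus 4 from moving the
rates. -/
lemma IsMollifier.abs_commutator_sub_le (hρ : IsMollifier ρ) {B : ℝ} (hB : ∀ v, ρ v ≤ B)
    (hB' : ∀ v w, |ρ v - ρ w| ≤ B * ‖v - w‖)
    (hg : IsRegular M g) (hh : LocallyIntegrable h) (hδ : 0 < δ) (hδ1 : δ ≤ 1 / 8)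
    {p : (Vel × Sph) × Vel} (hp : p.1.1 ≠ 0) (ha : ‖dev p.1‖ ≤ δ) :
    |commutator (scaled ρ δ) g h p - commutator (scaled ρ δ) g h (swapMap p)| ≤
      6 * (B * lipConst M) * ‖dev p.1‖ * modulus g δ (p.2 - p.1.1) * localAvg h δ p.2 := by
  have hκ := hρ.isKernel_scaled hδ
  have hB0 : 0 ≤ B := (hρ.nonneg 0).trans (hB 0)
  have hL := lipConst_nonneg hg.const_nonneg
  set Γ := modulus g δ (p.2 - p.1.1)
  have hΓ : 0 ≤ Γ := modulus_nonneg hδ _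
  set a := dev p.1
  set v := p.2
  obtain ⟨i1, e1⟩ := hg.commutator_eq hκ hh p
  obtain ⟨i2, e2⟩ := hg.commutator_eq hκ hh (swapMap p)
  rw [e1, e2, ← integral_sub i1 i2]
  have hsw : (swapMap p).2 = v + a := rfl
  have hsx : (swapMap p).1 = flip p.1 := rfl
  rw [hsw, hsx]
  refine abs_integral_le_localAvg hδ hh p.2 (fun w hw => ?_) fun w hw => ?_
  · set k1 := scaled ρ δ (w - v)
    set k2 := scaled ρ δ (w - (v + a))
    set D1 := lossRate g w p.1 - lossRate g v p.1
    set D2 := lossRate g w (flip p.1) - lossRate g (v + a) (flip p.1)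
    have hk2 : 0 ≤ k2 := hκ.nonneg _
    have hk2' : k2 ≤ B * (δ⁻¹) ^ 3 := scaled_le hB hδ _
    have hk12 : |k1 - k2| ≤ B * (δ⁻¹) ^ 4 * ‖a‖ := by
      have := scaled_lipschitz hB' hδ (w - v) (w - (v + a))
      rwa [show w - v - (w - (v + a)) = a by module] at this
    have hD1 : |D1| ≤ lipConst M * (2 * δ) * Γ := hg.abs_lossRate_sub_le hδ hδ1 hw p.1
    have hD3 : |lossRate g w p.1 - lossRate g w (flip p.1)| ≤ lipConst M * (2 * ‖a‖) * Γ := by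
      have e3 : lossRate g w (flip p.1) =
          g (w - p.1.1 - (2 : ℝ) • a) * (1 + g (w - p.1.1 - a) + g (w - a)) := by
        simp only [lossRate, flip_fst, dev_flip hp]
        rw [show w - (p.1.1 + (2 : ℝ) • dev p.1) = w - p.1.1 - (2 : ℝ) • a by module,
          show w - p.1.1 - (2 : ℝ) • a - -dev p.1 = w - p.1.1 - a by module,
          ← sub_eq_add_neg]
      have n2 : ‖(2 : ℝ) • a‖ = 2 * ‖a‖ := by rw [norm_smul]; norm_num
      rw [e3]
      unfold lossRate
      refine hg.abs_product_sub_le hδ hδ1 (by positivity) (by linarith) ?_ ?_ ?_ ?_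
      · rw [show w - p.1.1 - (2 : ℝ) • a - (p.2 - p.1.1) = (w - v) - (2 : ℝ) • a by module]
        refine (norm_sub_le _ _).trans ?_
        rw [n2]
        linarith
      · rw [sub_sub_cancel, n2]
      · rw [sub_self, norm_zero]; positivity
      · rw [show w + dev p.1 - (w - a) = (2 : ℝ) • a by module, n2]
    have hD4 : |lossRate g v p.1 - lossRate g (v + a) (flip p.1)| ≤
        lipConst M * (2 * ‖a‖) * Γ := by
      rw [lossRate_swap hp]
      have e3 : gainRate g v p.1 = g (v - p.1.1 - a) * (1 + g (v - p.1.1) + g v) := rfl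
      rw [e3]
      unfold lossRate
      have na : ‖a‖ ≤ 2 * ‖a‖ := by linarith [norm_nonneg a]
      refine hg.abs_product_sub_le hδ hδ1 (by positivity) (by linarith) ?_ ?_ ?_ ?_
      · rw [show v - p.1.1 - a - (p.2 - p.1.1) = -a by module, norm_neg]
        linarith
      · rwa [sub_sub_cancel]
      · rwa [show v - p.1.1 - dev p.1 - (v - p.1.1) = -a by module, norm_neg]
      · rwa [add_sub_cancel_left]
    -- Regrouped so that each bracket compares the rates before and after the exchange, at w and at
    -- the centre, rather than at w against the centre.
    have hD12 : |D1 - D2| ≤ 4 * (lipConst M * ‖a‖ * Γ) := by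
      have : D1 - D2 = (lossRate g w p.1 - lossRate g w (flip p.1)) -
          (lossRate g v p.1 - lossRate g (v + a) (flip p.1)) := by simp only [D1, D2]; ring
      rw [this]
      refine (abs_sub _ _).trans ?_
      linarith
    have e4 : k1 * (D1 * h w) - k2 * (D2 * h w) = ((k1 - k2) * D1 + k2 * (D1 - D2)) * h w := by ring
    rw [e4, abs_mul]
    refine mul_le_mul_of_nonneg_right ((abs_add_le _ _).trans ?_) (abs_nonneg _)
    rw [abs_mul, abs_mul, abs_of_nonneg hk2]
    calc _ ≤ (B * (δ⁻¹) ^ 4 * ‖a‖) * (lipConst M * (2 * δ) * Γ) +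
          (B * (δ⁻¹) ^ 3) * (4 * (lipConst M * ‖a‖ * Γ)) := by gcongr
      _ = _ := by field_simp; ring
  · have h1 : δ < ‖w - (v + a)‖ := by
      have := norm_add_le (w - (v + a)) a
      rw [show w - (v + a) + a = w - v by module] at this
      linarith
    rw [hκ.supp _ (by linarith), hκ.supp _ h1]
    ring

lemma IsMollifier.abs_avg_sub_le (hρ : IsMollifier ρ) {B : ℝ}
    (hB' : ∀ v w, |ρ v - ρ w| ≤ B * ‖v - w‖) (hh : LocallyIntegrable h) (hδ : 0 < δ) {v a : Vel}
    (ha : ‖a‖ ≤ δ) :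
    |avg (scaled ρ δ) h (v + a) - avg (scaled ρ δ) h v| ≤ B * δ⁻¹ * ‖a‖ * localAvg h δ v := by
  have hκ := hρ.isKernel_scaled hδ
  simp only [avg]
  rw [← integral_sub (hκ.integrable_mul hh _) (hκ.integrable_mul hh _)]
  refine abs_integral_le_localAvg hδ hh v (fun w hw => ?_) fun w hw => ?_
  · rw [← sub_mul, abs_mul]
    refine mul_le_mul_of_nonneg_right ?_ (abs_nonneg _)
    have := scaled_lipschitz hB' hδ (w - (v + a)) (w - v)
    rw [show w - (v + a) - (w - v) = -a by module, norm_neg] at this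
    exact this.trans_eq (by ring)
  · have h1 : δ < ‖w - (v + a)‖ := by
      have := norm_add_le (w - (v + a)) a
      rw [show w - (v + a) + a = w - v by module] at this
      linarith
    have h2 : δ < ‖w - v‖ := by linarith
    rw [hκ.supp _ h2, hκ.supp _ h1]
    ring

end

end QuantumBoltzmann

namespace QuantumBoltzmann

noncomputable section

variable {C γ s ε M δ : ℝ} {g h ρ : Vel → ℝ}

/-! ### Lower bound for the mollified form -/

/-- The convexity inequality for the negative part leaves a spare m(f' - f)²/2. Half of it absorbs
the part of V of size √(w m); the part of size δ w is paid for by the bound on δ|f' - f|. Both leave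
errors quadratic in μ, which stands for min(|a|, δ). -/
lemma form_pointwise {m w η μ δ u f f' V H B c Γ : ℝ} (hm : 0 ≤ m) (hw : 0 ≤ w) (hμ : 0 ≤ μ)
    (hc : 0 ≤ c) (hH : 0 ≤ H) (hB : 0 ≤ B) (hf : f = max (-(u + η)) 0) (hf' : 0 ≤ f')
    (hΓ : Γ ≤ √(w * m) + δ * w) (hV : |V| ≤ c * μ * Γ * H)
    (hD : δ * |f' - f| ≤ μ * (B * H + f + f')) :
    m * ((f ^ 2 / 2 + η * f) - (f' ^ 2 / 2 + η * f')) -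
        (c ^ 2 + c * (B + 1)) * (μ ^ 2 * w * (H ^ 2 + f ^ 2 + f' ^ 2)) ≤
      (m * u + V) * (f' - f) := by
  -- With f = (u + η)_-, the right side is -f(f' - f) where u + η < 0 and is nonnegative elsewhere
  -- because then f = 0. The shift by η later accounts for the linear term η f.
  have h1 : (f' - f) ^ 2 / 2 + (f ^ 2 - f' ^ 2) / 2 ≤ (u + η) * (f' - f) := by
    rcases le_or_gt 0 (u + η) with h | h
    · have : f = 0 := by rw [hf]; exact max_eq_right (by linarith)
      rw [this]
      nlinarith
    · have : u + η = -f := by rw [hf, max_eq_left (by linarith)]; ring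
      rw [this]
      nlinarith
  have h2 := mul_le_mul_of_nonneg_left h1 hm
  have hf0 : 0 ≤ f := by rw [hf]; exact le_max_right _ _
  set D := |f' - f| with hDdef
  have hD0 : 0 ≤ D := abs_nonneg _
  have hDsq : D ^ 2 = (f' - f) ^ 2 := sq_abs _
  have h3 : |V * (f' - f)| ≤ c * μ * (√(w * m) + δ * w) * H * D := by
    rw [abs_mul]
    refine mul_le_mul_of_nonneg_right (hV.trans ?_) hD0
    gcongr
  -- Young's inequality in the form of the square of √m D/2 - c μ √w H.
  have h4 : c * μ * √(w * m) * H * D ≤ m * D ^ 2 / 4 + c ^ 2 * (μ ^ 2 * w * H ^ 2) := by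
    rw [Real.sqrt_mul hw]
    have := sq_nonneg (√m * D / 2 - c * μ * √w * H)
    have e1 := Real.sq_sqrt hm
    have e2 := Real.sq_sqrt hw
    have e3 : (√m * D / 2 - c * μ * √w * H) ^ 2 =
        √m ^ 2 * D ^ 2 / 4 - c * μ * (√w * √m) * H * D + c ^ 2 * (μ ^ 2 * √w ^ 2 * H ^ 2) := by ring
    rw [e1, e2] at e3
    linarith
  -- The factor δ in the modulus combines with D, and `hD` trades δ D for a second factor μ.
  have h5 : c * μ * (δ * w) * H * D ≤ c * (B + 1) * (μ ^ 2 * w * (H ^ 2 + f ^ 2 + f' ^ 2)) := by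
    have e1 : H * (B * H + f + f') ≤ (B + 1) * (H ^ 2 + f ^ 2 + f' ^ 2) := by
      nlinarith [sq_nonneg (H - f), sq_nonneg (H - f'), mul_nonneg hB (sq_nonneg f),
        mul_nonneg hB (sq_nonneg f'), sq_nonneg f, sq_nonneg f']
    calc c * μ * (δ * w) * H * D = c * μ * w * H * (δ * D) := by ring
      _ ≤ c * μ * w * H * (μ * (B * H + f + f')) := by gcongr
      _ = c * (μ ^ 2 * w) * (H * (B * H + f + f')) := by ring
      _ ≤ c * (μ ^ 2 * w) * ((B + 1) * (H ^ 2 + f ^ 2 + f' ^ 2)) := by gcongr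
      _ = _ := by ring
  have h6 : -(c * μ * (√(w * m) + δ * w) * H * D) ≤ V * (f' - f) := by
    have := neg_abs_le (V * (f' - f))
    linarith
  have h7 : 0 ≤ c ^ 2 * (μ ^ 2 * w * (f ^ 2 + f' ^ 2)) := by positivity
  have h8 : 0 ≤ m * D ^ 2 := by positivity
  rw [hDsq] at h4 h8
  nlinarith

lemma IsKernelParam.integrable_loss_diff (hp : IsKernelParam C γ s) (hε : 0 < ε)
    (hg : IsRegular M g) {P : Vel → ℝ} (hP : Integrable P) (hP0 : ∀ v, 0 ≤ P v) :
    Integrable (fun p => lossRate g p.2 p.1 * (P p.2 - P (p.2 + dev p.1)))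
      (pairMeasure C γ s ε) := by
  have hM := hg.const_nonneg
  have ml := measurable_lossRate_pair hg.cont.measurable
  refine hp.integrable_pair hε (hP.const_mul (M * (1 + 2 * M))) (hP.const_mul (M * (1 + 2 * M)))
    (ml.aestronglyMeasurable.mul (hP.aestronglyMeasurable.comp_snd.sub
      (aestronglyMeasurable_comp_add_dev hP.aestronglyMeasurable))) fun p => ?_
  have h1 := hg.lossRate_le p.2 p.1
  have h2 : |P p.2 - P (p.2 + dev p.1)| ≤ P p.2 + P (p.2 + dev p.1) := by
    rw [abs_le]; constructor <;> linarith [hP0 p.2, hP0 (p.2 + dev p.1)]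
  rw [abs_mul, abs_of_nonneg (lossRate_nonneg hg.nonneg _ _)]
  calc _ ≤ M * (1 + 2 * M) * wt (p.2 - p.1.1) * (P p.2 + P (p.2 + dev p.1)) :=
        mul_le_mul h1 h2 (abs_nonneg _) (mul_nonneg (by positivity) (wt_pos _).le)
    _ = _ := by ring

/-- Exchanging velocities in the term with P(v') replaces loss by gain at P(v). The cancellation
lemma then bounds the inner integral for each v, and P ≥ 0 preserves the inequality. -/
lemma IsKernelParam.exists_loss_diff_bound (hp : IsKernelParam C γ s) (M : ℝ) : ∃ K : ℝ, 0 < K ∧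
    ∀ (ε : ℝ) (g P : Vel → ℝ), 0 < ε → IsRegular M g → Integrable P → (∀ v, 0 ≤ P v) →
      -(K * ∫ v, P v) ≤ ∫ p, lossRate g p.2 p.1 * (P p.2 - P (p.2 + dev p.1))
        ∂(pairMeasure C γ s ε) := by
  obtain ⟨K, hK, hb⟩ := exists_cancellation_bound hp.C_pos hp.neg_three_lt hp.gamma_neg hp.s_pos
    hp.s_lt_one hp.soft M
  refine ⟨K, hK, fun ε g P hε hg hP hP0 => ?_⟩
  have hM := hg.const_nonneg
  have ml := measurable_lossRate_pair hg.cont.measurable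
  have i1 : Integrable (fun p => lossRate g p.2 p.1 * P p.2) (pairMeasure C γ s ε) := by
    refine hp.integrable_pair hε (Q := fun _ => 0) (hP.const_mul (M * (1 + 2 * M)))
      (integrable_zero _ _ _) (ml.aestronglyMeasurable.mul hP.aestronglyMeasurable.comp_snd)
      fun p => ?_
    rw [abs_of_nonneg (mul_nonneg (lossRate_nonneg hg.nonneg _ _) (hP0 _)), add_zero]
    calc _ ≤ M * (1 + 2 * M) * wt (p.2 - p.1.1) * P p.2 :=
          mul_le_mul_of_nonneg_right (hg.lossRate_le _ _) (hP0 _)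
      _ = _ := by ring
  have i2 : Integrable (fun p => lossRate g p.2 p.1 * P (p.2 + dev p.1)) (pairMeasure C γ s ε) := by
    refine (i1.sub (hp.integrable_loss_diff hε hg hP hP0)).congr (Eventually.of_forall fun p => ?_)
    simp only [Pi.sub_apply]
    ring
  have e2 : (fun p => gainRate g p.2 p.1 * P p.2) =ᵐ[pairMeasure C γ s ε]
      fun p => lossRate g (swapMap p).2 (swapMap p).1 * P ((swapMap p).2 + dev (swapMap p).1) := by
    filter_upwards [ae_pairMeasure] with p hp0
    simp only [swapMap]
    rw [lossRate_swap hp0, dev_flip hp0, add_neg_cancel_right]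
  have i3 : Integrable (fun p => gainRate g p.2 p.1 * P p.2) (pairMeasure C γ s ε) :=
    (measurePreserving_swapMap.integrable_comp_of_integrable i2).congr e2.symm
  have e3 : ∫ p, gainRate g p.2 p.1 * P p.2 ∂(pairMeasure C γ s ε) =
      ∫ p, lossRate g p.2 p.1 * P (p.2 + dev p.1) ∂(pairMeasure C γ s ε) := by
    rw [integral_congr_ae e2]
    exact integral_comp_measurePreserving measurePreserving_swapMap i2.aestronglyMeasurable
  have i4 : Integrable (fun p => (lossRate g p.2 p.1 - gainRate g p.2 p.1) * P p.2)
      (pairMeasure C γ s ε) := by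
    refine (i1.sub i3).congr (Eventually.of_forall fun p => ?_)
    simp only [Pi.sub_apply]
    ring
  have e4 : ∫ p, lossRate g p.2 p.1 * (P p.2 - P (p.2 + dev p.1)) ∂(pairMeasure C γ s ε) =
      ∫ p, (lossRate g p.2 p.1 - gainRate g p.2 p.1) * P p.2 ∂(pairMeasure C γ s ε) := by
    simp only [mul_sub, sub_mul]
    rw [integral_sub i1 i2, integral_sub i1 i3, e3]
  rw [e4, integral_prod_symm _ i4, ← integral_const_mul, ← integral_neg]
  refine integral_mono (hP.const_mul K).neg i4.integral_prod_right fun v => ?_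
  simp only
  rw [integral_mul_const, ← neg_mul]
  exact mul_le_mul_of_nonneg_right (abs_le.1 (hb ε g v hε hg)).1 (hP0 v)

lemma max_neg_add_lipschitz (x y η : ℝ) : |max (-(x + η)) 0 - max (-(y + η)) 0| ≤ |x - y| := by
  refine (abs_max_sub_max_le_abs _ _ _).trans_eq ?_
  rw [show -(x + η) - -(y + η) = -(x - y) by ring, abs_neg]

/-- The negative part of `u + η`. -/
def negPart (η : ℝ) (u : Vel → ℝ) (v : Vel) : ℝ := max (-(u v + η)) 0

lemma negPart_nonneg (η : ℝ) (u : Vel → ℝ) (v : Vel) : 0 ≤ negPart η u v := le_max_right _ _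

/-- Half the difference of the commutator and its image under `swapMap` for small deviations, and
the commutator itself for large ones. -/
def symCommutator (κ g h : Vel → ℝ) (δ : ℝ) (p : (Vel × Sph) × Vel) : ℝ :=
  if ‖dev p.1‖ ≤ δ then (commutator κ g h p - commutator κ g h (swapMap p)) / 2
  else commutator κ g h p

lemma IsMollifier.abs_symCommutator_le (hρ : IsMollifier ρ) {B : ℝ} (hB : ∀ v, ρ v ≤ B)
    (hB' : ∀ v w, |ρ v - ρ w| ≤ B * ‖v - w‖)
    (hg : IsRegular M g) (hh : LocallyIntegrable h) (hδ : 0 < δ) (hδ1 : δ ≤ 1 / 8)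
    {p : (Vel × Sph) × Vel} (hp : p.1.1 ≠ 0) :
    |symCommutator (scaled ρ δ) g h δ p| ≤
      6 * (B * lipConst M) * min ‖dev p.1‖ δ * modulus g δ (p.2 - p.1.1) * localAvg h δ p.2 := by
  unfold symCommutator
  split_ifs with ha
  · rw [min_eq_left ha, abs_div, abs_two]
    have h1 := hρ.abs_commutator_sub_le hB hB' hg hh hδ hδ1 hp ha
    have h2 := abs_nonneg (commutator (scaled ρ δ) g h p - commutator (scaled ρ δ) g h (swapMap p))
    linarith
  · rw [min_eq_right (not_le.1 ha).le]
    exact hρ.abs_commutator_le hB hg hh hδ hδ1 p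

/-- The exchange preserves the set |a| ≤ δ and changes the sign of f' - f. On that set the
commutator may therefore be replaced by half the difference with its image; outside it no
symmetrization is needed. -/
lemma IsKernelParam.integral_rateAvg_eq (hp : IsKernelParam C γ s) (hε : 0 < ε)
    (hg : IsRegular M g) (hh : Measurable h) (hh2 : MemLp h 2) {κ : Vel → ℝ} {r : ℝ}
    (hκ : IsKernel κ r) (hr : r ≤ 1) (hu : Measurable (avg κ h)) {f : Vel → ℝ} (hf : MemLp f 2) :
    Integrable (fun p => (lossRate g p.2 p.1 * avg κ h p.2 + symCommutator κ g h δ p) *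
      (f (p.2 + dev p.1) - f p.2)) (pairMeasure C γ s ε) ∧
    ∫ p, rateAvg κ g h p * (f (p.2 + dev p.1) - f p.2) ∂(pairMeasure C γ s ε) =
      ∫ p, (lossRate g p.2 p.1 * avg κ h p.2 + symCommutator κ g h δ p) *
        (f (p.2 + dev p.1) - f p.2) ∂(pairMeasure C γ s ε) := by
  have hgm := hg.cont.measurable
  have hM := hg.const_nonneg
  have hl : LocallyIntegrable h := hh2.locallyIntegrable (by norm_num)
  have ml := measurable_lossRate_pair hgm
  have mr := measurable_rateAvg hκ.meas hgm hh
  have md := measurable_dev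
  have mc : Measurable (commutator κ g h) := by
    unfold commutator; fun_prop
  set D : (Vel × Sph) × Vel → ℝ := fun p => f (p.2 + dev p.1) - f p.2 with hD
  have h1 : ∀ p : (Vel × Sph) × Vel, |rateAvg κ g h p| ≤
      16 * (M * (1 + 2 * M)) * wt (p.2 - p.1.1) * |avg κ (fun w => |h w|) p.2| := fun p =>
    (hg.abs_rateAvg_le hκ hr hl p).trans (mul_le_mul_of_nonneg_left (le_abs_self _)
      (mul_nonneg (by positivity) (wt_pos _).le))
  have i1 := hp.integrable_mul_diff hε (E := rateAvg κ g h)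
    (hκ.memLp_avg (h := fun w => |h w|) hh2.norm) hf mr.aestronglyMeasurable h1
  have i2 := hp.integrable_mul_diff hε (E := fun p => lossRate g p.2 p.1 * avg κ h p.2)
    (c := M * (1 + 2 * M)) (hκ.memLp_avg hh2) hf (by fun_prop) fun p => by
      rw [abs_mul, abs_of_nonneg (lossRate_nonneg hg.nonneg _ _)]
      exact mul_le_mul_of_nonneg_right (hg.lossRate_le _ _) (abs_nonneg _)
  have i3 : Integrable (fun p => commutator κ g h p * D p) (pairMeasure C γ s ε) := by
    refine (i1.sub i2).congr (Eventually.of_forall fun p => ?_)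
    simp only [Pi.sub_apply, commutator, D]
    ring
  set A : Set ((Vel × Sph) × Vel) := {p | ‖dev p.1‖ ≤ δ}
  have hA : MeasurableSet A := measurableSet_le (by fun_prop) measurable_const
  have i4 : Integrable (A.indicator fun p => commutator κ g h p * D p) (pairMeasure C γ s ε) :=
    i3.indicator hA
  have i5 : Integrable (fun p => A.indicator (fun p => commutator κ g h p * D p) (swapMap p))
      (pairMeasure C γ s ε) := measurePreserving_swapMap.integrable_comp_of_integrable i4
  have e5 : ∫ p, A.indicator (fun p => commutator κ g h p * D p) (swapMap p)
      ∂(pairMeasure C γ s ε) = ∫ p, A.indicator (fun p => commutator κ g h p * D p) p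
      ∂(pairMeasure C γ s ε) :=
    integral_comp_measurePreserving measurePreserving_swapMap i4.aestronglyMeasurable
  have key : (fun p => (lossRate g p.2 p.1 * avg κ h p.2 + symCommutator κ g h δ p) * D p)
      =ᵐ[pairMeasure C γ s ε] fun p => rateAvg κ g h p * D p +
        (A.indicator (fun p => commutator κ g h p * D p) (swapMap p) / 2 -
          A.indicator (fun p => commutator κ g h p * D p) p / 2) := by
    filter_upwards [ae_pairMeasure] with p hp0
    have hDs : D (swapMap p) = -D p := by
      simp only [D, swapMap]
      rw [dev_flip hp0, add_neg_cancel_right]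
      ring
    by_cases ha : ‖dev p.1‖ ≤ δ
    · have ha' : swapMap p ∈ A := by
        simp only [A, swapMap, mem_ofPred_eq, dev_flip hp0, norm_neg, ha]
      rw [indicator_of_mem ha', indicator_of_mem (show p ∈ A from ha), hDs]
      simp only [symCommutator, ha, if_true, commutator]
      ring
    · have ha' : swapMap p ∉ A := by
        simp only [A, swapMap, mem_ofPred_eq, dev_flip hp0, norm_neg, ha, not_false_eq_true]
      rw [indicator_of_notMem ha', indicator_of_notMem (show p ∉ A from ha)]
      simp only [symCommutator, ha, if_false, commutator]
      ring
  have i6 : Integrable (fun p => A.indicator (fun p => commutator κ g h p * D p) (swapMap p) / 2 -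
      A.indicator (fun p => commutator κ g h p * D p) p / 2) (pairMeasure C γ s ε) :=
    (i5.div_const 2).sub (i4.div_const 2)
  refine ⟨(i1.add i6).congr key.symm, ?_⟩
  rw [integral_congr_ae key, integral_add i1 i6,
    integral_sub (i5.div_const 2) (i4.div_const 2), integral_div, integral_div, e5]
  ring

/-- The pointwise inequality integrated: the main term is handled by cancellation, giving K₁, and
the commutator errors by the min(|a|, δ)² bound, giving the factor δ^(2-2s). Neither constant
depends on ε, δ or η. -/
lemma IsKernelParam.exists_form_bound (hp : IsKernelParam C γ s) (M : ℝ) (hρ : IsMollifier ρ) :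
    ∃ K₁ K₂ : ℝ, 0 < K₁ ∧ 0 < K₂ ∧ ∀ (ε δ η : ℝ) (g h : Vel → ℝ), 0 < ε → 0 < δ → δ ≤ 1 / 8 → 0 < η →
      IsRegular M g → Measurable h → MemLp h 2 →
      Integrable (negPart η (avg (scaled ρ δ) h)) → MemLp (negPart η (avg (scaled ρ δ) h)) 2 →
      -(K₁ * ∫ v, (negPart η (avg (scaled ρ δ) h) v ^ 2 / 2 + η * negPart η (avg (scaled ρ δ) h) v))
        - K₂ * δ ^ (2 - 2 * s) * ((∫ v, localAvg h δ v ^ 2) +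
          2 * ∫ v, negPart η (avg (scaled ρ δ) h) v ^ 2) ≤
      ∫ p, rateAvg (scaled ρ δ) g h p * (negPart η (avg (scaled ρ δ) h) (p.2 + dev p.1) -
        negPart η (avg (scaled ρ δ) h) p.2) ∂(pairMeasure C γ s ε) := by
  obtain ⟨K₁, hK₁, hb₁⟩ := hp.exists_loss_diff_bound M
  obtain ⟨Λ, hΛ, hb₂⟩ := hp.exists_min_sq_bound
  obtain ⟨B, hB0, hB, hB'⟩ := hρ.exists_bound
  set c : ℝ := 6 * (B * |lipConst M|)
  have hc : 0 ≤ c := by positivity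
  set k : ℝ := c ^ 2 + c * (B + 1)
  have hk : 0 ≤ k := by positivity
  refine ⟨K₁, k * Λ + 1, hK₁, by positivity, fun ε δ η g h hε hδ hδ1 hη hg hh hh2 hfi hf2 => ?_⟩
  have hL := lipConst_nonneg hg.const_nonneg
  have hl : LocallyIntegrable h := hh2.locallyIntegrable (by norm_num)
  have hκ := hρ.isKernel_scaled hδ
  set u := avg (scaled ρ δ) h
  have hu : Measurable u := (hρ.contDiff_avg hδ hl).continuous.measurable
  set f := negPart η u
  set H := localAvg h δ
  have hH2 : MemLp H 2 := (isKernel_bump hδ).memLp_avg (h := fun w => |h w|) hh2.norm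
  obtain ⟨iV, eV⟩ := hp.integral_rateAvg_eq (δ := δ) hε hg hh hh2 hκ (by linarith) hu hf2
  rw [eV]
  set P : Vel → ℝ := fun v => f v ^ 2 / 2 + η * f v
  have hPi : Integrable P := (hf2.integrable_sq.div_const 2).add (hfi.const_mul η)
  have hP0 : ∀ v, 0 ≤ P v := fun v => by
    have := negPart_nonneg η u v
    positivity
  set Q : Vel → ℝ := fun v => H v ^ 2 + f v ^ 2
  have hQi : Integrable Q := hH2.integrable_sq.add hf2.integrable_sq
  have hQ0 : ∀ v, 0 ≤ Q v := fun v => by positivity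
  have mwt := measurable_wt_pair
  have md := measurable_dev
  have mmin : Measurable fun p : (Vel × Sph) × Vel =>
      min ‖dev p.1‖ δ ^ 2 * wt (p.2 - p.1.1) := by fun_prop
  have hmin0 : ∀ p : (Vel × Sph) × Vel, 0 ≤ min ‖dev p.1‖ δ ^ 2 * wt (p.2 - p.1.1) := fun p =>
    mul_nonneg (sq_nonneg _) (wt_pos _).le
  have j0 := hp.integrable_loss_diff hε hg hPi hP0
  have j1 : Integrable (fun p => min ‖dev p.1‖ δ ^ 2 * wt (p.2 - p.1.1) * Q p.2)
      (pairMeasure C γ s ε) := by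
    refine hp.integrable_pair hε (Q := fun _ => 0) (hQi.const_mul (δ ^ 2)) (integrable_zero _ _ _)
      (mmin.aestronglyMeasurable.mul hQi.aestronglyMeasurable.comp_snd) fun p => ?_
    rw [abs_of_nonneg (mul_nonneg (hmin0 p) (hQ0 _)), add_zero]
    have := wt_pos (p.2 - p.1.1)
    have := hQ0 p.2
    calc _ ≤ δ ^ 2 * wt (p.2 - p.1.1) * Q p.2 := by gcongr; exact min_le_right _ _
      _ = _ := by ring
  have j2 : Integrable (fun p => min ‖dev p.1‖ δ ^ 2 * wt (p.2 - p.1.1) * f (p.2 + dev p.1) ^ 2)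
      (pairMeasure C γ s ε) := by
    refine hp.integrable_pair hε (P := fun _ => 0) (integrable_zero _ _ _)
      (hf2.integrable_sq.const_mul (δ ^ 2))
      (mmin.aestronglyMeasurable.mul
        (aestronglyMeasurable_comp_add_dev hf2.integrable_sq.aestronglyMeasurable)) fun p => ?_
    rw [abs_of_nonneg (mul_nonneg (hmin0 p) (sq_nonneg _)), zero_add]
    have := wt_pos (p.2 - p.1.1)
    calc _ ≤ δ ^ 2 * wt (p.2 - p.1.1) * f (p.2 + dev p.1) ^ 2 := by gcongr; exact min_le_right _ _
      _ = _ := by ring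
  have hmono : ∫ p, (lossRate g p.2 p.1 * (P p.2 - P (p.2 + dev p.1)) -
      (k * (min ‖dev p.1‖ δ ^ 2 * wt (p.2 - p.1.1) * Q p.2) +
        k * (min ‖dev p.1‖ δ ^ 2 * wt (p.2 - p.1.1) * f (p.2 + dev p.1) ^ 2)))
      ∂(pairMeasure C γ s ε) ≤ ∫ p, (lossRate g p.2 p.1 * u p.2 +
        symCommutator (scaled ρ δ) g h δ p) * (f (p.2 + dev p.1) - f p.2)
        ∂(pairMeasure C γ s ε) := by
    refine integral_mono_ae (j0.sub ((j1.const_mul k).add (j2.const_mul k))) iV ?_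
    filter_upwards [ae_pairMeasure] with p hp0
    have hV := hρ.abs_symCommutator_le hB hB' hg hl hδ hδ1 hp0
    rw [← abs_of_nonneg hL] at hV
    have hm0 := lossRate_nonneg hg.nonneg p.2 p.1
    have hΓ : modulus g δ (p.2 - p.1.1) ≤
        √(wt (p.2 - p.1.1) * lossRate g p.2 p.1) + δ * wt (p.2 - p.1.1) := by
      unfold modulus
      gcongr
      · exact (wt_pos _).le
      · exact le_mul_of_one_le_right (hg.nonneg _)
          (by linarith [hg.nonneg (p.2 - p.1.1 - dev p.1), hg.nonneg (p.2 + dev p.1)])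
    have hH0 : 0 ≤ H p.2 := localAvg_nonneg hδ p.2
    have hf0 := negPart_nonneg η u p.2
    have hf0' := negPart_nonneg η u (p.2 + dev p.1)
    -- For |a| ≤ δ the mollified function has Lipschitz constant of order H/δ; for larger a the
    -- trivial bound f + f' suffices.
    have hDf : δ * |f (p.2 + dev p.1) - f p.2| ≤
        min ‖dev p.1‖ δ * (B * H p.2 + f p.2 + f (p.2 + dev p.1)) := by
      rcases le_or_gt ‖dev p.1‖ δ with ha | ha
      · have h1 := hρ.abs_avg_sub_le hB' hl hδ (v := p.2) ha
        have h2 := (max_neg_add_lipschitz (u (p.2 + dev p.1)) (u p.2) η).trans h1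
        rw [min_eq_left ha]
        calc _ ≤ δ * (B * δ⁻¹ * ‖dev p.1‖ * localAvg h δ p.2) := by gcongr; exact h2
          _ = ‖dev p.1‖ * (B * H p.2 + 0 + 0) := by
            simp only [H]
            field_simp
            ring
          _ ≤ _ := by gcongr
      · rw [min_eq_right ha.le]
        refine mul_le_mul_of_nonneg_left ?_ hδ.le
        have : 0 ≤ B * H p.2 := by positivity
        rw [abs_le]
        constructor <;> linarith [hf0, hf0']
    have h := form_pointwise (m := lossRate g p.2 p.1) (w := wt (p.2 - p.1.1)) (η := η)
      (μ := min ‖dev p.1‖ δ) (δ := δ) (u := u p.2) (f := f p.2) (f' := f (p.2 + dev p.1))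
      (V := symCommutator (scaled ρ δ) g h δ p) (H := H p.2) (B := B) (c := c) hm0
      (wt_pos _).le (le_min (norm_nonneg _) hδ.le) hc hH0 hB0.le rfl hf0' hΓ hV hDf
    refine le_trans (le_of_eq ?_) h
    simp only [P, Q, k]
    ring
  refine le_trans ?_ hmono
  have j12 : Integrable (fun p => k * (min ‖dev p.1‖ δ ^ 2 * wt (p.2 - p.1.1) * Q p.2) +
        k * (min ‖dev p.1‖ δ ^ 2 * wt (p.2 - p.1.1) * f (p.2 + dev p.1) ^ 2))
      (pairMeasure C γ s ε) := (j1.const_mul k).add (j2.const_mul k)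
  rw [integral_sub j0 j12, integral_add (j1.const_mul k) (j2.const_mul k), integral_const_mul,
    integral_const_mul]
  have b0 := hb₁ ε g P hε hg hPi hP0
  have b1 := (hb₂ ε δ hε hδ Q hQi hQ0).1
  have b2 := (hb₂ ε δ hε hδ (fun v => f v ^ 2) hf2.integrable_sq (fun v => sq_nonneg _)).2
  have eQ : ∫ v, Q v = (∫ v, H v ^ 2) + ∫ v, f v ^ 2 :=
    integral_add hH2.integrable_sq hf2.integrable_sq
  rw [eQ] at b1
  have hpow : 0 < δ ^ (2 - 2 * s) := Real.rpow_pos_of_pos hδ _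
  have nH : 0 ≤ ∫ v, H v ^ 2 := integral_nonneg fun _ => sq_nonneg _
  have nf : 0 ≤ ∫ v, f v ^ 2 := integral_nonneg fun _ => sq_nonneg _
  have c1 := mul_le_mul_of_nonneg_left b1 hk
  have c2 := mul_le_mul_of_nonneg_left b2 hk
  have c3 : 0 ≤ δ ^ (2 - 2 * s) * ((∫ v, H v ^ 2) + 2 * ∫ v, f v ^ 2) := by positivity
  linarith

end

end QuantumBoltzmann

/-! ### Removal of the mollification. -/

namespace QuantumBoltzmann

noncomputable section

/-! ### Kato's inequality for the collision operator -/

lemma exists_isMollifier : ∃ ρ : Vel → ℝ, IsMollifier ρ := by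
  set b : ContDiffBump (0 : Vel) := ⟨1 / 2, 1, by norm_num, by norm_num⟩
  refine ⟨b.normed volume, b.contDiff_normed, b.nonneg_normed, b.normed_neg, fun v hv => ?_,
    b.integral_normed⟩
  have h := b.support_normed_eq (μ := (volume : Measure Vel))
  by_contra hne
  have : v ∈ Function.support (b.normed volume) := hne
  rw [h, mem_ball_zero_iff] at this
  have hb : b.rOut = 1 := rfl
  linarith

section

variable {α : Type*} [MeasurableSpace α] {μ : Measure α}

lemma abs_integral_mul_le_sqrt {a b : α → ℝ} (ha : MemLp a 2 μ) (hb : MemLp b 2 μ) :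
    |∫ x, a x * b x ∂μ| ≤ √(∫ x, a x ^ 2 ∂μ) * √(∫ x, b x ^ 2 ∂μ) := by
  have hab : Integrable (fun x => a x * b x) μ := ha.integrable_mul hb
  have ha2 := ha.integrable_sq
  have hb2 := hb.integrable_sq
  have A0 : 0 ≤ ∫ x, a x ^ 2 ∂μ := integral_nonneg fun _ => sq_nonneg _
  have B0 : 0 ≤ ∫ x, b x ^ 2 ∂μ := integral_nonneg fun _ => sq_nonneg _
  have key : ∀ t : ℝ, 0 ≤ (∫ x, b x ^ 2 ∂μ) * (t * t) + (-2 * ∫ x, a x * b x ∂μ) * t +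
      ∫ x, a x ^ 2 ∂μ := by
    intro t
    have h : 0 ≤ ∫ x, (a x - t * b x) ^ 2 ∂μ := integral_nonneg fun _ => sq_nonneg _
    have e : ∀ x, (a x - t * b x) ^ 2 = a x ^ 2 - 2 * t * (a x * b x) + t ^ 2 * b x ^ 2 :=
      fun x => by ring
    simp only [e] at h
    have i1 : Integrable (fun x => a x ^ 2 - 2 * t * (a x * b x)) μ := ha2.sub (hab.const_mul _)
    rw [integral_add i1 (hb2.const_mul _), integral_sub ha2 (hab.const_mul _), integral_const_mul,
      integral_const_mul] at h
    linarith
  have hd := discrim_le_zero key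
  rw [discrim] at hd
  rw [← Real.sqrt_mul A0]
  refine Real.abs_le_sqrt ?_
  nlinarith

lemma tendsto_integral_mul_of_L2 {a b : ℕ → α → ℝ} {a₀ b₀ : α → ℝ} (ha : ∀ n, MemLp (a n) 2 μ)
    (hb : ∀ n, MemLp (b n) 2 μ) (ha₀ : MemLp a₀ 2 μ) (hb₀ : MemLp b₀ 2 μ)
    (hat : Tendsto (fun n => ∫ x, (a n x - a₀ x) ^ 2 ∂μ) atTop (𝓝 0))
    (hbt : Tendsto (fun n => ∫ x, (b n x - b₀ x) ^ 2 ∂μ) atTop (𝓝 0)) :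
    Tendsto (fun n => ∫ x, a n x * b n x ∂μ) atTop (𝓝 (∫ x, a₀ x * b₀ x ∂μ)) := by
  rw [tendsto_iff_norm_sub_tendsto_zero]
  have hsa : Tendsto (fun n => √(∫ x, (a n x - a₀ x) ^ 2 ∂μ)) atTop (𝓝 0) := by
    have := hat.sqrt
    rwa [Real.sqrt_zero] at this
  have hsb : Tendsto (fun n => √(∫ x, (b n x - b₀ x) ^ 2 ∂μ)) atTop (𝓝 0) := by
    have := hbt.sqrt
    rwa [Real.sqrt_zero] at this
  have hlim : Tendsto (fun n => √(∫ x, (a n x - a₀ x) ^ 2 ∂μ) * √(∫ x, (b n x - b₀ x) ^ 2 ∂μ) +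
      √(∫ x, (a n x - a₀ x) ^ 2 ∂μ) * √(∫ x, b₀ x ^ 2 ∂μ) +
      √(∫ x, a₀ x ^ 2 ∂μ) * √(∫ x, (b n x - b₀ x) ^ 2 ∂μ)) atTop (𝓝 0) := by
    have := ((hsa.mul hsb).add (hsa.mul_const (√(∫ x, b₀ x ^ 2 ∂μ)))).add
      (hsb.const_mul (√(∫ x, a₀ x ^ 2 ∂μ)))
    simpa using this
  refine squeeze_zero (fun _ => norm_nonneg _) (fun n => ?_) hlim
  have da := (ha n).sub ha₀
  have db := (hb n).sub hb₀
  have i1 : Integrable (fun x => (a n x - a₀ x) * (b n x - b₀ x)) μ := da.integrable_mul db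
  have i2 : Integrable (fun x => (a n x - a₀ x) * b₀ x) μ := da.integrable_mul hb₀
  have i3 : Integrable (fun x => a₀ x * (b n x - b₀ x)) μ := ha₀.integrable_mul db
  have i12 : Integrable (fun x => (a n x - a₀ x) * (b n x - b₀ x) + (a n x - a₀ x) * b₀ x) μ :=
    i1.add i2
  have e : ∫ x, a n x * b n x ∂μ - ∫ x, a₀ x * b₀ x ∂μ = ∫ x, (a n x - a₀ x) * (b n x - b₀ x) ∂μ +
      ∫ x, (a n x - a₀ x) * b₀ x ∂μ + ∫ x, a₀ x * (b n x - b₀ x) ∂μ := by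
    have j1 : Integrable (fun x => a n x * b n x) μ := (ha n).integrable_mul (hb n)
    have j2 : Integrable (fun x => a₀ x * b₀ x) μ := ha₀.integrable_mul hb₀
    rw [← integral_sub j1 j2, ← integral_add i1 i2, ← integral_add i12 i3]
    refine integral_congr_ae (Eventually.of_forall fun x => ?_)
    simp only
    ring
  rw [e, Real.norm_eq_abs]
  refine (abs_add_le _ _).trans (add_le_add ((abs_add_le _ _).trans (add_le_add ?_ ?_)) ?_)
  · exact abs_integral_mul_le_sqrt da db
  · exact abs_integral_mul_le_sqrt da hb₀
  · exact abs_integral_mul_le_sqrt ha₀ db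

end

variable {C γ s M δ η : ℝ} {g h q ρ : Vel → ℝ}

lemma abs_negPart_sub_le (η : ℝ) (u w : Vel → ℝ) (v : Vel) :
    |negPart η u v - negPart η w v| ≤ |u v - w v| := max_neg_add_lipschitz _ _ _

lemma memLp_negPart {u : Vel → ℝ} (hu : MemLp u 2) : MemLp (negPart 0 u) 2 := by
  refine hu.mono ?_ (Eventually.of_forall fun v => ?_)
  · exact ((hu.aestronglyMeasurable.add aestronglyMeasurable_const).neg).sup
      aestronglyMeasurable_const
  · rw [Real.norm_eq_abs, Real.norm_eq_abs, abs_of_nonneg (negPart_nonneg _ _ _)]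
    simp only [negPart, add_zero]
    exact max_le (neg_le_abs _) (abs_nonneg _)

lemma negPart_le {η : ℝ} (hη : 0 ≤ η) (u : Vel → ℝ) (v : Vel) : negPart η u v ≤ negPart 0 u v := by
  unfold negPart
  exact max_le_max (by linarith) le_rfl

/-- Where f = (u + η)_- is positive, f + η = -u, and f²/2 + ηf is at most (f + η)². The bound no
longer involves η. -/
lemma sq_negPart_add_le {η : ℝ} (hη : 0 ≤ η) (u : Vel → ℝ) (v : Vel) :
    negPart η u v ^ 2 / 2 + η * negPart η u v ≤ negPart 0 u v ^ 2 := by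
  unfold negPart
  rcases le_or_gt (-(u v + η)) 0 with h | h
  · rw [max_eq_right h]
    nlinarith [sq_nonneg (max (-(u v + 0)) 0)]
  · rw [max_eq_left h.le, max_eq_left (by linarith)]
    nlinarith

lemma IsMollifier.negPart_avg (hρ : IsMollifier ρ) (hδ : 0 < δ) (hh : MemLp h 2) (hη : 0 < η) :
    Continuous (negPart η (avg (scaled ρ δ) h)) ∧
      HasCompactSupport (negPart η (avg (scaled ρ δ) h)) := by
  have hl : LocallyIntegrable h := hh.locallyIntegrable (by norm_num)
  refine ⟨(((hρ.contDiff_avg hδ hl).continuous.add continuous_const).neg).max continuous_const, ?_⟩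
  obtain ⟨R, hR⟩ := hρ.exists_radius_avg_lt hδ hh hη
  refine HasCompactSupport.intro (isCompact_closedBall (0 : Vel) R) fun v hv => ?_
  have h1 := hR v (by simpa using hv)
  rw [abs_lt] at h1
  exact max_eq_right (by linarith)

/-- The form bound at a fixed mollification scale. -/
lemma IsKernelParam.exists_mollified_kato (hp : IsKernelParam C γ s) (M : ℝ)
    (hρ : IsMollifier ρ) : ∃ K₁ K₂ : ℝ, 0 < K₁ ∧ 0 < K₂ ∧
    ∀ (δ η : ℝ) (g' g h q : Vel → ℝ), 0 < δ → δ ≤ 1 / 8 → 0 < η → Measurable g' → g' =ᵐ[volume] g →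
      IsRegular M g → Measurable h → MemLp h 2 → MemLp q 2 → IsCollisionTerm C γ s g' h q →
      -∫ v, avg (scaled ρ δ) q v * negPart η (avg (scaled ρ δ) h) v ≤
        K₁ * (∫ v, negPart 0 (avg (scaled ρ δ) h) v ^ 2) + K₂ * δ ^ (2 - 2 * s) * ∫ v, h v ^ 2 := by
  obtain ⟨K₁, K₂, hK₁, hK₂, hb⟩ := hp.exists_form_bound M hρ
  set b := 8 * (volume (Metric.closedBall (0 : Vel) 1)).toReal
  refine ⟨K₁, K₂ * (b ^ 2 + 2), hK₁, by positivity,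
    fun δ η g' g h q hδ hδ1 hη hg' hgg hg hh hh2 hq hcol => ?_⟩
  have hκ := hρ.isKernel_scaled hδ
  set k := scaled ρ δ
  set u := avg k h
  set f := negPart η u
  obtain ⟨fc, fs⟩ := hρ.negPart_avg hδ hh2 hη
  have fi : Integrable f := fc.integrable_of_hasCompactSupport fs
  have f2 : MemLp f 2 := fc.memLp_of_hasCompactSupport fs
  have u2 : MemLp u 2 := hκ.memLp_avg hh2
  have fl : LocallyIntegrable f := fi.locallyIntegrable
  set φ := avg k f
  have φs : ContDiff ℝ ∞ φ := hρ.contDiff_avg hδ fl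
  have φc : HasCompactSupport φ := hρ.hasCompactSupport_avg hδ fs
  have φ2 : MemLp φ 2 := hκ.memLp_avg f2
  set L : ℝ := -(K₁ * ∫ v, negPart 0 u v ^ 2) - K₂ * (b ^ 2 + 2) * δ ^ (2 - 2 * s) * ∫ v, h v ^ 2
  have un2 := memLp_negPart u2
  have hpow : 0 < δ ^ (2 - 2 * s) := Real.rpow_pos_of_pos hδ _
  -- The lower bound does not depend on ε, so it passes to the distributional limit defining the
  -- collision term, tested against the smooth function φ.
  have hlow : ∀ ε : ℝ, 0 < ε → L ≤ ∫ v, truncCollision C γ s ε g' h v * φ v := by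
    intro ε hε
    have e1 : ∫ v, truncCollision C γ s ε g' h v * φ v = ∫ v, truncCollision C γ s ε g h v * φ v := by
      refine integral_congr_ae ?_
      filter_upwards [hp.truncCollision_congr_ae (ε := ε) hg.cont.measurable hg' hh hgg] with v hv
      rw [hv]
    rw [e1, hp.integral_truncCollision_mul hε hg hh hh2 φs.continuous.measurable φ2,
      hp.integral_loss_avg hε hg hh hh2 hκ (fun v => hρ.scaled_even v) (by linarith) f2]
    refine le_trans ?_ (hb ε δ η g h hε hδ hδ1 hη hg hh hh2 fi f2)
    have c1 : ∫ v, (f v ^ 2 / 2 + η * f v) ≤ ∫ v, negPart 0 u v ^ 2 :=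
      integral_mono ((f2.integrable_sq.div_const 2).add (fi.const_mul η)) un2.integrable_sq
        fun v => sq_negPart_add_le hη.le u v
    have c2 : ∫ v, localAvg h δ v ^ 2 ≤ b ^ 2 * ∫ v, h v ^ 2 := by
      have := (isKernel_bump hδ).integral_avg_sq_le (h := fun w => |h w|) hh2.norm
      simp only [sq_abs] at this
      rwa [integral_bump hδ] at this
    have c3 : ∫ v, f v ^ 2 ≤ ∫ v, h v ^ 2 := by
      have h1 : ∫ v, f v ^ 2 ≤ ∫ v, u v ^ 2 := by
        refine integral_mono f2.integrable_sq u2.integrable_sq fun v => ?_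
        have h2 : f v ≤ |u v| := max_le (by linarith [neg_le_abs (u v)]) (abs_nonneg _)
        have := pow_le_pow_left₀ (negPart_nonneg η u v) h2 2
        rwa [sq_abs] at this
      have h3 := hκ.integral_avg_sq_le hh2
      rw [hρ.integral_scaled hδ, one_pow, one_mul] at h3
      exact h1.trans h3
    have d1 := mul_le_mul_of_nonneg_left c1 hK₁.le
    have d2 : K₂ * δ ^ (2 - 2 * s) * ((∫ v, localAvg h δ v ^ 2) + 2 * ∫ v, f v ^ 2) ≤
        K₂ * δ ^ (2 - 2 * s) * (b ^ 2 * (∫ v, h v ^ 2) + 2 * ∫ v, h v ^ 2) := by gcongr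
    simp only [L]
    linarith
  have hlim := ge_of_tendsto (hcol φ φs φc) (by
    filter_upwards [self_mem_nhdsWithin] with ε hε
    exact hlow ε hε)
  rw [hκ.integral_mul_avg (fun v => hρ.scaled_even v) hq f2] at hlim
  simp only [L] at hlim
  linarith

/-- The remaining error is a multiple of δ^(2-2s) ‖h‖². It involves all of h and not only h_-, but
disappears as δ → 0 because s < 1. Since q is in L², the other terms converge by strong L²
convergence of the mollifications. -/
lemma IsKernelParam.exists_kato (hp : IsKernelParam C γ s) (M : ℝ) : ∃ K : ℝ, 0 < K ∧
    ∀ g' g h q : Vel → ℝ, Measurable g' → g' =ᵐ[volume] g → IsRegular M g → Measurable h →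
      MemLp h 2 → MemLp q 2 → IsCollisionTerm C γ s g' h q →
      -∫ v, q v * negPart 0 h v ≤ K * ∫ v, negPart 0 h v ^ 2 := by
  obtain ⟨ρ, hρ⟩ := exists_isMollifier
  obtain ⟨K₁, K₂, hK₁, hK₂, hb⟩ := hp.exists_mollified_kato M hρ
  refine ⟨K₁, hK₁, fun g' g h q hg' hgg hg hh hh2 hq hcol => ?_⟩
  have hs1 := hp.s_lt_one
  -- At fixed δ, (u + η)_- increases to u_- as η decreases to 0, and is dominated by it.
  have stepη : ∀ δ : ℝ, 0 < δ → δ ≤ 1 / 8 →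
      -∫ v, avg (scaled ρ δ) q v * negPart 0 (avg (scaled ρ δ) h) v ≤
        K₁ * (∫ v, negPart 0 (avg (scaled ρ δ) h) v ^ 2) + K₂ * δ ^ (2 - 2 * s) * ∫ v, h v ^ 2 := by
    intro δ hδ hδ1
    have hκ := hρ.isKernel_scaled hδ
    have u2 := hκ.memLp_avg hh2
    have q2 := hκ.memLp_avg hq
    have hlim : Tendsto (fun n : ℕ => ∫ v, avg (scaled ρ δ) q v *
        negPart (1 / ((n : ℝ) + 1)) (avg (scaled ρ δ) h) v) atTop
        (𝓝 (∫ v, avg (scaled ρ δ) q v * negPart 0 (avg (scaled ρ δ) h) v)) := by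
      have i0 : Integrable fun v => avg (scaled ρ δ) q v * negPart 0 (avg (scaled ρ δ) h) v :=
        q2.integrable_mul (memLp_negPart u2)
      refine tendsto_integral_of_dominated_convergence _ (fun n => ?_) i0.norm (fun n => ?_) ?_
      · exact q2.aestronglyMeasurable.mul
          (hρ.negPart_avg hδ hh2 (η := 1 / ((n : ℝ) + 1)) (by positivity)).1.aestronglyMeasurable
      · refine Eventually.of_forall fun v => ?_
        rw [norm_mul, norm_mul]
        refine mul_le_mul_of_nonneg_left ?_ (norm_nonneg _)
        rw [Real.norm_of_nonneg (negPart_nonneg _ _ _), Real.norm_of_nonneg (negPart_nonneg _ _ _)]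
        exact negPart_le (by positivity) _ _
      · refine Eventually.of_forall fun v => Tendsto.const_mul _ ?_
        unfold negPart
        exact ((tendsto_one_div_add_atTop_nhds_zero_nat.const_add _).neg).max tendsto_const_nhds
    refine le_of_tendsto hlim.neg (Eventually.of_forall fun n => ?_)
    exact hb δ _ g' g h q hδ hδ1 (by positivity) hg' hgg hg hh hh2 hq hcol
  set d : ℕ → ℝ := fun n => 1 / 8 * (1 / ((n : ℝ) + 1))
  have hd : ∀ n, 0 < d n := fun n => by positivity
  have hd1 : ∀ n, d n ≤ 1 / 8 := fun n => by
    have : 1 / ((n : ℝ) + 1) ≤ 1 := by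
      rw [div_le_one (by positivity)]
      linarith [n.cast_nonneg (α := ℝ)]
    simp only [d]
    linarith
  have hd0 : Tendsto d atTop (𝓝 0) := by
    have := (tendsto_one_div_add_atTop_nhds_zero_nat (𝕜 := ℝ)).const_mul (1 / 8)
    rwa [mul_zero] at this
  have mh : ∀ n, MemLp (avg (scaled ρ (d n)) h) 2 := fun n => (hρ.isKernel_scaled (hd n)).memLp_avg hh2
  have mq : ∀ n, MemLp (avg (scaled ρ (d n)) q) 2 := fun n => (hρ.isKernel_scaled (hd n)).memLp_avg hq
  have th := hρ.tendsto_avg_L2 hd hd0 hh2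
  have tq := hρ.tendsto_avg_L2 hd hd0 hq
  have tn : Tendsto (fun n => ∫ v, (negPart 0 (avg (scaled ρ (d n)) h) v - negPart 0 h v) ^ 2)
      atTop (𝓝 0) := by
    refine squeeze_zero (fun n => integral_nonneg fun _ => sq_nonneg _) (fun n => ?_) th
    refine integral_mono ((memLp_negPart (mh n)).sub (memLp_negPart hh2)).integrable_sq
      ((mh n).sub hh2).integrable_sq fun v => ?_
    exact sq_le_sq.2 (abs_negPart_sub_le 0 _ _ v)
  have l1 := tendsto_integral_mul_of_L2 mq (fun n => memLp_negPart (mh n)) hq (memLp_negPart hh2) tq tn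
  have l2 := tendsto_integral_mul_of_L2 (fun n => memLp_negPart (mh n))
    (fun n => memLp_negPart (mh n)) (memLp_negPart hh2) (memLp_negPart hh2) tn tn
  have l3 : Tendsto (fun n => d n ^ (2 - 2 * s)) atTop (𝓝 0) := by
    have := hd0.rpow_const (p := 2 - 2 * s) (Or.inr (by linarith))
    rwa [Real.zero_rpow (by linarith)] at this
  have l4 := (l2.const_mul K₁).add ((l3.const_mul K₂).mul_const (∫ v, h v ^ 2))
  rw [mul_zero, zero_mul, add_zero] at l4
  simp only [← pow_two] at l4
  refine le_of_tendsto_of_tendsto' l1.neg l4 fun n => ?_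
  exact stepη (d n) (hd n) (hd1 n)

end

end QuantumBoltzmann

/-! ### From the Sobolev bound to regular velocity slices of G. -/

namespace QuantumBoltzmann

noncomputable section

open scoped ComplexConjugate

/-! ### Fourier series on the torus -/

lemma volume_torus_eq :
    (volume : Measure Torus3) = Measure.pi fun _ : Fin 3 => (AddCircle.haarAddCircle : Measure UnitAddCircle) := by
  rw [volume_pi]
  congr 1
  funext i
  simp [AddCircle.volume_eq_smul_haarAddCircle]

/-- The symbol `1 + 4π²|k|²` of `1 - Δ` on the torus. -/
def symbol (k : Fin 3 → ℤ) : ℝ := 1 + 4 * Real.pi ^ 2 * ∑ i, (k i : ℝ) ^ 2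

lemma one_le_symbol (k : Fin 3 → ℤ) : 1 ≤ symbol k := by
  unfold symbol
  have : 0 ≤ 4 * Real.pi ^ 2 * ∑ i, (k i : ℝ) ^ 2 := by positivity
  linarith

lemma summable_int_rpow : Summable fun k : ℤ => (1 + (k : ℝ) ^ 2) ^ (-(2 / 3) : ℝ) := by
  have h : Summable fun n : ℕ => (1 + (n : ℝ) ^ 2) ^ (-(2 / 3) : ℝ) := by
    have h1 : Summable fun n : ℕ => ((n : ℝ)) ^ (-(4 / 3) : ℝ) :=
      Real.summable_nat_rpow.2 (by norm_num)
    refine (summable_nat_add_iff 1).1 (Summable.of_nonneg_of_le (fun n => by positivity) (fun n => ?_)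
      ((summable_nat_add_iff 1).2 h1))
    have hn : (0 : ℝ) < ((n + 1 : ℕ) : ℝ) := by positivity
    have e : (((n + 1 : ℕ) : ℝ)) ^ (-(4 / 3) : ℝ) = (((n + 1 : ℕ) : ℝ) ^ 2) ^ (-(2 / 3) : ℝ) := by
      rw [← Real.rpow_natCast, ← Real.rpow_mul hn.le]
      norm_num
    rw [e]
    exact Real.rpow_le_rpow_of_nonpos (by positivity) (by linarith) (by norm_num)
  exact Summable.of_nat_of_neg (by simpa using h) (by simpa using h)

/-- Each 1 + k_i² is at most the symbol, so symbol⁻² is bounded by the product of the three factors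
(1 + k_i²)^(-2/3), and each sum over ℤ converges because 4/3 > 1. -/
lemma summable_symbol : Summable fun k : Fin 3 → ℤ => (symbol k ^ 2)⁻¹ := by
  set a : ℤ → ℝ := fun k => (1 + (k : ℝ) ^ 2) ^ (-(2 / 3) : ℝ) with ha
  have ha0 : ∀ k, 0 ≤ a k := fun k => by simp only [ha]; positivity
  have hprod : Summable fun k : Fin 3 → ℤ => ∏ i, a (k i) := by
    refine summable_of_sum_le (c := ∏ _i : Fin 3, ∑' k, a k)
      (fun k => Finset.prod_nonneg fun i _ => ha0 _) fun u => ?_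
    let t : Finset ℤ := u.biUnion fun k => Finset.univ.image k
    calc ∑ k ∈ u, ∏ i, a (k i) ≤ ∑ k ∈ Fintype.piFinset fun _ : Fin 3 => t, ∏ i, a (k i) := by
          refine Finset.sum_le_sum_of_subset_of_nonneg (fun k hk => ?_)
            fun k _ _ => Finset.prod_nonneg fun i _ => ha0 _
          rw [Fintype.mem_piFinset]
          intro i
          exact Finset.mem_biUnion.2 ⟨k, hk, Finset.mem_image_of_mem _ (Finset.mem_univ i)⟩
      _ = ∏ _i : Fin 3, ∑ k ∈ t, a k := by rw [Finset.prod_univ_sum]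
      _ ≤ _ := Finset.prod_le_prod (fun i _ => Finset.sum_nonneg fun k _ => ha0 k)
          fun i _ => summable_int_rpow.sum_le_tsum _ fun k _ => ha0 k
  refine Summable.of_nonneg_of_le (fun k => by positivity) (fun k => ?_) hprod
  have hS : ∀ i, 1 + (k i : ℝ) ^ 2 ≤ symbol k := fun i => by
    have h1 : (k i : ℝ) ^ 2 ≤ ∑ j, (k j : ℝ) ^ 2 :=
      Finset.single_le_sum (f := fun j => (k j : ℝ) ^ 2) (fun j _ => sq_nonneg _) (Finset.mem_univ i)
    have h2 : 1 ≤ 4 * Real.pi ^ 2 := by nlinarith [Real.pi_gt_three]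
    have h3 : 0 ≤ ∑ j, (k j : ℝ) ^ 2 := Finset.sum_nonneg fun j _ => sq_nonneg _
    unfold symbol
    nlinarith
  have hpos : 0 < symbol k := one_pos.trans_le (one_le_symbol k)
  calc (symbol k ^ 2)⁻¹ = ∏ _i : Fin 3, symbol k ^ (-(2 / 3) : ℝ) := by
        rw [Finset.prod_const, Finset.card_univ, Fintype.card_fin, ← Real.rpow_natCast,
          ← Real.rpow_natCast, ← Real.rpow_mul hpos.le, ← Real.rpow_neg hpos.le]
        norm_num
    _ ≤ _ := Finset.prod_le_prod (fun i _ => by positivity) fun i _ =>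
        Real.rpow_le_rpow_of_nonpos (by positivity) (hS i) (by norm_num)

lemma hasSum_sq_mFourierCoeff {V : Torus3 → ℂ} (hV : MemLp V 2) :
    HasSum (fun k => ‖∫ x, UnitAddTorus.mFourier (-k) x * V x‖ ^ 2) (∫ x, ‖V x‖ ^ 2) := by
  rw [volume_torus_eq] at hV ⊢
  have h := UnitAddTorus.hasSum_sq_mFourierCoeff (MemLp.toLp V hV)
  have e : ∀ k, UnitAddTorus.mFourierCoeff (MemLp.toLp V hV) k =
      ∫ x, UnitAddTorus.mFourier (-k) x * V x
        ∂(Measure.pi fun _ : Fin 3 => (AddCircle.haarAddCircle : Measure UnitAddCircle)) := fun k => by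
    refine integral_congr_ae ?_
    filter_upwards [MemLp.coeFn_toLp hV] with x hx
    simp only [hx, smul_eq_mul]
  have e2 : ∫ x, ‖MemLp.toLp V hV x‖ ^ 2
        ∂(Measure.pi fun _ : Fin 3 => (AddCircle.haarAddCircle : Measure UnitAddCircle))
      = ∫ x, ‖V x‖ ^ 2
        ∂(Measure.pi fun _ : Fin 3 => (AddCircle.haarAddCircle : Measure UnitAddCircle)) := by
    refine integral_congr_ae ?_
    filter_upwards [MemLp.coeFn_toLp hV] with x hx
    simp only [hx]
  simp only [e] at h
  rw [← e2]
  exact h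

lemma ae_eq_of_hasSum_mFourier {U : Torus3 → ℂ} (hU : MemLp U 2) {S : C(Torus3, ℂ)}
    (hS : HasSum (fun k => (∫ x, UnitAddTorus.mFourier (-k) x * U x) • UnitAddTorus.mFourier k) S) :
    U =ᵐ[volume] S := by
  rw [volume_torus_eq] at hU hS ⊢
  have h := UnitAddTorus.hasSum_mFourier_series_L2 (MemLp.toLp U hU)
  have e : ∀ k, UnitAddTorus.mFourierCoeff (MemLp.toLp U hU) k =
      ∫ x, UnitAddTorus.mFourier (-k) x * U x
        ∂(Measure.pi fun _ : Fin 3 => (AddCircle.haarAddCircle : Measure UnitAddCircle)) := fun k => by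
    refine integral_congr_ae ?_
    filter_upwards [MemLp.coeFn_toLp hU] with x hx
    simp only [hx, smul_eq_mul]
  simp only [e] at h
  have h2 := hS.mapL (ContinuousMap.toLp (E := ℂ) 2
    (Measure.pi fun _ : Fin 3 => (AddCircle.haarAddCircle : Measure UnitAddCircle)) ℂ)
  simp only [map_smul] at h2
  have h3 := h.unique h2
  filter_upwards [MemLp.coeFn_toLp hU, ContinuousMap.coeFn_toLp (𝕜 := ℂ) (p := 2)
    (Measure.pi fun _ : Fin 3 => (AddCircle.haarAddCircle : Measure UnitAddCircle)) S] with x h4 h5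
  rw [← h4, ← h5, h3]

/-- The constant of the embedding `H²(𝕋³) ⊆ L^∞(𝕋³)`. -/
def embConst : ℝ := √(∑' k : Fin 3 → ℤ, (symbol k ^ 2)⁻¹)

/-- The hypothesis says V = (1 - Δ)U on the Fourier side. By Cauchy–Schwarz and Parseval the
coefficients of U are absolutely summable, so its Fourier series converges uniformly. -/
lemma ae_norm_le_of_mFourierCoeff {U V : Torus3 → ℂ} (hU : MemLp U 2) (hV : MemLp V 2)
    (h : ∀ k, (symbol k : ℂ) * ∫ x, UnitAddTorus.mFourier k x * U x =
      ∫ x, UnitAddTorus.mFourier k x * V x) :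
    ∀ᵐ x, ‖U x‖ ≤ embConst * √(∫ x, ‖V x‖ ^ 2) := by
  set b : (Fin 3 → ℤ) → ℂ := fun k => ∫ x, UnitAddTorus.mFourier (-k) x * U x with hb
  set c : (Fin 3 → ℤ) → ℂ := fun k => ∫ x, UnitAddTorus.mFourier (-k) x * V x with hc
  have hsum := hasSum_sq_mFourierCoeff hV
  have hbc : ∀ k, ‖b k‖ = (symbol k)⁻¹ * ‖c k‖ := fun k => by
    have h1 := h (-k)
    have h2 : symbol (-k) = symbol k := by simp [symbol]
    have hpos : 0 < symbol k := one_pos.trans_le (one_le_symbol k)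
    rw [h2] at h1
    have h3 : ‖c k‖ = symbol k * ‖b k‖ := by
      simp only [hc, ← h1, norm_mul, hb, Complex.norm_real, Real.norm_eq_abs, abs_of_pos hpos]
    rw [h3]
    field_simp
  have hle : ∀ s : Finset (Fin 3 → ℤ), ∑ k ∈ s, ‖b k‖ ≤ embConst * √(∫ x, ‖V x‖ ^ 2) := fun s => by
    refine (Real.le_sqrt_of_sq_le ?_).trans_eq (Real.sqrt_mul (tsum_nonneg fun k => by positivity) _)
    calc (∑ k ∈ s, ‖b k‖) ^ 2 = (∑ k ∈ s, (symbol k)⁻¹ * ‖c k‖) ^ 2 := by simp only [hbc]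
      _ ≤ (∑ k ∈ s, (symbol k)⁻¹ ^ 2) * ∑ k ∈ s, ‖c k‖ ^ 2 := Finset.sum_mul_sq_le_sq_mul_sq _ _ _
      _ ≤ _ := by
        refine mul_le_mul ?_ ?_ (by positivity) (tsum_nonneg fun k => by positivity)
        · simp only [inv_pow]
          exact summable_symbol.sum_le_tsum _ fun k _ => by positivity
        · exact sum_le_hasSum _ (fun k _ => by positivity) hsum
  have hsb : Summable fun k => ‖b k‖ := summable_of_sum_le (fun k => norm_nonneg _) hle
  have hs : Summable fun k => b k • (UnitAddTorus.mFourier k : C(Torus3, ℂ)) := by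
    refine Summable.of_norm ?_
    simpa only [norm_smul, UnitAddTorus.mFourier_norm, mul_one] using hsb
  have hn : ‖∑' k, b k • (UnitAddTorus.mFourier k : C(Torus3, ℂ))‖ ≤ embConst * √(∫ x, ‖V x‖ ^ 2) := by
    refine (norm_tsum_le_tsum_norm ?_).trans ?_
    · simpa only [norm_smul, UnitAddTorus.mFourier_norm, mul_one] using hsb
    · simp only [norm_smul, UnitAddTorus.mFourier_norm, mul_one]
      exact hsb.tsum_le_of_sum_le hle
  filter_upwards [ae_eq_of_hasSum_mFourier hU hs.hasSum] with x hx
  rw [hx]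
  exact (ContinuousMap.norm_coe_le_norm _ x).trans hn

/-! ### Real waves -/

/-- The real part of `c e^{2πi k·x}`. -/
def wave (c : ℂ) (k : Fin 3 → ℤ) (x : Torus3) : ℝ := (c * UnitAddTorus.mFourier k x).re

lemma continuous_wave (c : ℂ) (k : Fin 3 → ℤ) : Continuous (wave c k) :=
  Complex.continuous_re.comp (continuous_const.mul (UnitAddTorus.mFourier k).continuous)

lemma abs_wave_le (c : ℂ) (k : Fin 3 → ℤ) (x : Torus3) : |wave c k x| ≤ ‖c‖ := by
  refine (Complex.abs_re_le_norm _).trans ?_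
  rw [norm_mul]
  have := (UnitAddTorus.mFourier k : C(Torus3, ℂ)).norm_coe_le_norm x
  rw [UnitAddTorus.mFourier_norm] at this
  nlinarith [norm_nonneg c]

/-- The phase `2πi k·y`. -/
def phase (k : Fin 3 → ℤ) (y : Vel) : ℂ := ∑ i, 2 * Real.pi * Complex.I * k i * y i

lemma mFourier_toTorus (k : Fin 3 → ℤ) (y : Vel) :
    UnitAddTorus.mFourier k (toTorus y) = Complex.exp (phase k y) := by
  simp only [UnitAddTorus.mFourier, ContinuousMap.coe_mk, toTorus, fourier_coe_apply, phase,
    Complex.exp_sum]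
  simp

lemma mFourier_add_toTorus (k : Fin 3 → ℤ) (x : Torus3) (y : Vel) :
    UnitAddTorus.mFourier k (x + toTorus y) = UnitAddTorus.mFourier k x * Complex.exp (phase k y) := by
  rw [← mFourier_toTorus]
  simp only [UnitAddTorus.mFourier, ContinuousMap.coe_mk, Pi.add_apply, fourier_apply, smul_add,
    AddCircle.toCircle_add, Circle.coe_mul, Finset.prod_mul_distrib]

lemma wave_add_toTorus (c : ℂ) (k : Fin 3 → ℤ) (x : Torus3) (y : Vel) :
    wave c k (x + toTorus y) = wave (c * Complex.exp (phase k y)) k x := by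
  simp only [wave, mFourier_add_toTorus]
  congr 1
  ring

lemma integral_mFourier_mul {U : Torus3 → ℝ} (hU : Integrable U) (k : Fin 3 → ℤ) :
    ∫ x, UnitAddTorus.mFourier k x * (U x : ℂ) =
      (∫ x, U x * wave 1 k x : ℝ) + (∫ x, U x * wave (-Complex.I) k x : ℝ) * Complex.I := by
  have hi : ∀ c, Integrable fun x => U x * wave c k x := fun c =>
    hU.mul_bdd (c := ‖c‖) (continuous_wave c k).aestronglyMeasurable
      (Eventually.of_forall fun x => abs_wave_le c k x)
  rw [← integral_complex_ofReal, ← integral_complex_ofReal, ← integral_mul_const, ← integral_add (hi _).ofReal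
    ((hi _).ofReal.mul_const _)]
  refine integral_congr_ae (Eventually.of_forall fun x => ?_)
  apply Complex.ext <;> simp [wave] <;> ring

/-- The values c = 1 and c = -i give cosine and sine, hence all Fourier coefficients of a real
function. -/
lemma ae_abs_le_of_wave {U V : Torus3 → ℝ} (hU : MemLp U 2) (hV : MemLp V 2)
    (h : ∀ k, ∀ c ∈ ({1, -Complex.I} : Set ℂ), symbol k * ∫ x, U x * wave c k x = ∫ x, V x * wave c k x) :
    ∀ᵐ x, |U x| ≤ embConst * √(∫ x, V x ^ 2) := by
  have h1 := ae_norm_le_of_mFourierCoeff (U := fun x => (U x : ℂ)) (V := fun x => (V x : ℂ))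
    hU.ofReal hV.ofReal fun k => by
      rw [integral_mFourier_mul (hU.integrable (by norm_num)),
        integral_mFourier_mul (hV.integrable (by norm_num)), ← h k 1 (by simp),
        ← h k (-Complex.I) (by simp)]
      push_cast
      ring
  simpa using h1

end

end QuantumBoltzmann

namespace QuantumBoltzmann

noncomputable section

/-! ### Test functions of the velocity -/

/-- The partial derivative `∂_{v_i}`. -/
def dV (i : Fin 3) (ψ : Vel → ℝ) (v : Vel) : ℝ :=
  deriv (fun r : ℝ => ψ (v + EuclideanSpace.single i r)) 0

lemma single_eq_smul (i : Fin 3) (r : ℝ) :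
    (EuclideanSpace.single i r : Vel) = r • EuclideanSpace.single i 1 := by
  ext j
  by_cases h : j = i
  · subst h; simp
  · rw [PiLp.smul_apply, PiLp.single_apply, PiLp.single_apply, if_neg h, if_neg h, smul_zero]

lemma dV_eq_fderiv {ψ : Vel → ℝ} (hψ : Differentiable ℝ ψ) (i : Fin 3) (v : Vel) :
    dV i ψ v = fderiv ℝ ψ v (EuclideanSpace.single i 1) := by
  have h1 : HasDerivAt (fun r : ℝ => v + r • (EuclideanSpace.single i 1 : Vel))
      ((1 : ℝ) • EuclideanSpace.single i 1) 0 := ((hasDerivAt_id (0 : ℝ)).smul_const _).const_add v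
  have h2 : HasFDerivAt ψ (fderiv ℝ ψ v) (v + (0 : ℝ) • (EuclideanSpace.single i 1 : Vel)) := by
    rw [zero_smul, add_zero]
    exact (hψ v).hasFDerivAt
  have h3 := h2.comp_hasDerivAt 0 h1
  rw [one_smul] at h3
  have h4 : (fun r : ℝ => ψ (v + EuclideanSpace.single i r)) =
      fun r : ℝ => ψ (v + r • EuclideanSpace.single i 1) := by
    funext r
    rw [single_eq_smul i r]
  unfold dV
  rw [h4]
  exact h3.deriv

lemma contDiff_dV {ψ : Vel → ℝ} (hψ : ContDiff ℝ ∞ ψ) (i : Fin 3) : ContDiff ℝ ∞ (dV i ψ) := by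
  have : dV i ψ = fun v => fderiv ℝ ψ v (EuclideanSpace.single i 1) :=
    funext fun v => dV_eq_fderiv (hψ.differentiable (by simp)) i v
  rw [this]
  exact (hψ.fderiv_right (m := ∞) (by simp)).clm_apply contDiff_const

lemma hasCompactSupport_dV {ψ : Vel → ℝ} (hψ : ContDiff ℝ ∞ ψ) (hc : HasCompactSupport ψ) (i : Fin 3) :
    HasCompactSupport (dV i ψ) := by
  have : dV i ψ = fun v => fderiv ℝ ψ v (EuclideanSpace.single i 1) :=
    funext fun v => dV_eq_fderiv (hψ.differentiable (by simp)) i v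
  rw [this]
  exact hc.fderiv_apply (𝕜 := ℝ) _

lemma dV_comm {ψ : Vel → ℝ} (hψ : ContDiff ℝ ∞ ψ) (i j : Fin 3) : dV i (dV j ψ) = dV j (dV i ψ) := by
  have hd : Differentiable ℝ ψ := hψ.differentiable (by simp)
  have hd2 : Differentiable ℝ (fderiv ℝ ψ) :=
    (hψ.fderiv_right (m := ∞) (by simp)).differentiable (by simp)
  have key : ∀ a b : Fin 3, ∀ v, dV a (dV b ψ) v =
      fderiv ℝ (fderiv ℝ ψ) v (EuclideanSpace.single a 1) (EuclideanSpace.single b 1) := fun a b v => by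
    rw [dV_eq_fderiv ((contDiff_dV hψ b).differentiable (by simp))]
    have : dV b ψ = fun v => fderiv ℝ ψ v (EuclideanSpace.single b 1) :=
      funext fun v => dV_eq_fderiv hd b v
    rw [this, fderiv_clm_apply (hd2 v) (differentiableAt_const _)]
    simp
  funext v
  rw [key, key]
  exact (hψ.contDiffAt.isSymmSndFDerivAt (by rw [minSmoothness_of_isRCLikeNormedField]; exact WithTop.coe_le_coe.2 (le_top : (2 : ℕ∞) ≤ ⊤))).eq _ _

/-- Smooth functions of the velocity with compact support. -/
def VTest : Submodule ℝ (Vel → ℝ) where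
  carrier := {ψ | ContDiff ℝ ∞ ψ ∧ HasCompactSupport ψ}
  add_mem' h1 h2 := ⟨h1.1.add h2.1, h1.2.add h2.2⟩
  zero_mem' := ⟨contDiff_const, HasCompactSupport.zero⟩
  smul_mem' c _ h := ⟨contDiff_const.smul h.1, h.2.smul_left (f := fun _ => c)⟩

namespace VTest

lemma memLp (ψ : VTest) : MemLp (ψ : Vel → ℝ) 2 :=
  ψ.2.1.continuous.memLp_of_hasCompactSupport ψ.2.2

/-- The partial derivative `∂_{v_i}` of test functions. -/
def D (i : Fin 3) : Module.End ℝ VTest where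
  toFun ψ := ⟨dV i ψ, contDiff_dV ψ.2.1 i, hasCompactSupport_dV ψ.2.1 ψ.2.2 i⟩
  map_add' ψ χ := by
    ext v
    have h1 := ψ.2.1.differentiable (by simp)
    have h2 := χ.2.1.differentiable (by simp)
    have h3 : Differentiable ℝ ((ψ + χ : VTest) : Vel → ℝ) := h1.add h2
    simp only [Submodule.coe_add, Pi.add_apply, dV_eq_fderiv h1, dV_eq_fderiv h2]
    rw [dV_eq_fderiv (by exact h3)]
    rw [fderiv_add (h1 v) (h2 v)]
    rfl
  map_smul' c ψ := by
    ext v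
    have h1 := ψ.2.1.differentiable (by simp)
    have h3 : Differentiable ℝ ((c • ψ : VTest) : Vel → ℝ) := h1.const_smul c
    simp only [Submodule.coe_smul, Pi.smul_apply, dV_eq_fderiv h1, RingHom.id_apply]
    rw [dV_eq_fderiv (by exact h3), fderiv_const_smul (h1 v)]
    rfl

lemma coe_D (i : Fin 3) (ψ : VTest) : (D i ψ : Vel → ℝ) = dV i ψ := rfl

lemma commute_D (i j : Fin 3) : Commute (D i) (D j) := by
  ext ψ v
  exact congrFun (dV_comm ψ.2.1 i j) v

/-- The derivative `∂^β` of test functions. -/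
def DD (β : Fin 3 → ℕ) : Module.End ℝ VTest := D 0 ^ β 0 * (D 1 ^ β 1 * D 2 ^ β 2)

lemma DD_zero : DD 0 = 1 := by simp [DD]

lemma DD_add_single (β : Fin 3 → ℕ) (i : Fin 3) (n : ℕ) :
    DD (β + Pi.single i n) = DD β * D i ^ n := by
  have h : ∀ a b : Fin 3, ∀ m : ℕ, Commute (D a ^ m) (D b ^ n) := fun a b m =>
    (commute_D a b).pow_pow m n
  fin_cases i
  · simp only [DD, Pi.add_apply, Fin.zero_eta, Pi.single_eq_same, pow_add, ne_eq, one_ne_zero,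
      not_false_eq_true, Pi.single_eq_of_ne, add_zero, Fin.reduceEq, mul_assoc]
    rw [(h 2 0 _).eq, ← mul_assoc (D 1 ^ β 1), (h 1 0 _).eq, mul_assoc]
  · simp only [DD, Pi.add_apply, Fin.mk_one, Pi.single_eq_same, pow_add, ne_eq, zero_ne_one,
      not_false_eq_true, Pi.single_eq_of_ne, add_zero, Fin.reduceEq, mul_assoc]
    rw [(h 2 1 _).eq]
  · simp [DD, pow_add, mul_assoc]

/-- Translation of test functions. -/
def trans (v₀ : Vel) (ψ : VTest) : VTest :=
  ⟨fun v => ψ.1 (v - v₀), ψ.2.1.comp (contDiff_id.sub contDiff_const),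
    ψ.2.2.comp_homeomorph (Homeomorph.subRight v₀)⟩

lemma coe_trans (v₀ : Vel) (ψ : VTest) (v : Vel) : (trans v₀ ψ : Vel → ℝ) v = (ψ : Vel → ℝ) (v - v₀) := rfl

lemma D_trans (i : Fin 3) (v₀ : Vel) (ψ : VTest) : D i (trans v₀ ψ) = trans v₀ (D i ψ) := by
  ext v
  simp only [coe_D, coe_trans, dV]
  congr 1
  funext r
  rw [add_sub_right_comm]

lemma integral_trans_sq (v₀ : Vel) (ψ : VTest) :
    ∫ v, (trans v₀ ψ : Vel → ℝ) v ^ 2 = ∫ v, (ψ : Vel → ℝ) v ^ 2 := by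
  simp only [coe_trans]
  exact integral_sub_right_eq_self (fun v => (ψ : Vel → ℝ) v ^ 2) v₀

end VTest

/-! ### Products of waves and velocity test functions -/

lemma wave_real_mul (r : ℝ) (c : ℂ) (k : Fin 3 → ℤ) (x : Torus3) :
    wave (r * c) k x = r * wave c k x := by
  simp [wave, mul_assoc]

lemma hasDerivAt_wave (c : ℂ) (k : Fin 3 → ℤ) (i : Fin 3) (x : Torus3) :
    HasDerivAt (fun r : ℝ => wave c k (x + toTorus (EuclideanSpace.single i r)))
      (wave (2 * Real.pi * Complex.I * k i * c) k x) 0 := by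
  have e : ∀ r : ℝ, phase k (EuclideanSpace.single i r) = 2 * Real.pi * Complex.I * k i * r := fun r => by
    unfold phase
    rw [Finset.sum_eq_single i (fun j _ hj => by simp [hj]) (by simp)]
    simp
  have h1 : HasDerivAt (fun r : ℝ => c * Complex.exp (2 * Real.pi * Complex.I * k i * r) *
      UnitAddTorus.mFourier k x) (2 * Real.pi * Complex.I * k i * c * UnitAddTorus.mFourier k x) 0 := by
    have h2 : HasDerivAt (fun r : ℝ => 2 * Real.pi * Complex.I * k i * (r : ℂ))
        (2 * Real.pi * Complex.I * k i * 1) 0 := (Complex.ofRealCLM.hasDerivAt (x := (0 : ℝ))).const_mul _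
    have h3 := ((h2.cexp).const_mul c).mul_const (UnitAddTorus.mFourier k x)
    refine h3.congr_deriv ?_
    simp only [Complex.ofReal_zero, mul_zero, Complex.exp_zero, mul_one, one_mul]
    ring
  have h4 := Complex.reCLM.hasFDerivAt.comp_hasDerivAt 0 h1
  simp only [wave_add_toTorus, e]
  exact h4

lemma partialX_wave (c : ℂ) (k : Fin 3 → ℤ) (i : Fin 3) (ψ : Vel → ℝ) :
    partialX i (fun x v => wave c k x * ψ v) =
      fun x v => wave (2 * Real.pi * Complex.I * k i * c) k x * ψ v := by
  funext x v
  exact ((hasDerivAt_wave c k i x).mul_const (ψ v)).deriv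

lemma partialX_two_wave (c : ℂ) (k : Fin 3 → ℤ) (i : Fin 3) (ψ : Vel → ℝ) :
    (partialX i)^[2] (fun x v => wave c k x * ψ v) =
      fun x v => -(4 * Real.pi ^ 2 * k i ^ 2) * (wave c k x * ψ v) := by
  simp only [Function.iterate_succ, Function.iterate_zero, Function.comp_apply, id_eq, partialX_wave]
  funext x v
  rw [← mul_assoc (-_), ← wave_real_mul]
  congr 2
  push_cast
  linear_combination (4 * Real.pi ^ 2 * k i ^ 2 * c : ℂ) * Complex.I_sq

lemma partialV_wave (c : ℂ) (k : Fin 3 → ℤ) (i : Fin 3) (ψ : VTest) (n : ℕ) :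
    (partialV i)^[n] (fun x v => wave c k x * (ψ : Vel → ℝ) v) =
      fun x v => wave c k x * ((VTest.D i ^ n) ψ : Vel → ℝ) v := by
  induction n with
  | zero => simp
  | succ n ih =>
    rw [Function.iterate_succ_apply', ih]
    funext x v
    rw [pow_succ', Module.End.mul_apply, VTest.coe_D]
    exact deriv_const_mul_field _

lemma partialXV_zero_wave (c : ℂ) (k : Fin 3 → ℤ) (β : Fin 3 → ℕ) (ψ : VTest) :
    partialXV 0 β (fun x v => wave c k x * (ψ : Vel → ℝ) v) =
      fun x v => wave c k x * (VTest.DD β ψ : Vel → ℝ) v := by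
  simp only [partialXV, partialV_wave, VTest.DD, Module.End.mul_apply]
  rfl

lemma partialXV_single_wave (c : ℂ) (k : Fin 3 → ℤ) (j : Fin 3) (β : Fin 3 → ℕ) (ψ : VTest) :
    partialXV (Pi.single j 2) β (fun x v => wave c k x * (ψ : Vel → ℝ) v) =
      fun x v => -(4 * Real.pi ^ 2 * k j ^ 2) * (wave c k x * (VTest.DD β ψ : Vel → ℝ) v) := by
  simp only [partialXV, partialV_wave, VTest.DD, Module.End.mul_apply]
  fin_cases j <;> simpa using partialX_two_wave c k _ _

lemma contDiff_wave (c : ℂ) (k : Fin 3 → ℤ) : ContDiff ℝ ∞ fun y : Vel => wave c k (toTorus y) := by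
  have h1 : ContDiff ℝ ∞ (phase k) := ContDiff.sum fun i _ => contDiff_const.mul
    (Complex.ofRealCLM.contDiff.comp (by fun_prop : ContDiff ℝ ∞ fun y : Vel => y i))
  have : ContDiff ℝ ∞ fun y : Vel => c * Complex.exp (phase k y) := contDiff_const.mul h1.cexp
  simp only [wave, mFourier_toTorus]
  exact Complex.reCLM.contDiff.comp this

lemma isTestXV_wave (c : ℂ) (k : Fin 3 → ℤ) (ψ : VTest) :
    IsTestXV fun x v => wave c k x * (ψ : Vel → ℝ) v := by
  refine ⟨((contDiff_wave c k).comp contDiff_fst).mul (ψ.2.1.comp contDiff_snd), ?_⟩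
  refine HasCompactSupport.intro (isCompact_univ.prod ψ.2.2.isCompact) fun z hz => ?_
  have : (ψ : Vel → ℝ) z.2 = 0 := image_eq_zero_of_notMem_tsupport fun h => hz ⟨mem_univ _, h⟩
  simp [this]

end

end QuantumBoltzmann

namespace QuantumBoltzmann

noncomputable section

/-! ### Integrable functions without Fourier coefficients -/

/-- The positive and negative parts of U define finite measures with the same integrals of
continuous functions, hence the same measure. -/
lemma ae_eq_zero_of_forall_continuous {U : Torus3 → ℝ} (hU : Integrable U)
    (H : ∀ f : C(Torus3, ℝ), ∫ x, U x * f x = 0) : ∀ᵐ x, U x = 0 := by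
  have hp : Integrable fun x => max (U x) 0 := hU.pos_part
  have hn : Integrable fun x => max (-U x) 0 := hU.neg_part
  have hfin : ∀ V : Torus3 → ℝ, Integrable V → IsFiniteMeasure (volume.withDensity fun x => ENNReal.ofReal (V x)) :=
    fun V hV => isFiniteMeasure_withDensity_ofReal hV.hasFiniteIntegral
  have := hfin U hU
  have := hfin (fun x => -U x) hU.neg
  have key : (volume.withDensity fun x => ENNReal.ofReal (U x)) =
      volume.withDensity fun x => ENNReal.ofReal (-U x) := by
    refine ext_of_forall_integral_eq_of_IsFiniteMeasure fun f => ?_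
    have e : ∀ V : Torus3 → ℝ, Integrable V → ∫ x, f x ∂(volume.withDensity fun x => ENNReal.ofReal (V x)) =
        ∫ x, max (V x) 0 * f x := fun V hV => by
      rw [integral_withDensity_eq_integral_toReal_smul₀ hV.1.aemeasurable.ennreal_ofReal
        (Eventually.of_forall fun x => ENNReal.ofReal_lt_top)]
      simp only [smul_eq_mul, ENNReal.toReal_ofReal']
    have hi : ∀ V : Torus3 → ℝ, Integrable V → Integrable fun x => V x * f x := fun V hV =>
      hV.mul_bdd (c := ‖f‖) f.continuous.aestronglyMeasurable (Eventually.of_forall fun x => f.norm_coe_le_norm x)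
    rw [e U hU, e (fun x => -U x) hU.neg, ← sub_eq_zero, ← integral_sub (hi _ hp) (hi _ hn)]
    refine Eq.trans ?_ (H f.toContinuousMap)
    refine integral_congr_ae (Eventually.of_forall fun x => ?_)
    change max (U x) 0 * f x - max (-U x) 0 * f x = U x * f x
    rw [← sub_mul]
    congr 1
    rcases le_total (U x) 0 with h | h
    · rw [max_eq_right h, max_eq_left (by linarith)]; ring
    · rw [max_eq_left h, max_eq_right (by linarith)]; ring
  have h1 := (withDensity_eq_iff hU.1.aemeasurable.ennreal_ofReal hU.neg.1.aemeasurable.ennreal_ofReal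
    ((hU.lintegral_lt_top).ne)).1 key
  filter_upwards [h1] with x hx
  simp only [Pi.neg_apply] at hx
  rcases le_total (U x) 0 with h | h
  · rw [ENNReal.ofReal_of_nonpos h, eq_comm, ENNReal.ofReal_eq_zero] at hx
    linarith
  · rw [ENNReal.ofReal_of_nonpos (by linarith : -U x ≤ 0), ENNReal.ofReal_eq_zero] at hx
    linarith

/-- Trigonometric polynomials are dense in C(𝕋³) and f ↦ ∫ U f is continuous there. The L² theory
does not apply, since U is only integrable. -/
lemma ae_eq_zero_of_wave_of_integrable {U : Torus3 → ℝ} (hU : Integrable U)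
    (H : ∀ k, ∀ c ∈ ({1, -Complex.I} : Set ℂ), ∫ x, U x * wave c k x = 0) : ∀ᵐ x, U x = 0 := by
  have hi : ∀ f : C(Torus3, ℂ), Integrable fun x => (U x : ℂ) * f x := fun f =>
    hU.ofReal.mul_bdd (c := ‖f‖) f.continuous.aestronglyMeasurable
      (Eventually.of_forall fun x => f.norm_coe_le_norm x)
  let Λ : C(Torus3, ℂ) →ₗ[ℂ] ℂ :=
    { toFun := fun f => ∫ x, (U x : ℂ) * f x
      map_add' := fun f g => by
        simp only [ContinuousMap.add_apply, mul_add]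
        exact integral_add (hi f) (hi g)
      map_smul' := fun c f => by
        simp only [ContinuousMap.smul_apply, smul_eq_mul, RingHom.id_apply, ← integral_const_mul]
        refine integral_congr_ae (Eventually.of_forall fun x => ?_)
        simp only
        ring }
  let L : C(Torus3, ℂ) →L[ℂ] ℂ := Λ.mkContinuous (∫ x, |U x|) fun f => by
    refine (norm_integral_le_integral_norm _).trans ?_
    rw [← integral_mul_const]
    refine integral_mono (hi f).norm (hU.abs.mul_const _) fun x => ?_
    simp only [norm_mul, Complex.norm_real, Real.norm_eq_abs]
    exact mul_le_mul_of_nonneg_left (f.norm_coe_le_norm x) (abs_nonneg _)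
  have hL : ∀ f, L f = 0 := by
    have h1 : (⊤ : Submodule ℂ C(Torus3, ℂ)) ≤ LinearMap.ker (L : C(Torus3, ℂ) →ₗ[ℂ] ℂ) := by
      rw [← UnitAddTorus.span_mFourier_closure_eq_top]
      refine Submodule.topologicalClosure_minimal _ (Submodule.span_le.2 ?_) L.isClosed_ker
      rintro _ ⟨k, rfl⟩
      change ∫ x, (U x : ℂ) * UnitAddTorus.mFourier k x = 0
      simp only [mul_comm (_ : ℂ) (UnitAddTorus.mFourier k _)]
      rw [integral_mFourier_mul hU, H k 1 (by simp), H k (-Complex.I) (by simp)]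
      simp
    exact fun f => h1 Submodule.mem_top
  refine ae_eq_zero_of_forall_continuous hU fun f => ?_
  have h2 : ∫ x, ((U x * f x : ℝ) : ℂ) = 0 := by
    have := hL ⟨fun x => (f x : ℂ), Complex.continuous_ofReal.comp f.continuous⟩
    simpa [L, Λ] using this
  rw [integral_complex_ofReal] at h2
  exact_mod_cast h2

/-! ### Velocity integrals of functions on `𝕋³ × ℝ³` -/

/-- The function `x ↦ ∫ h(x,v) ψ(v) dv`. -/
def vint (h : Torus3 → Vel → ℝ) (ψ : Vel → ℝ) (x : Torus3) : ℝ := ∫ v, h x v * ψ v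

section

variable {h : Torus3 → Vel → ℝ} {ψ : Vel → ℝ}

lemma ae_memLp_slice (hh : MemLp (fun z : Torus3 × Vel => h z.1 z.2) 2) : ∀ᵐ x, MemLp (h x) 2 := by
  have h1 : ∀ᵐ x, Integrable (fun v => h x v ^ 2) := hh.integrable_sq.prod_right_ae
  filter_upwards [h1, AEStronglyMeasurable.prodMk_left hh.aestronglyMeasurable] with x h2 h3
  exact (memLp_two_iff_integrable_sq h3).2 h2

/-- The set where h vanishes need not be measurable, so the passage from slices to the product goes
through a strongly measurable representative. -/
lemma ae_prod_eq_zero_of_slices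
    (hh : AEStronglyMeasurable (fun z : Torus3 × Vel => h z.1 z.2) (volume.prod volume))
    (H : ∀ᵐ x, ∀ᵐ v, h x v = 0) : ∀ᵐ z : Torus3 × Vel, h z.1 z.2 = 0 := by
  have h1 : ∀ᵐ x, ∀ᵐ v, h x v = hh.mk _ (x, v) := Measure.ae_ae_of_ae_prod hh.ae_eq_mk
  have h2 : ∀ᵐ z ∂((volume : Measure Torus3).prod (volume : Measure Vel)), hh.mk _ z = 0 := by
    refine (Measure.ae_prod_iff_ae_ae
      (hh.stronglyMeasurable_mk.measurable (measurableSet_singleton 0))).2 ?_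
    filter_upwards [h1, H] with x h3 h4
    filter_upwards [h3, h4] with v h5 h6
    rw [← h5, h6]
    rfl
  rw [Measure.volume_eq_prod]
  filter_upwards [h2, hh.ae_eq_mk] with z h3 h4
  rw [h4, h3]

lemma memLp_vint (hh : MemLp (fun z : Torus3 × Vel => h z.1 z.2) 2) (hψ : MemLp ψ 2) :
    MemLp (vint h ψ) 2 ∧
      ∫ x, vint h ψ x ^ 2 ≤ (∫ z : Torus3 × Vel, h z.1 z.2 ^ 2) * ∫ v, ψ v ^ 2 := by
  have hm : AEStronglyMeasurable (vint h ψ) volume := by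
    have h2 : AEStronglyMeasurable (fun z : Torus3 × Vel => h z.1 z.2 * ψ z.2) (volume.prod volume) :=
      hh.aestronglyMeasurable.mul hψ.aestronglyMeasurable.comp_snd
    exact h2.integral_prod_right'
  have hi : Integrable (fun x => (∫ v, h x v ^ 2) * ∫ v, ψ v ^ 2) :=
    (Integrable.integral_prod_left (f := fun z : Torus3 × Vel => h z.1 z.2 ^ 2)
      hh.integrable_sq).mul_const _
  have hle : ∀ᵐ x, vint h ψ x ^ 2 ≤ (∫ v, h x v ^ 2) * ∫ v, ψ v ^ 2 := by
    filter_upwards [ae_memLp_slice hh] with x hx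
    have h1 := abs_integral_mul_le_sqrt hx hψ
    rw [← Real.sqrt_mul (integral_nonneg fun v => sq_nonneg _)] at h1
    rw [← sq_abs]
    exact (Real.le_sqrt (abs_nonneg _) (mul_nonneg (integral_nonneg fun v => sq_nonneg _)
      (integral_nonneg fun v => sq_nonneg _))).1 h1
  have hi2 : Integrable fun x => vint h ψ x ^ 2 := by
    refine hi.mono' (hm.pow 2) ?_
    filter_upwards [hle] with x hx
    rwa [Real.norm_eq_abs, abs_of_nonneg (sq_nonneg _)]
  refine ⟨(memLp_two_iff_integrable_sq hm).2 hi2, (integral_mono_ae hi2 hi hle).trans_eq ?_⟩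
  rw [integral_mul_const]
  congr 1
  exact (integral_prod (fun z : Torus3 × Vel => h z.1 z.2 ^ 2) hh.integrable_sq).symm

lemma integrable_mul_test (hh : LocallyIntegrable (fun z : Torus3 × Vel => h z.1 z.2)) (ψ : VTest) :
    Integrable (fun z : Torus3 × Vel => h z.1 z.2 * (ψ : Vel → ℝ) z.2) := by
  refine hh.integrable_smul_right_of_hasCompactSupport (g := fun z => (ψ : Vel → ℝ) z.2)
    (ψ.2.1.continuous.comp continuous_snd) ?_
  refine HasCompactSupport.intro (isCompact_univ.prod ψ.2.2.isCompact) fun z hz => ?_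
  exact image_eq_zero_of_notMem_tsupport fun h => hz ⟨mem_univ _, h⟩

lemma integral_mul_wave (hh : LocallyIntegrable (fun z : Torus3 × Vel => h z.1 z.2)) (ψ : VTest)
    (c : ℂ) (k : Fin 3 → ℤ) :
    ∫ z : Torus3 × Vel, h z.1 z.2 * (wave c k z.1 * (ψ : Vel → ℝ) z.2) =
      ∫ x, vint h ψ x * wave c k x := by
  have h3 : Integrable (fun z : Torus3 × Vel => h z.1 z.2 * (ψ : Vel → ℝ) z.2 * wave c k z.1) :=
    (integrable_mul_test hh ψ).mul_bdd (c := ‖c‖)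
      ((continuous_wave c k).comp continuous_fst).aestronglyMeasurable
      (Eventually.of_forall fun x => abs_wave_le c k x.1)
  have h4 : ∀ z : Torus3 × Vel, h z.1 z.2 * (wave c k z.1 * (ψ : Vel → ℝ) z.2) =
      h z.1 z.2 * (ψ : Vel → ℝ) z.2 * wave c k z.1 := fun z => by ring
  simp only [h4]
  rw [Measure.volume_eq_prod, integral_prod _ h3]
  simp only [vint, integral_mul_const]

lemma ae_locallyIntegrable_slice (hh : LocallyIntegrable (fun z : Torus3 × Vel => h z.1 z.2)) :
    ∀ᵐ x, LocallyIntegrable (h x) := by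
  have h1 : ∀ᵐ x, ∀ n : ℕ, IntegrableOn (h x) (Metric.closedBall 0 n) := by
    refine ae_all_iff.2 fun n => ?_
    have h2 := hh.integrableOn_isCompact (isCompact_univ.prod (isCompact_closedBall (0 : Vel) n))
    rw [IntegrableOn, Measure.volume_eq_prod, ← Measure.prod_restrict, Measure.restrict_univ] at h2
    exact h2.prod_right_ae
  filter_upwards [h1] with x hx
  refine locallyIntegrable_iff.2 fun K hK => ?_
  obtain ⟨R, hR⟩ := hK.isBounded.subset_closedBall 0
  obtain ⟨n, hn⟩ := exists_nat_ge R
  exact (hx n).mono_set (hR.trans (Metric.closedBall_subset_closedBall hn))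

lemma tendsto_half_pow : Tendsto (fun n : ℕ => (1 / 2 : ℝ) ^ n) atTop (𝓝 0) :=
  tendsto_pow_atTop_nhds_zero_of_lt_one (by norm_num) (by norm_num)

/-- The mollifier at scale `2⁻ⁿ` as a test function. -/
def IsMollifier.test {ρ : Vel → ℝ} (hρ : IsMollifier ρ) (n : ℕ) : VTest :=
  ⟨scaled ρ ((1 / 2) ^ n), hρ.scaled_smooth, hρ.scaled_hasCompactSupport (by positivity)⟩

/-- A countable family of tests determines a locally integrable function: waves in x, and in v
mollifiers of scale 2⁻ⁿ centred at a dense sequence. Countability keeps the exceptional sets null;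
continuity of the mollified slice fills in the other centres. -/
lemma IsMollifier.ae_eq_zero_of_wave {ρ : Vel → ℝ} (hρ : IsMollifier ρ)
    (hh : LocallyIntegrable (fun z : Torus3 × Vel => h z.1 z.2))
    (H : ∀ k, ∀ c ∈ ({1, -Complex.I} : Set ℂ), ∀ n j,
      ∫ z : Torus3 × Vel, h z.1 z.2 * (wave c k z.1 *
        (VTest.trans (TopologicalSpace.denseSeq Vel j) (hρ.test n) : Vel → ℝ) z.2) = 0) :
    ∀ᵐ z : Torus3 × Vel, h z.1 z.2 = 0 := by
  have h1 : ∀ᵐ x, ∀ n j, vint h (VTest.trans (TopologicalSpace.denseSeq Vel j) (hρ.test n)) x = 0 := by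
    refine ae_all_iff.2 fun n => ae_all_iff.2 fun j => ?_
    refine ae_eq_zero_of_wave_of_integrable (integrable_mul_test hh _).integral_prod_left fun k c hc => ?_
    rw [← integral_mul_wave hh]
    exact H k c hc n j
  have h2 : ∀ᵐ x, ∀ᵐ v, h x v = 0 := by
    filter_upwards [h1, ae_locallyIntegrable_slice hh] with x hx hl
    have h3 : ∀ n v, avg (scaled ρ ((1 / 2) ^ n)) (h x) v = 0 := fun n => by
      have hc : Continuous (avg (scaled ρ ((1 / 2) ^ n)) (h x)) :=
        (hρ.contDiff_avg (by positivity) hl).continuous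
      refine congrFun (hc.ext_on (TopologicalSpace.denseRange_denseSeq Vel) continuous_const ?_)
      rintro _ ⟨j, rfl⟩
      rw [← hx n j]
      simp only [avg, vint, VTest.coe_trans, IsMollifier.test, mul_comm]
    filter_upwards [hρ.ae_tendsto_avg (fun n => by positivity) tendsto_half_pow hl] with v hv
    simp only [h3] at hv
    exact (tendsto_nhds_unique hv tendsto_const_nhds)
  exact ae_prod_eq_zero_of_slices hh.aestronglyMeasurable h2

end

end

end QuantumBoltzmann

namespace QuantumBoltzmann

noncomputable section

/-! ### Mollifiers whose rescalings differ by second derivatives -/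

/-- A smooth even function on the line with integral one that vanishes outside `[-1/2, 1/2]`. -/
structure IsBump (r : ℝ → ℝ) : Prop where
  smooth : ContDiff ℝ ∞ r
  nonneg : ∀ t, 0 ≤ r t
  even : ∀ t, r (-t) = r t
  supp : ∀ t, 1 / 2 < |t| → r t = 0
  int : ∫ t, r t = 1

lemma exists_isBump : ∃ r, IsBump r := by
  let f : ContDiffBump (0 : ℝ) := ⟨1 / 4, 1 / 2, by norm_num, by norm_num⟩
  refine ⟨f.normed volume, f.contDiff_normed, f.nonneg_normed, f.normed_neg, fun t ht => ?_, f.integral_normed⟩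
  have h : t ∉ Function.support (f.normed volume) := by
    rw [f.support_normed_eq]
    simp only [Metric.mem_ball, dist_zero_right, Real.norm_eq_abs, not_lt]
    exact ht.le
  simpa using h

/-- A primitive of a smooth function is smooth. -/
lemma contDiff_primitive {r : ℝ → ℝ} (hr : ContDiff ℝ ∞ r) :
    ContDiff ℝ ∞ fun t => ∫ s in (0 : ℝ)..t, r s := by
  have hd : deriv (fun t => ∫ s in (0 : ℝ)..t, r s) = r := by
    funext t
    exact hr.continuous.deriv_integral _ _ _
  rw [contDiff_infty_iff_deriv]
  refine ⟨fun t => ?_, by rwa [hd]⟩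
  exact (hr.continuous.integral_hasStrictDerivAt 0 t).hasDerivAt.differentiableAt

namespace IsBump

variable {r : ℝ → ℝ}

lemma primitive_neg (hr : IsBump r) (t : ℝ) : ∫ s in (0 : ℝ)..(-t), r s = -∫ s in (0 : ℝ)..t, r s := by
  have h := intervalIntegral.integral_comp_neg (f := r) (a := 0) (b := t)
  simp only [hr.even, neg_zero] at h
  rw [h, intervalIntegral.integral_symm]

lemma primitive_eq_half (hr : IsBump r) {t : ℝ} (ht : 1 / 2 ≤ t) : ∫ s in (0 : ℝ)..t, r s = 1 / 2 := by
  have hi : ∀ a b, IntervalIntegrable r volume a b := fun a b => hr.smooth.continuous.intervalIntegrable a b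
  have h1 : ∫ s in (-t)..t, r s = 1 := by
    rw [← hr.int]
    refine intervalIntegral.integral_eq_integral_of_support_subset fun s hs => ?_
    have h2 : |s| ≤ 1 / 2 := by
      by_contra h
      exact hs (hr.supp s (not_le.1 h))
    have h3 : s ≠ -t := by
      rintro rfl
      have h4 : t = 1 / 2 := le_antisymm (by rwa [abs_neg, abs_of_nonneg (by linarith)] at h2) ht
      refine hs ?_
      subst h4
      rw [hr.even]
      have h5 : Tendsto r (𝓝[>] (1 / 2)) (𝓝 (r (1 / 2))) :=
        hr.smooth.continuous.continuousAt.mono_left nhdsWithin_le_nhds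
      refine tendsto_nhds_unique h5 (tendsto_const_nhds.congr' ?_)
      filter_upwards [self_mem_nhdsWithin] with x hx
      exact (hr.supp x (lt_of_lt_of_le hx (le_abs_self x))).symm
    obtain ⟨h4, h5⟩ := abs_le.1 h2
    exact ⟨lt_of_le_of_ne (by linarith) (Ne.symm h3), by linarith⟩
  rw [← intervalIntegral.integral_add_adjacent_intervals (hi (-t) 0) (hi 0 t),
    intervalIntegral.integral_symm, hr.primitive_neg] at h1
  linarith

/-- The even second primitive of a bump, equal to `|t| / 2` up to a constant for large `t`. -/
def pot (r : ℝ → ℝ) (t : ℝ) : ℝ := ∫ s in (0 : ℝ)..t, ∫ u in (0 : ℝ)..s, r u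

lemma contDiff_pot (hr : IsBump r) : ContDiff ℝ ∞ (pot r) := contDiff_primitive (contDiff_primitive hr.smooth)

lemma deriv_pot (hr : IsBump r) : deriv (pot r) = fun t => ∫ u in (0 : ℝ)..t, r u := by
  funext t
  exact (contDiff_primitive hr.smooth).continuous.deriv_integral _ _ _

lemma deriv_deriv_pot (hr : IsBump r) : deriv (deriv (pot r)) = r := by
  rw [hr.deriv_pot]
  funext t
  exact hr.smooth.continuous.deriv_integral _ _ _

lemma pot_neg (hr : IsBump r) (t : ℝ) : pot r (-t) = pot r t := by
  have h := intervalIntegral.integral_comp_neg (f := fun s => ∫ u in (0 : ℝ)..s, r u) (a := 0) (b := t)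
  simp only [hr.primitive_neg, neg_zero, intervalIntegral.integral_neg] at h
  unfold pot
  rw [intervalIntegral.integral_symm, ← h, neg_neg]

lemma pot_of_le (hr : IsBump r) {t : ℝ} (ht : 1 / 2 ≤ t) : pot r t = pot r (1 / 2) + (t - 1 / 2) / 2 := by
  have hi : ∀ a b, IntervalIntegrable (fun s => ∫ u in (0 : ℝ)..s, r u) volume a b := fun a b =>
    (contDiff_primitive hr.smooth).continuous.intervalIntegrable a b
  unfold pot
  rw [← intervalIntegral.integral_add_adjacent_intervals (hi 0 (1 / 2)) (hi (1 / 2) t)]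
  congr 1
  rw [intervalIntegral.integral_congr (g := fun _ => (1 / 2 : ℝ)) fun s hs => ?_]
  · simp; ring
  · rw [uIcc_of_le ht] at hs
    exact hr.primitive_eq_half hs.1

/-- A compactly supported function with second derivative `2 r(2t) - r(t)`. -/
def cor (r : ℝ → ℝ) (t : ℝ) : ℝ := 1 / 2 * pot r (2 * t) - pot r t + (1 / 2 * pot r (1 / 2) - 1 / 8)

lemma contDiff_cor (hr : IsBump r) : ContDiff ℝ ∞ (cor r) :=
  ((contDiff_const.mul (hr.contDiff_pot.comp (contDiff_const.mul contDiff_id))).sub hr.contDiff_pot).add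
    contDiff_const

/-- Outside [-1/2, 1/2] both pot(2t)/2 and pot(t) are |t|/2 plus constants, so the linear parts
cancel; the constant in `cor` removes the rest. -/
lemma cor_eq_zero (hr : IsBump r) {t : ℝ} (ht : 1 / 2 ≤ |t|) : cor r t = 0 := by
  have key : ∀ t, 1 / 2 ≤ t → cor r t = 0 := fun t ht => by
    unfold cor
    rw [hr.pot_of_le ht, hr.pot_of_le (by linarith : 1 / 2 ≤ 2 * t)]
    ring
  rcases abs_cases t with ⟨h, _⟩ | ⟨h, _⟩
  · exact key t (h ▸ ht)
  · rw [← key (-t) (h ▸ ht)]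
    unfold cor
    rw [mul_neg, hr.pot_neg, hr.pot_neg]

lemma deriv_deriv_cor (hr : IsBump r) : deriv (deriv (cor r)) = fun t => 2 * r (2 * t) - r t := by
  have hp : ∀ t, HasDerivAt (pot r) (deriv (pot r) t) t := fun t =>
    (hr.contDiff_pot.differentiable (by simp) t).hasDerivAt
  have hp2 : ∀ t, HasDerivAt (deriv (pot r)) (r t) t := fun t => by
    have := (((contDiff_infty_iff_deriv.1 hr.contDiff_pot).2).differentiable (by simp) t).hasDerivAt
    rwa [hr.deriv_deriv_pot] at this
  have h2 : ∀ t : ℝ, HasDerivAt (fun t : ℝ => 2 * t) 2 t := fun t => by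
    simpa using (hasDerivAt_id t).const_mul 2
  have e1 : deriv (cor r) = fun t => deriv (pot r) (2 * t) - deriv (pot r) t := by
    funext t
    have := ((((hp (2 * t)).comp t (h2 t)).const_mul (1 / 2)).sub (hp t)).add_const
      (1 / 2 * pot r (1 / 2) - 1 / 8)
    refine (this.congr_deriv ?_).deriv
    ring
  rw [e1]
  funext t
  refine ((((hp2 (2 * t)).comp t (h2 t)).sub (hp2 t)).congr_deriv ?_).deriv
  ring

end IsBump

end

end QuantumBoltzmann

/-! ### Dyadic telescoping of tensor-product mollifiers. -/

namespace QuantumBoltzmann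

noncomputable section

/-- The tensor product `v ↦ p₀(v₀) p₁(v₁) p₂(v₂)`. -/
def prodFn (p : Fin 3 → ℝ → ℝ) (v : Vel) : ℝ := ∏ i, p i (v i)

lemma prodFn_eq (p : Fin 3 → ℝ → ℝ) (v : Vel) : prodFn p v = p 0 (v 0) * p 1 (v 1) * p 2 (v 2) := by
  simp [prodFn, Fin.prod_univ_three]

lemma exists_half_lt_coord {v : Vel} (hv : 1 < ‖v‖) : ∃ i, 1 / 2 < |v i| := by
  by_contra! h
  have h2 : ‖v‖ ^ 2 = ∑ i, |v i| ^ 2 := by rw [EuclideanSpace.norm_sq_eq]; simp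
  have h3 : ∑ i, |v i| ^ 2 ≤ ∑ _i : Fin 3, (1 / 2 : ℝ) ^ 2 :=
    Finset.sum_le_sum fun i _ => pow_le_pow_left₀ (abs_nonneg _) (h i) 2
  rw [← h2, Finset.sum_const, Finset.card_univ, Fintype.card_fin] at h3
  norm_num at h3
  nlinarith

lemma prodFn_mem {p : Fin 3 → ℝ → ℝ} (hp : ∀ i, ContDiff ℝ ∞ (p i)) (hs : ∀ i t, 1 / 2 < |t| → p i t = 0) :
    prodFn p ∈ VTest := by
  refine ⟨contDiff_prod fun i _ => (hp i).comp (by fun_prop), ?_⟩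
  refine HasCompactSupport.intro (isCompact_closedBall (0 : Vel) 1) fun v hv => ?_
  have h1 : 1 < ‖v‖ := by simpa using hv
  obtain ⟨i, hi⟩ := exists_half_lt_coord h1
  exact Finset.prod_eq_zero (Finset.mem_univ i) (hs i _ hi)

lemma dV_prodFn (p : Fin 3 → ℝ → ℝ) (i : Fin 3) :
    dV i (prodFn p) = prodFn (Function.update p i (deriv (p i))) := by
  funext v
  have h0 : ∀ q : ℝ → ℝ, ∀ t : ℝ, deriv (fun r => q (t + r)) 0 = deriv q t := fun q t => by
    rw [deriv_comp_const_add, add_zero]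
  fin_cases i
  · simp only [dV, prodFn_eq, Fin.zero_eta, PiLp.add_apply, PiLp.single_apply, Fin.isValue, if_true,
      one_ne_zero, if_false, add_zero, Fin.reduceEq, Function.update_self, ne_eq,
      not_false_eq_true, Function.update_of_ne]
    rw [deriv_mul_const_field, deriv_mul_const_field, h0]
  · simp only [dV, prodFn_eq, Fin.mk_one, PiLp.add_apply, PiLp.single_apply, Fin.isValue, if_true,
      zero_ne_one, if_false, add_zero, Fin.reduceEq, Function.update_self, ne_eq,
      not_false_eq_true, Function.update_of_ne]
    rw [deriv_mul_const_field, deriv_const_mul_field, h0]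
  · simp only [dV, prodFn_eq, Fin.reduceFinMk, PiLp.add_apply, PiLp.single_apply, Fin.isValue, if_true,
      if_false, add_zero, Fin.reduceEq, Function.update_self, ne_eq,
      not_false_eq_true, Function.update_of_ne]
    rw [deriv_const_mul_field, h0]

lemma dV_dV_prodFn (p : Fin 3 → ℝ → ℝ) (i : Fin 3) :
    dV i (dV i (prodFn p)) = prodFn (Function.update p i (deriv (deriv (p i)))) := by
  rw [dV_prodFn, dV_prodFn, Function.update_self, Function.update_idem]

namespace VTest

/-- The rescaling `v ↦ 2ⁿ ψ(2ⁿ v)`. -/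
def dil (n : ℕ) (ψ : VTest) : VTest :=
  ⟨fun v => 2 ^ n * ψ.1 ((2 : ℝ) ^ n • v), contDiff_const.mul (ψ.2.1.comp (contDiff_const_smul ((2 : ℝ) ^ n))),
    (ψ.2.2.comp_homeomorph (Homeomorph.smulOfNeZero ((2 : ℝ) ^ n) (by positivity))).mul_left⟩

lemma coe_dil (n : ℕ) (ψ : VTest) (v : Vel) :
    (dil n ψ : Vel → ℝ) v = 2 ^ n * (ψ : Vel → ℝ) ((2 : ℝ) ^ n • v) := rfl

lemma D_dil (i : Fin 3) (n : ℕ) (ψ : VTest) : D i (dil n ψ) = (2 : ℝ) ^ n • dil n (D i ψ) := by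
  ext v
  have h1 : ∀ r : ℝ, (2 : ℝ) ^ n • (v + EuclideanSpace.single i r : Vel) =
      (2 : ℝ) ^ n • v + EuclideanSpace.single i (2 ^ n * r) := fun r => by
    rw [smul_add, single_eq_smul i r, smul_smul, ← single_eq_smul]
  simp only [coe_D, dV, coe_dil, h1, Submodule.coe_smul, Pi.smul_apply, smul_eq_mul]
  rw [deriv_const_mul_field]
  have := deriv_comp_mul_left ((2 : ℝ) ^ n)
    (fun r => (ψ : Vel → ℝ) ((2 : ℝ) ^ n • v + EuclideanSpace.single i r)) 0
  rw [this, mul_zero, smul_eq_mul]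

lemma integral_dil_sq (n : ℕ) (ψ : VTest) :
    ∫ v, (dil n ψ : Vel → ℝ) v ^ 2 = (1 / 2) ^ n * ∫ v, (ψ : Vel → ℝ) v ^ 2 := by
  simp only [coe_dil, mul_pow]
  rw [integral_const_mul, Measure.integral_comp_smul volume (fun v => (ψ : Vel → ℝ) v ^ 2)]
  rw [abs_of_pos (by positivity), smul_eq_mul, ← mul_assoc]
  congr 1
  simp only [finrank_euclideanSpace, Fintype.card_fin, one_div, inv_pow]
  field_simp

/-- The squared L² norm of the j-th dilate is 2⁻ʲ times the original, so the sum converges uniformly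
in n. Cauchy–Schwarz with weights (3/4)^j and (4/3)^j gives 12 = 4 · 3, from the geometric sums of
ratios 3/4 and 2/3. -/
lemma integral_sum_dil_sq_le (n : ℕ) (ψ : VTest) :
    ∫ v, ((∑ j ∈ Finset.range n, dil j ψ : VTest) : Vel → ℝ) v ^ 2 ≤ 12 * ∫ v, (ψ : Vel → ℝ) v ^ 2 := by
  have hgeo : ∀ a : ℝ, 0 ≤ a → a < 1 → ∑ j ∈ Finset.range n, a ^ j ≤ (1 - a)⁻¹ := fun a h0 h1 =>
    sum_le_hasSum _ (fun j _ => by positivity) (hasSum_geometric_of_lt_one h0 h1)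
  have h1 : ∀ v, ((∑ j ∈ Finset.range n, dil j ψ : VTest) : Vel → ℝ) v ^ 2 ≤
      4 * ∑ j ∈ Finset.range n, (4 / 3 : ℝ) ^ j * (dil j ψ : Vel → ℝ) v ^ 2 := fun v => by
    rw [Submodule.coe_sum, Finset.sum_apply]
    refine (Finset.sum_sq_le_sum_mul_sum_of_sq_le_mul _ (f := fun j => (3 / 4 : ℝ) ^ j)
      (g := fun j => (4 / 3 : ℝ) ^ j * (dil j ψ : Vel → ℝ) v ^ 2)
      (fun j _ => by positivity) (fun j _ => by positivity) fun j _ => le_of_eq ?_).trans ?_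
    · rw [← mul_assoc, ← mul_pow]
      norm_num
    · refine mul_le_mul_of_nonneg_right ((hgeo _ (by norm_num) (by norm_num)).trans (by norm_num))
        (Finset.sum_nonneg fun j _ => by positivity)
  have hi : ∀ j, Integrable fun v => (4 / 3 : ℝ) ^ j * (dil j ψ : Vel → ℝ) v ^ 2 := fun j =>
    (VTest.memLp (dil j ψ)).integrable_sq.const_mul _
  refine (integral_mono (VTest.memLp _).integrable_sq
    ((integrable_finsetSum _ fun j _ => hi j).const_mul 4) h1).trans ?_
  rw [integral_const_mul, integral_finsetSum _ fun j _ => hi j]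
  simp only [integral_const_mul, integral_dil_sq, ← mul_assoc, ← mul_pow]
  rw [← Finset.sum_mul, ← mul_assoc]
  refine mul_le_mul_of_nonneg_right ?_ (integral_nonneg fun v => sq_nonneg _)
  have := hgeo (4 / 3 * (1 / 2)) (by norm_num) (by norm_num)
  norm_num at this ⊢
  linarith

end VTest

/-- A substitute for Sobolev embedding in velocity: averaging u at scale 2⁻ⁿ amounts to averaging at
scale 1 plus pairing second derivatives of u with functions bounded in L² uniformly in n. -/
lemma exists_mollifier_decomposition : ∃ (ρ : Vel → ℝ) (hρ : IsMollifier ρ) (ζ : ℕ → Fin 3 → VTest) (B : ℝ),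
    (∀ n i, ∫ v, (ζ n i : Vel → ℝ) v ^ 2 ≤ B) ∧
      ∀ n, hρ.test n = hρ.test 0 + ∑ i, VTest.D i (VTest.D i (ζ n i)) := by
  obtain ⟨r, hr⟩ := exists_isBump
  have hr2 : ContDiff ℝ ∞ fun t => 2 * r (2 * t) :=
    contDiff_const.mul (hr.smooth.comp (contDiff_const.mul contDiff_id))
  have hs2 : ∀ t, 1 / 2 < |t| → 2 * r (2 * t) = 0 := fun t ht => by
    rw [hr.supp, mul_zero]
    rw [abs_mul, abs_two]
    linarith
  have hc : ∀ t, 1 / 2 < |t| → IsBump.cor r t = 0 := fun t ht => hr.cor_eq_zero ht.le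
  set ρ : Vel → ℝ := prodFn fun _ => r with hρdef
  have hmem : ρ ∈ VTest := prodFn_mem (fun _ => hr.smooth) fun _ => hr.supp
  have hρ : IsMollifier ρ := by
    refine ⟨hmem.1, fun v => Finset.prod_nonneg fun i _ => hr.nonneg _, fun v => ?_, fun v hv => ?_, ?_⟩
    · simp [hρdef, prodFn, hr.even]
    · obtain ⟨i, hi⟩ := exists_half_lt_coord hv
      exact Finset.prod_eq_zero (Finset.mem_univ i) (hr.supp _ hi)
    · have h1 := (EuclideanSpace.volume_preserving_symm_measurableEquiv_toLp (Fin 3)).integral_comp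
        (MeasurableEquiv.measurableEmbedding _) (fun x : Fin 3 → ℝ => ∏ i, r (x i))
      have h2 := integral_fintype_prod_volume_eq_prod (ι := Fin 3) (fun _ => r)
      rw [h2] at h1
      simp only [hr.int, Finset.prod_const_one] at h1
      exact h1
  -- The three coordinates are rescaled one at a time, starting from the last. The i-th product has
  -- `cor` in the coordinate being rescaled, so its second derivative in that coordinate is one step
  -- of the telescoping sum.
  set p : Fin 3 → Fin 3 → ℝ → ℝ :=
    ![![IsBump.cor r, fun t => 2 * r (2 * t), fun t => 2 * r (2 * t)],
      ![r, IsBump.cor r, fun t => 2 * r (2 * t)], ![r, r, IsBump.cor r]] with hp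
  have hpm : ∀ i, prodFn (p i) ∈ VTest := fun i => by
    refine prodFn_mem (fun j => ?_) fun j => ?_
    · fin_cases i <;> fin_cases j <;>
        first | exact hr.contDiff_cor | exact hr2 | exact hr.smooth
    · fin_cases i <;> fin_cases j <;>
        first | exact hc | exact hs2 | exact hr.supp
  let H : Fin 3 → VTest := fun i => ⟨prodFn (p i), hpm i⟩
  have hH : ∀ v, scaled ρ (1 / 2) v - ρ v = ∑ i, (VTest.D i (VTest.D i (H i)) : Vel → ℝ) v := fun v => by
    have e : ∀ i, (VTest.D i (VTest.D i (H i)) : Vel → ℝ) =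
        prodFn (Function.update (p i) i (deriv (deriv (p i i)))) := fun i => dV_dV_prodFn _ _
    simp only [e, Fin.sum_univ_three, prodFn_eq, scaled, hρdef]
    simp [hp, hr.deriv_deriv_cor]
    ring
  -- Two derivatives of the dilate give 2^(2n), and with its own factor 2^n this is the 2^(3n) of
  -- the rescaled mollifier.
  have hstep : ∀ n, hρ.test (n + 1) = hρ.test n + ∑ i, VTest.D i (VTest.D i (VTest.dil n (H i))) := fun n => by
    ext v
    have h1 := hH ((2 : ℝ) ^ n • v)
    simp only [VTest.D_dil, map_smul, Submodule.coe_add, Pi.add_apply, Submodule.coe_sum,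
      Finset.sum_apply, Submodule.coe_smul, Pi.smul_apply, smul_eq_mul, VTest.coe_dil,
      ← Finset.mul_sum]
    rw [← h1]
    have e : ∀ m : ℕ, ((1 / 2 : ℝ) ^ m)⁻¹ = 2 ^ m := fun m => by rw [one_div, inv_pow, inv_inv]
    have e1 : (1 / 2 : ℝ)⁻¹ = 2 := by norm_num
    simp only [IsMollifier.test, scaled, e, e1, smul_smul, pow_succ (2 : ℝ) n]
    rw [mul_comm (2 : ℝ) (2 ^ n)]
    ring
  refine ⟨ρ, hρ, fun n i => ∑ j ∈ Finset.range n, VTest.dil j (H i),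
    12 * ∑ i, ∫ v, (H i : Vel → ℝ) v ^ 2, fun n i => ?_, fun n => ?_⟩
  · refine (VTest.integral_sum_dil_sq_le n (H i)).trans ?_
    gcongr
    exact Finset.single_le_sum (f := fun i => ∫ v, (H i : Vel → ℝ) v ^ 2)
      (fun i _ => integral_nonneg fun v => sq_nonneg _) (Finset.mem_univ i)
  · induction n with
    | zero => simp
    | succ n ih =>
      rw [hstep, ih]
      simp only [Finset.sum_range_succ, map_add, Finset.sum_add_distrib, add_assoc]

end

end QuantumBoltzmann

namespace QuantumBoltzmann

noncomputable section

/-! ### From Sobolev norms to bounds of mollified functions -/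

lemma mem_multiIndices {m : ℕ} {α : Fin 3 → ℕ} : α ∈ multiIndices m ↔ ∑ i, α i ≤ m := by
  simp only [multiIndices, Finset.mem_filter, Fintype.mem_piFinset, Finset.mem_range,
    and_iff_right_iff_imp]
  intro h i
  have := Finset.single_le_sum (f := α) (fun j _ => Nat.zero_le _) (Finset.mem_univ i)
  omega

lemma sum_single (j : Fin 3) (n : ℕ) : ∑ i, (Pi.single j n : Fin 3 → ℕ) i = n := by simp

lemma integral_sq_le_of_eLpNorm_le {α : Type*} [MeasurableSpace α] {μ : Measure α} {f : α → ℝ}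
    (hf : MemLp f 2 μ) {N : ℝ} (hN : 0 ≤ N) (h : eLpNorm f 2 μ ≤ ENNReal.ofReal N) :
    ∫ x, f x ^ 2 ∂μ ≤ N ^ 2 := by
  rw [hf.eLpNorm_eq_integral_rpow_norm (by norm_num) (by norm_num),
    ENNReal.ofReal_le_ofReal_iff hN] at h
  simp only [ENNReal.toReal_ofNat, Real.norm_eq_abs, Real.rpow_ofNat, sq_abs] at h
  rw [← one_div, ← Real.sqrt_eq_rpow] at h
  exact (Real.sqrt_le_left hN).1 h

/-- The `w α β` with `|α| ≤ 2`, `|β| ≤ 4` are weak derivatives of `u` with norms at most `N + 1`. -/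
def IsDerivFamily (u : Torus3 → Vel → ℝ) (w : (Fin 3 → ℕ) → (Fin 3 → ℕ) → Torus3 → Vel → ℝ) (N : ℝ) : Prop :=
  ∀ α ∈ multiIndices 2, ∀ β ∈ multiIndices 4,
    IsWeakDeriv α β u (w α β) ∧ MemLp (fun z : Torus3 × Vel => w α β z.1 z.2) 2 ∧
      ∫ z : Torus3 × Vel, w α β z.1 z.2 ^ 2 ≤ (N + 1) ^ 2

/-- The derivative norms are infima over candidates, so the extra 1 leaves room to choose actual
functions without discussing uniqueness. -/
lemma exists_weakDeriv {u : Torus3 → Vel → ℝ} {N : ℝ} (hN : 0 ≤ N)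
    (h : sobolevNorm 2 4 u ≤ ENNReal.ofReal N) :
    ∃ w, IsDerivFamily u w N := by
  have key : ∀ α β : Fin 3 → ℕ, ∃ w : Torus3 → Vel → ℝ, α ∈ multiIndices 2 → β ∈ multiIndices 4 →
      IsWeakDeriv α β u w ∧ MemLp (fun z : Torus3 × Vel => w z.1 z.2) 2 ∧
        ∫ z : Torus3 × Vel, w z.1 z.2 ^ 2 ≤ (N + 1) ^ 2 := fun α β => by
    by_cases hα : α ∈ multiIndices 2
    swap; · exact ⟨0, fun h => absurd h hα⟩
    by_cases hβ : β ∈ multiIndices 4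
    swap; · exact ⟨0, fun _ h => absurd h hβ⟩
    have h1 : weakDerivNorm α β u ^ 2 ≤ ∑ α ∈ multiIndices 2, ∑ β ∈ multiIndices 4, weakDerivNorm α β u ^ 2 :=
      (Finset.single_le_sum (f := fun β => weakDerivNorm α β u ^ 2) (fun _ _ => zero_le) hβ).trans
        (Finset.single_le_sum (f := fun α => ∑ β ∈ multiIndices 4, weakDerivNorm α β u ^ 2)
          (fun _ _ => zero_le) hα)
    have h2 : weakDerivNorm α β u ≤ ENNReal.ofReal N := by
      refine le_trans ?_ h
      have h3 := ENNReal.rpow_le_rpow h1 (by norm_num : (0 : ℝ) ≤ 1 / 2)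
      rw [← ENNReal.rpow_natCast, ← ENNReal.rpow_mul] at h3
      norm_num at h3
      simpa [sobolevNorm] using h3
    have h3 : weakDerivNorm α β u < ENNReal.ofReal (N + 1) :=
      h2.trans_lt ((ENNReal.ofReal_lt_ofReal_iff (by linarith)).2 (by linarith))
    simp only [weakDerivNorm, iInf_lt_iff] at h3
    obtain ⟨w, hw, hlt⟩ := h3
    have hm : MemLp (fun z : Torus3 × Vel => w z.1 z.2) 2 :=
      ⟨hw.2.1.aestronglyMeasurable, hlt.trans ENNReal.ofReal_lt_top⟩
    exact ⟨w, fun _ _ => ⟨hw, hm, integral_sq_le_of_eLpNorm_le hm (by linarith) hlt.le⟩⟩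
  choose w hw using key
  exact ⟨w, fun α hα β hβ => hw α β hα hβ⟩

lemma integrable_mul_wave {f : Torus3 → Vel → ℝ}
    (hf : LocallyIntegrable fun z : Torus3 × Vel => f z.1 z.2) (ψ : VTest) (c : ℂ) (k : Fin 3 → ℤ) :
    Integrable fun z : Torus3 × Vel => f z.1 z.2 * (wave c k z.1 * (ψ : Vel → ℝ) z.2) := by
  refine ((integrable_mul_test hf ψ).mul_bdd (c := ‖c‖)
    ((continuous_wave c k).comp continuous_fst).aestronglyMeasurable
    (Eventually.of_forall fun x => abs_wave_le c k x.1)).congr (Eventually.of_forall fun z => ?_)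
  simp only [Function.comp_apply]
  ring

lemma integral_vint_add_mul_wave {f : Torus3 → Vel → ℝ}
    (hf : LocallyIntegrable fun z : Torus3 × Vel => f z.1 z.2) (ψ χ : VTest) (c : ℂ) (k : Fin 3 → ℤ) :
    ∫ x, vint f (ψ + χ : VTest) x * wave c k x =
      (∫ x, vint f ψ x * wave c k x) + ∫ x, vint f χ x * wave c k x := by
  rw [← integral_mul_wave hf, ← integral_mul_wave hf, ← integral_mul_wave hf,
    ← integral_add (integrable_mul_wave hf ψ c k) (integrable_mul_wave hf χ c k)]
  refine integral_congr_ae (Eventually.of_forall fun z => ?_)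
  simp only [Submodule.coe_add, Pi.add_apply, mul_add]

/-- Needed to know that u itself is in L²: the Sobolev norm only speaks of its weak derivatives,
including the one of order zero. -/
lemma IsWeakDeriv.ae_eq_of_zero {u w : Torus3 → Vel → ℝ} (h : IsWeakDeriv 0 0 u w) :
    ∀ᵐ z : Torus3 × Vel, u z.1 z.2 = w z.1 z.2 := by
  obtain ⟨ρ, hρ⟩ := exists_isMollifier
  have h1 := hρ.ae_eq_zero_of_wave (h := fun x v => u x v - w x v) (h.1.sub h.2.1) fun k c _ n j => by
    set ψ := VTest.trans (TopologicalSpace.denseSeq Vel j) (hρ.test n)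
    have h2 := h.2.2 _ (isTestXV_wave c k ψ)
    simp only [partialXV_zero_wave, VTest.DD_zero, Module.End.one_apply, Pi.zero_apply,
      Finset.sum_const_zero, add_zero, pow_zero, one_mul] at h2
    simp only [sub_mul]
    rw [integral_sub (integrable_mul_wave h.1 ψ c k) (integrable_mul_wave h.2.1 ψ c k), h2, sub_self]
  filter_upwards [h1] with z hz
  linarith

/-- The weak derivative `(1 - Δ_x) ∂_v^β`, from the family of weak derivatives. -/
def ellip (w : (Fin 3 → ℕ) → (Fin 3 → ℕ) → Torus3 → Vel → ℝ) (β : Fin 3 → ℕ) : Torus3 → Vel → ℝ :=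
  fun x v => w 0 β x v - ∑ j, w (Pi.single j 2) β x v

section

variable {u : Torus3 → Vel → ℝ} {w : (Fin 3 → ℕ) → (Fin 3 → ℕ) → Torus3 → Vel → ℝ} {N : ℝ}

lemma zero_mem_multiIndices (m : ℕ) : (0 : Fin 3 → ℕ) ∈ multiIndices m := mem_multiIndices.2 (by simp)

lemma single_mem_multiIndices (j : Fin 3) : (Pi.single j 2 : Fin 3 → ℕ) ∈ multiIndices 2 :=
  mem_multiIndices.2 (sum_single j 2).le

lemma memLp_ellip (hw : IsDerivFamily u w N) {β : Fin 3 → ℕ} (hβ : β ∈ multiIndices 4) :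
    MemLp (fun z : Torus3 × Vel => ellip w β z.1 z.2) 2 ∧
      ∫ z : Torus3 × Vel, ellip w β z.1 z.2 ^ 2 ≤ 16 * (N + 1) ^ 2 := by
  have h0 := hw 0 (zero_mem_multiIndices 2) β hβ
  have h1 := fun j => hw _ (single_mem_multiIndices j) β hβ
  have hm : MemLp (fun z : Torus3 × Vel => ellip w β z.1 z.2) 2 :=
    h0.2.1.sub (memLp_finsetSum _ fun j _ => (h1 j).2.1)
  refine ⟨hm, ?_⟩
  have hle : ∀ z : Torus3 × Vel, ellip w β z.1 z.2 ^ 2 ≤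
      4 * (w 0 β z.1 z.2 ^ 2 + ∑ j, w (Pi.single j 2) β z.1 z.2 ^ 2) := fun z => by
    simp only [ellip, Fin.sum_univ_three]
    set a := w 0 β z.1 z.2
    set b := w (Pi.single 0 2) β z.1 z.2
    set c := w (Pi.single 1 2) β z.1 z.2
    set d := w (Pi.single 2 2) β z.1 z.2
    nlinarith [sq_nonneg (a + b), sq_nonneg (a + c), sq_nonneg (a + d), sq_nonneg (b - c),
      sq_nonneg (b - d), sq_nonneg (c - d)]
  have hi : Integrable fun z : Torus3 × Vel => ∑ j, w (Pi.single j 2) β z.1 z.2 ^ 2 :=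
    integrable_finsetSum _ fun j _ => (h1 j).2.1.integrable_sq
  have hi2 : Integrable fun z : Torus3 × Vel => w 0 β z.1 z.2 ^ 2 + ∑ j, w (Pi.single j 2) β z.1 z.2 ^ 2 :=
    h0.2.1.integrable_sq.add hi
  refine (integral_mono hm.integrable_sq (hi2.const_mul 4) hle).trans ?_
  rw [integral_const_mul, integral_add h0.2.1.integrable_sq hi,
    integral_finsetSum _ fun j _ => (h1 j).2.1.integrable_sq, Fin.sum_univ_three]
  have a0 := h0.2.2
  have a1 := (h1 0).2.2
  have a2 := (h1 1).2.2
  have a3 := (h1 2).2.2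
  linarith

/-- Testing the weak derivatives with a wave in x turns 1 - Δ_x into multiplication by the symbol,
while the velocity derivatives are transferred from the test function to u. -/
lemma symbol_mul_integral_vint (hw : IsDerivFamily u w N) {β : Fin 3 → ℕ} (hβ : β ∈ multiIndices 4) (ψ : VTest) (c : ℂ)
    (k : Fin 3 → ℤ) :
    symbol k * ∫ x, vint u (VTest.DD β ψ) x * wave c k x =
      (-1) ^ (∑ i, β i) * ∫ x, vint (ellip w β) ψ x * wave c k x := by
  have h0 := hw 0 (zero_mem_multiIndices 2) β hβ
  have h1 := fun j => hw _ (single_mem_multiIndices j) β hβ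
  have hu := h0.1.1
  have hl : ∀ f : Torus3 → Vel → ℝ, MemLp (fun z : Torus3 × Vel => f z.1 z.2) 2 →
      LocallyIntegrable fun z : Torus3 × Vel => f z.1 z.2 := fun f hf => hf.locallyIntegrable (by norm_num)
  have hi : ∀ f : Torus3 → Vel → ℝ, MemLp (fun z : Torus3 × Vel => f z.1 z.2) 2 →
      Integrable fun z : Torus3 × Vel => f z.1 z.2 * (wave c k z.1 * (ψ : Vel → ℝ) z.2) := fun f hf =>
    integrable_mul_wave (hl f hf) ψ c k
  have e0 : ∫ x, vint u (VTest.DD β ψ) x * wave c k x =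
      (-1) ^ (∑ i, β i) * ∫ z : Torus3 × Vel, w 0 β z.1 z.2 * (wave c k z.1 * (ψ : Vel → ℝ) z.2) := by
    have h2 := h0.1.2.2 _ (isTestXV_wave c k ψ)
    simp only [partialXV_zero_wave, Pi.zero_apply, Finset.sum_const_zero, zero_add] at h2
    rw [← integral_mul_wave hu, h2]
  have e1 : ∀ j, -(4 * Real.pi ^ 2 * k j ^ 2) * ∫ x, vint u (VTest.DD β ψ) x * wave c k x =
      (-1) ^ (∑ i, β i) * ∫ z : Torus3 × Vel, w (Pi.single j 2) β z.1 z.2 *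
        (wave c k z.1 * (ψ : Vel → ℝ) z.2) := fun j => by
    have h2 := (h1 j).1.2.2 _ (isTestXV_wave c k ψ)
    simp only [partialXV_single_wave, sum_single, pow_add, even_two, Even.neg_pow, one_pow, one_mul] at h2
    rw [← integral_mul_wave hu, ← h2, ← integral_const_mul]
    refine integral_congr_ae (Eventually.of_forall fun z => ?_)
    simp only
    ring
  have e2 : ∫ x, vint (ellip w β) ψ x * wave c k x =
      (∫ z : Torus3 × Vel, w 0 β z.1 z.2 * (wave c k z.1 * (ψ : Vel → ℝ) z.2)) -
        ∑ j, ∫ z : Torus3 × Vel, w (Pi.single j 2) β z.1 z.2 * (wave c k z.1 * (ψ : Vel → ℝ) z.2) := by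
    rw [← integral_mul_wave (hl _ (memLp_ellip hw hβ).1),
      ← integral_finsetSum _ fun j _ => hi _ (h1 j).2.1,
      ← integral_sub (hi _ h0.2.1) (integrable_finsetSum _ fun j _ => hi _ (h1 j).2.1)]
    refine integral_congr_ae (Eventually.of_forall fun z => ?_)
    simp only [ellip, sub_mul, Finset.sum_mul]
  rw [e2, mul_sub, ← e0, Finset.mul_sum]
  simp only [← e1]
  rw [← Finset.sum_mul, symbol, Finset.sum_neg_distrib, ← Finset.mul_sum]
  ring

/-- H²(𝕋³) ⊂ L^∞ applied to a velocity integral of u. The bound needs only the L² norms of ψ₀ and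
the ζ i, not of their derivatives. The 256 is 4 for the square of a sum of four terms, times four
terms, times 16 from `memLp_ellip`. -/
lemma ae_abs_vint_le (hw : IsDerivFamily u w N) {ψ₀ : VTest} {ζ : Fin 3 → VTest} {B : ℝ} {β : Fin 3 → ℕ} (hβ : β ∈ multiIndices 2)
    (h0 : ∫ v, (ψ₀ : Vel → ℝ) v ^ 2 ≤ B) (hζ : ∀ i, ∫ v, (ζ i : Vel → ℝ) v ^ 2 ≤ B) :
    ∀ᵐ x, |vint u (VTest.DD β (ψ₀ + ∑ i, VTest.D i (VTest.D i (ζ i)))) x| ≤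
      embConst * √(256 * (N + 1) ^ 2 * B) := by
  have hβ' : β ∈ multiIndices 4 := mem_multiIndices.2 ((mem_multiIndices.1 hβ).trans (by norm_num))
  have hβi : ∀ i, β + Pi.single i 2 ∈ multiIndices 4 := fun i => mem_multiIndices.2 (by
    have h1 := mem_multiIndices.1 hβ
    simp only [Pi.add_apply, Finset.sum_add_distrib, sum_single]
    omega)
  have hu : MemLp (fun z : Torus3 × Vel => u z.1 z.2) 2 := by
    have h1 := hw 0 (zero_mem_multiIndices 2) 0 (zero_mem_multiIndices 4)
    refine h1.2.1.ae_eq ?_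
    filter_upwards [h1.1.ae_eq_of_zero] with z hz using hz.symm
  -- The two extra derivatives are added to β. This is where four velocity derivatives of u are
  -- required to control |β| ≤ 2.
  have hDD : VTest.DD β (ψ₀ + ∑ i, VTest.D i (VTest.D i (ζ i))) =
      VTest.DD β ψ₀ + ∑ i, VTest.DD (β + Pi.single i 2) (ζ i) := by
    simp only [map_add, map_sum, VTest.DD_add_single, pow_two, Module.End.mul_apply]
  set V : Torus3 → ℝ := fun x => (-1) ^ (∑ i, β i) *
    (vint (ellip w β) ψ₀ x + ∑ i, vint (ellip w (β + Pi.single i 2)) (ζ i) x) with hV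
  have m0 := memLp_vint (memLp_ellip hw hβ').1 (VTest.memLp ψ₀)
  have mi := fun i => memLp_vint (memLp_ellip hw (hβi i)).1 (VTest.memLp (ζ i))
  have hVm : MemLp V 2 := (m0.1.add (memLp_finsetSum _ fun i _ => (mi i).1)).const_mul _
  have hVle : ∫ x, V x ^ 2 ≤ 256 * (N + 1) ^ 2 * B := by
    have hB : 0 ≤ B := (integral_nonneg fun v => sq_nonneg _).trans h0
    have hle : ∀ x, V x ^ 2 ≤ 4 * (vint (ellip w β) ψ₀ x ^ 2 +
        ∑ i, vint (ellip w (β + Pi.single i 2)) (ζ i) x ^ 2) := fun x => by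
      have hsgn : ((-1 : ℝ) ^ (∑ i, β i)) ^ 2 = 1 := by rw [← pow_mul, mul_comm, pow_mul]; simp
      simp only [hV, mul_pow, hsgn, one_mul]
      simp only [Fin.sum_univ_three]
      set a := vint (ellip w β) ψ₀ x
      set b := vint (ellip w (β + Pi.single 0 2)) (ζ 0) x
      set c := vint (ellip w (β + Pi.single 1 2)) (ζ 1) x
      set d := vint (ellip w (β + Pi.single 2 2)) (ζ 2) x
      nlinarith [sq_nonneg (a - b), sq_nonneg (a - c), sq_nonneg (a - d), sq_nonneg (b - c),
        sq_nonneg (b - d), sq_nonneg (c - d)]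
    have hb : ∀ {β' : Fin 3 → ℕ} {χ : VTest}, β' ∈ multiIndices 4 → ∫ v, (χ : Vel → ℝ) v ^ 2 ≤ B →
        ∫ x, vint (ellip w β') χ x ^ 2 ≤ 16 * (N + 1) ^ 2 * B := fun {β'} {χ} h1 h2 =>
      (memLp_vint (memLp_ellip hw h1).1 (VTest.memLp χ)).2.trans
        (mul_le_mul (memLp_ellip hw h1).2 h2 (integral_nonneg fun v => sq_nonneg _) (by positivity))
    have hi : Integrable fun x => ∑ i, vint (ellip w (β + Pi.single i 2)) (ζ i) x ^ 2 :=
      integrable_finsetSum _ fun i _ => (mi i).1.integrable_sq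
    have hi2 : Integrable fun x => vint (ellip w β) ψ₀ x ^ 2 +
        ∑ i, vint (ellip w (β + Pi.single i 2)) (ζ i) x ^ 2 := m0.1.integrable_sq.add hi
    refine (integral_mono hVm.integrable_sq (hi2.const_mul 4) hle).trans ?_
    rw [integral_const_mul, integral_add m0.1.integrable_sq hi,
      integral_finsetSum _ fun i _ => (mi i).1.integrable_sq, Fin.sum_univ_three]
    have a0 := hb hβ' h0
    have a1 := hb (hβi 0) (hζ 0)
    have a2 := hb (hβi 1) (hζ 1)
    have a3 := hb (hβi 2) (hζ 2)
    linarith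
  have hU := memLp_vint hu (VTest.memLp (VTest.DD β (ψ₀ + ∑ i, VTest.D i (VTest.D i (ζ i)))))
  have key := ae_abs_le_of_wave hU.1 hVm fun k c _ => by
    have hs : ∀ i, (-1 : ℝ) ^ (∑ l, (β + Pi.single i 2 : Fin 3 → ℕ) l) = (-1) ^ (∑ l, β l) := fun i => by
      simp only [Pi.add_apply, Finset.sum_add_distrib, sum_single, pow_add, even_two, Even.neg_pow,
        one_pow, mul_one]
    have hl : LocallyIntegrable fun z : Torus3 × Vel => u z.1 z.2 := hu.locallyIntegrable (by norm_num)
    have hi : ∀ f : Torus3 → ℝ, MemLp f 2 → Integrable fun x => f x * wave c k x := fun f hf =>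
      (hf.integrable (by norm_num)).mul_bdd (c := ‖c‖) (continuous_wave c k).aestronglyMeasurable
        (Eventually.of_forall fun x => abs_wave_le c k x)
    have e : ∫ x, V x * wave c k x = (-1) ^ (∑ i, β i) * ((∫ x, vint (ellip w β) ψ₀ x * wave c k x) +
        ∑ i, ∫ x, vint (ellip w (β + Pi.single i 2)) (ζ i) x * wave c k x) := by
      rw [← integral_finsetSum _ fun i _ => hi _ (mi i).1, ← integral_add (hi _ m0.1)
        (integrable_finsetSum _ fun i _ => hi _ (mi i).1), ← integral_const_mul]
      refine integral_congr_ae (Eventually.of_forall fun x => ?_)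
      simp only [hV, Finset.sum_mul, mul_add, add_mul, Finset.mul_sum, mul_assoc]
    rw [e, hDD, Fin.sum_univ_three, integral_vint_add_mul_wave hl, integral_vint_add_mul_wave hl,
      integral_vint_add_mul_wave hl, mul_add, mul_add, mul_add, symbol_mul_integral_vint hw hβ',
      symbol_mul_integral_vint hw (hβi 0), symbol_mul_integral_vint hw (hβi 1),
      symbol_mul_integral_vint hw (hβi 2), hs, hs, hs]
    simp only [Fin.sum_univ_three]
    ring
  filter_upwards [key] with x hx
  exact hx.trans (mul_le_mul_of_nonneg_left (Real.sqrt_le_sqrt hVle) (Real.sqrt_nonneg _))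

end

end

end QuantumBoltzmann

namespace QuantumBoltzmann

noncomputable section

open scoped Convolution

/-! ### Functions with bounded second derivatives -/

section

variable {h : Vel → ℝ} {ψ : VTest}

lemma VTest.hasCompactSupport_neg (ψ : VTest) : HasCompactSupport fun v => (ψ : Vel → ℝ) (-v) :=
  ψ.2.2.comp_homeomorph (Homeomorph.neg Vel)

lemma contDiff_avg_test (hh : LocallyIntegrable h) (ψ : VTest) : ContDiff ℝ ∞ (avg ψ h) := by
  rw [avg_eq_convolution]
  exact (VTest.hasCompactSupport_neg ψ).contDiff_convolution_left _ (ψ.2.1.comp contDiff_neg) hh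

/-- The sign appears because the average has kernel κ(w - v), differentiated in v. -/
lemma dV_avg (hh : LocallyIntegrable h) (ψ : VTest) (i : Fin 3) (v : Vel) :
    dV i (avg ψ h) v = -avg (VTest.D i ψ) h v := by
  have hd : Differentiable ℝ (ψ : Vel → ℝ) := ψ.2.1.differentiable (by simp)
  have hc : ContDiff ℝ 1 fun v => (ψ : Vel → ℝ) (-v) := (ψ.2.1.comp contDiff_neg).of_le (by simp)
  rw [dV_eq_fderiv ((contDiff_avg_test hh ψ).differentiable (by simp)), avg_eq_convolution,
    ((VTest.hasCompactSupport_neg ψ).hasFDerivAt_convolution_left (ContinuousLinearMap.lsmul ℝ ℝ) hc hh v).fderiv]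
  have hex := ((VTest.hasCompactSupport_neg ψ).fderiv ℝ).convolutionExists_left
    (ContinuousLinearMap.precompL Vel (ContinuousLinearMap.lsmul ℝ ℝ)) (hc.continuous_fderiv (by simp)) hh v
  rw [convolution_def, ContinuousLinearMap.integral_apply hex]
  rw [← integral_sub_left_eq_self _ volume v, avg, ← integral_neg]
  refine integral_congr_ae (Eventually.of_forall fun w => ?_)
  have h1 : fderiv ℝ (fun v => (ψ : Vel → ℝ) (-v)) (v - w) = -fderiv ℝ (ψ : Vel → ℝ) (w - v) := by
    have h2 := ((hd (-(v - w))).hasFDerivAt.comp (v - w) (hasFDerivAt_id (v - w)).neg).fderiv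
    refine h2.trans ?_
    ext y
    simp
  simp only [ContinuousLinearMap.precompL_apply, h1, VTest.coe_D, dV_eq_fderiv hd, sub_sub_cancel]
  simp

end

lemma norm_clm_le_sum (φ : Vel →L[ℝ] ℝ) : ‖φ‖ ≤ ∑ i, |φ (EuclideanSpace.single i 1)| := by
  refine φ.opNorm_le_bound (Finset.sum_nonneg fun i _ => abs_nonneg _) fun x => ?_
  have hx : x = ∑ i, x i • (EuclideanSpace.single i 1 : Vel) := by
    ext j
    fin_cases j <;> simp [Fin.sum_univ_three]
  conv_lhs => rw [hx]
  rw [map_sum, Finset.sum_mul]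
  refine (norm_sum_le _ _).trans (Finset.sum_le_sum fun i _ => ?_)
  rw [map_smul, smul_eq_mul, norm_mul, mul_comm]
  exact mul_le_mul_of_nonneg_left (PiLp.norm_apply_le x i) (abs_nonneg _)

/-- Bounded nonnegative functions with the difference bounds that follow from bounded first and
second derivatives. -/
structure IsTame (L : ℝ) (f : Vel → ℝ) : Prop where
  nonneg : ∀ v, 0 ≤ f v
  le : ∀ v, f v ≤ L
  lip : ∀ v y, |f (v + y) - f v| ≤ L * ‖y‖
  sqrt_lip : ∀ v y, |f (v + y) - f v| ≤ ‖y‖ * √(4 * L * f v) + L * ‖y‖ ^ 2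
  diff2 : ∀ v a b, |f (v + a) + f (v + b) - 2 * f v| ≤ L * (‖a‖ ^ 2 + ‖b‖ ^ 2 + ‖a + b‖)

/-- Summing coordinates bounds the gradient by 3K and its Lipschitz constant by 9K; the difference
bounds are Taylor's formula, and the square-root bound also uses nonnegativity. -/
lemma isTame_of_dV {f : Vel → ℝ} {K : ℝ} (hf : ContDiff ℝ ∞ f) (hf0 : ∀ v, 0 ≤ f v) (hK : ∀ v, |f v| ≤ K)
    (h1 : ∀ i v, |dV i f v| ≤ K) (h2 : ∀ i j v, |dV j (dV i f) v| ≤ K) : IsTame (9 * K) f := by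
  have hK0 : 0 ≤ K := (abs_nonneg _).trans (hK 0)
  have hbd : ∀ g : Vel → ℝ, ContDiff ℝ ∞ g → (∀ i v, |dV i g v| ≤ K) → ∀ v, ‖fderiv ℝ g v‖ ≤ 3 * K :=
    fun g hg h v => by
      refine (norm_clm_le_sum _).trans ?_
      simp only [← dV_eq_fderiv (hg.differentiable (by simp))]
      exact (Finset.sum_le_sum fun i _ => h i v).trans_eq (by simp)
  have hlip : ∀ g : Vel → ℝ, ContDiff ℝ ∞ g → (∀ i v, |dV i g v| ≤ K) → ∀ v w,
      ‖g w - g v‖ ≤ 3 * K * ‖w - v‖ := fun g hg h v w =>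
    convex_univ.norm_image_sub_le_of_norm_fderiv_le (𝕜 := ℝ)
      (fun x _ => hg.differentiable (by simp) x) (fun x _ => hbd g hg h x) (mem_univ v) (mem_univ w)
  have hfd : Differentiable ℝ f := hf.differentiable (by simp)
  have hlip2 : ∀ v w, ‖fderiv ℝ f w - fderiv ℝ f v‖ ≤ 9 * K * ‖w - v‖ := fun v w => by
    refine (norm_clm_le_sum _).trans ?_
    simp only [_root_.sub_apply, ← dV_eq_fderiv hfd]
    refine (Finset.sum_le_sum fun i _ => hlip (dV i f) (contDiff_dV hf i) (h2 i) v w).trans_eq ?_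
    simp
    ring
  have htay : ∀ v y, |f (v + y) - f v - fderiv ℝ f v y| ≤ 9 * K * ‖y‖ ^ 2 := fun v y => by
    have := (convex_closedBall v ‖y‖).norm_image_sub_le_of_norm_fderiv_le' (𝕜 := ℝ) (f := f)
      (φ := fderiv ℝ f v) (C := 9 * K * ‖y‖) (x := v) (y := v + y) (fun x _ => hfd x) (fun x hx => ?_)
      (by simp) (by simp)
    · rw [add_sub_cancel_left] at this
      exact this.trans_eq (by ring)
    · refine (hlip2 v x).trans ?_
      gcongr
      simpa [dist_eq_norm] using hx
  -- The Taylor majorant of f along the line v + t y is a quadratic in t that stays above f ≥ 0, so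
  -- its discriminant is nonpositive.
  have hdisc : ∀ v y, |fderiv ℝ f v y| ≤ ‖y‖ * √(4 * (9 * K) * f v) := fun v y => by
    have h3 : discrim (9 * K * ‖y‖ ^ 2) (fderiv ℝ f v y) (f v) ≤ 0 := by
      refine discrim_le_zero fun t => ?_
      have h4 := (abs_le.1 (htay v (t • y))).2
      rw [map_smul, norm_smul, smul_eq_mul, mul_pow, Real.norm_eq_abs, sq_abs] at h4
      have h5 := hf0 (v + t • y)
      nlinarith
    rw [discrim] at h3
    refine Real.abs_le_sqrt (by nlinarith : (fderiv ℝ f v y) ^ 2 ≤ ‖y‖ ^ 2 * (4 * (9 * K) * f v)) |>.trans_eq ?_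
    rw [Real.sqrt_mul (sq_nonneg _), Real.sqrt_sq (norm_nonneg _)]
  refine ⟨hf0, fun v => ?_, fun v y => ?_, fun v y => ?_, fun v a b => ?_⟩
  · linarith [le_abs_self (f v), hK v]
  · have h3 := hlip f hf h1 v (v + y)
    rw [add_sub_cancel_left, Real.norm_eq_abs] at h3
    nlinarith [norm_nonneg y]
  · have h3 := htay v y
    have h4 := hdisc v y
    rw [abs_le] at *
    constructor <;> linarith [h3.1, h3.2, h4.1, h4.2]
  · have h3 := htay v a
    have h4 := htay v b
    have h5 : |fderiv ℝ f v (a + b)| ≤ 9 * K * ‖a + b‖ := by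
      refine ((fderiv ℝ f v).le_opNorm _).trans ?_
      gcongr
      linarith [hbd f hf h1 v]
    rw [map_add] at h5
    rw [abs_le] at *
    constructor <;> nlinarith [h3.1, h3.2, h4.1, h4.2, h5.1, h5.2]

/-- Almost everywhere convergence is convergence on a dense set; the common Lipschitz constant
extends it to every point, and the closed inequalities pass to the limit. -/
lemma exists_isTame_of_ae_tendsto {f : ℕ → Vel → ℝ} {h : Vel → ℝ} {L : ℝ} (hf : ∀ n, IsTame L (f n))
    (hlim : ∀ᵐ v, Tendsto (fun n => f n v) atTop (𝓝 (h v))) : ∃ F, IsTame L F ∧ h =ᵐ[volume] F := by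
  have hL : 0 ≤ L := ((hf 0).nonneg 0).trans ((hf 0).le 0)
  have hd : Dense {v | Tendsto (fun n => f n v) atTop (𝓝 (h v))} := Measure.dense_of_ae hlim
  have hcau : ∀ v, ∃ l, Tendsto (fun n => f n v) atTop (𝓝 l) := fun v => by
    refine cauchySeq_tendsto_of_complete (Metric.cauchySeq_iff'.2 fun ε hε => ?_)
    obtain ⟨s, hs, hvs⟩ := hd.exists_dist_lt v (show 0 < ε / (4 * (L + 1)) by positivity)
    have h1 : ∀ n, |f n v - f n s| ≤ ε / 4 := fun n => by
      have := (hf n).lip s (v - s)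
      rw [add_sub_cancel] at this
      refine this.trans ?_
      rw [dist_eq_norm, lt_div_iff₀ (by positivity)] at hvs
      nlinarith [norm_nonneg (v - s)]
    obtain ⟨n₀, hn₀⟩ := Metric.cauchySeq_iff'.1 (Tendsto.cauchySeq hs) (ε / 2) (by positivity)
    refine ⟨n₀, fun n hn => ?_⟩
    have h2 := hn₀ n hn
    have h3 := h1 n
    have h4 := h1 n₀
    rw [Real.dist_eq] at *
    rw [abs_lt] at *
    rw [abs_le] at *
    constructor <;> linarith [h2.1, h2.2, h3.1, h3.2, h4.1, h4.2]
  choose F hF using hcau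
  refine ⟨F, ⟨fun v => ?_, fun v => ?_, fun v y => ?_, fun v y => ?_, fun v a b => ?_⟩, ?_⟩
  · exact ge_of_tendsto' (hF v) fun n => (hf n).nonneg v
  · exact le_of_tendsto' (hF v) fun n => (hf n).le v
  · exact le_of_tendsto' ((hF _).sub (hF v)).abs fun n => (hf n).lip v y
  · exact le_of_tendsto_of_tendsto' ((hF _).sub (hF v)).abs
      ((((hF v).const_mul _).sqrt.const_mul _).add tendsto_const_nhds) fun n => (hf n).sqrt_lip v y
  · exact le_of_tendsto' (((hF _).add (hF _)).sub ((hF v).const_mul 2)).abs fun n => (hf n).diff2 v a b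
  · filter_upwards [hlim] with v hv
    exact tendsto_nhds_unique hv (hF v)

end

end QuantumBoltzmann

namespace QuantumBoltzmann

noncomputable section

/-! ### Functions in `H²_x H⁴` have tame velocity slices -/

lemma VTest.DD_trans (β : Fin 3 → ℕ) (v₀ : Vel) (ψ : VTest) :
    VTest.DD β (VTest.trans v₀ ψ) = VTest.trans v₀ (VTest.DD β ψ) := by
  have h : ∀ (i : Fin 3) (n : ℕ) (ψ : VTest), (VTest.D i ^ n) (VTest.trans v₀ ψ) =
      VTest.trans v₀ ((VTest.D i ^ n) ψ) := fun i n ψ => by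
    induction n with
    | zero => simp
    | succ n ih => rw [pow_succ', Module.End.mul_apply, ih, VTest.D_trans, Module.End.mul_apply]
  simp only [VTest.DD, Module.End.mul_apply, h]

lemma VTest.trans_add_sum (v₀ : Vel) (ψ : VTest) (χ : Fin 3 → VTest) :
    VTest.trans v₀ (ψ + ∑ i, χ i) = VTest.trans v₀ ψ + ∑ i, VTest.trans v₀ (χ i) := by
  ext v
  simp only [VTest.coe_trans, Submodule.coe_add, Pi.add_apply, Submodule.coe_sum, Finset.sum_apply]

lemma VTest.DD_single (i : Fin 3) : VTest.DD (Pi.single i 1) = VTest.D i := by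
  have := VTest.DD_add_single 0 i 1
  rwa [zero_add, VTest.DD_zero, one_mul, pow_one] at this

/-- Each mollified slice has derivatives up to order two bounded uniformly in the scale, first at a
dense sequence of centres for almost every x, then everywhere by continuity. The mollifications
converge to the slice, so it has a tame version. -/
lemma exists_isTame_of_sobolevNorm {N : ℝ} (hN : 0 ≤ N) : ∃ L : ℝ, ∀ u : Torus3 → Vel → ℝ,
    sobolevNorm 2 4 u ≤ ENNReal.ofReal N → (∀ᵐ z : Torus3 × Vel, 0 ≤ u z.1 z.2) →
      ∀ᵐ x, ∃ f, IsTame L f ∧ u x =ᵐ[volume] f := by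
  obtain ⟨ρ, hρ, ζ, B, hB, hdec⟩ := exists_mollifier_decomposition
  set B' := max B (∫ v, (hρ.test 0 : Vel → ℝ) v ^ 2) with hB'
  set K := embConst * √(256 * (N + 1) ^ 2 * B') with hK
  refine ⟨9 * K, fun u hu hu0 => ?_⟩
  obtain ⟨w, hw⟩ := exists_weakDeriv hN hu
  have hl : LocallyIntegrable fun z : Torus3 × Vel => u z.1 z.2 :=
    (hw 0 (zero_mem_multiIndices 2) 0 (zero_mem_multiIndices 4)).1.1
  have h1 : ∀ᵐ x, ∀ (n j : ℕ) (β : Fin 3 → ℕ), β ∈ multiIndices 2 →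
      |vint u (VTest.DD β (VTest.trans (TopologicalSpace.denseSeq Vel j) (hρ.test n))) x| ≤ K := by
    refine ae_all_iff.2 fun n => ae_all_iff.2 fun j => ae_all_iff.2 fun β => ?_
    by_cases hβ : β ∈ multiIndices 2
    swap
    · exact Eventually.of_forall fun x h => absurd h hβ
    have h2 := ae_abs_vint_le (ψ₀ := VTest.trans (TopologicalSpace.denseSeq Vel j) (hρ.test 0))
      (ζ := fun i => VTest.trans (TopologicalSpace.denseSeq Vel j) (ζ n i)) (B := B') hw hβ
      (by rw [VTest.integral_trans_sq]; exact le_max_right _ _)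
      (fun i => by rw [VTest.integral_trans_sq]; exact (hB n i).trans (le_max_left _ _))
    simp only [VTest.D_trans] at h2
    rw [← VTest.trans_add_sum, ← hdec] at h2
    filter_upwards [h2] with x hx _ using hx
  have h2 : ∀ᵐ x, ∀ᵐ v, 0 ≤ u x v := Measure.ae_ae_of_ae_prod hu0
  filter_upwards [h1, h2, ae_locallyIntegrable_slice hl] with x hx hx0 hxl
  have hbd : ∀ (n : ℕ) (β : Fin 3 → ℕ), β ∈ multiIndices 2 → ∀ v,
      |avg (VTest.DD β (hρ.test n)) (u x) v| ≤ K := fun n β hβ v => by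
    refine (TopologicalSpace.denseRange_denseSeq Vel).induction_on
      (p := fun v => |avg (VTest.DD β (hρ.test n)) (u x) v| ≤ K) v
      (isClosed_le (contDiff_avg_test hxl _).continuous.abs continuous_const) fun j => ?_
    have h3 := hx n j β hβ
    rw [VTest.DD_trans] at h3
    simpa only [vint, avg, VTest.coe_trans, mul_comm] using h3
  have key : ∀ n, IsTame (9 * K) (avg (hρ.test n) (u x)) := fun n => by
    have hd1 : ∀ i, dV i (avg (hρ.test n) (u x)) = fun v => -avg (VTest.D i (hρ.test n)) (u x) v :=
      fun i => funext fun v => dV_avg hxl _ i v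
    refine isTame_of_dV (contDiff_avg_test hxl _) (fun v => ?_) (fun v => ?_) (fun i v => ?_) fun i j v => ?_
    · refine integral_nonneg_of_ae ?_
      filter_upwards [hx0] with w hw0
      exact mul_nonneg (hρ.scaled_nonneg (by positivity) _) hw0
    · have := hbd n 0 (zero_mem_multiIndices 2) v
      rwa [VTest.DD_zero, Module.End.one_apply] at this
    · have := hbd n (Pi.single i 1) (mem_multiIndices.2 (by rw [sum_single]; norm_num)) v
      rw [VTest.DD_single, ← abs_neg] at this
      rwa [hd1]
    · have := hbd n (Pi.single i 1 + Pi.single j 1) (mem_multiIndices.2 (by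
        simp only [Pi.add_apply, Finset.sum_add_distrib, sum_single]; norm_num)) v
      rw [VTest.DD_add_single, VTest.DD_single, pow_one, (VTest.commute_D i j).eq, Module.End.mul_apply] at this
      rw [hd1]
      have h3 : dV j (fun v => -avg (VTest.D i (hρ.test n)) (u x) v) v =
          -dV j (avg (VTest.D i (hρ.test n)) (u x)) v := deriv.fun_neg
      rwa [h3, dV_avg hxl, neg_neg]
  exact exists_isTame_of_ae_tendsto key (hρ.ae_tendsto_avg (fun n => by positivity) tendsto_half_pow hxl)

/-! ### Gaussian weights -/

lemma abs_exp_sub_one_le (x : ℝ) : |Real.exp x - 1| ≤ |x| * Real.exp |x| := by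
  have := Complex.norm_exp_sub_sum_le_norm_mul_exp (x : ℂ) 1
  simp only [Finset.range_one, Finset.sum_singleton, pow_zero, Nat.factorial_zero, Nat.cast_one, div_one,
    pow_one, Complex.norm_real, Real.norm_eq_abs] at this
  rw [← Real.norm_eq_abs, ← Complex.norm_real]
  push_cast
  exact this

lemma abs_exp_sub_one_sub_le (x : ℝ) : |Real.exp x - 1 - x| ≤ x ^ 2 * Real.exp |x| := by
  have := Complex.norm_exp_sub_sum_le_norm_mul_exp (x : ℂ) 2
  simp only [Finset.sum_range_succ, Finset.range_one, Finset.sum_singleton, pow_zero, Nat.factorial, Nat.cast_one, div_one,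
    pow_one, Complex.norm_real, Real.norm_eq_abs, sq_abs] at this
  rw [← Real.norm_eq_abs, ← Complex.norm_real]
  push_cast
  rw [sub_sub]
  simpa using this

/-- The weight `μ^{1/4}`. -/
def gauss (v : Vel) : ℝ := maxwellian v ^ (1 / 4 : ℝ)

/-- A majorant of the differences of `gauss` on unit balls. -/
def gaussMaj (v : Vel) : ℝ := gauss v * (1 + ‖v‖) ^ 2 * Real.exp ((1 + ‖v‖) / 4)

lemma gauss_eq (v : Vel) :
    gauss v = ((2 * Real.pi) ^ (-(3 / 2) : ℝ)) ^ (1 / 4 : ℝ) * Real.exp (-(‖v‖ ^ 2 / 8)) := by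
  rw [gauss, maxwellian, Real.mul_rpow (by positivity) (by positivity), ← Real.exp_mul]
  congr 2
  ring

lemma gauss_pos (v : Vel) : 0 < gauss v := by rw [gauss_eq]; positivity

lemma continuous_gauss : Continuous gauss := by
  have : gauss = fun v => _ := funext gauss_eq
  rw [this]
  fun_prop

lemma gauss_le_exp (v : Vel) : gauss v ≤ Real.exp (-(‖v‖ ^ 2 / 8)) := by
  rw [gauss_eq]
  refine mul_le_of_le_one_left (Real.exp_pos _).le (Real.rpow_le_one (by positivity) ?_ (by norm_num))
  exact Real.rpow_le_one_of_one_le_of_nonpos (by nlinarith [Real.pi_gt_three]) (by norm_num)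

lemma gauss_add (v y : Vel) :
    gauss (v + y) = gauss v * Real.exp (-((2 * inner ℝ v y + ‖y‖ ^ 2) / 8)) := by
  rw [gauss_eq, gauss_eq, mul_assoc, ← Real.exp_add, norm_add_sq_real]
  congr 2
  ring

/-- Only half of the Gaussian exponent is needed to absorb the polynomial and exponential growth.
The other half is the factor √gauss in the second bound. -/
lemma exists_gaussMaj_le : ∃ A : ℝ, 0 < A ∧
    ∀ v, gaussMaj v ≤ A * wt v ∧ gaussMaj v ≤ A * √(wt v * gauss v) := by
  refine ⟨720 * Real.exp (15 / 2), by positivity, fun v => ?_⟩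
  set R := 1 + ‖v‖ with hR
  have hR1 : 1 ≤ R := by simp [hR]
  have hR0 : 0 < R := by linarith
  -- R⁶ ≤ 720 e^R leaves the exponent 5R/4 - |v|²/16, whose maximum, at |v| = 10, is 15/2.
  have key : Real.exp (-(‖v‖ ^ 2 / 16)) * R ^ 6 * Real.exp (R / 4) ≤ 720 * Real.exp (15 / 2) := by
    have h1 := Real.pow_div_factorial_le_exp R hR0.le 6
    rw [div_le_iff₀ (by positivity)] at h1
    have h2 : ((Nat.factorial 6 : ℕ) : ℝ) = 720 := by norm_num [Nat.factorial]
    rw [h2] at h1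
    calc Real.exp (-(‖v‖ ^ 2 / 16)) * R ^ 6 * Real.exp (R / 4)
        ≤ Real.exp (-(‖v‖ ^ 2 / 16)) * (Real.exp R * 720) * Real.exp (R / 4) := by gcongr
      _ = 720 * Real.exp (-(‖v‖ ^ 2 / 16) + R + R / 4) := by
        rw [Real.exp_add (-(‖v‖ ^ 2 / 16) + R), Real.exp_add (-(‖v‖ ^ 2 / 16)) R]; ring
      _ ≤ _ := by
        gcongr
        rw [hR]
        nlinarith [sq_nonneg (‖v‖ / 4 - 5 / 2)]
  have hs : √(gauss v) ≤ Real.exp (-(‖v‖ ^ 2 / 16)) := by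
    refine (Real.sqrt_le_sqrt (gauss_le_exp v)).trans_eq ?_
    rw [Real.sqrt_eq_iff_mul_self_eq (Real.exp_pos _).le (Real.exp_pos _).le, ← Real.exp_add]
    congr 1
    ring
  have hg : gauss v ≤ Real.exp (-(‖v‖ ^ 2 / 16)) := by
    refine (gauss_le_exp v).trans (Real.exp_le_exp.2 ?_)
    nlinarith [sq_nonneg ‖v‖]
  have hw : wt v = (R ^ 4)⁻¹ := rfl
  have hw2 : √(wt v) = (R ^ 2)⁻¹ := by
    rw [hw, Real.sqrt_eq_iff_mul_self_eq (by positivity) (by positivity)]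
    field_simp
  have hE := Real.exp_pos (R / 4)
  constructor
  · rw [hw, ← div_eq_mul_inv, le_div_iff₀ (by positivity)]
    refine le_trans ?_ key
    calc gaussMaj v * R ^ 4 = gauss v * R ^ 6 * Real.exp (R / 4) := by rw [gaussMaj]; ring
      _ ≤ _ := by gcongr
  · rw [Real.sqrt_mul (wt_pos v).le, hw2, ← mul_assoc, ← div_eq_mul_inv]
    have h3 : gaussMaj v = √(gauss v) * √(gauss v) * R ^ 2 * Real.exp (R / 4) := by
      rw [Real.mul_self_sqrt (gauss_pos v).le, gaussMaj]
    rw [h3]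
    calc √(gauss v) * √(gauss v) * R ^ 2 * Real.exp (R / 4)
        = (√(gauss v) * R ^ 4 * Real.exp (R / 4)) / R ^ 2 * √(gauss v) := by field_simp
      _ ≤ (Real.exp (-(‖v‖ ^ 2 / 16)) * R ^ 6 * Real.exp (R / 4)) / R ^ 2 * √(gauss v) := by
        have h4 : R ^ 4 ≤ R ^ 6 := pow_le_pow_right₀ hR1 (by norm_num)
        gcongr
      _ ≤ _ := by gcongr

lemma gauss_le_gaussMaj (v : Vel) : gauss v ≤ gaussMaj v := by
  have h1 : 1 ≤ (1 + ‖v‖) ^ 2 := one_le_pow₀ (by simp)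
  have h2 : 1 ≤ Real.exp ((1 + ‖v‖) / 4) := Real.one_le_exp (by positivity)
  have h3 := gauss_pos v
  calc gauss v = gauss v * 1 * 1 := by ring
    _ ≤ _ := by unfold gaussMaj; gcongr

lemma abs_gauss_exponent_le (v : Vel) {y : Vel} (hy : ‖y‖ ≤ 1) :
    |(-((2 * inner ℝ v y + ‖y‖ ^ 2) / 8))| ≤ (1 + ‖v‖) / 4 * ‖y‖ := by
  have h1 := abs_le.1 (abs_real_inner_le_norm v y)
  have h2 := norm_nonneg y
  rw [abs_le]
  constructor <;> nlinarith [h1.1, h1.2]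

lemma abs_gauss_exponent_le' (v : Vel) {y : Vel} (hy : ‖y‖ ≤ 1) :
    |(-((2 * inner ℝ v y + ‖y‖ ^ 2) / 8))| ≤ (1 + ‖v‖) / 4 :=
  (abs_gauss_exponent_le v hy).trans (mul_le_of_le_one_right (by positivity) hy)

lemma gauss_add_le (v : Vel) {y : Vel} (hy : ‖y‖ ≤ 1) : gauss (v + y) ≤ gaussMaj v := by
  have h1 : 1 ≤ (1 + ‖v‖) ^ 2 := one_le_pow₀ (by simp)
  have h3 := gauss_pos v
  rw [gauss_add, gaussMaj]
  calc _ ≤ gauss v * 1 * Real.exp ((1 + ‖v‖) / 4) := by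
        rw [mul_one]
        gcongr
        exact (le_abs_self _).trans (abs_gauss_exponent_le' v hy)
    _ ≤ _ := by gcongr

lemma abs_gauss_add_sub_le (v : Vel) {y : Vel} (hy : ‖y‖ ≤ 1) :
    |gauss (v + y) - gauss v| ≤ gaussMaj v * ‖y‖ := by
  have h3 := gauss_pos v
  set E := -((2 * inner ℝ v y + ‖y‖ ^ 2) / 8) with hE
  have h1 : gauss (v + y) - gauss v = gauss v * (Real.exp E - 1) := by rw [gauss_add]; ring
  have hR : (1 : ℝ) ≤ 1 + ‖v‖ := by simp
  rw [h1, abs_mul, abs_of_pos h3, gaussMaj]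
  calc gauss v * |Real.exp E - 1| ≤ gauss v * (((1 + ‖v‖) / 4 * ‖y‖) * Real.exp ((1 + ‖v‖) / 4)) := by
        gcongr
        refine (abs_exp_sub_one_le E).trans ?_
        gcongr
        · exact abs_gauss_exponent_le v hy
        · exact abs_gauss_exponent_le' v hy
    _ ≤ gauss v * (((1 + ‖v‖) ^ 2 * ‖y‖) * Real.exp ((1 + ‖v‖) / 4)) := by
        gcongr
        nlinarith
    _ = _ := by ring

lemma abs_gauss_diff2_le (v : Vel) {a b : Vel} (ha : ‖a‖ ≤ 1) (hb : ‖b‖ ≤ 1) :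
    |gauss (v + a) + gauss (v + b) - 2 * gauss v| ≤ 2 * gaussMaj v * (‖a‖ ^ 2 + ‖b‖ ^ 2 + ‖a + b‖) := by
  have h3 := gauss_pos v
  set E : Vel → ℝ := fun y => -((2 * inner ℝ v y + ‖y‖ ^ 2) / 8) with hE
  have h1 : gauss (v + a) + gauss (v + b) - 2 * gauss v =
      gauss v * ((Real.exp (E a) - 1 - E a) + (Real.exp (E b) - 1 - E b) + (E a + E b)) := by
    rw [gauss_add, gauss_add]; ring
  set R := 1 + ‖v‖ with hRdef
  have hR : 1 ≤ R := by simp [hRdef]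
  have hexp : 1 ≤ Real.exp (R / 4) := Real.one_le_exp (by positivity)
  have hq : ∀ y : Vel, ‖y‖ ≤ 1 → |Real.exp (E y) - 1 - E y| ≤ R ^ 2 * Real.exp (R / 4) * ‖y‖ ^ 2 := fun y hy => by
    refine (abs_exp_sub_one_sub_le (E y)).trans ?_
    have h4 : E y ^ 2 ≤ (R / 4 * ‖y‖) ^ 2 := by
      rw [← sq_abs]
      exact pow_le_pow_left₀ (abs_nonneg _) (abs_gauss_exponent_le v hy) 2
    calc E y ^ 2 * Real.exp |E y| ≤ (R / 4 * ‖y‖) ^ 2 * Real.exp (R / 4) := by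
          gcongr
          exact abs_gauss_exponent_le' v hy
      _ ≤ _ := by
          have : 0 ≤ R ^ 2 * Real.exp (R / 4) * ‖y‖ ^ 2 := by positivity
          nlinarith
  have hlin : |E a + E b| ≤ R ^ 2 * Real.exp (R / 4) * (‖a‖ ^ 2 + ‖b‖ ^ 2 + ‖a + b‖) := by
    have e : E a + E b = -((2 * inner ℝ v (a + b) + ‖a‖ ^ 2 + ‖b‖ ^ 2) / 8) := by
      simp only [hE, inner_add_right]; ring
    have h5 := abs_le.1 (abs_real_inner_le_norm v (a + b))
    have h6 : |E a + E b| ≤ R * (‖a‖ ^ 2 + ‖b‖ ^ 2 + ‖a + b‖) := by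
      rw [e, abs_le]
      have h7 := norm_nonneg (a + b)
      have h8 := sq_nonneg ‖a‖
      have h9 := sq_nonneg ‖b‖
      have h10 := norm_nonneg v
      constructor <;> nlinarith [h5.1, h5.2, mul_nonneg h10 h7, mul_nonneg h10 h8, mul_nonneg h10 h9]
    refine h6.trans ?_
    gcongr
    nlinarith
  rw [h1, abs_mul, abs_of_pos h3, gaussMaj, ← hRdef]
  have hpos : 0 ≤ R ^ 2 * Real.exp (R / 4) := by positivity
  have hsum : |(Real.exp (E a) - 1 - E a) + (Real.exp (E b) - 1 - E b) + (E a + E b)| ≤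
      2 * (R ^ 2 * Real.exp (R / 4)) * (‖a‖ ^ 2 + ‖b‖ ^ 2 + ‖a + b‖) := by
    refine (abs_add_le _ _).trans ?_
    have h4 := abs_add_le (Real.exp (E a) - 1 - E a) (Real.exp (E b) - 1 - E b)
    have h5 := hq a ha
    have h6 := hq b hb
    have h7 := mul_nonneg hpos (norm_nonneg (a + b))
    linarith
  calc _ ≤ gauss v * (2 * (R ^ 2 * Real.exp (R / 4)) * (‖a‖ ^ 2 + ‖b‖ ^ 2 + ‖a + b‖)) := by gcongr
    _ = _ := by ring

/-- Product rule for differences. The square-root Lipschitz bound survives because gaussMaj √f is at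
most a multiple of √(w · gauss f), and the term where the Gaussian is differenced is reduced to it
by f ≤ √L √f. -/
lemma exists_isRegular_gauss_mul (L : ℝ) : ∃ M : ℝ, ∀ f, IsTame L f → IsRegular M fun v => gauss v * f v := by
  obtain ⟨A, hA, hmaj⟩ := exists_gaussMaj_le
  refine ⟨A * (3 * √L + 4 * L), fun f hf => ?_⟩
  have hL : 0 ≤ L := (hf.nonneg 0).trans (hf.le 0)
  have hmaj0 : ∀ v, 0 ≤ gaussMaj v := fun v => (gauss_pos v).le.trans (gauss_le_gaussMaj v)
  have hsL := Real.sqrt_nonneg L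
  refine ⟨continuous_gauss.mul ?_, fun v => mul_nonneg (gauss_pos v).le (hf.nonneg v), fun v => ?_,
    fun v y hy => ?_, fun v a b ha hb => ?_⟩
  · refine Metric.continuous_iff.2 fun v ε hε => ⟨ε / (L + 1), by positivity, fun w hw => ?_⟩
    have := hf.lip v (w - v)
    rw [add_sub_cancel] at this
    rw [dist_eq_norm, lt_div_iff₀ (by positivity)] at hw
    rw [Real.dist_eq]
    nlinarith [norm_nonneg (w - v)]
  · calc gauss v * f v ≤ gaussMaj v * L := mul_le_mul (gauss_le_gaussMaj v) (hf.le v) (hf.nonneg v) (hmaj0 v)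
      _ ≤ (A * wt v) * L := by gcongr; exact (hmaj v).1
      _ ≤ _ := by
        have := mul_nonneg (mul_nonneg hA.le (wt_pos v).le) (by positivity : 0 ≤ 3 * √L + 3 * L)
        nlinarith
  · have hf0 := hf.nonneg v
    set S := √(wt v * (gauss v * f v)) with hS
    have hSeq : S = √(wt v * gauss v) * √(f v) := by
      rw [hS, ← mul_assoc, Real.sqrt_mul (mul_nonneg (wt_pos v).le (gauss_pos v).le)]
    have h1 : gaussMaj v * √(f v) ≤ A * S := by
      rw [hSeq, ← mul_assoc]
      exact mul_le_mul_of_nonneg_right (hmaj v).2 (Real.sqrt_nonneg _)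
    have h2 : gaussMaj v * f v ≤ A * √L * S := by
      have h3 : f v ≤ √(f v) * √L := by
        conv_lhs => rw [← Real.mul_self_sqrt hf0]
        exact mul_le_mul_of_nonneg_left (Real.sqrt_le_sqrt (hf.le v)) (Real.sqrt_nonneg _)
      calc gaussMaj v * f v ≤ gaussMaj v * (√(f v) * √L) := mul_le_mul_of_nonneg_left h3 (hmaj0 v)
        _ = gaussMaj v * √(f v) * √L := by ring
        _ ≤ A * S * √L := by gcongr
        _ = _ := by ring
    have h4 : √(4 * L * f v) = 2 * √L * √(f v) := by
      rw [Real.sqrt_mul (by positivity), Real.sqrt_mul (by norm_num)]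
      congr 2
      rw [show (4 : ℝ) = 2 ^ 2 by norm_num, Real.sqrt_sq (by norm_num)]
    have e : gauss (v + y) * f (v + y) - gauss v * f v =
        gauss (v + y) * (f (v + y) - f v) + (gauss (v + y) - gauss v) * f v := by ring
    have hy0 := norm_nonneg y
    rw [e]
    calc _ ≤ gaussMaj v * (‖y‖ * √(4 * L * f v) + L * ‖y‖ ^ 2) + gaussMaj v * ‖y‖ * f v := by
          refine (abs_add_le _ _).trans (add_le_add ?_ ?_)
          · rw [abs_mul, abs_of_pos (gauss_pos _)]
            exact mul_le_mul (gauss_add_le v hy) (hf.sqrt_lip v y) (abs_nonneg _) (hmaj0 v)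
          · rw [abs_mul, abs_of_nonneg hf0]
            exact mul_le_mul_of_nonneg_right (abs_gauss_add_sub_le v hy) hf0
      _ = ‖y‖ * (2 * √L * (gaussMaj v * √(f v)) + gaussMaj v * f v) + gaussMaj v * (L * ‖y‖ ^ 2) := by
          rw [h4]; ring
      _ ≤ ‖y‖ * (2 * √L * (A * S) + A * √L * S) + A * wt v * (L * ‖y‖ ^ 2) := by
          gcongr
          exact (hmaj v).1
      _ ≤ _ := by
          have hS0 : 0 ≤ S := Real.sqrt_nonneg _
          have t1 : 0 ≤ A * (4 * L) * (‖y‖ * S) := by positivity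
          have t2 : 0 ≤ A * (3 * √L + 3 * L) * (‖y‖ ^ 2 * wt v) := by
            have := (wt_pos v).le
            positivity
          nlinarith
  · set D := ‖a‖ ^ 2 + ‖b‖ ^ 2 + ‖a + b‖ with hD
    have hD0 : 0 ≤ D := by positivity
    have hf0 := hf.nonneg v
    have e : gauss (v + a) * f (v + a) + gauss (v + b) * f (v + b) - 2 * (gauss v * f v) =
        gauss v * (f (v + a) + f (v + b) - 2 * f v) + (gauss (v + a) + gauss (v + b) - 2 * gauss v) * f v +
          (gauss (v + a) - gauss v) * (f (v + a) - f v) + (gauss (v + b) - gauss v) * (f (v + b) - f v) := by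
      ring
    have h1 : |gauss v * (f (v + a) + f (v + b) - 2 * f v)| ≤ gaussMaj v * (L * D) := by
      rw [abs_mul, abs_of_pos (gauss_pos v)]
      exact mul_le_mul (gauss_le_gaussMaj v) (hf.diff2 v a b) (abs_nonneg _) (hmaj0 v)
    have h2 : |(gauss (v + a) + gauss (v + b) - 2 * gauss v) * f v| ≤ 2 * gaussMaj v * D * L := by
      rw [abs_mul, abs_of_nonneg hf0]
      exact mul_le_mul (abs_gauss_diff2_le v ha hb) (hf.le v) hf0 (by have := hmaj0 v; positivity)
    have h3 : ∀ y : Vel, ‖y‖ ≤ 1 → |(gauss (v + y) - gauss v) * (f (v + y) - f v)| ≤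
        gaussMaj v * L * ‖y‖ ^ 2 := fun y hy => by
      rw [abs_mul]
      refine (mul_le_mul (abs_gauss_add_sub_le v hy) (hf.lip v y) (abs_nonneg _)
        (mul_nonneg (hmaj0 v) (norm_nonneg y))).trans_eq (by ring)
    have h4 := h3 a ha
    have h5 := h3 b hb
    rw [e]
    have hPL : 0 ≤ gaussMaj v * L := mul_nonneg (hmaj0 v) hL
    have h6 : gaussMaj v * L * (‖a‖ ^ 2 + ‖b‖ ^ 2) ≤ gaussMaj v * L * D := by
      gcongr
      have := norm_nonneg (a + b)
      linarith
    calc _ ≤ 4 * (gaussMaj v * L * D) := by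
          refine (abs_add_le _ _).trans ?_
          have h7 := abs_add_three (gauss v * (f (v + a) + f (v + b) - 2 * f v))
            ((gauss (v + a) + gauss (v + b) - 2 * gauss v) * f v)
            ((gauss (v + a) - gauss v) * (f (v + a) - f v))
          linarith
      _ ≤ 4 * (A * wt v * L * D) := by gcongr; exact (hmaj v).1
      _ ≤ _ := by
          have := mul_nonneg (mul_nonneg hA.le (wt_pos v).le) (mul_nonneg hsL hD0)
          nlinarith

lemma exists_isRegular_of_sobolevNorm {N : ℝ} (hN : 0 ≤ N) : ∃ M : ℝ, ∀ G : Torus3 → Vel → ℝ,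
    sobolevNorm 2 4 (fun x v => maxwellian v ^ (-(1 / 4) : ℝ) * G x v) ≤ ENNReal.ofReal N →
      (∀ᵐ z : Torus3 × Vel, 0 ≤ G z.1 z.2) → ∀ᵐ x, ∃ g, IsRegular M g ∧ G x =ᵐ[volume] g := by
  obtain ⟨L, hL⟩ := exists_isTame_of_sobolevNorm hN
  obtain ⟨M, hM⟩ := exists_isRegular_gauss_mul L
  refine ⟨M, fun G hG hG0 => ?_⟩
  have hmu : ∀ v, 0 < maxwellian v := fun v => by unfold maxwellian; positivity
  have h0 : ∀ᵐ z : Torus3 × Vel, 0 ≤ maxwellian z.2 ^ (-(1 / 4) : ℝ) * G z.1 z.2 := by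
    filter_upwards [hG0] with z hz
    exact mul_nonneg (Real.rpow_nonneg (hmu _).le _) hz
  filter_upwards [hL _ hG h0] with x ⟨f, hf, hfe⟩
  refine ⟨_, hM f hf, ?_⟩
  filter_upwards [hfe] with v hv
  rw [← hv, gauss, ← mul_assoc, ← Real.rpow_add (hmu v)]
  norm_num

end

end QuantumBoltzmann

/-! ### One-dimensional calculus and free transport. -/

namespace QuantumBoltzmann

noncomputable section

/-! ### Primitives on an interval -/

lemma AbsolutelyContinuousOnInterval.lipschitz_comp {f φ : ℝ → ℝ} {a b : ℝ}
    (hf : AbsolutelyContinuousOnInterval f a b) (hφ : ∀ x y, |φ x - φ y| ≤ |x - y|) :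
    AbsolutelyContinuousOnInterval (fun t => φ (f t)) a b := by
  unfold AbsolutelyContinuousOnInterval at hf ⊢
  refine squeeze_zero (fun E => Finset.sum_nonneg fun i _ => dist_nonneg)
    (fun E => Finset.sum_le_sum fun i _ => ?_) hf
  simpa only [Real.dist_eq] using hφ _ _

lemma intervalIntegrable_of_integrableOn {T : ℝ} {b : ℝ → ℝ} (hb : IntegrableOn b (Icc 0 T)) {t : ℝ}
    (ht : t ∈ Icc 0 T) : IntervalIntegrable b volume 0 t := by
  rw [intervalIntegrable_iff_integrableOn_Ioc_of_le ht.1]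
  exact hb.mono_set ((Ioc_subset_Icc_self).trans (Icc_subset_Icc_right ht.2))

/-- The chain rule for the square of the negative part of a primitive. -/
lemma sq_min_primitive {T y₀ : ℝ} {b : ℝ → ℝ} (hb : IntegrableOn b (Icc 0 T)) (hy₀ : 0 ≤ y₀) {t : ℝ}
    (ht : t ∈ Icc 0 T) :
    min (y₀ + ∫ s in (0 : ℝ)..t, b s) 0 ^ 2 =
      2 * ∫ s in (0 : ℝ)..t, b s * min (y₀ + ∫ u in (0 : ℝ)..s, b u) 0 := by
  set f : ℝ → ℝ := fun s => y₀ + ∫ u in (0 : ℝ)..s, b u with hf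
  set m : ℝ → ℝ := fun s => min (f s) 0 with hm
  have hbi := intervalIntegrable_of_integrableOn hb ht
  have hac0 := hbi.absolutelyContinuousOnInterval_intervalIntegral (c := 0) left_mem_uIcc
  have hac : AbsolutelyContinuousOnInterval m 0 t :=
    AbsolutelyContinuousOnInterval.lipschitz_comp (φ := fun x => min (y₀ + x) 0) hac0 fun x y => by
      refine (abs_min_sub_min_le_max _ _ _ _).trans ?_
      simp
  have h1 := hac.integral_deriv_mul_eq_sub hac
  have hm0 : m 0 = 0 := by simp [hm, hf, hy₀]
  rw [hm0] at h1
  have h2 : ∫ s in (0 : ℝ)..t, (deriv m s * m s + m s * deriv m s) = ∫ s in (0 : ℝ)..t, 2 * (b s * m s) := by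
    refine intervalIntegral.integral_congr_ae ?_
    filter_upwards [hbi.ae_hasDerivAt_integral] with s hs hst
    have h3 : HasDerivAt f (b s) s := (hs (uIoc_subset_uIcc hst) 0 left_mem_uIcc).const_add y₀
    rcases lt_or_ge (f s) 0 with h4 | h4
    · have h5 : m =ᶠ[𝓝 s] f := by
        filter_upwards [h3.continuousAt.eventually_lt continuousAt_const h4] with r hr
        exact min_eq_left hr.le
      rw [h5.deriv_eq, h3.deriv]
      ring
    -- Where the primitive is nonnegative its negative part may fail to be differentiable, but the
    -- factor m s vanishes on both sides.
    · have h5 : m s = 0 := min_eq_right h4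
      rw [h5]
      ring
  rw [h2, intervalIntegral.integral_const_mul] at h1
  rw [h1]
  ring

/-- A function whose weak derivative on `[0, T)` with initial value `A₀` is `B`. -/
lemma ae_eq_primitive_of_weak {A B : ℝ → ℝ} {A₀ T : ℝ} (hT : 0 < T) (hA : IntegrableOn A (Icc 0 T))
    (hB : IntegrableOn B (Icc 0 T))
    (H : ∀ η : ℝ → ℝ, ContDiff ℝ ∞ η → HasCompactSupport η → tsupport η ⊆ Iio T →
      (∫ t in Icc 0 T, (deriv η t * A t + η t * B t)) + η 0 * A₀ = 0) :
    ∀ᵐ t ∂(volume.restrict (Icc 0 T)), A t = A₀ + ∫ s in (0 : ℝ)..t, B s := by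
  set I : ℝ → ℝ := fun t => ∫ s in (0 : ℝ)..t, B s with hI
  have hBi : IntervalIntegrable B volume 0 T := intervalIntegrable_of_integrableOn hB (right_mem_Icc.2 hT.le)
  have hIac := hBi.absolutelyContinuousOnInterval_intervalIntegral (c := 0) left_mem_uIcc
  have hIc : ContinuousOn I (Icc 0 T) := by
    have := hIac.continuousOn
    rwa [uIcc_of_le hT.le] at this
  have hIi : IntegrableOn I (Icc 0 T) := hIc.integrableOn_Icc
  have hfi : IntegrableOn (fun t => A t - (A₀ + I t)) (Icc 0 T) :=
    hA.sub ((integrableOn_const (by simp)).add hIi)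
  have key := isOpen_Ioo.ae_eq_zero_of_integral_contDiff_smul_eq_zero (U := Ioo 0 T) (μ := volume)
    (f := fun t => A t - (A₀ + I t)) ((hfi.mono_set Ioo_subset_Icc_self).locallyIntegrableOn) fun ϑ hϑ hϑc hϑs => by
    -- The primitive of ϑ that vanishes near and after T. Its value -∫ ϑ at 0 is what brings in the
    -- initial datum A₀.
    set E : ℝ → ℝ := fun t => (∫ s in (0 : ℝ)..t, ϑ s) - ∫ s in (0 : ℝ)..T, ϑ s with hE
    have hEs : ContDiff ℝ ∞ E := (contDiff_primitive hϑ).sub contDiff_const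
    have hEd : ∀ t, HasDerivAt E (ϑ t) t := fun t =>
      (hϑ.continuous.integral_hasStrictDerivAt 0 t).hasDerivAt.sub_const _
    obtain ⟨b, hbT, hb⟩ : ∃ b < T, ∀ t, b < t → ϑ t = 0 := by
      rcases (tsupport ϑ).eq_empty_or_nonempty with h | h
      · exact ⟨0, hT, fun t _ => image_eq_zero_of_notMem_tsupport (by simp [h])⟩
      · obtain ⟨b, hb, hmax⟩ := hϑc.isCompact.exists_isMaxOn h continuousOn_id
        exact ⟨b, (hϑs hb).2, fun t ht => image_eq_zero_of_notMem_tsupport fun h2 => not_lt.2 (hmax h2) ht⟩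
    have hE0 : ∀ t, b < t → E t = 0 := fun t ht => by
      have hi : ∀ a c, IntervalIntegrable ϑ volume a c := fun a c => hϑ.continuous.intervalIntegrable a c
      rw [hE]
      simp only
      rw [intervalIntegral.integral_interval_sub_left (hi _ _) (hi _ _)]
      refine intervalIntegral.integral_zero_ae (Eventually.of_forall fun s hs => hb s ?_)
      exact (lt_min hbT ht).trans hs.1
    -- E is constant for very negative times; the factor cuts it off between -2 and -1, so η is
    -- compactly supported and agrees with E in a neighbourhood of every t ≥ 0.
    set η : ℝ → ℝ := fun t => Real.smoothTransition (t + 2) * E t with hη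
    have hηs : ContDiff ℝ ∞ η :=
      (Real.smoothTransition.contDiff.comp (contDiff_id.add contDiff_const)).mul hEs
    have hsupp : tsupport η ⊆ Icc (-2) b := by
      refine closure_minimal (fun t ht => ?_) isClosed_Icc
      by_contra h
      refine ht ?_
      rw [mem_Icc, not_and_or, not_le, not_le] at h
      rcases h with h | h
      · simp only [hη, Real.smoothTransition.zero_of_nonpos (by linarith : t + 2 ≤ 0), zero_mul]
      · simp only [hη, hE0 t h, mul_zero]
    have hηE : ∀ t, 0 ≤ t → η =ᶠ[𝓝 t] E := fun t ht => by
      filter_upwards [lt_mem_nhds (by linarith : -1 < t)] with r hr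
      simp only [hη, Real.smoothTransition.one_of_one_le (by linarith : 1 ≤ r + 2), one_mul]
    have h1 := H η hηs (HasCompactSupport.of_support_subset_isCompact isCompact_Icc
      ((subset_tsupport η).trans hsupp)) (hsupp.trans fun t ht => ht.2.trans_lt hbT)
    have h2 : ∫ t in Icc 0 T, (deriv η t * A t + η t * B t) = ∫ t in Icc 0 T, (ϑ t * A t + E t * B t) := by
      refine setIntegral_congr_fun measurableSet_Icc fun t ht => ?_
      simp only [(hηE t ht.1).deriv_eq, (hηE t ht.1).eq_of_nhds, (hEd t).deriv]
    have hbdd : ∀ {g k : ℝ → ℝ}, Continuous g → IntegrableOn k (Icc 0 T) → IntegrableOn (fun t => g t * k t) (Icc 0 T) :=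
      fun hg hk => hk.continuousOn_mul hg.continuousOn isCompact_Icc
    have iA := hbdd hϑ.continuous hA
    have iB := hbdd hEs.continuous hB
    have iI := hbdd hϑ.continuous hIi
    have iϑ : IntegrableOn (fun t => ϑ t * A₀) (Icc 0 T) := (hϑ.continuous.mul continuous_const).integrableOn_Icc
    have hET : E T = 0 := hE0 T hbT
    have hEz : E 0 = -∫ t in Icc 0 T, ϑ t := by
      simp [hE, intervalIntegral.integral_of_le hT.le, integral_Icc_eq_integral_Ioc]
    have hEac : AbsolutelyContinuousOnInterval E 0 T :=
      (hEs.contDiffOn.of_le (by simp)).absolutelyContinuousOnInterval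
    have hparts := hEac.integral_mul_deriv_eq_deriv_mul hIac
    have h3 : ∫ t in (0 : ℝ)..T, E t * deriv I t = ∫ t in Icc 0 T, E t * B t := by
      rw [integral_Icc_eq_integral_Ioc, ← intervalIntegral.integral_of_le hT.le]
      refine intervalIntegral.integral_congr_ae ?_
      filter_upwards [hBi.ae_hasDerivAt_integral] with s hs hst
      rw [(hs (uIoc_subset_uIcc hst) 0 left_mem_uIcc).deriv]
    have h4 : ∫ t in (0 : ℝ)..T, deriv E t * I t = ∫ t in Icc 0 T, ϑ t * I t := by
      rw [integral_Icc_eq_integral_Ioc, ← intervalIntegral.integral_of_le hT.le]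
      simp only [(hEd _).deriv]
    have hI0 : I 0 = 0 := by simp [hI]
    have hparts' : ∫ t in Icc 0 T, E t * B t = -∫ t in Icc 0 T, ϑ t * I t := by
      rw [← h3, ← h4]
      refine hparts.trans ?_
      rw [hET]
      change 0 * I T - E 0 * I 0 - _ = _
      rw [hI0]
      ring
    rw [h2, integral_add iA iB, (hηE 0 le_rfl).eq_of_nhds, hEz, hparts'] at h1
    have h5 : ∫ t, ϑ t • (A t - (A₀ + I t)) = ∫ t in Icc 0 T, ϑ t • (A t - (A₀ + I t)) := by
      refine (setIntegral_eq_integral_of_forall_compl_eq_zero fun t ht => ?_).symm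
      have : ϑ t = 0 := image_eq_zero_of_notMem_tsupport fun h => ht (Ioo_subset_Icc_self (hϑs h))
      simp [this]
    have h6 : ∀ t, ϑ t • (A t - (A₀ + I t)) = ϑ t * A t - ϑ t * A₀ - ϑ t * I t := fun t => by
      simp only [smul_eq_mul]; ring
    have iAA : IntegrableOn (fun t => ϑ t * A t - ϑ t * A₀) (Icc 0 T) := iA.sub iϑ
    rw [h5]
    simp only [h6]
    rw [integral_sub iAA iI, integral_sub iA iϑ, integral_mul_const]
    linarith
  rw [← restrict_Ioo_eq_restrict_Icc, ae_restrict_iff' measurableSet_Ioo]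
  filter_upwards [key] with t ht hmem
  exact sub_eq_zero.1 (ht hmem)

/-- Gronwall's inequality for bounded functions with zero initial value. -/
lemma ae_eq_zero_of_le_primitive {N : ℝ → ℝ} {T K B : ℝ} (hK : 0 ≤ K)
    (hN : IntegrableOn N (Icc 0 T)) (hN0 : ∀ᵐ t ∂(volume.restrict (Icc 0 T)), 0 ≤ N t)
    (hB : ∀ᵐ t ∂(volume.restrict (Icc 0 T)), N t ≤ B)
    (H : ∀ᵐ t ∂(volume.restrict (Icc 0 T)), N t ≤ K * ∫ s in (0 : ℝ)..t, N s) :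
    ∀ᵐ t ∂(volume.restrict (Icc 0 T)), N t = 0 := by
  -- Iterating the integral inequality from the crude bound B produces the terms of an exponential
  -- series, which tend to 0.
  have key : ∀ n : ℕ, ∀ᵐ t ∂(volume.restrict (Icc 0 T)), N t ≤ B * ((K * t) ^ n / n.factorial) := fun n => by
    induction n with
    | zero => simpa using hB
    | succ n ih =>
      filter_upwards [H, ae_restrict_mem measurableSet_Icc] with t ht hmem
      refine ht.trans ?_
      have h1 : ∫ s in (0 : ℝ)..t, N s ≤ ∫ s in (0 : ℝ)..t, B * ((K * s) ^ n / n.factorial) := by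
        refine intervalIntegral.integral_mono_ae_restrict hmem.1 (intervalIntegrable_of_integrableOn hN hmem)
          (Continuous.intervalIntegrable (by fun_prop) _ _) ?_
        exact ae_mono (Measure.restrict_mono_set _ (Icc_subset_Icc_right hmem.2)) ih
      have h2 : ∫ s in (0 : ℝ)..t, B * ((K * s) ^ n / n.factorial) =
          B * K ^ n / n.factorial * (t ^ (n + 1) / (n + 1)) := by
        have : ∀ s : ℝ, B * ((K * s) ^ n / n.factorial) = B * K ^ n / n.factorial * s ^ n := fun s => by
          rw [mul_pow]; ring
        simp only [this]
        rw [intervalIntegral.integral_const_mul, integral_pow]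
        simp
      rw [h2] at h1
      refine (mul_le_mul_of_nonneg_left h1 hK).trans_eq ?_
      rw [Nat.factorial_succ, mul_pow]
      push_cast
      field_simp
      ring
  filter_upwards [ae_all_iff.2 key, hN0] with t ht h0
  refine le_antisymm ?_ h0
  have h1 : Tendsto (fun n : ℕ => B * ((K * t) ^ n / n.factorial)) atTop (𝓝 (B * 0)) :=
    (FloorSemiring.tendsto_pow_div_factorial_atTop (K * t)).const_mul B
  rw [mul_zero] at h1
  exact ge_of_tendsto' h1 ht

end

end QuantumBoltzmann

namespace QuantumBoltzmann

noncomputable section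

/-! ### Free transport -/

lemma continuous_toTorus : Continuous toTorus :=
  continuous_pi fun i => (AddCircle.continuous_mk' 1).comp (by fun_prop : Continuous fun y : Vel => y i)

lemma toTorus_add (y w : Vel) : toTorus (y + w) = toTorus y + toTorus w := by
  funext i
  simp [toTorus]

lemma toTorus_sub (y w : Vel) : toTorus (y - w) = toTorus y - toTorus w := by
  funext i
  simp [toTorus]

/-- Free transport during the time `t`. -/
def stream (t : ℝ) (z : Torus3 × Vel) : Torus3 × Vel := (z.1 + toTorus (t • z.2), z.2)

lemma measurable_stream : Measurable fun p : ℝ × Torus3 × Vel => stream p.1 p.2 := by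
  have h : Continuous fun p : ℝ × Torus3 × Vel => stream p.1 p.2 :=
    (continuous_snd.fst.add (continuous_toTorus.comp (continuous_fst.smul continuous_snd.snd))).prodMk
      continuous_snd.snd
  exact h.measurable

lemma measurePreserving_stream (t : ℝ) : MeasurePreserving (stream t) := by
  have h1 : MeasurePreserving (fun p : Vel × Torus3 => (p.1, p.2 + toTorus (t • p.1)))
      (volume.prod volume) (volume.prod volume) := by
    refine (MeasurePreserving.id volume).skew_product (g := fun v x => x + toTorus (t • v)) ?_ ?_
    · have : Continuous fun p : Vel × Torus3 => p.2 + toTorus (t • p.1) :=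
        continuous_snd.add (continuous_toTorus.comp (continuous_fst.const_smul t))
      exact this.measurable
    · exact Eventually.of_forall fun v => (measurePreserving_add_right volume (toTorus (t • v))).map_eq
  exact (Measure.measurePreserving_swap.comp (h1.comp Measure.measurePreserving_swap))

/-- A function along free transport. -/
def along (f : ℝ → Torus3 → Vel → ℝ) (t : ℝ) (z : Torus3 × Vel) : ℝ := f t (stream t z).1 (stream t z).2

/-- The norm in `L²(𝕋³ × ℝ³)` of a function of one variable. -/
abbrev nrm (a : Torus3 × Vel → ℝ) : ℝ≥0∞ := eLpNorm a 2 volume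

lemma nrm_along {f : ℝ → Torus3 → Vel → ℝ} (hf : Measurable fun p : ℝ × Torus3 × Vel => f p.1 p.2.1 p.2.2)
    (t : ℝ) : nrm (along f t) = normL2 (f t) := by
  have hm : Measurable fun z : Torus3 × Vel => f t z.1 z.2 := hf.comp (measurable_const.prodMk measurable_id)
  exact eLpNorm_comp_measurePreserving (g := fun z : Torus3 × Vel => f t z.1 z.2)
    hm.aestronglyMeasurable (measurePreserving_stream t)

lemma measurable_along {f : ℝ → Torus3 → Vel → ℝ} (hf : Measurable fun p : ℝ × Torus3 × Vel => f p.1 p.2.1 p.2.2) :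
    Measurable fun p : ℝ × Torus3 × Vel => along f p.1 p.2 :=
  hf.comp (measurable_fst.prodMk measurable_stream)

lemma integral_along {f : ℝ → Torus3 → Vel → ℝ} (hf : Measurable fun p : ℝ × Torus3 × Vel => f p.1 p.2.1 p.2.2)
    (t : ℝ) : ∫ z, along f t z = ∫ z : Torus3 × Vel, f t z.1 z.2 := by
  have hm : Measurable fun z : Torus3 × Vel => f t z.1 z.2 := hf.comp (measurable_const.prodMk measurable_id)
  rw [← (measurePreserving_stream t).map_eq]
  rw [integral_map (measurePreserving_stream t).measurable.aemeasurable hm.aestronglyMeasurable]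
  rw [(measurePreserving_stream t).map_eq]
  rfl

lemma lintegral_enorm_mul_le {a b : Torus3 × Vel → ℝ} (ha : AEStronglyMeasurable a) (hb : AEStronglyMeasurable b) :
    ∫⁻ z, ‖a z * b z‖ₑ ≤ nrm a * nrm b := by
  have h := eLpNorm_smul_le_mul_eLpNorm (p := 2) (q := 2) (r := 1) hb ha
  rw [eLpNorm_one_eq_lintegral_enorm] at h
  exact h

/-- Products of functions bounded in `L²` with functions integrable in time with values in `L²`. -/
lemma integrable_prod_of_nrm {T : ℝ} {a b : ℝ → Torus3 × Vel → ℝ}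
    (ha : Measurable fun p : ℝ × Torus3 × Vel => a p.1 p.2) (hb : Measurable fun p : ℝ × Torus3 × Vel => b p.1 p.2)
    {A : ℝ≥0∞} (hA : A ≠ ⊤) (haA : ∀ᵐ t ∂(volume.restrict (Icc 0 T)), nrm (a t) ≤ A)
    (hbi : ∫⁻ t in Icc 0 T, nrm (b t) < ⊤) :
    Integrable (fun p : ℝ × Torus3 × Vel => a p.1 p.2 * b p.1 p.2) ((volume.restrict (Icc 0 T)).prod volume) := by
  have hab : Measurable fun p : ℝ × Torus3 × Vel => a p.1 p.2 * b p.1 p.2 := ha.mul hb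
  refine ⟨hab.aestronglyMeasurable, ?_⟩
  rw [hasFiniteIntegral_iff_enorm, lintegral_prod _ hab.enorm.aemeasurable]
  refine lt_of_le_of_lt ?_ (ENNReal.mul_lt_top hA.lt_top hbi)
  rw [← lintegral_const_mul' _ _ hA]
  refine lintegral_mono_ae ?_
  filter_upwards [haA] with t ht
  have hat : Measurable (a t) := ha.comp (measurable_const.prodMk measurable_id)
  have hbt : Measurable (b t) := hb.comp (measurable_const.prodMk measurable_id)
  refine (lintegral_enorm_mul_le hat.aestronglyMeasurable hbt.aestronglyMeasurable).trans ?_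
  gcongr

lemma wave_test_mem (c : ℂ) (k : Fin 3 → ℤ) (ψ : VTest) :
    Continuous (fun z : Torus3 × Vel => wave c k z.1 * (ψ : Vel → ℝ) z.2) ∧
      HasCompactSupport fun z : Torus3 × Vel => wave c k z.1 * (ψ : Vel → ℝ) z.2 :=
  ⟨((continuous_wave c k).comp continuous_fst).mul (ψ.2.1.continuous.comp continuous_snd),
    (isTestXV_wave c k ψ).2⟩

/-- The test functions `η(t) e(x - t v) ψ(v)`. -/
def streamTest (η : ℝ → ℝ) (c : ℂ) (k : Fin 3 → ℤ) (ψ : Vel → ℝ) (t : ℝ) (x : Torus3) (v : Vel) : ℝ :=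
  η t * (wave c k (x - toTorus (t • v)) * ψ v)

/-- x - t v is constant along the flow, so the transport derivative falls on η alone and the weak
equation becomes one-dimensional in time. -/
lemma transportDeriv_streamTest (η : ℝ → ℝ) (c : ℂ) (k : Fin 3 → ℤ) (ψ : Vel → ℝ) :
    transportDeriv (streamTest η c k ψ) = streamTest (deriv η) c k ψ := by
  funext t x v
  have h : ∀ r : ℝ, x + toTorus (r • v) - toTorus ((t + r) • v) = x - toTorus (t • v) := fun r => by
    rw [add_smul, toTorus_add]
    abel
  simp only [transportDeriv, streamTest, h]
  rw [deriv_mul_const_field, deriv_comp_const_add, add_zero]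

lemma isTestTXV_streamTest {η : ℝ → ℝ} {T : ℝ} (hη : ContDiff ℝ ∞ η) (hc : HasCompactSupport η)
    (hs : tsupport η ⊆ Iio T) (c : ℂ) (k : Fin 3 → ℤ) (ψ : VTest) :
    IsTestTXV T (streamTest η c k ψ) := by
  refine ⟨?_, ?_, ?_⟩
  · have h1 : ContDiff ℝ ∞ fun p : ℝ × Vel × Vel => p.2.1 - p.1 • p.2.2 :=
      contDiff_snd.fst.sub (contDiff_fst.smul contDiff_snd.snd)
    have h2 := (contDiff_wave c k).comp h1
    simp only [Function.comp_def, toTorus_sub] at h2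
    exact (hη.comp contDiff_fst).mul (h2.mul (ψ.2.1.comp contDiff_snd.snd))
  · refine HasCompactSupport.intro (hc.isCompact.prod (isCompact_univ.prod ψ.2.2.isCompact)) fun p hp => ?_
    by_cases h1 : p.1 ∈ tsupport η
    · have h2 : p.2.2 ∉ tsupport (ψ : Vel → ℝ) := fun h2 => hp ⟨h1, mem_univ _, h2⟩
      simp only [streamTest, image_eq_zero_of_notMem_tsupport h2, mul_zero]
    · simp only [streamTest, image_eq_zero_of_notMem_tsupport h1, zero_mul]
  · have h1 : tsupport (fun p : ℝ × Torus3 × Vel => streamTest η c k ψ p.1 p.2.1 p.2.2) ⊆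
        Prod.fst ⁻¹' tsupport η := by
      refine closure_minimal (fun p hp => ?_) ((isClosed_tsupport η).preimage continuous_fst)
      by_contra h
      exact hp (by simp only [streamTest, image_eq_zero_of_notMem_tsupport h, zero_mul])
    exact h1.trans fun p hp => hs hp

/-- The weak formulation against one product test function, along free transport. -/
lemma ae_integral_along_eq {T : ℝ} (hT : 0 < T) {F q : ℝ → Torus3 → Vel → ℝ} {F₀ : Torus3 → Vel → ℝ}
    (hF : Measurable fun p : ℝ × Torus3 × Vel => F p.1 p.2.1 p.2.2)
    (hq : Measurable fun p : ℝ × Torus3 × Vel => q p.1 p.2.1 p.2.2)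
    (hFi : ∫⁻ t in Icc 0 T, normL2 (F t) < ⊤) (hqi : ∫⁻ t in Icc 0 T, normL2 (q t) < ⊤)
    (H : ∀ φ : ℝ → Torus3 → Vel → ℝ, IsTestTXV T φ →
      (∫ t in Icc 0 T, ∫ z : Torus3 × Vel,
          (F t z.1 z.2 * transportDeriv φ t z.1 z.2 + q t z.1 z.2 * φ t z.1 z.2))
        + ∫ z : Torus3 × Vel, F₀ z.1 z.2 * φ 0 z.1 z.2 = 0)
    (c : ℂ) (k : Fin 3 → ℤ) (ψ : VTest) :
    ∀ᵐ t ∂(volume.restrict (Icc 0 T)),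
      ∫ z, along F t z * (wave c k z.1 * (ψ : Vel → ℝ) z.2) =
        (∫ z : Torus3 × Vel, F₀ z.1 z.2 * (wave c k z.1 * (ψ : Vel → ℝ) z.2)) +
          ∫ s in (0 : ℝ)..t, ∫ z, along q s z * (wave c k z.1 * (ψ : Vel → ℝ) z.2) := by
  set w : Torus3 × Vel → ℝ := fun z => wave c k z.1 * (ψ : Vel → ℝ) z.2 with hw
  obtain ⟨hwc, hws⟩ := wave_test_mem c k ψ
  have hwm : MemLp w 2 := hwc.memLp_of_hasCompactSupport hws
  have hint : ∀ f : ℝ → Torus3 → Vel → ℝ, (Measurable fun p : ℝ × Torus3 × Vel => f p.1 p.2.1 p.2.2) →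
      ∫⁻ t in Icc 0 T, normL2 (f t) < ⊤ →
      Integrable (fun p : ℝ × Torus3 × Vel => along f p.1 p.2 * w p.2) ((volume.restrict (Icc 0 T)).prod volume) :=
    fun f hf hfi => by
      have := integrable_prod_of_nrm (T := T) (a := fun _ => w) (b := along f)
        (hwc.measurable.comp measurable_snd) (measurable_along hf) hwm.2.ne
        (Eventually.of_forall fun _ => le_rfl) (by simpa only [nrm_along hf] using hfi)
      simpa only [mul_comm] using this
  have iF := hint F hF hFi
  have iq := hint q hq hqi
  refine ae_eq_primitive_of_weak hT iF.integral_prod_left iq.integral_prod_left fun η hη hηc hηs => ?_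
  have h1 := H _ (isTestTXV_streamTest hη hηc hηs c k ψ)
  rw [transportDeriv_streamTest] at h1
  have h2 : ∫ z : Torus3 × Vel, F₀ z.1 z.2 * streamTest η c k ψ 0 z.1 z.2 =
      η 0 * ∫ z : Torus3 × Vel, F₀ z.1 z.2 * w z := by
    rw [← integral_const_mul (η 0)]
    refine integral_congr_ae (Eventually.of_forall fun z => ?_)
    have h3 : toTorus (0 : Vel) = 0 := by funext i; simp [toTorus]
    simp only [streamTest, zero_smul, h3, sub_zero, hw]
    ring
  rw [h2] at h1
  refine Eq.trans (congrArg (fun r : ℝ => r + η 0 * ∫ z : Torus3 × Vel, F₀ z.1 z.2 * w z)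
    (integral_congr_ae ?_)) h1
  filter_upwards [iF.prod_right_ae, iq.prod_right_ae] with t htF htq
  have e : ∀ (f : ℝ → Torus3 → Vel → ℝ) (θ : ℝ → ℝ) (z : Torus3 × Vel),
      along (fun t x v => f t x v * streamTest θ c k ψ t x v) t z = θ t * (along f t z * w z) := fun f θ z => by
    simp only [along, streamTest, stream, add_sub_cancel_right, hw]
    ring
  have hst : ∀ θ : ℝ → ℝ, Continuous θ → Measurable fun p : ℝ × Torus3 × Vel =>
      streamTest θ c k ψ p.1 p.2.1 p.2.2 := fun θ hθ => by
    have h4 : Continuous fun p : ℝ × Torus3 × Vel => p.2.1 - toTorus (p.1 • p.2.2) :=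
      continuous_snd.fst.sub (continuous_toTorus.comp (continuous_fst.smul continuous_snd.snd))
    have h5 : Continuous fun p : ℝ × Torus3 × Vel => streamTest θ c k ψ p.1 p.2.1 p.2.2 :=
      (hθ.comp continuous_fst).mul (((continuous_wave c k).comp h4).mul (ψ.2.1.continuous.comp continuous_snd.snd))
    exact h5.measurable
  have hd : Continuous (deriv η) := ContDiff.continuous_deriv (n := ∞) hη (by simp)
  have hg : Measurable fun p : ℝ × Torus3 × Vel =>
      F p.1 p.2.1 p.2.2 * streamTest (deriv η) c k ψ p.1 p.2.1 p.2.2 +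
        q p.1 p.2.1 p.2.2 * streamTest η c k ψ p.1 p.2.1 p.2.2 :=
    (hF.mul (hst _ hd)).add (hq.mul (hst _ hη.continuous))
  have h6 := integral_along (f := fun t x v => F t x v * streamTest (deriv η) c k ψ t x v +
    q t x v * streamTest η c k ψ t x v) hg t
  have h7 : Integrable fun z => deriv η t * (along F t z * w z) := htF.const_mul _
  have h8 : Integrable fun z => η t * (along q t z * w z) := htq.const_mul _
  rw [← h6]
  simp only [← integral_const_mul]
  rw [← integral_add h7 h8]
  refine integral_congr_ae (Eventually.of_forall fun z => ?_)
  simp only [← e]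
  rfl

end

end QuantumBoltzmann

/-! ### The equation integrated along characteristics. -/

namespace QuantumBoltzmann

noncomputable section

section

variable {T : ℝ} {F q : ℝ → Torus3 → Vel → ℝ} {F₀ : Torus3 → Vel → ℝ}

lemma measurable_normL2 {f : ℝ → Torus3 → Vel → ℝ}
    (hf : Measurable fun p : ℝ × Torus3 × Vel => f p.1 p.2.1 p.2.2) : Measurable fun t => normL2 (f t) := by
  have h1 : Measurable fun t => ∫⁻ z : Torus3 × Vel, ‖f t z.1 z.2‖ₑ ^ (2 : ℝ) :=
    (hf.enorm.pow_const (2 : ℝ)).lintegral_prod_right'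
  have h2 : (fun t => normL2 (f t)) =
      fun t => (∫⁻ z : Torus3 × Vel, ‖f t z.1 z.2‖ₑ ^ (2 : ℝ)) ^ (1 / 2 : ℝ) := by
    funext t
    simp only [normL2, eLpNorm_eq_lintegral_rpow_enorm_toReal two_ne_zero ENNReal.ofNat_ne_top,
      ENNReal.toReal_ofNat]
  rw [h2]
  exact h1.pow_const _

lemma integrable_along_restrict (hq : Measurable fun p : ℝ × Torus3 × Vel => q p.1 p.2.1 p.2.2)
    (hqi : ∫⁻ t in Icc 0 T, normL2 (q t) < ⊤) {K : Set (Torus3 × Vel)} (hK : IsCompact K) :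
    Integrable (fun p : ℝ × Torus3 × Vel => along q p.1 p.2)
      ((volume.restrict (Icc 0 T)).prod (volume.restrict K)) := by
  have hKm : MeasurableSet K := hK.measurableSet
  have hm : Measurable (K.indicator fun _ => (1 : ℝ)) := measurable_const.indicator hKm
  have hL : MemLp (K.indicator fun _ => (1 : ℝ)) 2 :=
    memLp_indicator_const 2 hKm 1 (Or.inr hK.measure_lt_top.ne)
  have h1 := integrable_prod_of_nrm (T := T) (a := fun _ => K.indicator fun _ => (1 : ℝ)) (b := along q)
    (hm.comp measurable_snd) (measurable_along hq) hL.2.ne (Eventually.of_forall fun _ => le_rfl)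
    (by simpa only [nrm_along hq] using hqi)
  have h2 : (volume.restrict (Icc 0 T)).prod (volume.restrict K) =
      ((volume.restrict (Icc 0 T)).prod volume).restrict (univ ×ˢ K) := by
    rw [← Measure.prod_restrict, Measure.restrict_univ]
  rw [h2]
  refine (integrable_indicator_iff (MeasurableSet.univ.prod hKm)).1 (h1.congr (Eventually.of_forall fun p => ?_))
  by_cases hp : p.2 ∈ K
  · simp [hp]
  · simp [hp]

lemma ae_integrableOn_along (hq : Measurable fun p : ℝ × Torus3 × Vel => q p.1 p.2.1 p.2.2)
    (hqi : ∫⁻ t in Icc 0 T, normL2 (q t) < ⊤) :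
    ∀ᵐ z, IntegrableOn (fun s => along q s z) (Icc 0 T) := by
  have h1 : ∀ᵐ z, ∀ n : ℕ, z ∈ (univ : Set Torus3) ×ˢ Metric.closedBall (0 : Vel) n →
      IntegrableOn (fun s => along q s z) (Icc 0 T) := by
    refine ae_all_iff.2 fun n => ?_
    have hc : IsCompact ((univ : Set Torus3) ×ˢ Metric.closedBall (0 : Vel) n) :=
      isCompact_univ.prod (isCompact_closedBall _ _)
    exact (ae_restrict_iff' hc.measurableSet).1 (integrable_along_restrict hq hqi hc).prod_left_ae
  filter_upwards [h1] with z hz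
  obtain ⟨n, hn⟩ := exists_nat_ge ‖z.2‖
  exact hz n ⟨mem_univ _, by simpa using hn⟩

lemma locallyIntegrable_primitive (hq : Measurable fun p : ℝ × Torus3 × Vel => q p.1 p.2.1 p.2.2)
    (hqi : ∫⁻ t in Icc 0 T, normL2 (q t) < ⊤) {t : ℝ} (ht : t ∈ Icc 0 T) :
    LocallyIntegrable fun z => ∫ s in (0 : ℝ)..t, along q s z := by
  refine locallyIntegrable_iff.2 fun K hK => ?_
  have h1 : Integrable (fun p : ℝ × Torus3 × Vel => along q p.1 p.2)
      ((volume.restrict (Ioc 0 t)).prod (volume.restrict K)) :=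
    (integrable_along_restrict hq hqi hK).mono_measure
      (Measure.prod_mono (Measure.restrict_mono_set _ ((Ioc_subset_Icc_self).trans (Icc_subset_Icc_right ht.2)))
        le_rfl)
  simp only [intervalIntegral.integral_of_le ht.1]
  exact h1.integral_prod_right

/-- Solutions are integrated along free transport. -/
lemma ae_along_eq (hT : 0 < T) (hF₀ : MemLp (fun z : Torus3 × Vel => F₀ z.1 z.2) 2)
    (hF : Measurable fun p : ℝ × Torus3 × Vel => F p.1 p.2.1 p.2.2)
    (hq : Measurable fun p : ℝ × Torus3 × Vel => q p.1 p.2.1 p.2.2)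
    (hFi : ∫⁻ t in Icc 0 T, normL2 (F t) < ⊤) (hqi : ∫⁻ t in Icc 0 T, normL2 (q t) < ⊤)
    (H : ∀ φ : ℝ → Torus3 → Vel → ℝ, IsTestTXV T φ →
      (∫ t in Icc 0 T, ∫ z : Torus3 × Vel,
          (F t z.1 z.2 * transportDeriv φ t z.1 z.2 + q t z.1 z.2 * φ t z.1 z.2))
        + ∫ z : Torus3 × Vel, F₀ z.1 z.2 * φ 0 z.1 z.2 = 0) :
    ∀ᵐ t ∂(volume.restrict (Icc 0 T)), ∀ᵐ z : Torus3 × Vel,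
      along F t z = F₀ z.1 z.2 + ∫ s in (0 : ℝ)..t, along q s z := by
  obtain ⟨ρ, hρ⟩ := exists_isMollifier
  -- Only countably many tests are used, so one null set of times serves for all of them.
  have h1 : ∀ᵐ t ∂(volume.restrict (Icc 0 T)), ∀ k : Fin 3 → ℤ, ∀ b : Bool, ∀ n j : ℕ,
      ∫ z, along F t z * (wave (if b then 1 else -Complex.I) k z.1 *
        (VTest.trans (TopologicalSpace.denseSeq Vel j) (hρ.test n) : Vel → ℝ) z.2) =
        (∫ z : Torus3 × Vel, F₀ z.1 z.2 * (wave (if b then 1 else -Complex.I) k z.1 *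
          (VTest.trans (TopologicalSpace.denseSeq Vel j) (hρ.test n) : Vel → ℝ) z.2)) +
          ∫ s in (0 : ℝ)..t, ∫ z, along q s z * (wave (if b then 1 else -Complex.I) k z.1 *
            (VTest.trans (TopologicalSpace.denseSeq Vel j) (hρ.test n) : Vel → ℝ) z.2) :=
    ae_all_iff.2 fun k => ae_all_iff.2 fun b => ae_all_iff.2 fun n => ae_all_iff.2 fun j =>
      ae_integral_along_eq hT hF hq hFi hqi H _ k _
  have h2 : ∀ᵐ t ∂(volume.restrict (Icc 0 T)), normL2 (F t) < ⊤ := by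
    exact ae_lt_top (measurable_normL2 hF) hFi.ne
  filter_upwards [h1, h2, ae_restrict_mem measurableSet_Icc] with t ht hfin hmem
  have hFt : MemLp (along F t) 2 := by
    have hm : Measurable (along F t) := (measurable_along hF).comp (measurable_const.prodMk measurable_id)
    refine ⟨hm.aestronglyMeasurable, ?_⟩
    change nrm (along F t) < ⊤
    rwa [nrm_along hF]
  have l1 : LocallyIntegrable (along F t) := hFt.locallyIntegrable (by norm_num)
  have l2 : LocallyIntegrable fun z : Torus3 × Vel => F₀ z.1 z.2 := hF₀.locallyIntegrable (by norm_num)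
  have l3 := locallyIntegrable_primitive hq hqi hmem
  have key := hρ.ae_eq_zero_of_wave
    (h := fun x v => along F t (x, v) - F₀ x v - ∫ s in (0 : ℝ)..t, along q s (x, v))
    ((l1.sub l2).sub l3) fun k c hc n j => by
      obtain ⟨b, rfl⟩ : ∃ b : Bool, c = if b then 1 else -Complex.I := by
        rcases hc with rfl | rfl
        · exact ⟨true, rfl⟩
        · exact ⟨false, rfl⟩
      have h3 := ht k b n j
      set c : ℂ := if b then 1 else -Complex.I
      set ψ := VTest.trans (TopologicalSpace.denseSeq Vel j) (hρ.test n)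
      have i1 : Integrable fun z : Torus3 × Vel => along F t z * (wave c k z.1 * (ψ : Vel → ℝ) z.2) :=
        integrable_mul_wave (f := fun x v => along F t (x, v)) l1 ψ c k
      have i2 : Integrable fun z : Torus3 × Vel => F₀ z.1 z.2 * (wave c k z.1 * (ψ : Vel → ℝ) z.2) :=
        integrable_mul_wave l2 ψ c k
      have i3 : Integrable fun z : Torus3 × Vel => (∫ s in (0 : ℝ)..t, along q s z) *
          (wave c k z.1 * (ψ : Vel → ℝ) z.2) :=
        integrable_mul_wave (f := fun x v => ∫ s in (0 : ℝ)..t, along q s (x, v)) l3 ψ c k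
      have h4 : ∫ s in (0 : ℝ)..t, ∫ z, along q s z * (wave c k z.1 * (ψ : Vel → ℝ) z.2) =
          ∫ z, (∫ s in (0 : ℝ)..t, along q s z) * (wave c k z.1 * (ψ : Vel → ℝ) z.2) := by
        obtain ⟨hwc, hws⟩ := wave_test_mem c k ψ
        have hwm := hwc.memLp_of_hasCompactSupport (p := 2) (μ := volume) hws
        have i4 := integrable_prod_of_nrm (T := T) (a := fun _ z => wave c k z.1 * (ψ : Vel → ℝ) z.2)
          (b := along q) (hwc.measurable.comp measurable_snd) (measurable_along hq) hwm.2.ne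
          (Eventually.of_forall fun _ => le_rfl) (by simpa only [nrm_along hq] using hqi)
        have i5 : Integrable (fun p : ℝ × Torus3 × Vel => along q p.1 p.2 * (wave c k p.2.1 * (ψ : Vel → ℝ) p.2.2))
            ((volume.restrict (Ioc 0 t)).prod volume) := by
          refine (i4.mono_measure (Measure.prod_mono (Measure.restrict_mono_set _
            ((Ioc_subset_Icc_self).trans (Icc_subset_Icc_right hmem.2))) le_rfl)).congr
            (Eventually.of_forall fun p => ?_)
          simp only
          ring
        simp only [intervalIntegral.integral_of_le hmem.1]
        rw [integral_integral_swap (f := fun s z => along q s z * (wave c k z.1 * (ψ : Vel → ℝ) z.2)) i5]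
        simp only [integral_mul_const]
      have i12 : Integrable fun z : Torus3 × Vel => along F t z * (wave c k z.1 * (ψ : Vel → ℝ) z.2) -
          F₀ z.1 z.2 * (wave c k z.1 * (ψ : Vel → ℝ) z.2) := i1.sub i2
      simp only [sub_mul]
      change ∫ z : Torus3 × Vel, (along F t z * (wave c k z.1 * (ψ : Vel → ℝ) z.2) -
        F₀ z.1 z.2 * (wave c k z.1 * (ψ : Vel → ℝ) z.2) - (∫ s in (0 : ℝ)..t, along q s z) *
          (wave c k z.1 * (ψ : Vel → ℝ) z.2)) = 0
      rw [integral_sub i12 i3, integral_sub i1 i2, h3, h4]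
      ring
  filter_upwards [key] with z hz
  linarith

end

end

end QuantumBoltzmann

namespace QuantumBoltzmann

noncomputable section

/-! ### The energy of the negative part -/

section

variable {T : ℝ} {F q : ℝ → Torus3 → Vel → ℝ} {F₀ : Torus3 → Vel → ℝ}

lemma measurable_primitive (hq : Measurable fun p : ℝ × Torus3 × Vel => q p.1 p.2.1 p.2.2) :
    Measurable fun p : ℝ × Torus3 × Vel => ∫ s in Ioc 0 p.1, along q s p.2 := by
  have h1 : MeasurableSet {r : (ℝ × Torus3 × Vel) × ℝ | 0 < r.2 ∧ r.2 ≤ r.1.1} :=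
    (measurableSet_lt measurable_const measurable_snd).inter
      (measurableSet_le measurable_snd measurable_fst.fst)
  have h2 : Measurable fun r : (ℝ × Torus3 × Vel) × ℝ => along q r.2 r.1.2 :=
    (measurable_along hq).comp (measurable_snd.prodMk measurable_fst.snd)
  have h3 := (h2.indicator h1).stronglyMeasurable.integral_prod_right' (ν := volume)
  have h4 : (fun p : ℝ × Torus3 × Vel => ∫ s in Ioc 0 p.1, along q s p.2) = fun p =>
      ∫ s, {r : (ℝ × Torus3 × Vel) × ℝ | 0 < r.2 ∧ r.2 ≤ r.1.1}.indicator
        (fun r => along q r.2 r.1.2) (p, s) := by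
    funext p
    rw [← integral_indicator measurableSet_Ioc]
    rfl
  rw [h4]
  exact h3.measurable

/-- The chain rule needs the formula for almost every time on a fixed characteristic. Exchanging the
two quantifiers requires a jointly measurable set, hence the representative of F₀. -/
lemma ae_ae_along_eq (hF₀ : MemLp (fun z : Torus3 × Vel => F₀ z.1 z.2) 2)
    (hF : Measurable fun p : ℝ × Torus3 × Vel => F p.1 p.2.1 p.2.2)
    (hq : Measurable fun p : ℝ × Torus3 × Vel => q p.1 p.2.1 p.2.2)
    (H : ∀ᵐ t ∂(volume.restrict (Icc 0 T)), ∀ᵐ z : Torus3 × Vel,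
      along F t z = F₀ z.1 z.2 + ∫ s in (0 : ℝ)..t, along q s z) :
    ∀ᵐ z : Torus3 × Vel, ∀ᵐ t ∂(volume.restrict (Icc 0 T)),
      along F t z = F₀ z.1 z.2 + ∫ s in (0 : ℝ)..t, along q s z := by
  have hmk := hF₀.1.ae_eq_mk
  have hm := hF₀.1.stronglyMeasurable_mk.measurable
  have h1 : ∀ᵐ t ∂(volume.restrict (Icc 0 T)), ∀ᵐ z : Torus3 × Vel,
      along F t z = hF₀.1.mk _ z + ∫ s in Ioc 0 t, along q s z := by
    filter_upwards [H, ae_restrict_mem measurableSet_Icc] with t ht hmem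
    filter_upwards [ht, hmk] with z hz hz2
    rw [hz, hz2, intervalIntegral.integral_of_le hmem.1]
  have h5 : MeasurableSet {p : ℝ × Torus3 × Vel | along F p.1 p.2 =
      hF₀.1.mk _ p.2 + ∫ s in Ioc 0 p.1, along q s p.2} :=
    measurableSet_eq_fun (measurable_along hF) ((hm.comp measurable_snd).add (measurable_primitive hq))
  have h2 := (Measure.ae_ae_comm (p := fun t z => along F t z =
    hF₀.1.mk _ z + ∫ s in Ioc 0 t, along q s z) h5).1 h1
  filter_upwards [h2, hmk] with z hz hz2
  filter_upwards [hz, ae_restrict_mem measurableSet_Icc] with t ht hmem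
  rw [ht, hz2, intervalIntegral.integral_of_le hmem.1]

/-- The square of the negative part along free transport. -/
lemma ae_sq_min_along (hF₀ : MemLp (fun z : Torus3 × Vel => F₀ z.1 z.2) 2)
    (hF₀n : ∀ᵐ z : Torus3 × Vel, 0 ≤ F₀ z.1 z.2)
    (hF : Measurable fun p : ℝ × Torus3 × Vel => F p.1 p.2.1 p.2.2)
    (hq : Measurable fun p : ℝ × Torus3 × Vel => q p.1 p.2.1 p.2.2)
    (hqi : ∫⁻ t in Icc 0 T, normL2 (q t) < ⊤)
    (H : ∀ᵐ t ∂(volume.restrict (Icc 0 T)), ∀ᵐ z : Torus3 × Vel,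
      along F t z = F₀ z.1 z.2 + ∫ s in (0 : ℝ)..t, along q s z) :
    ∀ᵐ t ∂(volume.restrict (Icc 0 T)), ∀ᵐ z : Torus3 × Vel,
      min (along F t z) 0 ^ 2 = 2 * ∫ s in Ioc 0 t, along q s z * min (along F s z) 0 := by
  filter_upwards [H, ae_restrict_mem measurableSet_Icc] with t ht hmem
  filter_upwards [ht, ae_ae_along_eq hF₀ hF hq H, ae_integrableOn_along hq hqi, hF₀n] with z hz hz2 hzi hz0
  rw [hz, sq_min_primitive hzi hz0 hmem, intervalIntegral.integral_of_le hmem.1]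
  congr 1
  refine integral_congr_ae ?_
  filter_upwards [ae_mono (Measure.restrict_mono_set volume
    ((Ioc_subset_Icc_self).trans (Icc_subset_Icc_right hmem.2))) hz2] with s hs
  rw [hs]

/-- The negative part of the energy, from the inequality on almost every fibre. -/
lemma integral_mul_min_le {K : ℝ} {h p : Torus3 → Vel → ℝ}
    (hp : MemLp (fun z : Torus3 × Vel => p z.1 z.2) 2)
    (hn : MemLp (fun z : Torus3 × Vel => min (h z.1 z.2) 0) 2)
    (H : ∀ᵐ x, -∫ v, p x v * negPart 0 (h x) v ≤ K * ∫ v, negPart 0 (h x) v ^ 2) :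
    ∫ z : Torus3 × Vel, p z.1 z.2 * min (h z.1 z.2) 0 ≤ K * ∫ z : Torus3 × Vel, min (h z.1 z.2) 0 ^ 2 := by
  have e : ∀ x v, min (h x v) 0 = -negPart 0 (h x) v := fun x v => by
    rw [negPart, add_zero, ← neg_neg (min (h x v) 0), ← max_neg_neg, neg_zero]
  have i1 : Integrable (fun z : Torus3 × Vel => p z.1 z.2 * min (h z.1 z.2) 0) (volume.prod volume) :=
    hp.integrable_mul hn
  have i2 : Integrable (fun z : Torus3 × Vel => min (h z.1 z.2) 0 ^ 2) (volume.prod volume) := hn.integrable_sq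
  rw [Measure.volume_eq_prod, integral_prod _ i1, integral_prod _ i2, ← integral_const_mul K]
  refine integral_mono_ae i1.integral_prod_left (i2.integral_prod_left.const_mul K) ?_
  filter_upwards [H] with x hx
  simpa only [e, mul_neg, integral_neg, neg_sq] using hx

lemma normL2_min_le (f : Torus3 → Vel → ℝ) : normL2 (fun x v => min (f x v) 0) ≤ normL2 f := by
  refine eLpNorm_mono fun z => ?_
  rw [Real.norm_eq_abs, Real.norm_eq_abs]
  rcases le_total (f z.1 z.2) 0 with h | h
  · simp [h]
  · simp [h]

lemma integral_sq_le {f : Torus3 → Vel → ℝ} (hf : AEStronglyMeasurable fun z : Torus3 × Vel => f z.1 z.2)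
    {A : ℝ≥0∞} (hA : A ≠ ⊤) (h : normL2 f ≤ A) : ∫ z : Torus3 × Vel, f z.1 z.2 ^ 2 ≤ (A * A).toReal := by
  have h1 : ‖∫ z : Torus3 × Vel, f z.1 z.2 ^ 2‖ₑ ≤ A * A := by
    refine (enorm_integral_le_lintegral_enorm _).trans ?_
    simp only [pow_two]
    exact (lintegral_enorm_mul_le hf hf).trans (mul_le_mul' h h)
  have h2 := ENNReal.toReal_mono (ENNReal.mul_ne_top hA hA) h1
  rw [toReal_enorm] at h2
  exact (Real.le_norm_self _).trans h2

/-- Free transport preserves measure, so the chain rule on characteristics integrates to an energy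
identity for the negative part. Kato's inequality bounds its right side by the energy itself, and
Gronwall's inequality concludes. -/
lemma ae_nonneg_of_kato {K : ℝ} (hK : 0 ≤ K) (hF₀ : MemLp (fun z : Torus3 × Vel => F₀ z.1 z.2) 2)
    (hF₀n : ∀ᵐ z : Torus3 × Vel, 0 ≤ F₀ z.1 z.2)
    (hF : Measurable fun p : ℝ × Torus3 × Vel => F p.1 p.2.1 p.2.2)
    (hq : Measurable fun p : ℝ × Torus3 × Vel => q p.1 p.2.1 p.2.2)
    {A : ℝ≥0∞} (hA : A ≠ ⊤) (hFA : ∀ᵐ t ∂(volume.restrict (Icc 0 T)), normL2 (F t) ≤ A)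
    (hqi : ∫⁻ t in Icc 0 T, normL2 (q t) < ⊤)
    (H : ∀ᵐ t ∂(volume.restrict (Icc 0 T)), ∀ᵐ z : Torus3 × Vel,
      along F t z = F₀ z.1 z.2 + ∫ s in (0 : ℝ)..t, along q s z)
    (HK : ∀ᵐ t ∂(volume.restrict (Icc 0 T)), ∀ᵐ x, MemLp (F t x) 2 → MemLp (q t x) 2 →
      -∫ v, q t x v * negPart 0 (F t x) v ≤ K * ∫ v, negPart 0 (F t x) v ^ 2) :
    ∀ᵐ t ∂(volume.restrict (Icc 0 T)), ∀ᵐ z : Torus3 × Vel, 0 ≤ F t z.1 z.2 := by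
  set m : ℝ → Torus3 → Vel → ℝ := fun t x v => min (F t x v) 0 with hm
  have hmm : Measurable fun p : ℝ × Torus3 × Vel => m p.1 p.2.1 p.2.2 := hF.min measurable_const
  have slice : ∀ {f : ℝ → Torus3 → Vel → ℝ}, (Measurable fun p : ℝ × Torus3 × Vel => f p.1 p.2.1 p.2.2) →
      ∀ t, Measurable fun z : Torus3 × Vel => f t z.1 z.2 :=
    fun hf t => hf.comp (measurable_const.prodMk measurable_id)
  have hmA : ∀ᵐ t ∂(volume.restrict (Icc 0 T)), normL2 (m t) ≤ A := by
    filter_upwards [hFA] with t ht using (normL2_min_le (F t)).trans ht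
  have hmi : ∫⁻ t in Icc 0 T, normL2 (m t) < ⊤ := by
    refine (lintegral_mono_ae hmA).trans_lt ?_
    rw [lintegral_const]
    exact ENNReal.mul_lt_top hA.lt_top (by simp)
  have hmA' : ∀ᵐ t ∂(volume.restrict (Icc 0 T)), nrm (along m t) ≤ A := by simpa only [nrm_along hmm] using hmA
  have iN := (integrable_prod_of_nrm (T := T) (measurable_along hmm) (measurable_along hmm) hA hmA'
    (by simpa only [nrm_along hmm] using hmi)).integral_prod_left
  have iq := integrable_prod_of_nrm (T := T) (measurable_along hmm) (measurable_along hq) hA hmA'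
    (by simpa only [nrm_along hq] using hqi)
  have eN : ∀ t, ∫ z, along m t z * along m t z = ∫ z : Torus3 × Vel, m t z.1 z.2 ^ 2 := fun t => by
    rw [← integral_along (f := fun t x v => m t x v ^ 2) (hmm.pow_const 2)]
    simp only [along, pow_two]
  have eq' : ∀ t, ∫ z, along m t z * along q t z = ∫ z : Torus3 × Vel, q t z.1 z.2 * m t z.1 z.2 := fun t => by
    rw [← integral_along (f := fun t x v => q t x v * m t x v) (hq.mul hmm)]
    simp only [along, mul_comm]
  have iN' : IntegrableOn (fun t => ∫ z : Torus3 × Vel, m t z.1 z.2 ^ 2) (Icc 0 T) := by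
    simp only [eN] at iN
    exact iN
  have hdiss : ∀ᵐ t ∂(volume.restrict (Icc 0 T)), ∫ z : Torus3 × Vel, q t z.1 z.2 * m t z.1 z.2 ≤
      K * ∫ z : Torus3 × Vel, m t z.1 z.2 ^ 2 := by
    filter_upwards [HK, hFA, hmA, ae_lt_top (measurable_normL2 hq) hqi.ne] with t h1 h2 h3 h4
    have mF : MemLp (fun z : Torus3 × Vel => F t z.1 z.2) 2 :=
      ⟨(slice hF t).aestronglyMeasurable, h2.trans_lt hA.lt_top⟩
    have mq : MemLp (fun z : Torus3 × Vel => q t z.1 z.2) 2 := ⟨(slice hq t).aestronglyMeasurable, h4⟩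
    refine integral_mul_min_le mq ⟨(slice hmm t).aestronglyMeasurable, h3.trans_lt hA.lt_top⟩ ?_
    filter_upwards [h1, ae_memLp_slice mF, ae_memLp_slice mq] with x h5 h6 h7 using h5 h6 h7
  -- No boundary term appears at time 0 because F₀ ≥ 0. The bound of the negative part in L²,
  -- uniform in time, against q in L¹_t L² justifies Fubini's theorem.
  have henergy : ∀ᵐ t ∂(volume.restrict (Icc 0 T)), ∫ z : Torus3 × Vel, m t z.1 z.2 ^ 2 ≤
      2 * K * ∫ s in (0 : ℝ)..t, ∫ z : Torus3 × Vel, m s z.1 z.2 ^ 2 := by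
    filter_upwards [ae_sq_min_along hF₀ hF₀n hF hq hqi H, ae_restrict_mem measurableSet_Icc] with t ht hmem
    have hle : volume.restrict (Ioc 0 t) ≤ volume.restrict (Icc 0 T) :=
      Measure.restrict_mono_set _ ((Ioc_subset_Icc_self).trans (Icc_subset_Icc_right hmem.2))
    have iqt : Integrable (fun p : ℝ × Torus3 × Vel => along m p.1 p.2 * along q p.1 p.2)
      ((volume.restrict (Ioc 0 t)).prod volume) := iq.mono_measure (Measure.prod_mono hle le_rfl)
    have h1 : ∫ z : Torus3 × Vel, m t z.1 z.2 ^ 2 =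
        2 * ∫ s in Ioc 0 t, ∫ z : Torus3 × Vel, q s z.1 z.2 * m s z.1 z.2 := by
      rw [← eN t]
      simp only [← eq']
      rw [integral_integral_swap iqt, ← integral_const_mul (2 : ℝ)]
      refine integral_congr_ae ?_
      filter_upwards [ht] with z hz
      rw [← pow_two]
      refine Eq.trans hz ?_
      congr 1
      refine integral_congr_ae (Eventually.of_forall fun s => ?_)
      exact mul_comm _ _
    have iqt' : IntegrableOn (fun s => ∫ z : Torus3 × Vel, q s z.1 z.2 * m s z.1 z.2) (Ioc 0 t) := by
      have := iqt.integral_prod_left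
      simp only [eq'] at this
      exact this
    rw [h1, intervalIntegral.integral_of_le hmem.1, mul_assoc, ← integral_const_mul K]
    refine mul_le_mul_of_nonneg_left ?_ zero_le_two
    exact integral_mono_ae iqt' ((Integrable.mono_measure iN' hle).const_mul K) (ae_mono hle hdiss)
  have hz := ae_eq_zero_of_le_primitive (mul_nonneg zero_le_two hK) iN'
    (Eventually.of_forall fun t => integral_nonneg fun z => sq_nonneg _)
    (by
      filter_upwards [hmA] with t ht
      exact integral_sq_le (slice hmm t).aestronglyMeasurable hA ht) henergy
  filter_upwards [hz, hmA] with t ht hA2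
  have mt : MemLp (fun z : Torus3 × Vel => m t z.1 z.2) 2 :=
    ⟨(slice hmm t).aestronglyMeasurable, hA2.trans_lt hA.lt_top⟩
  have h0 := (integral_eq_zero_iff_of_nonneg (fun z => sq_nonneg _) mt.integrable_sq).1 ht
  filter_upwards [h0] with z hz
  have h5 : m t z.1 z.2 = 0 := pow_eq_zero_iff two_ne_zero |>.1 hz
  exact min_eq_right_iff.1 h5

end

end

end QuantumBoltzmann

/-! ### Conclusion. -/

theorem mainTheorem10
    (C γ s : ℝ) (hC : 0 < C) (hγ : -3 < γ) (hγ0 : γ < 0) (hs : 0 < s) (hs1 : s < 1)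
    (hγs : γ + 2 * s ≤ 0)
    (T : ℝ) (hT : 0 < T)
    (F₀ : QuantumBoltzmann.Torus3 → QuantumBoltzmann.Vel → ℝ)
    (hF₀_mem : MemLp (fun z : QuantumBoltzmann.Torus3 × QuantumBoltzmann.Vel => F₀ z.1 z.2) 2 volume)
    (hF₀ : ∀ᵐ z : QuantumBoltzmann.Torus3 × QuantumBoltzmann.Vel, 0 ≤ F₀ z.1 z.2)
    (G : ℝ → QuantumBoltzmann.Torus3 → QuantumBoltzmann.Vel → ℝ)
    (hG_meas : Measurable
      (fun p : ℝ × QuantumBoltzmann.Torus3 × QuantumBoltzmann.Vel => G p.1 p.2.1 p.2.2))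
    (hG : ∀ᵐ t ∂(volume.restrict (Icc 0 T)),
      ∀ᵐ z : QuantumBoltzmann.Torus3 × QuantumBoltzmann.Vel, 0 ≤ G t z.1 z.2)
    (hG_bound : (⨆ t ∈ Icc 0 T, QuantumBoltzmann.sobolevNorm 2 4
      (fun x v => QuantumBoltzmann.maxwellian v ^ (-(1 / 4) : ℝ) * G t x v)) < ⊤)
    (F : ℝ → QuantumBoltzmann.Torus3 → QuantumBoltzmann.Vel → ℝ)
    (hF_mem : QuantumBoltzmann.MemLinftyL2 T F)
    (hF : QuantumBoltzmann.IsSolution C γ s T G F₀ F) :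
    ∀ᵐ t ∂(volume.restrict (Icc 0 T)),
      ∀ᵐ z : QuantumBoltzmann.Torus3 × QuantumBoltzmann.Vel, 0 ≤ F t z.1 z.2 := by
  have hp : QuantumBoltzmann.IsKernelParam C γ s := ⟨hC, hγ, hγ0, hs, hs1, hγs⟩
  -- The supremum over time is used as N, so one M, and then one Kato constant K, serves all times
  -- and almost every x.
  obtain ⟨M, hM⟩ := QuantumBoltzmann.exists_isRegular_of_sobolevNorm
    (N := (⨆ t ∈ Icc 0 T, QuantumBoltzmann.sobolevNorm 2 4
      (fun x v => QuantumBoltzmann.maxwellian v ^ (-(1 / 4) : ℝ) * G t x v)).toReal) ENNReal.toReal_nonneg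
  rw [ENNReal.ofReal_toReal hG_bound.ne] at hM
  obtain ⟨K, hK, hkato⟩ := hp.exists_kato M
  obtain ⟨hFm, hFs⟩ := hF_mem
  obtain ⟨q, hq, hqi, hcol, H⟩ := hF
  have hFA := ae_le_essSup (μ := volume.restrict (Icc 0 T)) (f := fun t => QuantumBoltzmann.normL2 (F t))
  have hFi : ∫⁻ t in Icc 0 T, QuantumBoltzmann.normL2 (F t) < ⊤ := by
    refine (lintegral_mono_ae hFA).trans_lt ?_
    rw [lintegral_const]
    exact ENNReal.mul_lt_top hFs (by simp)
  refine QuantumBoltzmann.ae_nonneg_of_kato hK.le hF₀_mem hF₀ hFm hq hFs.ne hFA hqi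
    (QuantumBoltzmann.ae_along_eq hT hF₀_mem hFm hq hFi hqi H) ?_
  -- For almost every (t, x) the slice of G has a regular version and q is its collision term with
  -- F, so Kato's inequality holds on that slice.
  filter_upwards [hcol, hG, ae_restrict_mem measurableSet_Icc] with t h1 h2 ht
  filter_upwards [h1, hM (G t) (le_iSup₂_of_le t ht le_rfl) h2] with x h3 h4 h5 h6
  obtain ⟨g, hg, hGg⟩ := h4
  exact hkato (G t x) g (F t x) (q t x)
    (hG_meas.comp (measurable_const.prodMk (measurable_const.prodMk measurable_id))) hGg hg
    (hFm.comp (measurable_const.prodMk (measurable_const.prodMk measurable_id))) h5 h6 h3
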